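/- **Theorem 1 (Ergodicity and $O(h)$ bias).** Let $\alpha,\beta,\delta,m,L,a>0$, $b,\sigma\ge 0$, and real numbers $M,L_\psi,\sigma_4$ and $(K_p)_{p\in\mathbb N}$ be given. *Potential.* Let $U\in C^4(\mathbb R^d)$ have bounded derivatives of orders $2,3,4$, with $\|\nabla U(\theta)-\nabla U(\theta')\|\le L\|\theta-\theta'\|$ and $\langle\theta,\nabla U(\theta)\rangle\ge a\|\theta\|^2-b$. Let $\pi\propto e^{-\beta U}$ be the Gibbs probability measure and $\mathcal L=-\nabla U\cdot\nabla+\beta^{-1}\Delta$. *Test function.* Let $f:\mathbb R^d\to\mathbb R$ be such that $\mathcal L\phi=f-\pi(f)$ has a solution $\phi\in C^4(\mathbb R^d)$ with $\|D^j\phi(\theta)\|\le A_j(1+\|\theta\|^q)$ for $j=0,\dots,4$ and some $q\ge0$. *Algorithm.* For a step parameter $h>0$ put $\rho=e^{-\alpha h}$, and let $$\zeta_{n+1}=\rho\,\zeta_n+\tfrac{1-\rho}{\alpha}\big(\|G_n\|^2+\delta\big),\qquad \Delta t_{n+1}=\psi(\zeta_{n+1})\,h,$$ $$\theta_{n+1}=\theta_n-\Delta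 t_{n+1}G_n+\sqrt{2\beta^{-1}\Delta t_{n+1}}\;\varepsilon_{n+1},$$ where $\zeta_0\ge0$ is integrable and, with $\mathcal F_n=\sigma(\theta_0,\zeta_0,\varepsilon_1,\dots,\varepsilon_n,G_0,\dots,G_{n-1})$, $\varepsilon_{n+1}\sim\mathcal N(0,I_d)$ is independent of $\mathcal F_n\vee\sigma(G_n)$. Assume: 1. $m\le\psi\le M$ and $|\psi(x)-\psi(y)|\le L_\psi|x-y|$ on $[(1-\rho)\delta/\alpha,\infty)$; 2. $\mathbb E[G_n\mid\mathcal F_n]=\nabla U(\theta_n)$, $\ \mathbb E[\|G_n-\nabla U(\theta_n)\|^2\mid\mathcal F_n]\le\sigma^2(1+\|\theta_n\|^2)$ and $\mathbb E[\|G_n-\nabla U(\theta_n)\|^4\mid\mathcal F_n]\le\sigma_4^2(1+\|\theta_n\|^4)$; 3. $2amh-(2L^2+2\sigma^2)M^2h^2-2\sigma Mh>0$; 4. $\sup_n\mathbb E\|\theta_n\|^p\le K_p$ for every $p\in\mathbb N$; 5. $(\theta_n,\zeta_n)$ is an ergodic Markov chain on $\mathbb R^d\times[0,\infty)$ with invariant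 probability measure $\widetilde\pi_h$: from every initial state its $n$-step laws converge to $\widetilde\pi_h$ in total variation. Put $$\mathcal A_n=\frac{\sum_{k=1}^n\Delta t_kf(\theta_k)}{\sum_{k=1}^n\Delta t_k},\qquad \pi_h(f)=\frac{\widetilde\pi_h[\psi(\zeta)f(\theta)]}{\widetilde\pi_h[\psi(\zeta)]}.$$ Then $f$ is $\pi$-integrable, and there is a constant $C>0$, depending only on $d,U,\psi,f,\phi$ and the constants $\alpha,\beta,\delta,m,M,L_\psi,L,a,b,\sigma,\sigma_4,(K_p)$, but not on $h$ or on the run of the algorithm, such that for every $h>0$ and every run as above: - $\psi(\zeta)$ and $\psi(\zeta)f(\theta)$ are $\widetilde\pi_h$-integrable, and $\mathcal A_n$ is integrable for every $n\ge1$; - $\mathcal A_n\to\pi_h(f)$ almost surely as $n\to\infty$; - $|\pi_h(f)-\pi(f)|\le Ch$; - there is $C'$ (which may depend on $h$ and on the run) with $|\mathbb E\mathcal A_n-\pi(f)|\le Ch+C'/n$ for all $n\ge1$; - if moreover the conditional law of $G_n$ given $\mathcal F_n$ is $Q(\theta_n,\cdot)$ for a Markov kernel $Q$ on $\mathbb R^d$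 not depending on $n$ (as for mini-batch gradients with mini-batches drawn independently of the past), then there is $C'$ (which may depend on $h$ and on the run) with $|\mathbb E\mathcal A_n-\pi(f)|\le|\pi_h(f)-\pi(f)|+C'/n$ for all $n\ge1$. -/

import Mathlib

open MeasureTheory ProbabilityTheory Filter Topology

noncomputable section

namespace SASGLD

/-- Parameter space `ℝ^d` with the Euclidean norm. -/
abbrev E (d : ℕ) : Type := EuclideanSpace ℝ (Fin d)

/-- The Gibbs probability measure proportional to `exp (-β U)` with respect to Lebesgue measure. -/
def gibbs {d : ℕ} (U : E d → ℝ) (β : ℝ) : Measure (E d) :=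
  (volume : Measure (E d)).tilted (fun θ => -(β * U θ))

/-- The overdamped Langevin generator `L φ = -∇U · ∇φ + β⁻¹ Δ φ`. -/
def generator {d : ℕ} (U : E d → ℝ) (β : ℝ) (φ : E d → ℝ) (θ : E d) : ℝ :=
  -(inner ℝ (gradient U θ) (gradient φ θ)) + β⁻¹ * Laplacian.laplacian φ θ

/-- `ρ = exp (-α h)`. -/
def rho (α h : ℝ) : ℝ := Real.exp (-(α * h))

/-- `γ(h) = 2 a m h - C₁ M² h² - 2 σ M h` with `C₁ = 2 L² + 2 σ²`. -/
def gammaRate (a m M L σ h : ℝ) : ℝ :=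
  2 * a * m * h - (2 * L ^ 2 + 2 * σ ^ 2) * M ^ 2 * h ^ 2 - 2 * σ * M * h

/-- The potential: of class `C⁴` with bounded derivatives of orders 2, 3, 4, with `L`-Lipschitz
gradient, and `(a, b)`-dissipative. (A dissipative gradient is itself unbounded.) -/
structure IsAdmissiblePotential {d : ℕ} (U : E d → ℝ) (L a b : ℝ) : Prop where
  contDiff : ContDiff ℝ 4 U
  bounded_deriv : ∀ j : ℕ, 2 ≤ j → j ≤ 4 → ∃ B : ℝ, ∀ θ, ‖iteratedFDeriv ℝ j U θ‖ ≤ B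
  lipschitz_grad : ∀ θ θ' : E d, ‖gradient U θ - gradient U θ'‖ ≤ L * ‖θ - θ'‖
  dissipative : ∀ θ : E d, a * ‖θ‖ ^ 2 - b ≤ inner ℝ θ (gradient U θ)

/-- `φ` is a `C⁴` solution of the Poisson equation `L φ = f - π(f)` whose derivatives of order
at most 4 grow at most polynomially. -/
structure IsPoissonSolution {d : ℕ} (U : E d → ℝ) (β : ℝ) (f φ : E d → ℝ) : Prop where
  contDiff : ContDiff ℝ 4 φ
  eq : ∀ θ, generator U β φ θ = f θ - ∫ x, f x ∂(gibbs U β)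
  growth : ∃ q : ℝ, 0 ≤ q ∧ ∀ j : ℕ, j ≤ 4 → ∃ A : ℝ, ∀ θ,
    ‖iteratedFDeriv ℝ j φ θ‖ ≤ A * (1 + ‖θ‖ ^ q)

/-- The step-size function satisfies `m ≤ ψ ≤ M` and is `Lψ`-Lipschitz on the half-line
`ζ ≥ (1 - ρ) δ / α`, which contains every `ζ_n` with `n ≥ 1`. -/
structure IsStepFunction (ψ : ℝ → ℝ) (m M Lψ α δ h : ℝ) : Prop where
  lower : ∀ x, (1 - rho α h) * δ / α ≤ x → m ≤ ψ x
  upper : ∀ x, (1 - rho α h) * δ / α ≤ x → ψ x ≤ M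
  lipschitz : ∀ x y, (1 - rho α h) * δ / α ≤ x → (1 - rho α h) * δ / α ≤ y →
    |ψ x - ψ y| ≤ Lψ * |x - y|

section Chain

variable {d : ℕ} {Ω : Type*} [MeasurableSpace Ω]

/-- `𝓕_n = σ(θ_0, ζ_0, ε_1, …, ε_n, G_0, …, G_{n-1})`. -/
abbrev past (θ : ℕ → Ω → E d) (ζ : ℕ → Ω → ℝ) (G ε : ℕ → Ω → E d) (n : ℕ) : MeasurableSpace Ω :=
  MeasurableSpace.comap (θ 0) inferInstance ⊔ MeasurableSpace.comap (ζ 0) inferInstance ⊔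
    (⨆ k : Fin n, MeasurableSpace.comap (ε (k + 1)) inferInstance) ⊔
    (⨆ k : Fin n, MeasurableSpace.comap (G k) inferInstance)

/-- The random sequences `θ`, `ζ`, `G` (stochastic gradients) and `ε` (Gaussian noise,
`ε_1, ε_2, …`) form a run of the algorithm with step parameter `h`, and the stochastic gradients
are unbiased with conditional second and fourth moment bounds. -/
structure IsRun (P : Measure Ω) (U : E d → ℝ) (ψ : ℝ → ℝ) (α β δ σ σ₄ h : ℝ)
    (θ : ℕ → Ω → E d) (ζ : ℕ → Ω → ℝ) (G ε : ℕ → Ω → E d) : Prop where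
  measurable_θ : ∀ n, Measurable (θ n)
  measurable_ζ : ∀ n, Measurable (ζ n)
  measurable_G : ∀ n, Measurable (G n)
  measurable_ε : ∀ n, Measurable (ε n)
  ζ_zero_nonneg : ∀ ω, 0 ≤ ζ 0 ω
  ζ_zero_integrable : Integrable (ζ 0) P
  ζ_succ : ∀ n ω, ζ (n + 1) ω = rho α h * ζ n ω + (1 - rho α h) / α * (‖G n ω‖ ^ 2 + δ)
  θ_succ : ∀ n ω, θ (n + 1) ω = θ n ω - (ψ (ζ (n + 1) ω) * h) • G n ω +
    Real.sqrt (2 * β⁻¹ * (ψ (ζ (n + 1) ω) * h)) • ε (n + 1) ω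
  noise_law : ∀ n, P.map (ε (n + 1)) = stdGaussian (E d)
  noise_indep : ∀ n, Indep (past θ ζ G ε n ⊔ MeasurableSpace.comap (G n) inferInstance)
    (MeasurableSpace.comap (ε (n + 1)) inferInstance) P
  grad_integrable : ∀ n, Integrable (G n) P
  grad_unbiased : ∀ n, P[G n | past θ ζ G ε n] =ᵐ[P] fun ω => gradient U (θ n ω)
  grad_sq_integrable : ∀ n, Integrable (fun ω => ‖G n ω - gradient U (θ n ω)‖ ^ 2) P
  grad_sq : ∀ n, P[fun ω => ‖G n ω - gradient U (θ n ω)‖ ^ 2 | past θ ζ G ε n] ≤ᵐ[P]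
    fun ω => σ ^ 2 * (1 + ‖θ n ω‖ ^ 2)
  grad_fourth_integrable : ∀ n, Integrable (fun ω => ‖G n ω - gradient U (θ n ω)‖ ^ 4) P
  grad_fourth : ∀ n, P[fun ω => ‖G n ω - gradient U (θ n ω)‖ ^ 4 | past θ ζ G ε n] ≤ᵐ[P]
    fun ω => σ₄ ^ 2 * (1 + ‖θ n ω‖ ^ 4)

/-- All moments of `θ_n` are bounded uniformly in `n`: `E ‖θ_n‖^p ≤ K p`. -/
def HasMomentBounds (P : Measure Ω) (K : ℕ → ℝ) (θ : ℕ → Ω → E d) : Prop :=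
  ∀ p n : ℕ, Integrable (fun ω => ‖θ n ω‖ ^ p) P ∧ ∫ ω, ‖θ n ω‖ ^ p ∂P ≤ K p

/-- The conditional law of the stochastic gradient `G_n` given the past is a function of the
current position `θ_n` only, as for a mini-batch gradient evaluated at `θ_n` with a mini-batch
that is drawn independently of the past. -/
def HasFreshGradients (P : Measure Ω) (θ : ℕ → Ω → E d) (ζ : ℕ → Ω → ℝ)
    (G ε : ℕ → Ω → E d) : Prop :=
  ∃ Q : Kernel (E d) (E d), IsMarkovKernel Q ∧ ∀ (n : ℕ) (B : Set (E d)), MeasurableSet B →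
    P[(G n ⁻¹' B).indicator (fun _ => (1 : ℝ)) | past θ ζ G ε n] =ᵐ[P]
      fun ω => (Q (θ n ω)).real B

/-- `A_n = (∑_{k=1}^n Δt_k f(θ_k)) / (∑_{k=1}^n Δt_k)` with `Δt_k = ψ(ζ_k) h`. -/
def timeAverage (ψ : ℝ → ℝ) (h : ℝ) (f : E d → ℝ) (θ : ℕ → Ω → E d) (ζ : ℕ → Ω → ℝ)
    (n : ℕ) (ω : Ω) : ℝ :=
  (∑ k ∈ Finset.Icc 1 n, ψ (ζ k ω) * h * f (θ k ω)) / (∑ k ∈ Finset.Icc 1 n, ψ (ζ k ω) * h)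

end Chain

section Markov

variable {S Ω : Type*} [MeasurableSpace S] [MeasurableSpace Ω]

/-- The process `X` is a time-homogeneous Markov chain with transition kernel `κ`
(with respect to its own filtration). -/
def IsMarkovChain (P : Measure Ω) (X : ℕ → Ω → S) (κ : Kernel S S) : Prop :=
  ∀ (n : ℕ) (B : Set S), MeasurableSet B →
    P[(X (n + 1) ⁻¹' B).indicator (fun _ => (1 : ℝ)) |
        ⨆ k : Fin (n + 1), MeasurableSpace.comap (X k) inferInstance] =ᵐ[P]
      fun ω => (κ (X n ω)).real B

/-- Total variation distance `sup_B |μ B - ν B|`. -/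
def tvDist (μ ν : Measure S) : ℝ :=
  ⨆ B : {B : Set S // MeasurableSet B}, |μ.real B - ν.real B|

/-- The kernel `κ` is ergodic on the state space `D` with invariant probability measure `ν`:
from every initial state in `D`, the `n`-step laws converge to `ν` in total variation. -/
structure IsErgodicKernel (κ : Kernel S S) (D : Set S) (ν : Measure S) : Prop where
  invariant : Kernel.Invariant κ ν
  tendsto_tv : ∀ x ∈ D, Tendsto (fun n : ℕ => tvDist ((κ ^ n) x) ν) atTop (𝓝 0)

/-- `X` is an ergodic Markov chain on the state space `D` with invariant probability
measure `ν`. -/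
def IsErgodicMarkov (P : Measure Ω) (X : ℕ → Ω → S) (D : Set S) (ν : Measure S) : Prop :=
  IsProbabilityMeasure ν ∧
    ∃ κ : Kernel S S, IsMarkovKernel κ ∧ IsMarkovChain P X κ ∧ IsErgodicKernel κ D ν

end Markov

/-- The `ψ`-weighted marginal `π_h(f) = ν[ψ(ζ) f(θ)] / ν[ψ(ζ)]`. -/
def weightedMarginal {d : ℕ} (ψ : ℝ → ℝ) (ν : Measure (E d × ℝ)) (f : E d → ℝ) : ℝ :=
  (∫ x, ψ x.2 * f x.1 ∂ν) / (∫ x, ψ x.2 ∂ν)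

end SASGLD

end

/-! Bias. Write `ν` for the invariant law of the pair `(θ, ζ)` and let `L φ = f - π(f)`. One step
moves the mean of `φ(θ_n)` by `h E[ψ(ζ_{n+1}) L φ(θ_n)] + O(h²)` (`exists_weak_error_bound`): in a
Taylor expansion the terms that are odd in the Gaussian noise integrate to zero, the quadratic term
gives the Laplacian, and the remainder is of second order. The delicate point is that the step size
depends on the very gradient that it multiplies, so unbiasedness cannot be applied directly. But one
gradient enters `ζ` only with weight `(1 - ρ) / α ≤ h`. Without its contribution the step size is a
function of the past, the gradient noise averages out, and the replacement costs `O(h)` inside the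
bracket. For a similar reason `ψ(ζ_{n+1})` may be replaced by `ψ(ζ_n)`, up to a transient. As `n →
∞` the two means of `φ` cancel and `|ν(ψ(ζ) L φ(θ))| ≤ C h` is left (`exists_bias_bound`); division
by `ν(ψ(ζ)) ≥ m` gives the bias. The constant does not depend on `h`, because a positive rate bounds
`h` from above, nor on the run, because it only uses the moment bounds.

Almost sure convergence. The probability of a shift-invariant event, as a function of the initial
state, is harmonic. Fatou's lemma along the convergent `n`-step laws bounds it below by its value
under the stationary law; the same for the complement makes it constant. Hence invariant events are
trivial and have the same probability for every initial law. Together with the maximal ergodic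
inequality this gives the strong law (`IsMarkovChain.strongLaw`), applied to numerator and
denominator of the time average.

Expectations. Total variation convergence gives setwise convergence of the laws, and bounded moments
extend it to functions of polynomial growth (`IsControlledRun.tendsto_integral`). Second moments of
the time averages are bounded, so their expectations converge to `π_h(f)`. Without any rate, the
error is at most `h` from some index on, and `C' / n` absorbs the finitely many earlier ones.

The rate `1 / n`. For fresh gradients the transition mechanism of `(θ, ζ)` is explicit, but Harris'
theorem does not apply: `ζ` receives no noise of its own, so laws from different `ζ` need not
overlap. A weak form replaces it (`IsWeakHarris.exists_geometric_decay`). Far out, a quadratic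
energy decreases. In a sublevel set the Gaussian noise lets two positions coincide with positive
probability; from then on the same gradients are used and the states `ζ` approach each other by the
factor `ρ` per step. For equal positions and close `ζ`, the Gaussian laws of the next positions are
close. Two oscillation seminorms, one weighted by the energy and one by the distance of the states
`ζ`, contract jointly. Truncation extends the resulting geometric decay to correlations of functions
of polynomial growth. Centred sums then have bounded means and linearly growing second moments, and
an expansion of the ratio to second order yields `C' / n` (`IsControlledRun.exists_rate_bound`). -/

noncomputable section

namespace SASGLD

/-! ### The maximal ergodic inequality. -/

section MaximalErgodic

variable {X : Type*}

/-- `max (0, S_1, …, S_N)` for the Birkhoff sums `S_k` of `g`. -/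
def birkhoffMax (T : X → X) (g : X → ℝ) : ℕ → X → ℝ
  | 0 => fun _ => 0
  | N + 1 => fun x => max 0 (g x + birkhoffMax T g N (T x))

lemma birkhoffMax_nonneg (T : X → X) (g : X → ℝ) (N : ℕ) (x : X) :
    0 ≤ birkhoffMax T g N x := by
  cases N with
  | zero => exact le_rfl
  | succ n => exact le_max_left _ _

lemma birkhoffMax_mono_succ (T : X → X) (g : X → ℝ) (N : ℕ) (x : X) :
    birkhoffMax T g N x ≤ birkhoffMax T g (N + 1) x := by
  induction N generalizing x with
  | zero => exact birkhoffMax_nonneg _ _ _ _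
  | succ n ih =>
    change max 0 _ ≤ max 0 _
    gcongr
    exact ih _

lemma birkhoffSum_le_birkhoffMax (T : X → X) (g : X → ℝ) (N : ℕ) (x : X) :
    birkhoffSum T g N x ≤ birkhoffMax T g N x := by
  induction N generalizing x with
  | zero => simp [birkhoffMax]
  | succ n ih =>
    rw [birkhoffSum_succ']
    exact le_trans (by gcongr; exact ih _) (le_max_right _ _)

variable [MeasurableSpace X]

lemma integrable_birkhoffMax {μ : Measure X} [IsFiniteMeasure μ] {T : X → X}
    (hT : MeasurePreserving T μ μ) {g : X → ℝ} (hg : Integrable g μ) (N : ℕ) :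
    Integrable (birkhoffMax T g N) μ := by
  induction N with
  | zero => exact integrable_const _
  | succ n ih =>
    exact (integrable_const (0 : ℝ)).sup (hg.add ((hT.integrable_comp ih.1).2 ih))

/-- Garsia's maximal inequality, at a finite horizon. -/
lemma setIntegral_birkhoffMax_nonneg {μ : Measure X} [IsFiniteMeasure μ] {T : X → X}
    (hT : MeasurePreserving T μ μ) {g : X → ℝ} (hgm : Measurable g) (hg : Integrable g μ) (N : ℕ) :
    0 ≤ ∫ x in {x | 0 < birkhoffMax T g N x}, g x ∂μ := by
  have hmeas : ∀ N, Measurable (birkhoffMax T g N) := by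
    intro N
    induction N with
    | zero => exact measurable_const
    | succ n ih => exact measurable_const.max (hgm.add (ih.comp hT.measurable))
  have hI := integrable_birkhoffMax hT hg N
  have hIT : Integrable (fun x => birkhoffMax T g N (T x)) μ := (hT.integrable_comp hI.1).2 hI
  have hset : MeasurableSet {x | 0 < birkhoffMax T g N x} :=
    measurableSet_lt measurable_const (hmeas N)
  -- Where the maximum is positive, the recursion for `N + 1` does not select `0`. So `g` dominates
  -- there a coboundary, whose integral over the whole space is zero.
  have hle : ∀ x ∈ {x | 0 < birkhoffMax T g N x},
      birkhoffMax T g N x - birkhoffMax T g N (T x) ≤ g x := by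
    intro x hx
    have hx' : 0 < birkhoffMax T g N x := hx
    have h1 := birkhoffMax_mono_succ T g N x
    have h2 : birkhoffMax T g (N + 1) x = g x + birkhoffMax T g N (T x) := by
      have h3 : 0 < birkhoffMax T g (N + 1) x := hx'.trans_le h1
      change max 0 _ = _
      change 0 < max 0 _ at h3
      rcases max_choice 0 (g x + birkhoffMax T g N (T x)) with h | h
      · rw [h] at h3; exact absurd h3 (lt_irrefl _)
      · exact h
    linarith
  have hcomp : ∫ x, birkhoffMax T g N (T x) ∂μ = ∫ x, birkhoffMax T g N x ∂μ := by
    conv_rhs => rw [← hT.map_eq]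
    rw [integral_map hT.measurable.aemeasurable (hmeas N).aestronglyMeasurable]
  -- Restriction to the positivity set does not change the integral of the maximum, which vanishes
  -- elsewhere, and can only lower that of its composition with `T`, which is nonnegative.
  calc (0 : ℝ) = ∫ x, birkhoffMax T g N x ∂μ - ∫ x, birkhoffMax T g N (T x) ∂μ := by
        rw [hcomp, sub_self]
    _ ≤ ∫ x in {x | 0 < birkhoffMax T g N x}, birkhoffMax T g N x ∂μ
        - ∫ x in {x | 0 < birkhoffMax T g N x}, birkhoffMax T g N (T x) ∂μ := by
        refine sub_le_sub ?_ (setIntegral_le_integral hIT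
          (ae_of_all _ fun x => birkhoffMax_nonneg _ _ _ _))
        rw [← integral_indicator hset]
        refine integral_mono hI (hI.indicator hset) fun x => ?_
        by_cases hx : 0 < birkhoffMax T g N x
        · exact (Set.indicator_of_mem (s := {x | 0 < birkhoffMax T g N x}) hx _).ge
        · exact (not_lt.1 hx).trans (Set.indicator_nonneg (fun y _ => birkhoffMax_nonneg _ _ _ _) _)
    _ = ∫ x in {x | 0 < birkhoffMax T g N x},
          (birkhoffMax T g N x - birkhoffMax T g N (T x)) ∂μ :=
        (integral_sub hI.integrableOn hIT.integrableOn).symm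
    _ ≤ _ := setIntegral_mono_on (hI.sub hIT).integrableOn hg.integrableOn hset hle

/-- If almost every orbit has a positive Birkhoff sum, the integral is nonnegative. -/
lemma integral_nonneg_of_exists_birkhoffSum_pos {μ : Measure X} [IsFiniteMeasure μ] {T : X → X}
    (hT : MeasurePreserving T μ μ) {g : X → ℝ} (hgm : Measurable g) (hg : Integrable g μ)
    (hpos : ∀ᵐ x ∂μ, ∃ n, 0 < birkhoffSum T g n x) : 0 ≤ ∫ x, g x ∂μ := by
  have hmeas : ∀ N, Measurable (birkhoffMax T g N) := by
    intro N
    induction N with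
    | zero => exact measurable_const
    | succ n ih => exact measurable_const.max (hgm.add (ih.comp hT.measurable))
  have hset : ∀ N, MeasurableSet {x | 0 < birkhoffMax T g N x} := fun N =>
    measurableSet_lt measurable_const (hmeas N)
  have hlim : Tendsto (fun N => ∫ x in {x | 0 < birkhoffMax T g N x}, g x ∂μ) atTop
      (𝓝 (∫ x in ⋃ N, {x | 0 < birkhoffMax T g N x}, g x ∂μ)) := by
    refine tendsto_setIntegral_of_monotone hset ?_ hg.integrableOn
    exact monotone_nat_of_le_succ fun N x (hx : 0 < _) => hx.trans_le (birkhoffMax_mono_succ _ _ _ _)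
  have hfull : ∫ x in ⋃ N, {x | 0 < birkhoffMax T g N x}, g x ∂μ = ∫ x, g x ∂μ := by
    rw [← setIntegral_univ (μ := μ) (f := g)]
    refine setIntegral_congr_set ?_
    filter_upwards [hpos] with x ⟨n, hn⟩
    refine propext ⟨fun _ => trivial, fun _ => Set.mem_iUnion.2 ⟨n, ?_⟩⟩
    exact hn.trans_le (birkhoffSum_le_birkhoffMax _ _ _ _)
  rw [← hfull]
  exact ge_of_tendsto' hlim fun N => setIntegral_birkhoffMax_nonneg hT hgm hg N

end MaximalErgodic

/-! ### Laws of Markov chains on path space. -/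

section PathSpace

variable {S : Type*} [MeasurableSpace S]

/-- The `σ`-algebra on path space generated by the coordinates `0, …, n`. -/
@[reducible] def pathPast (n : ℕ) : MeasurableSpace (ℕ → S) :=
  ⨆ k : Fin (n + 1), MeasurableSpace.comap (fun w : ℕ → S => w k) inferInstance

lemma pathPast_le (n : ℕ) : pathPast (S := S) n ≤ MeasurableSpace.pi :=
  iSup_le fun k => (measurable_pi_apply (k : ℕ)).comap_le

lemma measurable_coord_pathPast {k n : ℕ} (hk : k ≤ n) :
    Measurable[pathPast n] (fun w : ℕ → S => w k) := by
  have : MeasurableSpace.comap (fun w : ℕ → S => w k) inferInstance ≤ pathPast (S := S) n :=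
    le_iSup (fun k : Fin (n + 1) => MeasurableSpace.comap (fun w : ℕ → S => w k) inferInstance)
      ⟨k, by omega⟩
  exact Measurable.of_comap_le this

lemma pathPast_mono {m n : ℕ} (h : m ≤ n) : pathPast (S := S) m ≤ pathPast n :=
  iSup_le fun k => (measurable_coord_pathPast (by omega)).comap_le

/-- Events that depend on finitely many coordinates form a π-system that generates the product
`σ`-algebra. -/
lemma ext_of_pathPast {μ μ' : Measure (ℕ → S)} [IsFiniteMeasure μ]
    (key : ∀ n, ∀ A, MeasurableSet[pathPast n] A → μ A = μ' A) : μ = μ' := by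
  refine ext_of_generate_finite (⋃ n, {s | MeasurableSet[pathPast n] s}) ?_ ?_ ?_
    (key 0 _ MeasurableSet.univ)
  · refine le_antisymm ?_ ?_
    · refine iSup_le fun k => ?_
      rintro _ ⟨B, hB, rfl⟩
      exact MeasurableSpace.measurableSet_generateFrom
        (Set.mem_iUnion.2 ⟨k, measurable_coord_pathPast le_rfl hB⟩)
    · refine MeasurableSpace.generateFrom_le fun s hs => ?_
      obtain ⟨n, hn⟩ := Set.mem_iUnion.1 hs
      exact pathPast_le n _ hn
  · exact isPiSystem_iUnion_of_monotone _ (fun n => (pathPast n).isPiSystem_measurableSet)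
      fun _ _ h => pathPast_mono h
  · intro s hs
    obtain ⟨n, hn⟩ := Set.mem_iUnion.1 hs
    exact key n s hn

/-- `μ` is the law of a (not necessarily normalised) Markov chain with kernel `κ`. -/
def IsMarkovLaw (κ : Kernel S S) (μ : Measure (ℕ → S)) : Prop :=
  ∀ (n : ℕ) (A : Set (ℕ → S)) (B : Set S), MeasurableSet[pathPast n] A → MeasurableSet B →
    μ (A ∩ (fun w => w (n + 1)) ⁻¹' B) = ∫⁻ w in A, κ (w n) B ∂μ

/-- The Markov identity carries agreement on `pathPast n` over to the sets `A ∩ {w (n + 1) ∈ B}`,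
which form a π-system generating `pathPast (n + 1)`. The mass is not normalised, so that the lemma
also applies to restrictions to events. -/
lemma IsMarkovLaw.ext {κ : Kernel S S} {μ μ' : Measure (ℕ → S)} [IsFiniteMeasure μ]
    [IsFiniteMeasure μ'] (h : IsMarkovLaw κ μ) (h' : IsMarkovLaw κ μ')
    (h0 : μ.map (fun w => w 0) = μ'.map (fun w => w 0)) : μ = μ' := by
  have huniv : μ Set.univ = μ' Set.univ := by
    have := congrArg (fun m => m Set.univ) h0
    simpa [Measure.map_apply (measurable_pi_apply 0) MeasurableSet.univ] using this
  have key : ∀ n, ∀ A, MeasurableSet[pathPast n] A → μ A = μ' A := by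
    intro n
    induction n with
    | zero =>
      intro A hA
      have hA' : MeasurableSet[MeasurableSpace.comap (fun w : ℕ → S => w 0) inferInstance] A := by
        have : pathPast (S := S) 0 ≤ MeasurableSpace.comap (fun w : ℕ → S => w 0) inferInstance := by
          refine iSup_le fun k => ?_
          have : (k : ℕ) = 0 := by omega
          rw [this]
        exact this _ hA
      obtain ⟨B, hB, rfl⟩ := hA'
      rw [← Measure.map_apply (measurable_pi_apply 0) hB, h0,
        Measure.map_apply (measurable_pi_apply 0) hB]
    | succ n ih =>
      intro A hA
      have htrim : μ.trim (pathPast_le n) = μ'.trim (pathPast_le n) := by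
        refine @Measure.ext _ (pathPast n) _ _ fun s hs => ?_
        rw [trim_measurableSet_eq _ hs, trim_measurableSet_eq _ hs, ih s hs]
      let C : Set (Set (ℕ → S)) :=
        {s | ∃ A B, MeasurableSet[pathPast n] A ∧ MeasurableSet B ∧
          s = A ∩ (fun w : ℕ → S => w (n + 1)) ⁻¹' B}
      have hgen : pathPast (S := S) (n + 1) = MeasurableSpace.generateFrom C := by
        refine le_antisymm (iSup_le fun k => ?_) (MeasurableSpace.generateFrom_le ?_)
        · rintro _ ⟨B, hB, rfl⟩
          refine MeasurableSpace.measurableSet_generateFrom ?_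
          rcases Nat.lt_or_ge k (n + 1) with hk | hk
          · exact ⟨(fun w => w k) ⁻¹' B, Set.univ,
              measurable_coord_pathPast (by omega) hB, .univ, by simp⟩
          · have : (k : ℕ) = n + 1 := by omega
            exact ⟨Set.univ, B, MeasurableSet.univ, hB, by simp [this]⟩
        · rintro _ ⟨A, B, hA, hB, rfl⟩
          exact (pathPast_mono (Nat.le_succ n) _ hA).inter
            (measurable_coord_pathPast le_rfl hB)
      have hpi : IsPiSystem C := by
        rintro _ ⟨A, B, hA, hB, rfl⟩ _ ⟨A', B', hA', hB', rfl⟩ _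
        refine ⟨A ∩ A', B ∩ B', hA.inter hA', hB.inter hB', ?_⟩
        ext w; simp only [Set.mem_inter_iff, Set.mem_preimage]; tauto
      have hC : ∀ s ∈ C, μ s = μ' s := by
        rintro _ ⟨A, B, hA, hB, rfl⟩
        have hm : Measurable[pathPast n]
            (A.indicator fun w : ℕ → S => κ (w n) B) := by
          refine Measurable.indicator ?_ hA
          exact (κ.measurable_coe hB).comp (measurable_coord_pathPast le_rfl)
        -- The integrand in the Markov identity is measurable for `pathPast n`, so both sides depend
        -- only on the trimmed measures, which agree by induction.
        rw [h n A B hA hB, h' n A B hA hB, ← lintegral_indicator (pathPast_le n _ hA),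
          ← lintegral_indicator (pathPast_le n _ hA), ← lintegral_trim (pathPast_le n) hm,
          ← lintegral_trim (pathPast_le n) hm, htrim]
      have := @ext_of_generate_finite _ (pathPast (n + 1)) (μ.trim (pathPast_le (n + 1)))
        (μ'.trim (pathPast_le (n + 1))) C hgen hpi (isFiniteMeasure_trim _) ?_ ?_
      · have h2 := congrArg (fun m => m A) this
        simpa only [trim_measurableSet_eq _ hA] using h2
      · rintro s hs
        have hs' : MeasurableSet[pathPast (n + 1)] s := by
          rw [hgen]; exact MeasurableSpace.measurableSet_generateFrom hs
        rw [trim_measurableSet_eq _ hs', trim_measurableSet_eq _ hs', hC s hs]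
      · rw [trim_measurableSet_eq _ MeasurableSet.univ, trim_measurableSet_eq _ MeasurableSet.univ,
          huniv]
  exact ext_of_pathPast key

/-- Forget the first `k` coordinates of a path. -/
def drop (k : ℕ) (w : ℕ → S) : ℕ → S := fun n => w (n + k)

lemma measurable_drop (k : ℕ) : Measurable (drop k : (ℕ → S) → ℕ → S) :=
  measurable_pi_lambda _ fun _ => measurable_pi_apply _

lemma measurableSet_drop_preimage {n k : ℕ} {A : Set (ℕ → S)} (hA : MeasurableSet[pathPast n] A) :
    MeasurableSet[pathPast (n + k)] (drop k ⁻¹' A) := by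
  have : @Measurable _ _ (pathPast (n + k)) (pathPast n) (drop k : (ℕ → S) → ℕ → S) := by
    refine Measurable.of_le_map (iSup_le fun j => ?_)
    rintro _ ⟨B, hB, rfl⟩
    exact measurable_coord_pathPast (k := j + k) (by omega) hB
  exact this hA

/-- Intersecting with an event known at time `k` stays inside the past of time `n + k`, where the
Markov identity is available. This is the source of the Markov property at a fixed time. -/
lemma IsMarkovLaw.map_drop_restrict {κ : Kernel S S} {μ : Measure (ℕ → S)}
    (h : IsMarkovLaw κ μ) {k : ℕ} {C : Set (ℕ → S)} (hC : MeasurableSet[pathPast k] C) :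
    IsMarkovLaw κ ((μ.restrict C).map (drop k)) := by
  intro n A B hA hB
  have hA' := pathPast_le n _ hA
  have hm : Measurable fun w : ℕ → S => κ (w n) B :=
    (κ.measurable_coe hB).comp (measurable_pi_apply n)
  have hD : MeasurableSet (drop k ⁻¹' A) := measurable_drop k hA'
  rw [Measure.map_apply (measurable_drop k) (hA'.inter (measurable_pi_apply _ hB)),
    setLIntegral_map hA' hm (measurable_drop k), Measure.restrict_apply
      (measurable_drop k (hA'.inter (measurable_pi_apply _ hB))),
    Measure.restrict_restrict hD]
  have := h (n + k) (drop k ⁻¹' A ∩ C) B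
    ((measurableSet_drop_preimage hA).inter (pathPast_mono (Nat.le_add_left k n) _ hC)) hB
  rw [show drop k ⁻¹' (A ∩ (fun w => w (n + 1)) ⁻¹' B) ∩ C =
    drop k ⁻¹' A ∩ C ∩ (fun w => w (n + k + 1)) ⁻¹' B by
      ext w; simp only [drop, Set.mem_inter_iff, Set.mem_preimage, Nat.add_right_comm n 1 k]; tauto,
    this]
  rfl

/-- Path-dependent version of a homogeneous kernel, as input for the Ionescu-Tulcea theorem. -/
def pathStep (κ : Kernel S S) (n : ℕ) : Kernel (Π _ : Finset.Iic n, S) S :=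
  κ.comap (fun u => u ⟨n, Finset.mem_Iic.2 le_rfl⟩) (measurable_pi_apply _)

instance (κ : Kernel S S) [IsMarkovKernel κ] (n : ℕ) : IsMarkovKernel (pathStep κ n) := by
  unfold pathStep; infer_instance

/-- The law of the Markov chain with kernel `κ`, as a function of the initial state. -/
def pathKernel (κ : Kernel S S) [IsMarkovKernel κ] : Kernel S (ℕ → S) :=
  (Kernel.traj (X := fun _ => S) (pathStep κ) 0).comap
    (fun x _ => x) (measurable_pi_lambda _ fun _ => measurable_id)

instance (κ : Kernel S S) [IsMarkovKernel κ] : IsMarkovKernel (pathKernel κ) := by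
  unfold pathKernel; infer_instance

/-- Connects the kernel with `Kernel.trajMeasure`, for which the joint law of the past and the next
coordinate is known. -/
lemma pathKernel_apply_eq (κ : Kernel S S) [IsMarkovKernel κ] (x : S) :
    pathKernel κ x = Kernel.trajMeasure (X := fun _ => S) (Measure.dirac x) (pathStep κ) := by
  have h : (Measure.dirac x).map (MeasurableEquiv.piUnique fun _ : Finset.Iic 0 => S).symm =
      Measure.dirac (fun _ => x) := Measure.map_dirac' (MeasurableEquiv.measurable _) _
  have h2 := Measure.dirac_bind (Kernel.traj (X := fun _ => S) (pathStep κ) 0).measurable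
    (fun _ => x)
  exact h2.symm.trans (congrArg (fun m => m.bind
    (Kernel.traj (X := fun _ => S) (pathStep κ) 0)) h.symm)

lemma isMarkovLaw_pathKernel (κ : Kernel S S) [IsMarkovKernel κ] (x : S) :
    IsMarkovLaw κ (pathKernel κ x) := by
  intro n A B hA hB
  have hle : pathPast (S := S) n ≤
      MeasurableSpace.comap (Preorder.frestrictLe (π := fun _ => S) n)
        MeasurableSpace.pi := by
    refine iSup_le fun k => ?_
    rintro _ ⟨B', hB', rfl⟩
    have hB'' : MeasurableSet B' := hB'
    exact ⟨(fun u => u ⟨k, Finset.mem_Iic.2 (by omega)⟩) ⁻¹' B', measurable_pi_apply _ hB'', rfl⟩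
  obtain ⟨A', hA', rfl⟩ := hle _ hA
  have hr : Measurable (Preorder.frestrictLe (π := fun _ => S) n) := by fun_prop
  have h := Kernel.map_frestrictLe_trajMeasure_compProd_eq_map_trajMeasure
    (X := fun _ => S) (μ₀ := Measure.dirac x) (κ := pathStep κ) (a := n)
  rw [← pathKernel_apply_eq] at h
  have h2 := congrArg (fun m => m (A' ×ˢ B)) h
  beta_reduce at h2
  rw [Measure.compProd_apply_prod hA' hB, Measure.map_apply (by fun_prop) (hA'.prod hB),
    setLIntegral_map hA' ((pathStep κ n).measurable_coe hB) hr] at h2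
  exact h2.symm

lemma pathKernel_map_zero (κ : Kernel S S) [IsMarkovKernel κ] (x : S) :
    (pathKernel κ x).map (fun w => w 0) = Measure.dirac x := by
  have h := Kernel.traj_map_frestrictLe_apply (X := fun _ => S) (κ := pathStep κ) 0 0 (fun _ => x)
  rw [Kernel.partialTraj_self] at h
  have hr : Measurable (Preorder.frestrictLe (π := fun _ => S) 0) := by fun_prop
  have he : Measurable fun u : Π _ : Finset.Iic 0, S => u ⟨0, Finset.mem_Iic.2 le_rfl⟩ :=
    measurable_pi_apply _
  have h2 := congrArg (fun m => m.map fun u => u ⟨0, Finset.mem_Iic.2 le_rfl⟩) h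
  beta_reduce at h2
  rw [Measure.map_map he hr, Kernel.id_apply,
    show (Measure.dirac fun _ => x).map (fun u : Π _ : Finset.Iic 0, S =>
      u ⟨0, Finset.mem_Iic.2 le_rfl⟩) = Measure.dirac x from Measure.map_dirac' he _] at h2
  exact h2

lemma isMarkovLaw_comp_pathKernel (κ : Kernel S S) [IsMarkovKernel κ] (μ : Measure S) :
    IsMarkovLaw κ (pathKernel κ ∘ₘ μ) := by
  intro n A B hA hB
  have hA' := pathPast_le n _ hA
  have hm : Measurable fun w : ℕ → S => κ (w n) B :=
    (κ.measurable_coe hB).comp (measurable_pi_apply n)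
  rw [Measure.bind_apply (hA'.inter (measurable_pi_apply _ hB)) (Kernel.aemeasurable _),
    ← lintegral_indicator hA', Measure.lintegral_bind (Kernel.aemeasurable _)
      (hm.indicator hA').aemeasurable]
  refine lintegral_congr fun x => ?_
  rw [lintegral_indicator hA']
  exact isMarkovLaw_pathKernel κ x n A B hA hB

lemma comp_pathKernel_map_zero (κ : Kernel S S) [IsMarkovKernel κ] (μ : Measure S) :
    (pathKernel κ ∘ₘ μ).map (fun w => w 0) = μ := by
  rw [Measure.map_comp _ _ (measurable_pi_apply 0)]
  have : (pathKernel κ).map (fun w => w 0) = Kernel.id := by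
    ext1 x
    rw [Kernel.map_apply _ (measurable_pi_apply 0), pathKernel_map_zero, Kernel.id_apply]
  rw [this, Measure.id_comp]

lemma IsMarkovLaw.eq_comp_pathKernel {κ : Kernel S S} [IsMarkovKernel κ] {μ : Measure (ℕ → S)}
    [IsFiniteMeasure μ] (h : IsMarkovLaw κ μ) :
    μ = pathKernel κ ∘ₘ (μ.map fun w => w 0) :=
  h.ext (isMarkovLaw_comp_pathKernel κ _) (comp_pathKernel_map_zero κ _).symm

/-- The Markov property at a fixed time. -/
lemma IsMarkovLaw.measure_inter_drop {κ : Kernel S S} [IsMarkovKernel κ] {μ : Measure (ℕ → S)}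
    [IsFiniteMeasure μ] (h : IsMarkovLaw κ μ) {k : ℕ} {C A : Set (ℕ → S)}
    (hC : MeasurableSet[pathPast k] C) (hA : MeasurableSet A) :
    μ (drop k ⁻¹' A ∩ C) = ∫⁻ w in C, pathKernel κ (w k) A ∂μ := by
  have h1 := (h.map_drop_restrict hC).eq_comp_pathKernel
  have h2 := congrArg (fun m => m A) h1
  beta_reduce at h2
  rw [Measure.map_map (measurable_pi_apply 0) (measurable_drop k),
    Measure.bind_apply hA (Kernel.aemeasurable _), Measure.map_apply (measurable_drop k) hA,
    Measure.restrict_apply (measurable_drop k hA), lintegral_map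
      ((pathKernel κ).measurable_coe hA) ((measurable_pi_apply 0).comp (measurable_drop k))] at h2
  rw [h2]
  simp [drop]

/-- The shifted law is again a Markov law, and invariance of `ν` says that its initial measure is
still `ν`; uniqueness of Markov laws does the rest. -/
lemma measurePreserving_drop (κ : Kernel S S) [IsMarkovKernel κ] (ν : Measure S)
    [IsFiniteMeasure ν] (hν : Kernel.Invariant κ ν) :
    MeasurePreserving (drop 1) (pathKernel κ ∘ₘ ν) (pathKernel κ ∘ₘ ν) := by
  refine ⟨measurable_drop 1, ?_⟩
  have hM := isMarkovLaw_comp_pathKernel κ ν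
  have hM1 : IsMarkovLaw κ ((pathKernel κ ∘ₘ ν).map (drop 1)) := by
    simpa using hM.map_drop_restrict (k := 1) (C := Set.univ) MeasurableSet.univ
  refine hM1.ext hM ?_
  rw [Measure.map_map (measurable_pi_apply 0) (measurable_drop 1)]
  ext B hB
  rw [Measure.map_apply ((measurable_pi_apply 0).comp (measurable_drop 1)) hB]
  have h := hM 0 Set.univ B MeasurableSet.univ hB
  rw [Set.univ_inter, Measure.restrict_univ] at h
  change (pathKernel κ ∘ₘ ν) ((fun w => w (0 + 1)) ⁻¹' B) = _
  rw [h, ← lintegral_map (f := fun x => κ x B) (κ.measurable_coe hB) (measurable_pi_apply 0),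
    comp_pathKernel_map_zero, ← Measure.bind_apply hB (Kernel.aemeasurable _), hν]

end PathSpace

end SASGLD
end

noncomputable section

namespace SASGLD

/-! ### Setwise convergence of the laws. -/

section Setwise

variable {S : Type*} [MeasurableSpace S]

/-- Setwise convergence of measures. -/
def SetwiseTendsto (μ : ℕ → Measure S) (ν : Measure S) : Prop :=
  ∀ B, MeasurableSet B → Tendsto (fun n => μ n B) atTop (𝓝 (ν B))

/-- Fatou's lemma for setwise convergent measures. -/
lemma SetwiseTendsto.lintegral_le {μ : ℕ → Measure S} {ν : Measure S}
    (h : SetwiseTendsto μ ν) (F : S → ENNReal) {c : ENNReal}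
    (hc : ∃ᶠ n in atTop, ∫⁻ x, F x ∂(μ n) ≤ c) : ∫⁻ x, F x ∂ν ≤ c := by
  -- It suffices to bound the integrals of simple functions below `F`; these are finite combinations
  -- of measures of sets and therefore converge.
  rw [lintegral_eq_nnreal]
  refine iSup₂_le fun φ hφ => ?_
  have hlim : Tendsto (fun n => (φ.map ((↑) : NNReal → ENNReal)).lintegral (μ n)) atTop
      (𝓝 ((φ.map ((↑) : NNReal → ENNReal)).lintegral ν)) := by
    simp only [SimpleFunc.map_lintegral]
    exact tendsto_finsetSum _ fun i _ =>
      ENNReal.Tendsto.const_mul (h _ (φ.measurableSet_fiber i)) (Or.inr ENNReal.coe_ne_top)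
  refine le_of_tendsto_of_frequently hlim (hc.mono fun n hn => ?_)
  refine le_trans ?_ hn
  rw [← SimpleFunc.lintegral_eq_lintegral]
  exact lintegral_mono fun x => hφ x

lemma measureReal_abs_sub_le_tvDist (μ ν : Measure S) [IsProbabilityMeasure μ]
    [IsProbabilityMeasure ν] {B : Set S} (hB : MeasurableSet B) :
    |μ.real B - ν.real B| ≤ tvDist μ ν := by
  -- The bound `1` is needed because an unbounded real supremum would take the default value `0`.
  refine le_ciSup (f := fun B : {B : Set S // MeasurableSet B} => |μ.real B - ν.real B|)
    ⟨1, ?_⟩ ⟨B, hB⟩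
  rintro _ ⟨B, rfl⟩
  have h1 : μ.real B ≤ 1 := measureReal_le_one
  have h2 : ν.real B ≤ 1 := measureReal_le_one
  have h3 : 0 ≤ μ.real (B : Set S) := measureReal_nonneg
  have h4 : 0 ≤ ν.real (B : Set S) := measureReal_nonneg
  exact abs_sub_le_iff.2 ⟨by linarith, by linarith⟩

instance isMarkovKernel_pow (κ : Kernel S S) [IsMarkovKernel κ] (n : ℕ) :
    IsMarkovKernel (κ ^ n) := by
  induction n with
  | zero => rw [pow_zero]; exact inferInstanceAs (IsMarkovKernel Kernel.id)
  | succ n ih => rw [pow_succ]; exact inferInstanceAs (IsMarkovKernel ((κ ^ n) ∘ₖ κ))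

lemma IsErgodicKernel.setwiseTendsto {κ : Kernel S S} [IsMarkovKernel κ] {D : Set S}
    {ν : Measure S} [IsProbabilityMeasure ν] (h : IsErgodicKernel κ D ν) {x : S} (hx : x ∈ D) :
    SetwiseTendsto (fun n => (κ ^ n) x) ν := by
  intro B hB
  have : Tendsto (fun n => ((κ ^ n) x).real B) atTop (𝓝 (ν.real B)) := by
    rw [tendsto_iff_dist_tendsto_zero]
    exact squeeze_zero (fun _ => dist_nonneg)
      (fun n => measureReal_abs_sub_le_tvDist ((κ ^ n) x) ν hB) (h.tendsto_tv x hx)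
  exact (ENNReal.tendsto_toReal_iff (fun _ => measure_ne_top _ _) (measure_ne_top _ _)).1 this

end Setwise

/-! ### A zero-one law for shift-invariant events. -/

section ZeroOne

variable {S : Type*}

lemma drop_preimage_of_invariant {A : Set (ℕ → S)} (hA1 : drop 1 ⁻¹' A = A) (k : ℕ) :
    drop k ⁻¹' A = A := by
  induction k with
  | zero => rfl
  | succ n ih =>
    have : (drop (n + 1) : (ℕ → S) → ℕ → S) = drop 1 ∘ drop n := by
      funext w i; exact congrArg w (by omega)
    rw [this, Set.preimage_comp, hA1, ih]

variable [MeasurableSpace S] {κ : Kernel S S} [IsMarkovKernel κ]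

lemma pathKernel_map_one (x : S) : (pathKernel κ x).map (fun w => w 1) = κ x := by
  ext B hB
  rw [Measure.map_apply (measurable_pi_apply 1) hB]
  have h := isMarkovLaw_pathKernel κ x 0 Set.univ B MeasurableSet.univ hB
  rw [Set.univ_inter, Measure.restrict_univ, ← lintegral_map (f := fun x => κ x B)
    (κ.measurable_coe hB) (measurable_pi_apply 0), pathKernel_map_zero,
    lintegral_dirac' _ (κ.measurable_coe hB)] at h
  exact h

/-- The Markov property at time one shows that `x ↦ pathKernel κ x A` is harmonic for `κ` when `A`
is shift-invariant. -/
lemma lintegral_pow_pathKernel {A : Set (ℕ → S)} (hA : MeasurableSet A)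
    (hA1 : drop 1 ⁻¹' A = A) (n : ℕ) (x : S) :
    ∫⁻ y, pathKernel κ y A ∂((κ ^ n) x) = pathKernel κ x A := by
  have h1 : ∀ x, ∫⁻ y, pathKernel κ y A ∂(κ x) = pathKernel κ x A := by
    intro x
    have h := (isMarkovLaw_pathKernel κ x).measure_inter_drop (k := 1) (C := Set.univ)
      MeasurableSet.univ hA
    rw [Set.inter_univ, hA1, Measure.restrict_univ,
      ← lintegral_map (f := fun x => pathKernel κ x A) ((pathKernel κ).measurable_coe hA)
      (measurable_pi_apply 1), pathKernel_map_one] at h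
    exact h.symm
  induction n generalizing x with
  | zero =>
    rw [pow_zero]
    change ∫⁻ y, _ ∂((Kernel.id : Kernel S S) x) = _
    rw [Kernel.id_apply, lintegral_dirac' _ ((pathKernel κ).measurable_coe hA)]
  | succ n ih =>
    rw [pow_succ]
    change ∫⁻ y, _ ∂(((κ ^ n) ∘ₖ κ) x) = _
    rw [Kernel.lintegral_comp _ _ _ ((pathKernel κ).measurable_coe hA)]
    simp_rw [ih, h1]

/-- Shift-invariant events have the same probability from every initial state. -/
lemma IsErgodicKernel.pathKernel_eq {D : Set S} {ν : Measure S} [IsProbabilityMeasure ν]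
    (herg : IsErgodicKernel κ D ν) {A : Set (ℕ → S)} (hA : MeasurableSet A)
    (hA1 : drop 1 ⁻¹' A = A) {x : S} (hx : x ∈ D) :
    pathKernel κ x A = (pathKernel κ ∘ₘ ν) A := by
  have hset := herg.setwiseTendsto hx
  -- Harmonicity and Fatou's lemma for the convergent `n`-step laws give one inequality; its
  -- application to the complement gives the other one.
  have hle : ∀ A : Set (ℕ → S), MeasurableSet A → drop 1 ⁻¹' A = A →
      (pathKernel κ ∘ₘ ν) A ≤ pathKernel κ x A := by
    intro A hA hA1
    rw [Measure.bind_apply hA (Kernel.aemeasurable _)]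
    exact hset.lintegral_le _ (Frequently.of_forall fun n => (lintegral_pow_pathKernel hA hA1 n x).le)
  refine le_antisymm ?_ (hle A hA hA1)
  have h2 := hle Aᶜ hA.compl (by rw [Set.preimage_compl, hA1])
  rw [prob_compl_eq_one_sub hA, prob_compl_eq_one_sub hA] at h2
  exact (ENNReal.sub_le_sub_iff_left prob_le_one ENNReal.one_ne_top).1 h2

/-- An invariant event can be read off from the path after time `k`. By the Markov property it is
independent of the past of time `k`, with the probability common to all initial states in `D`. The
initial law is arbitrary, which is what transfers null sets from the stationary chain to the given
one. -/
lemma IsErgodicKernel.measure_eq_of_invariant {D : Set S} {ν : Measure S}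
    [IsProbabilityMeasure ν] (herg : IsErgodicKernel κ D ν) {A : Set (ℕ → S)}
    (hA : MeasurableSet A) (hA1 : drop 1 ⁻¹' A = A) {μ : Measure (ℕ → S)}
    [IsProbabilityMeasure μ] (hμ : IsMarkovLaw κ μ) (hμD : ∀ k, ∀ᵐ w ∂μ, w k ∈ D) {k : ℕ}
    {C : Set (ℕ → S)} (hC : MeasurableSet[pathPast k] C) :
    μ (A ∩ C) = (pathKernel κ ∘ₘ ν) A * μ C := by
  have h := hμ.measure_inter_drop hC hA
  rw [drop_preimage_of_invariant hA1] at h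
  rw [h, lintegral_congr_ae (g := fun _ => (pathKernel κ ∘ₘ ν) A), setLIntegral_const]
  refine ae_restrict_of_ae ?_
  filter_upwards [hμD k] with w hw
  exact herg.pathKernel_eq hA hA1 hw

/-- Independence of the past of every time extends to the generated `σ`-algebra, so the event is
independent of itself. -/
lemma IsErgodicKernel.zero_one {D : Set S} {ν : Measure S} [IsProbabilityMeasure ν]
    (herg : IsErgodicKernel κ D ν) (hD : ∀ᵐ x ∂ν, x ∈ D)
    {A : Set (ℕ → S)} (hA : MeasurableSet A) (hA1 : drop 1 ⁻¹' A = A) :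
    (pathKernel κ ∘ₘ ν) A = 0 ∨ (pathKernel κ ∘ₘ ν) A = 1 := by
  set μ := pathKernel κ ∘ₘ ν with hμ
  have hmp := measurePreserving_drop κ ν herg.invariant
  have hμD : ∀ k, ∀ᵐ w ∂μ, w k ∈ D := by
    intro k
    have hk : MeasurePreserving (fun w : ℕ → S => w k) μ ν := by
      induction k with
      | zero => exact ⟨measurable_pi_apply 0, comp_pathKernel_map_zero κ ν⟩
      | succ n ih => exact ih.comp hmp
    exact hk.quasiMeasurePreserving.ae hD
  have hM := isMarkovLaw_comp_pathKernel κ ν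
  have key : μ.restrict A = (μ A) • μ := by
    have : IsFiniteMeasure ((μ A) • μ) := Measure.smul_finite μ (measure_ne_top _ _)
    refine ext_of_pathPast fun n C hC => ?_
    rw [Measure.restrict_apply (pathPast_le n _ hC), Set.inter_comm,
      herg.measure_eq_of_invariant hA hA1 hM hμD hC]
    rfl
  have h2 := congrArg (fun m => m A) key
  beta_reduce at h2
  rw [Measure.restrict_apply hA, Set.inter_self, Measure.smul_apply, smul_eq_mul] at h2
  by_cases h0 : μ A = 0
  · exact Or.inl h0
  · refine Or.inr ?_
    have h3 := (ENNReal.mul_eq_left h0 (measure_ne_top μ A)).1 h2.symm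
    exact h3

end ZeroOne

/-! ### The strong law of large numbers for ergodic Markov chains. -/

section StrongLaw

variable {S : Type*}

/-- Paths along which the averages of `g` infinitely often exceed a level above `c`. -/
def upperDeviation (g : S → ℝ) (c : ℝ) : Set (ℕ → S) :=
  {w | ∃ j : ℕ, ∃ᶠ n : ℕ in atTop,
    (c + 1 / ((j : ℝ) + 1)) * n < ∑ k ∈ Finset.range n, g (w k)}

/-- Additive constants are absorbed by an arbitrarily small loss of slope, since `(e - e') * n`
eventually exceeds them. -/
lemma frequently_average_shift {s : ℕ → ℝ} {a b e e' : ℝ} (he : e' < e)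
    (h : ∃ᶠ n : ℕ in atTop, e * n + b < s n + a) : ∃ᶠ n : ℕ in atTop, e' * n < s n := by
  have hev : ∀ᶠ n : ℕ in atTop, a - b ≤ (e - e') * n :=
    (tendsto_natCast_atTop_atTop.const_mul_atTop (sub_pos.2 he)).eventually_ge_atTop _
  refine (h.and_eventually hev).mono fun n ⟨h1, h2⟩ => ?_
  nlinarith

/-- The upper limit of the averages ignores finitely many terms. The level above `c` is quantified
existentially in order to make the event exactly invariant: removing or adding one term costs the
passage from `j` to `j + 1`. -/
lemma drop_preimage_upperDeviation (g : S → ℝ) (c : ℝ) :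
    drop 1 ⁻¹' upperDeviation g c = upperDeviation g c := by
  have hlt : ∀ j : ℕ, c + 1 / (((j + 1 : ℕ) : ℝ) + 1) < c + 1 / ((j : ℝ) + 1) := by
    intro j
    have : 1 / (((j + 1 : ℕ) : ℝ) + 1) < 1 / ((j : ℝ) + 1) :=
      one_div_lt_one_div_of_lt (by positivity) (by push_cast; linarith)
    linarith
  have hsum : ∀ (w : ℕ → S) (n : ℕ), ∑ k ∈ Finset.range (n + 1), g (w k) =
      ∑ k ∈ Finset.range n, g (drop 1 w k) + g (w 0) := fun w n => Finset.sum_range_succ' _ _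
  ext w
  constructor
  · rintro ⟨j, hj⟩
    refine ⟨j + 1, ?_⟩
    have h2 : ∃ᶠ n : ℕ in atTop, (c + 1 / (((j + 1 : ℕ) : ℝ) + 1)) * ((n + 1 : ℕ) : ℝ) <
        ∑ k ∈ Finset.range (n + 1), g (w k) := by
      have := frequently_average_shift (s := fun n => ∑ k ∈ Finset.range n, g (drop 1 w k))
        (a := 0) (b := 0) (hlt j) (by simpa using hj)
      have h3 := frequently_average_shift
        (s := fun n => ∑ k ∈ Finset.range (n + 1), g (w k) -
          (c + 1 / (((j + 1 : ℕ) : ℝ) + 1)))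
        (a := c + 1 / (((j + 1 : ℕ) : ℝ) + 1) - g (w 0)) (b := 0) (hlt j)
        (by
          refine hj.mono fun n hn => ?_
          rw [hsum]
          linarith)
      refine h3.mono fun n hn => ?_
      push_cast at hn ⊢
      linarith
    exact (tendsto_add_atTop_nat 1).frequently (p := fun n : ℕ =>
      (c + 1 / (((j + 1 : ℕ) : ℝ) + 1)) * n < ∑ k ∈ Finset.range n, g (w k)) h2
  · rintro ⟨j, hj⟩
    refine ⟨j + 1, ?_⟩
    have h2 : ∃ᶠ n : ℕ in atTop, (c + 1 / ((j : ℝ) + 1)) * ((n + 1 : ℕ) : ℝ) <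
        ∑ k ∈ Finset.range (n + 1), g (w k) := by
      rw [frequently_atTop] at hj ⊢
      intro a
      obtain ⟨b, hb, h⟩ := hj (a + 1)
      obtain ⟨m, rfl⟩ : ∃ m, b = m + 1 := ⟨b - 1, by omega⟩
      exact ⟨m, by omega, h⟩
    refine frequently_average_shift (a := g (w 0)) (b := c + 1 / ((j : ℝ) + 1)) (hlt j)
      (h2.mono fun n hn => ?_)
    rw [hsum] at hn
    push_cast at hn
    linarith

lemma drop_one_iterate (k : ℕ) : (drop 1 : (ℕ → S) → ℕ → S)^[k] = drop k := by
  induction k with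
  | zero => rfl
  | succ n ih =>
    rw [Function.iterate_succ, ih]
    funext w i
    exact congrArg w (by omega)

variable [MeasurableSpace S]

lemma measurableSet_upperDeviation {g : S → ℝ} (hg : Measurable g) (c : ℝ) :
    MeasurableSet (upperDeviation g c) := by
  simp only [upperDeviation, frequently_atTop, Set.ofPred_exists, Set.ofPred_forall]
  refine MeasurableSet.iUnion fun j => MeasurableSet.iInter fun a => MeasurableSet.iUnion fun b => ?_
  have h : Measurable fun w : ℕ → S => ∑ k ∈ Finset.range b, g (w k) := by
    exact Finset.measurable_sum _ fun k _ => hg.comp (measurable_pi_apply k)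
  exact (MeasurableSet.const (a ≤ b)).inter
    (measurableSet_lt (measurable_const (a := (c + 1 / ((j : ℝ) + 1)) * b)) h)

variable {κ : Kernel S S} [IsMarkovKernel κ]

/-- By the zero-one law the only alternative is full measure. Then almost every path has a positive
Birkhoff sum of `g - c`, and the maximal inequality forces `c ≤ ∫ g`. -/
lemma measure_upperDeviation_eq_zero {D : Set S} {ν : Measure S} [IsProbabilityMeasure ν]
    (herg : IsErgodicKernel κ D ν) (hD : ∀ᵐ x ∂ν, x ∈ D) {g : S → ℝ}
    (hgm : Measurable g) (hg : Integrable g ν) {c : ℝ} (hc : ∫ x, g x ∂ν < c) :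
    (pathKernel κ ∘ₘ ν) (upperDeviation g c) = 0 := by
  have hmp := measurePreserving_drop κ ν herg.invariant
  refine (herg.zero_one hD (measurableSet_upperDeviation hgm c)
    (drop_preimage_upperDeviation g c)).resolve_right fun h1 => ?_
  have h0 : MeasurePreserving (fun w : ℕ → S => w 0) (pathKernel κ ∘ₘ ν) ν :=
    ⟨measurable_pi_apply 0, comp_pathKernel_map_zero κ ν⟩
  have hint : Integrable (fun w : ℕ → S => g (w 0) - c) (pathKernel κ ∘ₘ ν) :=
    ((h0.integrable_comp hg.1).2 hg).sub (integrable_const _)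
  have hpos := integral_nonneg_of_exists_birkhoffSum_pos hmp
    (g := fun w : ℕ → S => g (w 0) - c) ((hgm.comp (measurable_pi_apply 0)).sub_const c) hint
    (by
      have h1' : ∀ᵐ w ∂(pathKernel κ ∘ₘ ν), w ∈ upperDeviation g c := by
        exact (mem_ae_iff_prob_eq_one (measurableSet_upperDeviation hgm c)).2 h1
      filter_upwards [h1'] with w ⟨j, hj⟩
      obtain ⟨n, hn⟩ := hj.exists
      refine ⟨n, ?_⟩
      simp only [birkhoffSum, drop_one_iterate, drop, zero_add, Finset.sum_sub_distrib,
        Finset.sum_const, Finset.card_range, nsmul_eq_mul]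
      have : (0 : ℝ) ≤ 1 / ((j : ℝ) + 1) * n := by positivity
      nlinarith)
  have hg0 : Integrable (fun w : ℕ → S => g (w 0)) (pathKernel κ ∘ₘ ν) :=
    (h0.integrable_comp hg.1).2 hg
  rw [integral_sub hg0 (integrable_const _)] at hpos
  have h3 : ∫ w : ℕ → S, g (w 0) ∂(pathKernel κ ∘ₘ ν) = ∫ x, g x ∂ν := by
    conv_rhs => rw [← h0.map_eq]
    rw [integral_map h0.measurable.aemeasurable hgm.aestronglyMeasurable]
  rw [h3] at hpos
  simp at hpos
  linarith

variable {Ω : Type*} [MeasurableSpace Ω] {P : Measure Ω} [IsProbabilityMeasure P]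
  {X : ℕ → Ω → S}

/-- The `σ`-algebra generated by `X_0, …, X_n`. -/
abbrev chainPast (X : ℕ → Ω → S) (n : ℕ) : MeasurableSpace Ω :=
  ⨆ k : Fin (n + 1), MeasurableSpace.comap (X k) inferInstance

lemma isMarkovLaw_of_isMarkovChain (hX : ∀ n, Measurable (X n)) (h : IsMarkovChain P X κ) :
    IsMarkovLaw κ (P.map fun ω n => X n ω) := by
  have hXm : Measurable fun ω n => X n ω := measurable_pi_lambda _ hX
  intro n A B hA hB
  have hle : chainPast X n ≤ (inferInstance : MeasurableSpace Ω) := iSup_le fun k => (hX k).comap_le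
  have hA' : MeasurableSet[chainPast X n] ((fun ω n => X n ω) ⁻¹' A) := by
    have : @Measurable _ _ (chainPast X n) (pathPast n) (fun ω n => X n ω) := by
      refine Measurable.of_le_map (iSup_le fun j => ?_)
      rintro _ ⟨B, hB, rfl⟩
      exact (le_iSup (fun k : Fin (n + 1) => MeasurableSpace.comap (X k) inferInstance) j) _
        ⟨B, hB, rfl⟩
    exact this hA
  have hAp := pathPast_le n _ hA
  rw [Measure.map_apply hXm (hAp.inter (measurable_pi_apply _ hB)),
    setLIntegral_map hAp (show Measurable fun w : ℕ → S => κ (w n) B from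
      (κ.measurable_coe hB).comp (measurable_pi_apply n)) hXm]
  have h1 := setIntegral_condExp hle (f := (X (n + 1) ⁻¹' B).indicator fun _ => (1 : ℝ))
    ((integrable_const (μ := P) (1 : ℝ)).indicator (hX _ hB)) hA'
  rw [setIntegral_congr_ae (hle _ hA') ((h n B hB).mono fun ω hω _ => hω),
    setIntegral_indicator (hX _ hB), setIntegral_one_eq_measureReal] at h1
  have h2 : ∫ ω in (fun ω n => X n ω) ⁻¹' A, (κ (X n ω)).real B ∂P =
      (∫⁻ ω in (fun ω n => X n ω) ⁻¹' A, κ (X n ω) B ∂P).toReal :=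
    integral_toReal ((κ.measurable_coe hB).comp (hX n)).aemeasurable
      (ae_of_all _ fun _ => measure_lt_top _ _)
  rw [h2, Measure.real] at h1
  refine ((ENNReal.toReal_eq_toReal_iff' ?_ (measure_ne_top _ _)).1 h1).symm
  refine ne_top_of_le_ne_top (measure_ne_top P Set.univ) ?_
  calc _ ≤ ∫⁻ ω in (fun ω n => X n ω) ⁻¹' A, 1 ∂P := lintegral_mono fun _ => prob_le_one
    _ ≤ _ := by simpa using measure_mono (μ := P) (Set.subset_univ _)

lemma IsMarkovChain.map_eq (hX : ∀ n, Measurable (X n)) (h : IsMarkovChain P X κ) (n : ℕ) :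
    P.map (X n) = (κ ^ n) ∘ₘ P.map (X 0) := by
  induction n with
  | zero =>
    rw [pow_zero]
    exact (Measure.id_comp).symm
  | succ n ih =>
    rw [pow_succ']
    change _ = (κ ∘ₖ (κ ^ n)) ∘ₘ _
    rw [← Measure.comp_assoc, ← ih]
    ext B hB
    have h1 := isMarkovLaw_of_isMarkovChain hX h n Set.univ B MeasurableSet.univ hB
    have hXm : Measurable fun ω n => X n ω := measurable_pi_lambda _ hX
    have hm : Measurable fun w : ℕ → S => κ (w n) B :=
      (κ.measurable_coe hB).comp (measurable_pi_apply n)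
    rw [Set.univ_inter, Measure.restrict_univ, Measure.map_apply hXm (measurable_pi_apply _ hB),
      lintegral_map hm hXm] at h1
    rw [Measure.bind_apply hB (Kernel.aemeasurable _), lintegral_map (κ.measurable_coe hB) (hX n),
      Measure.map_apply (hX _) hB]
    exact h1

/-- Convergence from each initial state is integrated against the initial law by dominated
convergence. -/
lemma IsMarkovChain.setwiseTendsto {D : Set S} {ν : Measure S} [IsProbabilityMeasure ν]
    (hX : ∀ n, Measurable (X n)) (h : IsMarkovChain P X κ) (herg : IsErgodicKernel κ D ν)
    (hD : ∀ ω, X 0 ω ∈ D) : SetwiseTendsto (fun n => P.map (X n)) ν := by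
  intro B hB
  have h1 : ∀ n, P.map (X n) B = ∫⁻ ω, (κ ^ n) (X 0 ω) B ∂P := by
    intro n
    rw [h.map_eq hX n, Measure.bind_apply hB (Kernel.aemeasurable _),
      lintegral_map ((κ ^ n).measurable_coe hB) (hX 0)]
  simp_rw [h1]
  have h2 : ν B = ∫⁻ _, ν B ∂P := by simp
  rw [h2]
  refine tendsto_lintegral_of_dominated_convergence (fun _ => 1)
    (fun n => ((κ ^ n).measurable_coe hB).comp (hX 0)) (fun n => ae_of_all _ fun _ => prob_le_one)
    (by simp) (ae_of_all _ fun ω => herg.setwiseTendsto (hD ω) B hB)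

/-- The strong law of large numbers for an ergodic Markov chain and an arbitrary initial law. -/
theorem IsMarkovChain.strongLaw {D : Set S} (hDm : MeasurableSet D) {ν : Measure S}
    [IsProbabilityMeasure ν] (hX : ∀ n, Measurable (X n)) (h : IsMarkovChain P X κ)
    (herg : IsErgodicKernel κ D ν) (hD : ∀ n ω, X n ω ∈ D) {g : S → ℝ} (hgm : Measurable g)
    (hg : Integrable g ν) :
    ∀ᵐ ω ∂P, Tendsto (fun n : ℕ => (∑ k ∈ Finset.range n, g (X k ω)) / n) atTop
      (𝓝 (∫ x, g x ∂ν)) := by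
  have hXm : Measurable fun ω n => X n ω := measurable_pi_lambda _ hX
  -- The limit `ν` charges only `D`, being a setwise limit of laws carried by `D`.
  have hνD : ∀ᵐ x ∂ν, x ∈ D := by
    have h1 := h.setwiseTendsto hX herg (hD 0) Dᶜ hDm.compl
    have h2 : ∀ n, P.map (X n) Dᶜ = 0 := by
      intro n
      rw [Measure.map_apply (hX n) hDm.compl]
      convert measure_empty (μ := P)
      ext ω; simpa using hD n ω
    simp only [h2] at h1
    exact tendsto_nhds_unique h1 tendsto_const_nhds
  have hμ := isMarkovLaw_of_isMarkovChain hX h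
  have : IsProbabilityMeasure (P.map fun ω n => X n ω) :=
    Measure.isProbabilityMeasure_map hXm.aemeasurable
  have hμD : ∀ k, ∀ᵐ w ∂(P.map fun ω n => X n ω), w k ∈ D := by
    intro k
    rw [ae_map_iff hXm.aemeasurable (measurable_pi_apply k hDm)]
    exact ae_of_all _ fun ω => hD k ω
  -- Upper deviations are invariant events, so they are null for the given chain because they are
  -- null for the stationary one.
  have key : ∀ g : S → ℝ, Measurable g → Integrable g ν → ∀ c, ∫ x, g x ∂ν < c →
      ∀ᵐ ω ∂P, (fun n => X n ω) ∉ upperDeviation g c := by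
    intro g hgm hg c hc
    have hA := measurableSet_upperDeviation hgm c
    have h0 := herg.measure_eq_of_invariant hA (drop_preimage_upperDeviation g c) hμ hμD
      (k := 0) (C := Set.univ) MeasurableSet.univ
    rw [measure_upperDeviation_eq_zero herg hνD hgm hg hc, zero_mul, Set.inter_univ,
      Measure.map_apply hXm hA] at h0
    exact measure_eq_zero_iff_ae_notMem.1 h0
  have hup : ∀ᵐ ω ∂P, ∀ i : ℕ, (fun n => X n ω) ∉
      upperDeviation g (∫ x, g x ∂ν + 1 / ((i : ℝ) + 1)) :=
    ae_all_iff.2 fun i => key g hgm hg _ (lt_add_of_pos_right _ (by positivity))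
  have hdn : ∀ᵐ ω ∂P, ∀ i : ℕ, (fun n => X n ω) ∉
      upperDeviation (fun x => -g x) (∫ x, -g x ∂ν + 1 / ((i : ℝ) + 1)) :=
    ae_all_iff.2 fun i => key _ hgm.neg hg.neg _ (lt_add_of_pos_right _ (by positivity))
  filter_upwards [hup, hdn] with ω hu hd
  rw [Metric.tendsto_nhds]
  intro e he
  obtain ⟨i, hi⟩ := exists_nat_one_div_lt (half_pos he)
  have hu' := hu i
  have hd' := hd i
  simp only [upperDeviation, Set.mem_ofPred_eq, not_exists, not_frequently, not_lt] at hu' hd'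
  filter_upwards [hu' i, hd' i, eventually_gt_atTop 0] with n h1 h2 hn
  have hn' : (0 : ℝ) < n := Nat.cast_pos.2 hn
  rw [integral_neg, Finset.sum_neg_distrib] at h2
  rw [Real.dist_eq, abs_sub_lt_iff]
  have h3 : 1 / ((i : ℝ) + 1) * n < e / 2 * n := by gcongr
  constructor
  · rw [sub_lt_iff_lt_add, div_lt_iff₀ hn']
    nlinarith
  · rw [sub_lt_comm, lt_div_iff₀ hn']
    nlinarith

end StrongLaw

end SASGLD
end

noncomputable section

namespace SASGLD

/-! ### Truncation and convergence of integrals. -/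

section Clamp

/-- Truncation at height `R`. -/
def clamp (R x : ℝ) : ℝ := max (-R) (min R x)

lemma abs_clamp_le {R : ℝ} (hR : 0 ≤ R) (x : ℝ) : |clamp R x| ≤ R :=
  abs_le.2 ⟨le_max_left _ _, max_le (by linarith) (min_le_left _ _)⟩

lemma continuous_clamp (R : ℝ) : Continuous (clamp R) :=
  continuous_const.max (continuous_const.min continuous_id)

lemma measurable_clamp (R : ℝ) : Measurable (clamp R) := (continuous_clamp R).measurable

lemma abs_clamp_le_abs {R : ℝ} (hR : 0 ≤ R) (x : ℝ) : |clamp R x| ≤ |x| := by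
  unfold clamp
  rcases le_total R x with h | h
  · rw [min_eq_left h, max_eq_right (by linarith), abs_of_nonneg hR, abs_of_nonneg (hR.trans h)]
    exact h
  · rw [min_eq_right h]
    rcases le_total (-R) x with h2 | h2
    · rw [max_eq_right h2]
    · rw [max_eq_left h2, abs_neg, abs_of_nonneg hR, abs_of_nonpos (by linarith)]
      linarith

/-- Only `|x| > R` contributes, and there `|x| ≤ x ^ 2 / R`. Thus a bound for second moments makes
truncation errors uniformly small. -/
lemma abs_sub_clamp_le {R : ℝ} (hR : 0 < R) (x : ℝ) : |x - clamp R x| ≤ x ^ 2 / R := by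
  rw [le_div_iff₀ hR]
  unfold clamp
  rcases le_total R x with h | h
  · rw [min_eq_left h, max_eq_right (by linarith), abs_of_nonneg (by linarith)]
    nlinarith
  · rw [min_eq_right h]
    rcases le_total (-R) x with h2 | h2
    · rw [max_eq_right h2, sub_self, abs_zero, zero_mul]
      positivity
    · rw [max_eq_left h2, abs_of_nonpos (by linarith)]
      nlinarith

variable {X : Type*} [MeasurableSpace X]

lemma integrable_of_sq {μ : Measure X} [IsFiniteMeasure μ] {u : X → ℝ}
    (hu : AEStronglyMeasurable u μ) (h : Integrable (fun x => u x ^ 2) μ) : Integrable u μ :=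
  ((memLp_two_iff_integrable_sq hu).2 h).integrable (by norm_num)

lemma abs_integral_sub_integral_clamp_le {μ : Measure X} [IsFiniteMeasure μ] {u : X → ℝ} {K R : ℝ}
    (hu : AEStronglyMeasurable u μ) (h : Integrable (fun x => u x ^ 2) μ)
    (hK : ∫ x, u x ^ 2 ∂μ ≤ K) (hR : 0 < R) :
    |∫ x, u x ∂μ - ∫ x, clamp R (u x) ∂μ| ≤ K / R := by
  have hi := integrable_of_sq hu h
  have hc : Integrable (fun x => clamp R (u x)) μ :=
    hi.mono ((continuous_clamp R).comp_aestronglyMeasurable hu)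
      (ae_of_all _ fun x => abs_clamp_le_abs hR.le _)
  rw [← integral_sub hi hc]
  calc |∫ x, (u x - clamp R (u x)) ∂μ| ≤ ∫ x, |u x - clamp R (u x)| ∂μ :=
        abs_integral_le_integral_abs
    _ ≤ ∫ x, u x ^ 2 / R ∂μ :=
        integral_mono (hi.sub hc).abs (h.div_const R) fun x => abs_sub_clamp_le hR _
    _ = (∫ x, u x ^ 2 ∂μ) / R := integral_div _ _
    _ ≤ K / R := by gcongr

/-- Convergence of all truncations implies convergence, under a uniform bound for the squares. -/
lemma tendsto_of_tendsto_clamp {a : ℕ → ℝ} {l K : ℝ} {b : ℝ → ℕ → ℝ} {b' : ℝ → ℝ}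
    (ha : ∀ R > 0, ∀ n, |a n - b R n| ≤ K / R) (hl : ∀ R > 0, |l - b' R| ≤ K / R)
    (hb : ∀ R > 0, Tendsto (b R) atTop (𝓝 (b' R))) : Tendsto a atTop (𝓝 l) := by
  have hK : 0 ≤ K := by
    have := (abs_nonneg _).trans (hl 1 one_pos)
    simpa using this
  rw [Metric.tendsto_nhds]
  intro e he
  have hR : 0 < 4 * (K + 1) / e := by positivity
  have h1 : K / (4 * (K + 1) / e) < e / 3 := by
    rw [div_lt_iff₀ hR, show e / 3 * (4 * (K + 1) / e) = 4 * (K + 1) / 3 by field_simp]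
    linarith
  filter_upwards [Metric.tendsto_nhds.1 (hb _ hR) (e / 3) (by positivity)] with n hn
  rw [Real.dist_eq] at hn ⊢
  have h2 := ha _ hR n
  have h3 := hl _ hR
  rw [abs_lt] at *
  rw [abs_le] at *
  constructor <;> linarith

/-- Bounded second moments give uniform integrability; here it is used through truncation and
dominated convergence at each level. -/
lemma tendsto_integral_of_ae_tendsto_of_sq_bounded {μ : Measure X} [IsProbabilityMeasure μ]
    {Y : ℕ → X → ℝ} {l K : ℝ} (hY : ∀ n, AEStronglyMeasurable (Y n) μ)
    (hY2 : ∀ n, Integrable (fun x => Y n x ^ 2) μ) (hK : ∀ n, ∫ x, Y n x ^ 2 ∂μ ≤ K)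
    (hl : ∀ᵐ x ∂μ, Tendsto (fun n => Y n x) atTop (𝓝 l)) :
    Tendsto (fun n => ∫ x, Y n x ∂μ) atTop (𝓝 l) := by
  refine tendsto_of_tendsto_clamp (K := max K (l ^ 2))
    (b := fun R n => ∫ x, clamp R (Y n x) ∂μ) (b' := fun R => clamp R l) ?_ ?_ ?_
  · exact fun R hR n => abs_integral_sub_integral_clamp_le (hY n) (hY2 n)
      ((hK n).trans (le_max_left _ _)) hR
  · exact fun R hR => (abs_sub_clamp_le hR l).trans (by gcongr; exact le_max_right _ _)
  · intro R hR
    have h2 : clamp R l = ∫ _, clamp R l ∂μ := by simp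
    rw [h2]
    refine tendsto_integral_of_dominated_convergence (fun _ => R)
      (fun n => (continuous_clamp R).comp_aestronglyMeasurable (hY n)) (integrable_const _)
      (fun n => ae_of_all _ fun x => abs_clamp_le hR.le _) ?_
    filter_upwards [hl] with x hx
    exact ((continuous_clamp R).tendsto l).comp hx

end Clamp

section SetwiseIntegral

variable {S : Type*} [MeasurableSpace S] {μ : ℕ → Measure S} {ν : Measure S}

/-- Fatou's lemma for the nonnegative function `g + R`. Used for `g` and `-g`, it yields both halves
of the convergence for bounded functions. -/
lemma SetwiseTendsto.integral_le_of_frequently [∀ n, IsProbabilityMeasure (μ n)]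
    [IsProbabilityMeasure ν] (h : SetwiseTendsto μ ν) {g : S → ℝ} (hg : Measurable g) {R c : ℝ}
    (hR : ∀ x, |g x| ≤ R) (hc : ∃ᶠ n in atTop, ∫ x, g x ∂(μ n) ≤ c) : ∫ x, g x ∂ν ≤ c := by
  have hi : ∀ m : Measure S, IsProbabilityMeasure m → Integrable g m := fun m _ =>
    (integrable_const R).mono' hg.aestronglyMeasurable (ae_of_all _ hR)
  have h0 : ∀ x, 0 ≤ g x + R := fun x => by linarith [(abs_le.1 (hR x)).1]
  have hE : ∀ m : Measure S, IsProbabilityMeasure m →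
      ∫⁻ x, ENNReal.ofReal (g x + R) ∂m = ENNReal.ofReal (∫ x, g x ∂m + R) := by
    intro m hm
    rw [← ofReal_integral_eq_lintegral_ofReal (f := fun x => g x + R)
        ((hi m hm).add (integrable_const R)) (ae_of_all _ h0),
      integral_add (hi m hm) (integrable_const R)]
    simp
  have hcR : 0 ≤ c + R := by
    obtain ⟨n, hn⟩ := hc.exists
    have h1 : 0 ≤ ∫ x, (g x + R) ∂(μ n) := integral_nonneg h0
    rw [integral_add (hi _ inferInstance) (integrable_const R)] at h1
    simp at h1
    linarith
  have h1 := h.lintegral_le (fun x => ENNReal.ofReal (g x + R)) (c := ENNReal.ofReal (c + R))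
    (hc.mono fun n hn => by rw [hE _ inferInstance]; exact ENNReal.ofReal_le_ofReal (by linarith))
  rw [hE _ inferInstance] at h1
  linarith [(ENNReal.ofReal_le_ofReal_iff hcR).1 h1]

lemma SetwiseTendsto.tendsto_integral_of_bounded [∀ n, IsProbabilityMeasure (μ n)]
    [IsProbabilityMeasure ν] (h : SetwiseTendsto μ ν) {g : S → ℝ} (hg : Measurable g) {R : ℝ}
    (hR : ∀ x, |g x| ≤ R) : Tendsto (fun n => ∫ x, g x ∂(μ n)) atTop (𝓝 (∫ x, g x ∂ν)) := by
  refine tendsto_order.2 ⟨fun c hc => ?_, fun c hc => ?_⟩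
  · by_contra hcon
    have h1 := h.integral_le_of_frequently hg hR
      ((not_eventually.1 hcon).mono fun n hn => not_lt.1 hn)
    linarith
  · by_contra hcon
    have h1 := h.integral_le_of_frequently hg.neg (c := -c) (by simpa using hR)
      ((not_eventually.1 hcon).mono fun n hn => by
        have := not_lt.1 hn
        simp only [Pi.neg_apply, integral_neg]
        linarith)
    simp only [Pi.neg_apply, integral_neg] at h1
    linarith

lemma SetwiseTendsto.integrable_of_nonneg [∀ n, IsProbabilityMeasure (μ n)]
    [IsProbabilityMeasure ν] (h : SetwiseTendsto μ ν) {g : S → ℝ} (hg : Measurable g)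
    (h0 : ∀ x, 0 ≤ g x) {K : ℝ} (hi : ∀ n, Integrable g (μ n)) (hK : ∀ n, ∫ x, g x ∂(μ n) ≤ K) :
    Integrable g ν ∧ ∫ x, g x ∂ν ≤ K := by
  have hK0 : 0 ≤ K := (integral_nonneg h0).trans (hK 0)
  have h1 := h.lintegral_le (fun x => ENNReal.ofReal (g x)) (c := ENNReal.ofReal K)
    (Frequently.of_forall fun n => by
      rw [← ofReal_integral_eq_lintegral_ofReal (hi n) (ae_of_all _ h0)]
      exact ENNReal.ofReal_le_ofReal (hK n))
  have hi : Integrable g ν := by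
    refine ⟨hg.aestronglyMeasurable, ?_⟩
    rw [hasFiniteIntegral_iff_ofReal (ae_of_all _ h0)]
    exact h1.trans_lt ENNReal.ofReal_lt_top
  refine ⟨hi, ?_⟩
  rw [← ofReal_integral_eq_lintegral_ofReal hi (ae_of_all _ h0)] at h1
  exact (ENNReal.ofReal_le_ofReal_iff hK0).1 h1

lemma SetwiseTendsto.tendsto_integral_of_sq_bounded [∀ n, IsProbabilityMeasure (μ n)]
    [IsProbabilityMeasure ν] (h : SetwiseTendsto μ ν) {u : S → ℝ} (hu : Measurable u) {K : ℝ}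
    (hi : ∀ n, Integrable (fun x => u x ^ 2) (μ n)) (hK : ∀ n, ∫ x, u x ^ 2 ∂(μ n) ≤ K) :
    Tendsto (fun n => ∫ x, u x ∂(μ n)) atTop (𝓝 (∫ x, u x ∂ν)) := by
  obtain ⟨h1, h2⟩ := h.integrable_of_nonneg (hu.pow_const 2) (fun x => sq_nonneg _) hi hK
  exact tendsto_of_tendsto_clamp (K := K)
    (fun R hR n => abs_integral_sub_integral_clamp_le hu.aestronglyMeasurable (hi n) (hK n) hR)
    (fun R hR => abs_integral_sub_integral_clamp_le hu.aestronglyMeasurable h1 h2 hR)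
    (fun R hR => h.tendsto_integral_of_bounded ((measurable_clamp R).comp hu)
      (fun x => abs_clamp_le hR.le _))

end SetwiseIntegral

end SASGLD
end

noncomputable section

namespace SASGLD

variable {d : ℕ}

/-! ### Functions of polynomial growth. -/

section Growth

/-- `F` grows at most polynomially. -/
def PolyBounded {F : Type*} [NormedAddCommGroup F] (g : E d → F) : Prop :=
  ∃ (A : ℝ) (N : ℕ), 0 ≤ A ∧ ∀ x, ‖g x‖ ≤ A * (1 + ‖x‖ ^ N)

lemma one_add_pow_le {t : ℝ} (ht : 0 ≤ t) {m n : ℕ} (h : m ≤ n) : 1 + t ^ m ≤ 2 * (1 + t ^ n) := by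
  have h0 : 0 ≤ t ^ n := pow_nonneg ht n
  rcases le_total t 1 with h1 | h1
  · have := pow_le_one₀ (n := m) ht h1
    linarith
  · have := pow_le_pow_right₀ h1 h
    linarith

lemma PolyBounded.exists_common {F F' : Type*} [NormedAddCommGroup F] [NormedAddCommGroup F']
    {g : E d → F} {g' : E d → F'} (h : PolyBounded g) (h' : PolyBounded g') :
    ∃ (A : ℝ) (N : ℕ), 0 ≤ A ∧ ∀ x, ‖g x‖ ≤ A * (1 + ‖x‖ ^ N) ∧ ‖g' x‖ ≤ A * (1 + ‖x‖ ^ N) := by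
  obtain ⟨A, N, hA, h⟩ := h
  obtain ⟨A', N', hA', h'⟩ := h'
  refine ⟨2 * A + 2 * A', max N N', by positivity, fun x => ?_⟩
  have h1 := one_add_pow_le (norm_nonneg x) (le_max_left N N')
  have h2 := one_add_pow_le (norm_nonneg x) (le_max_right N N')
  have h3 : 0 ≤ 1 + ‖x‖ ^ max N N' := by positivity
  constructor
  · refine (h x).trans ?_
    nlinarith
  · refine (h' x).trans ?_
    nlinarith

lemma PolyBounded.of_le {F : Type*} [NormedAddCommGroup F]
    {g : E d → F} {g' : E d → ℝ} (h : PolyBounded g') (hle : ∀ x, ‖g x‖ ≤ g' x) :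
    PolyBounded g := by
  obtain ⟨A, N, hA, h⟩ := h
  exact ⟨A, N, hA, fun x => ((hle x).trans (Real.le_norm_self _)).trans (h x)⟩

lemma PolyBounded.norm {F : Type*} [NormedAddCommGroup F] {g : E d → F} (h : PolyBounded g) :
    PolyBounded (fun x => ‖g x‖) := by
  obtain ⟨A, N, hA, h⟩ := h
  exact ⟨A, N, hA, fun x => by simpa using h x⟩

lemma PolyBounded.add {F : Type*} [NormedAddCommGroup F] {g g' : E d → F}
    (h : PolyBounded g) (h' : PolyBounded g') : PolyBounded (fun x => g x + g' x) := by
  obtain ⟨A, N, hA, h⟩ := h.exists_common h'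
  refine ⟨A + A, N, by positivity, fun x => (norm_add_le _ _).trans ?_⟩
  linarith [(h x).1, (h x).2]

lemma polyBounded_const {F : Type*} [NormedAddCommGroup F] (c : F) :
    PolyBounded (fun _ : E d => c) :=
  ⟨‖c‖, 0, norm_nonneg _, fun x => by simp; linarith [norm_nonneg c]⟩

lemma polyBounded_norm_pow (N : ℕ) : PolyBounded (fun x : E d => ‖x‖ ^ N) :=
  ⟨1, N, zero_le_one, fun x => by
    rw [Real.norm_of_nonneg (by positivity)]; linarith⟩

lemma PolyBounded.mul {g g' : E d → ℝ} (h : PolyBounded g) (h' : PolyBounded g') :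
    PolyBounded (fun x => g x * g' x) := by
  obtain ⟨A, N, hA, h⟩ := h.exists_common h'
  refine ⟨A * A * 4, N + N, by positivity, fun x => ?_⟩
  rw [norm_mul]
  calc ‖g x‖ * ‖g' x‖ ≤ (A * (1 + ‖x‖ ^ N)) * (A * (1 + ‖x‖ ^ N)) := by
        gcongr
        exacts [(h x).1, (h x).2]
    _ = A * A * ((1 + ‖x‖ ^ N) ^ 2) := by ring
    _ ≤ A * A * (4 * (1 + ‖x‖ ^ (N + N))) := by
        gcongr
        rw [pow_add]
        nlinarith [sq_nonneg (‖x‖ ^ N - 1), sq_nonneg (‖x‖ ^ N)]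
    _ = _ := by ring

lemma PolyBounded.pow {g : E d → ℝ} (h : PolyBounded g) (n : ℕ) :
    PolyBounded (fun x => g x ^ n) := by
  induction n with
  | zero => simpa using polyBounded_const (d := d) (1 : ℝ)
  | succ n ih => simpa [pow_succ] using ih.mul h

lemma PolyBounded.const_mul {g : E d → ℝ} (h : PolyBounded g) (c : ℝ) :
    PolyBounded (fun x => c * g x) := (polyBounded_const c).mul h

lemma PolyBounded.sub {g g' : E d → ℝ}
    (h : PolyBounded g) (h' : PolyBounded g') : PolyBounded (fun x => g x - g' x) := by
  simpa [sub_eq_add_neg] using h.add (h'.const_mul (-1))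

/-- Real exponents in growth bounds may be replaced by natural ones. -/
lemma polyBounded_of_rpow {F : Type*} [NormedAddCommGroup F] {g : E d → F} {A q : ℝ}
    (hq : 0 ≤ q) (h : ∀ x, ‖g x‖ ≤ A * (1 + ‖x‖ ^ q)) : PolyBounded g := by
  refine ⟨|A| * 2, ⌈q⌉₊, by positivity, fun x => ?_⟩
  have h0 : ‖x‖ ^ q ≤ 1 + ‖x‖ ^ ⌈q⌉₊ := by
    rcases le_total ‖x‖ 1 with h1 | h1
    · have := Real.rpow_le_one (norm_nonneg x) h1 hq
      have h2 : 0 ≤ ‖x‖ ^ ⌈q⌉₊ := by positivity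
      linarith
    · have := Real.rpow_le_rpow_of_exponent_le h1 (Nat.le_ceil q)
      rw [Real.rpow_natCast] at this
      linarith
  have h3 : 0 ≤ ‖x‖ ^ q := Real.rpow_nonneg (norm_nonneg x) q
  have h4 : 0 ≤ ‖x‖ ^ ⌈q⌉₊ := by positivity
  calc ‖g x‖ ≤ A * (1 + ‖x‖ ^ q) := h x
    _ ≤ |A| * (1 + ‖x‖ ^ q) := by gcongr; exact le_abs_self A
    _ ≤ |A| * (2 * (1 + ‖x‖ ^ ⌈q⌉₊)) := by gcongr; linarith
    _ = _ := by ring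

end Growth

/-! ### Integrability under the Gibbs measure. -/

section Potential

variable {U : E d → ℝ} {L a b : ℝ}

lemma IsAdmissiblePotential.norm_gradient_le (hU : IsAdmissiblePotential U L a b) (x : E d) :
    ‖gradient U x‖ ≤ ‖gradient U 0‖ + L * ‖x‖ := by
  have h1 := hU.lipschitz_grad x 0
  have h2 := norm_le_norm_add_norm_sub' (gradient U x) (gradient U 0)
  rw [sub_zero] at h1
  linarith

lemma IsAdmissiblePotential.continuous_gradient (hU : IsAdmissiblePotential U L a b) :
    Continuous (gradient U) := by
  have h := hU.contDiff.continuous_fderiv (by norm_num)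
  exact (InnerProductSpace.toDual ℝ (E d)).symm.continuous.comp h

/-- Outside a ball, dissipativity bounds the radial derivative of `U` at radius `r` below by `a r /
2`, so `U - (a / 4) r ^ 2` is nondecreasing along rays. Inside the ball there is a minimum by
compactness. -/
lemma IsAdmissiblePotential.exists_lower_bound (hU : IsAdmissiblePotential U L a b) (ha : 0 < a)
    (hb : 0 ≤ b) : ∃ c : ℝ, ∀ x, a / 4 * ‖x‖ ^ 2 - c ≤ U x := by
  -- Beyond this radius `b` is at most half of `a r ^ 2`; the summand `1` keeps the radius positive
  -- when `b = 0`.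
  set R : ℝ := Real.sqrt (2 * b / a) + 1 with hR
  have hR0 : 0 < R := by positivity
  have hR2 : 2 * b / a ≤ R ^ 2 := by
    have h1 := Real.sq_sqrt (show 0 ≤ 2 * b / a by positivity)
    have h2 := Real.sqrt_nonneg (2 * b / a)
    rw [hR]; nlinarith
  obtain ⟨x₀, -, hx₀⟩ := (isCompact_closedBall (0 : E d) R).exists_isMinOn
    ⟨0, Metric.mem_closedBall_self hR0.le⟩ hU.contDiff.continuous.continuousOn
  have hmin : ∀ x : E d, ‖x‖ ≤ R → U x₀ ≤ U x := fun x hx =>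
    hx₀ (by simpa using hx)
  refine ⟨a / 4 * R ^ 2 - U x₀, fun x => ?_⟩
  rcases le_total ‖x‖ R with hx | hx
  · have h1 := hmin x hx
    have h2 : ‖x‖ ^ 2 ≤ R ^ 2 := by gcongr
    nlinarith
  · have hx0 : 0 < ‖x‖ := hR0.trans_le hx
    set e : E d := ‖x‖⁻¹ • x with he
    have hne : ‖e‖ = 1 := by
      rw [he, norm_smul, norm_inv, norm_norm, inv_mul_cancel₀ hx0.ne']
    have hxe : x = ‖x‖ • e := by rw [he, smul_smul, mul_inv_cancel₀ hx0.ne', one_smul]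
    have hdiff : Differentiable ℝ U := hU.contDiff.differentiable (by norm_num)
    have hder : ∀ r : ℝ, HasDerivAt (fun r : ℝ => U (r • e) - a / 4 * r ^ 2)
        (inner ℝ (gradient U (r • e)) e - a / 2 * r) r := by
      intro r
      have h1 : HasDerivAt (fun r : ℝ => r • e) e r := by
        simpa using (hasDerivAt_id r).smul_const e
      have h2 : HasDerivAt (fun r : ℝ => U (r • e)) (inner ℝ (gradient U (r • e)) e) r := by
          have h2 := (hdiff (r • e)).hasGradientAt.hasFDerivAt
          exact HasFDerivAt.comp_hasDerivAt (f := fun r : ℝ => r • e) r h2 h1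
      have h3 : HasDerivAt (fun r : ℝ => a / 4 * r ^ 2) (a / 2 * r) r :=
        ((hasDerivAt_pow 2 r).const_mul (a / 4)).congr_deriv (by push_cast; ring)
      exact h2.sub h3
    have hmono : MonotoneOn (fun r : ℝ => U (r • e) - a / 4 * r ^ 2) (Set.Ici R) := by
      refine monotoneOn_of_deriv_nonneg (convex_Ici R)
        (fun r _ => (hder r).continuousAt.continuousWithinAt)
        (fun r _ => (hder r).differentiableAt.differentiableWithinAt) fun r hr => ?_
      rw [interior_Ici] at hr
      have hr' : R < r := hr
      have hr0 : 0 < r := hR0.trans hr'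
      rw [(hder r).deriv]
      have h1 := hU.dissipative (r • e)
      rw [norm_smul, hne, mul_one, Real.norm_of_nonneg hr0.le, real_inner_smul_left,
        real_inner_comm] at h1
      have h2 : 2 * b ≤ a * r ^ 2 := by
        rw [div_le_iff₀ ha] at hR2
        have : R ^ 2 ≤ r ^ 2 := by gcongr
        nlinarith
      have h3 : r * (a / 2 * r) ≤ r * inner ℝ (gradient U (r • e)) e := by nlinarith
      linarith [le_of_mul_le_mul_left h3 hr0]
    have h1 := hmono (Set.mem_Ici.2 le_rfl) (Set.mem_Ici.2 hx) hx
    simp only at h1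
    rw [← hxe] at h1
    have h2 := hmin (R • e) (by rw [norm_smul, hne, mul_one, Real.norm_of_nonneg hR0.le])
    linarith

lemma integrable_exp_neg_mul_sq_norm {c : ℝ} (hc : 0 < c) :
    Integrable (fun x : E d => Real.exp (-(c * ‖x‖ ^ 2))) := by
  have h := GaussianFourier.integrable_cexp_neg_mul_sq_norm_add (V := E d) (b := (c : ℂ))
    (by simpa using hc) 0 0
  refine h.norm.congr (ae_of_all _ fun x => ?_)
  simp only [Complex.norm_exp]
  congr 1
  simp [← Complex.ofReal_pow, ← Complex.ofReal_mul]

/-- One term of the exponential series, `(c t ^ 2) ^ N / N! ≤ exp (c t ^ 2)`, dominates the power.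
-/
lemma exists_pow_mul_exp_le {c : ℝ} (hc : 0 < c) (N : ℕ) :
    ∃ C : ℝ, 0 ≤ C ∧ ∀ t : ℝ, 0 ≤ t → (1 + t ^ N) * Real.exp (-(c * t ^ 2)) ≤ C := by
  refine ⟨2 * (1 + (N.factorial : ℝ) / c ^ N), by positivity, fun t ht => ?_⟩
  have h1 := one_add_pow_le ht (show N ≤ 2 * N by omega)
  have h2 := Real.pow_div_factorial_le_exp (c * t ^ 2) (by positivity) N
  rw [div_le_iff₀ (by positivity), mul_pow, ← pow_mul] at h2
  have h3 : t ^ (2 * N) * Real.exp (-(c * t ^ 2)) ≤ N.factorial / c ^ N := by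
    rw [le_div_iff₀ (by positivity), Real.exp_neg, mul_assoc, mul_comm _ (c ^ N), ← mul_assoc,
      ← div_eq_mul_inv, div_le_iff₀ (Real.exp_pos _)]
    linarith
  have h4 : Real.exp (-(c * t ^ 2)) ≤ 1 := Real.exp_le_one_iff.2 (by
    have : 0 ≤ c * t ^ 2 := by positivity
    linarith)
  calc (1 + t ^ N) * Real.exp (-(c * t ^ 2))
      ≤ 2 * (1 + t ^ (2 * N)) * Real.exp (-(c * t ^ 2)) := by gcongr
    _ = 2 * (Real.exp (-(c * t ^ 2)) + t ^ (2 * N) * Real.exp (-(c * t ^ 2))) := by ring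
    _ ≤ _ := by gcongr

/-- The Gaussian bound for `exp (-β U)` is split into two equal factors, one to absorb the
polynomial and one to be integrated. The case of the constant `1` shows that the normalising
integral is finite. -/
lemma IsAdmissiblePotential.integrable_gibbs (hU : IsAdmissiblePotential U L a b) (ha : 0 < a)
    (hb : 0 ≤ b) {β : ℝ} (hβ : 0 < β) {g : E d → ℝ} (hg : Continuous g) (hgp : PolyBounded g) :
    Integrable g (gibbs U β) := by
  obtain ⟨c, hc⟩ := hU.exists_lower_bound ha hb
  have hUc := hU.contDiff.continuous
  have key : ∀ g : E d → ℝ, Continuous g → PolyBounded g →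
      Integrable (fun x => Real.exp (-(β * U x)) * g x) := by
    intro g hg ⟨A, N, hA, hgp⟩
    obtain ⟨C, hC0, hC⟩ := exists_pow_mul_exp_le (c := β * a / 8) (by positivity) N
    refine ((integrable_exp_neg_mul_sq_norm (d := d) (c := β * a / 8) (by positivity)).const_mul
      (A * C * Real.exp (β * c))).mono' (by fun_prop) (ae_of_all _ fun x => ?_)
    rw [norm_mul, Real.norm_of_nonneg (Real.exp_pos _).le]
    have h1 : Real.exp (-(β * U x)) ≤ Real.exp (β * c) * Real.exp (-(β * a / 8 * ‖x‖ ^ 2)) *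
        Real.exp (-(β * a / 8 * ‖x‖ ^ 2)) := by
      rw [← Real.exp_add, ← Real.exp_add]
      refine Real.exp_le_exp.2 ?_
      nlinarith [hc x]
    calc Real.exp (-(β * U x)) * ‖g x‖
        ≤ (Real.exp (β * c) * Real.exp (-(β * a / 8 * ‖x‖ ^ 2)) *
          Real.exp (-(β * a / 8 * ‖x‖ ^ 2))) * (A * (1 + ‖x‖ ^ N)) := by
          gcongr
          exact hgp x
      _ = A * ((1 + ‖x‖ ^ N) * Real.exp (-(β * a / 8 * ‖x‖ ^ 2))) * Real.exp (β * c) *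
          Real.exp (-(β * a / 8 * ‖x‖ ^ 2)) := by ring
      _ ≤ A * C * Real.exp (β * c) * Real.exp (-(β * a / 8 * ‖x‖ ^ 2)) := by
          gcongr
          exact hC _ (norm_nonneg x)
  unfold gibbs
  rw [integrable_tilted_iff]
  · simpa using key g hg hgp
  · simpa using key _ continuous_const (polyBounded_const 1)

end Potential

/-! ### The solution of the Poisson equation. -/

section Poisson

variable {U f φ : E d → ℝ} {L a b β : ℝ}

lemma norm_gradient_eq (φ : E d → ℝ) (x : E d) : ‖gradient φ x‖ = ‖iteratedFDeriv ℝ 1 φ x‖ := by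
  rw [gradient, LinearIsometryEquiv.norm_map, norm_iteratedFDeriv_one]

lemma laplacian_eq_sum (φ : E d → ℝ) (x : E d) : Laplacian.laplacian φ x =
    ∑ i, fderiv ℝ (fderiv ℝ φ) x (EuclideanSpace.basisFun (Fin d) ℝ i)
      (EuclideanSpace.basisFun (Fin d) ℝ i) := by
  rw [InnerProductSpace.laplacian_eq_iteratedFDeriv_orthonormalBasis φ
    (EuclideanSpace.basisFun (Fin d) ℝ)]
  simp [iteratedFDeriv_two_apply]

lemma IsPoissonSolution.polyBounded (hφ : IsPoissonSolution U β f φ) {j : ℕ} (hj : j ≤ 4) :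
    PolyBounded (iteratedFDeriv ℝ j φ) := by
  obtain ⟨q, hq, h⟩ := hφ.growth
  obtain ⟨A, hA⟩ := h j hj
  exact polyBounded_of_rpow hq hA

lemma norm_fderiv_fderiv_eq (φ : E d → ℝ) (x : E d) :
    ‖fderiv ℝ (fderiv ℝ φ) x‖ = ‖iteratedFDeriv ℝ 2 φ x‖ := by
  rw [← norm_iteratedFDeriv_one, norm_iteratedFDeriv_fderiv]

lemma abs_laplacian_le (φ : E d → ℝ) (x : E d) :
    |Laplacian.laplacian φ x| ≤ d * ‖iteratedFDeriv ℝ 2 φ x‖ := by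
  rw [laplacian_eq_sum]
  refine (Finset.abs_sum_le_sum_abs _ _).trans ?_
  calc _ ≤ ∑ _i : Fin d, ‖iteratedFDeriv ℝ 2 φ x‖ := by
        refine Finset.sum_le_sum fun i _ => ?_
        have h := (fderiv ℝ (fderiv ℝ φ) x).le_opNorm₂ (EuclideanSpace.basisFun (Fin d) ℝ i)
          (EuclideanSpace.basisFun (Fin d) ℝ i)
        rw [norm_fderiv_fderiv_eq] at h
        simpa using h
    _ = _ := by simp

/-- Nothing is assumed on `f` directly: its continuity and growth are inherited from `φ` and `U`
through this identity. -/
lemma IsPoissonSolution.f_eq (hφ : IsPoissonSolution U β f φ) :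
    f = fun θ => generator U β φ θ + ∫ x, f x ∂(gibbs U β) := by
  funext θ
  rw [hφ.eq θ]; ring

lemma continuous_generator (hU : IsAdmissiblePotential U L a b) (hφ : ContDiff ℝ 4 φ) :
    Continuous (generator U β φ) := by
  have h1 : Continuous (gradient φ) :=
    (InnerProductSpace.toDual ℝ (E d)).symm.continuous.comp (hφ.continuous_fderiv (by norm_num))
  have h2 : Continuous (Laplacian.laplacian φ) := by
    have h3 : Continuous (fderiv ℝ (fderiv ℝ φ)) :=
      (hφ.fderiv_right (m := 3) (by norm_num)).continuous_fderiv (by norm_num)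
    have h4 : (Laplacian.laplacian φ : E d → ℝ) = _ := funext fun x => laplacian_eq_sum φ x
    rw [h4]
    fun_prop
  have h3 := hU.continuous_gradient
  unfold generator
  fun_prop

lemma IsPoissonSolution.continuous (hU : IsAdmissiblePotential U L a b)
    (hφ : IsPoissonSolution U β f φ) : Continuous f := by
  rw [hφ.f_eq]
  exact (continuous_generator hU hφ.contDiff).add continuous_const

lemma IsAdmissiblePotential.polyBounded_gradient (hU : IsAdmissiblePotential U L a b) :
    PolyBounded (gradient U) := by
  refine PolyBounded.of_le (g' := fun x => ‖gradient U 0‖ + L * ‖x‖ ^ 1) ?_ ?_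
  · exact (polyBounded_const _).add ((polyBounded_norm_pow 1).const_mul L)
  · intro x
    simpa using hU.norm_gradient_le x

lemma polyBounded_generator (hU : IsAdmissiblePotential U L a b)
    (hφ : IsPoissonSolution U β f φ) : PolyBounded (generator U β φ) := by
  refine PolyBounded.of_le (g' := fun x => ‖gradient U x‖ * ‖iteratedFDeriv ℝ 1 φ x‖ +
    |β⁻¹| * (d * ‖iteratedFDeriv ℝ 2 φ x‖)) ?_ fun x => ?_
  · exact (hU.polyBounded_gradient.norm.mul (hφ.polyBounded (by norm_num)).norm).add
      (((hφ.polyBounded (by norm_num)).norm.const_mul _).const_mul _)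
  · unfold generator
    refine (norm_add_le _ _).trans (add_le_add ?_ ?_)
    · rw [norm_neg, ← norm_gradient_eq]
      exact norm_inner_le_norm _ _
    · rw [norm_mul, Real.norm_eq_abs, Real.norm_eq_abs]
      gcongr
      exact abs_laplacian_le φ x

lemma IsPoissonSolution.polyBounded_f (hU : IsAdmissiblePotential U L a b)
    (hφ : IsPoissonSolution U β f φ) : PolyBounded f := by
  rw [hφ.f_eq]
  exact (polyBounded_generator hU hφ).add (polyBounded_const _)

end Poisson

end SASGLD
end

noncomputable section

namespace SASGLD

variable {d : ℕ}

/-! ### Taylor estimates with symmetric noise. -/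

section Taylor

variable {V F : Type*} [NormedAddCommGroup V] [NormedSpace ℝ V] [NormedAddCommGroup F]
  [NormedSpace ℝ F]

lemma norm_image_add_sub_le {g : V → F} (hg : Differentiable ℝ g) {x u : V} {B : ℝ}
    (hB : ∀ t ∈ Set.Icc (0 : ℝ) 1, ‖fderiv ℝ g (x + t • u)‖ ≤ B) :
    ‖g (x + u) - g x‖ ≤ B * ‖u‖ := by
  have h := (convex_segment x (x + u)).norm_image_sub_le_of_norm_fderiv_le (f := g) (C := B)
    (fun y _ => hg y) (fun y hy => ?_) (left_mem_segment ℝ x (x + u))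
    (right_mem_segment ℝ x (x + u))
  · simpa using h
  · rw [segment_eq_image'] at hy
    obtain ⟨t, ht, rfl⟩ := hy
    simpa using hB t ht

lemma hasDerivAt_comp_add_smul {g : V → F} (hg : Differentiable ℝ g) (x u : V) (t : ℝ) :
    HasDerivAt (fun t : ℝ => g (x + t • u)) (fderiv ℝ g (x + t • u) u) t := by
  have h1 : HasDerivAt (fun t : ℝ => x + t • u) u t := by
    simpa using ((hasDerivAt_id t).smul_const u).const_add x
  exact HasFDerivAt.comp_hasDerivAt (f := fun t : ℝ => x + t • u) t (hg _).hasFDerivAt h1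

lemma hasDerivAt_comp_sub_smul {g : V → F} (hg : Differentiable ℝ g) (x u : V) (t : ℝ) :
    HasDerivAt (fun t : ℝ => g (x - t • u)) (-fderiv ℝ g (x - t • u) u) t := by
  have h := hasDerivAt_comp_add_smul hg x (-u) t
  simpa [sub_eq_add_neg] using h

/-- First-order Taylor estimate. -/
lemma norm_image_add_sub_sub_le {g : V → F} (hg : ContDiff ℝ 2 g) {x u : V} {B : ℝ}
    (hB : ∀ t ∈ Set.Icc (0 : ℝ) 1, ‖fderiv ℝ (fderiv ℝ g) (x + t • u)‖ ≤ B) :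
    ‖g (x + u) - g x - fderiv ℝ g x u‖ ≤ B * ‖u‖ ^ 2 := by
  have hB0 : 0 ≤ B := (norm_nonneg (fderiv ℝ (fderiv ℝ g) (x + (0 : ℝ) • u))).trans (hB 0 (by simp))
  have hd : Differentiable ℝ g := hg.differentiable (by norm_num)
  have hd' : Differentiable ℝ (fderiv ℝ g) :=
    (hg.fderiv_right (m := 1) (by norm_num)).differentiable (by norm_num)
  have hder : ∀ t : ℝ, HasDerivAt (fun t : ℝ => g (x + t • u) - t • fderiv ℝ g x u)
      (fderiv ℝ g (x + t • u) u - fderiv ℝ g x u) t := by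
    intro t
    have h2 : HasDerivAt (fun t : ℝ => t • fderiv ℝ g x u) (fderiv ℝ g x u) t := by
      simpa using (hasDerivAt_id t).smul_const (fderiv ℝ g x u)
    exact (hasDerivAt_comp_add_smul hd x u t).sub h2
  have h := norm_image_sub_le_of_norm_deriv_le_segment_01' (C := B * ‖u‖ ^ 2)
    (fun t _ => (hder t).hasDerivWithinAt) fun t ht => ?_
  · simp only [one_smul, zero_smul, add_zero, sub_zero] at h
    rwa [sub_right_comm] at h
  · have ht' : t ∈ Set.Icc (0 : ℝ) 1 := ⟨ht.1, ht.2.le⟩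
    have h1 := norm_image_add_sub_le hd' (x := x) (u := t • u) (B := B) fun s hs => by
      rw [smul_smul]
      exact hB _ ⟨mul_nonneg hs.1 ht'.1, mul_le_one₀ hs.2 ht'.1 ht'.2⟩
    rw [norm_smul, Real.norm_of_nonneg ht'.1] at h1
    rw [← sub_apply]
    refine ((fderiv ℝ g (x + t • u) - fderiv ℝ g x).le_opNorm u).trans ?_
    calc _ ≤ (B * (t * ‖u‖)) * ‖u‖ := by gcongr
      _ ≤ (B * (1 * ‖u‖)) * ‖u‖ := by gcongr; exact ht'.2
      _ = _ := by ring

/-- Symmetric second differences. -/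
lemma norm_symmetric_difference_le {g : V → F} (hg : ContDiff ℝ 2 g) {x v : V} {B : ℝ}
    (hB : ∀ t ∈ Set.Icc (-1 : ℝ) 1, ‖fderiv ℝ (fderiv ℝ g) (x + t • v)‖ ≤ B) :
    ‖g (x + v) + g (x - v) - (2 : ℝ) • g x‖ ≤ 2 * (B * ‖v‖ ^ 2) := by
  have h1 := norm_image_add_sub_sub_le hg (x := x) (u := v) (B := B)
    fun t ht => hB t ⟨by linarith [ht.1], ht.2⟩
  have h2 := norm_image_add_sub_sub_le hg (x := x) (u := -v) (B := B) fun t ht => by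
    have := hB (-t) ⟨by linarith [ht.2], by linarith [ht.1]⟩
    rwa [neg_smul, ← smul_neg] at this
  have h3 := norm_add_le (g (x + v) - g x - fderiv ℝ g x v) (g (x + -v) - g x - fderiv ℝ g x (-v))
  rw [norm_neg] at h2
  have h4 : g (x + v) + g (x - v) - (2 : ℝ) • g x =
      g (x + v) - g x - fderiv ℝ g x v + (g (x + -v) - g x - fderiv ℝ g x (-v)) := by
    rw [map_neg, two_smul, ← sub_eq_add_neg x v]
    abel
  rw [h4]
  linarith

set_option maxSynthPendingDepth 4 in
/-- Symmetric fourth-order Taylor estimate. -/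
lemma abs_symmetric_taylor_le {g : V → ℝ} (hg : ContDiff ℝ 4 g) {x v : V} {B : ℝ}
    (hB : ∀ t ∈ Set.Icc (-1 : ℝ) 1,
      ‖fderiv ℝ (fderiv ℝ (fderiv ℝ (fderiv ℝ g))) (x + t • v)‖ ≤ B) :
    |g (x + v) + g (x - v) - 2 * g x - fderiv ℝ (fderiv ℝ g) x v v| ≤ 2 * (B * ‖v‖ ^ 4) := by
  have hB0 : 0 ≤ B := (norm_nonneg (fderiv ℝ (fderiv ℝ (fderiv ℝ (fderiv ℝ g)))
    (x + (0 : ℝ) • v))).trans (hB 0 (by simp))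
  have hg1 : ContDiff ℝ 3 (fderiv ℝ g) := hg.fderiv_right (by norm_num)
  have hg2 : ContDiff ℝ 2 (fderiv ℝ (fderiv ℝ g)) := hg1.fderiv_right (by norm_num)
  have hd0 : Differentiable ℝ g := hg.differentiable (by norm_num)
  have hd1 : Differentiable ℝ (fderiv ℝ g) := hg1.differentiable (by norm_num)
  -- The symmetric second difference of the second derivative is of second order in `v`. Two
  -- applications of the mean value inequality in `t` lift this to third order for the first
  -- derivative and to fourth order for `g`.
  have hsecond : ∀ t ∈ Set.Icc (0 : ℝ) 1,
      ‖fderiv ℝ (fderiv ℝ g) (x + t • v) + fderiv ℝ (fderiv ℝ g) (x - t • v) -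
        (2 : ℝ) • fderiv ℝ (fderiv ℝ g) x‖ ≤ 2 * (B * ‖v‖ ^ 2) := by
    intro t ht
    have h := norm_symmetric_difference_le hg2 (x := x) (v := t • v) (B := B) fun s hs => by
      rw [smul_smul]
      refine hB _ (abs_le.1 ?_)
      rw [abs_mul]
      exact mul_le_one₀ (abs_le.2 hs) (abs_nonneg _) (abs_le.2 ⟨by linarith [ht.1], ht.2⟩)
    refine h.trans ?_
    rw [norm_smul, Real.norm_of_nonneg ht.1]
    have h1 : t * ‖v‖ ≤ ‖v‖ := mul_le_of_le_one_left (norm_nonneg v) ht.2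
    have h0 := mul_nonneg ht.1 (norm_nonneg v)
    gcongr
  have hfirst : ∀ t ∈ Set.Icc (0 : ℝ) 1,
      ‖fderiv ℝ g (x + t • v) - fderiv ℝ g (x - t • v) -
        (2 * t) • fderiv ℝ (fderiv ℝ g) x v‖ ≤ 2 * (B * ‖v‖ ^ 3) := by
    intro t ht
    have hder : ∀ t : ℝ, HasDerivAt (fun t : ℝ => fderiv ℝ g (x + t • v) -
        fderiv ℝ g (x - t • v) - (2 * t) • fderiv ℝ (fderiv ℝ g) x v)
        (fderiv ℝ (fderiv ℝ g) (x + t • v) v - -fderiv ℝ (fderiv ℝ g) (x - t • v) v -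
          (2 : ℝ) • fderiv ℝ (fderiv ℝ g) x v) t := by
      intro t
      have h2 : HasDerivAt (fun t : ℝ => (2 * t) • fderiv ℝ (fderiv ℝ g) x v)
          ((2 : ℝ) • fderiv ℝ (fderiv ℝ g) x v) t := by
        simpa using ((hasDerivAt_id t).const_mul 2).smul_const (fderiv ℝ (fderiv ℝ g) x v)
      exact ((hasDerivAt_comp_add_smul hd1 x v t).sub (hasDerivAt_comp_sub_smul hd1 x v t)).sub h2
    have h := norm_image_sub_le_of_norm_deriv_le_segment' (C := 2 * (B * ‖v‖ ^ 3))
      (a := (0 : ℝ)) (b := 1) (fun t _ => (hder t).hasDerivWithinAt) (fun t ht => ?_) t ht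
    · simp only [zero_smul, add_zero, sub_zero, sub_self, mul_zero] at h
      refine h.trans (mul_le_of_le_one_right (by positivity) ht.2)
    · have h1 := hsecond t ⟨ht.1, ht.2.le⟩
      have h2 : fderiv ℝ (fderiv ℝ g) (x + t • v) v - -fderiv ℝ (fderiv ℝ g) (x - t • v) v -
          (2 : ℝ) • fderiv ℝ (fderiv ℝ g) x v =
          (fderiv ℝ (fderiv ℝ g) (x + t • v) + fderiv ℝ (fderiv ℝ g) (x - t • v) -
            (2 : ℝ) • fderiv ℝ (fderiv ℝ g) x) v := by
        simp [sub_neg_eq_add]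
      rw [h2]
      refine (ContinuousLinearMap.le_opNorm _ v).trans ?_
      calc _ ≤ 2 * (B * ‖v‖ ^ 2) * ‖v‖ := by gcongr
        _ = _ := by ring
  have hder : ∀ t : ℝ, HasDerivAt (fun t : ℝ => g (x + t • v) + g (x - t • v) -
      t ^ 2 * fderiv ℝ (fderiv ℝ g) x v v)
      (fderiv ℝ g (x + t • v) v + -fderiv ℝ g (x - t • v) v -
        2 * t * fderiv ℝ (fderiv ℝ g) x v v) t := by
    intro t
    have h2 : HasDerivAt (fun t : ℝ => t ^ 2 * fderiv ℝ (fderiv ℝ g) x v v)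
        (2 * t * fderiv ℝ (fderiv ℝ g) x v v) t :=
      ((hasDerivAt_pow 2 t).mul_const _).congr_deriv (by push_cast; ring)
    exact ((hasDerivAt_comp_add_smul hd0 x v t).add (hasDerivAt_comp_sub_smul hd0 x v t)).sub h2
  have h := norm_image_sub_le_of_norm_deriv_le_segment_01' (C := 2 * (B * ‖v‖ ^ 4))
    (fun t _ => (hder t).hasDerivWithinAt) fun t ht => ?_
  · simp only [one_smul, zero_smul, add_zero, sub_zero, one_pow, one_mul, zero_pow two_ne_zero,
      zero_mul] at h
    rw [Real.norm_eq_abs] at h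
    convert h using 2
    ring
  · have h1 := hfirst t ⟨ht.1, ht.2.le⟩
    have h2 : fderiv ℝ g (x + t • v) v + -fderiv ℝ g (x - t • v) v -
        2 * t * fderiv ℝ (fderiv ℝ g) x v v =
        (fderiv ℝ g (x + t • v) - fderiv ℝ g (x - t • v) -
          (2 * t) • fderiv ℝ (fderiv ℝ g) x v) v := by
      simp [← sub_eq_add_neg]
    rw [h2]
    refine (ContinuousLinearMap.le_opNorm _ v).trans ?_
    calc _ ≤ 2 * (B * ‖v‖ ^ 3) * ‖v‖ := by gcongr
      _ = _ := by ring

set_option maxSynthPendingDepth 4 in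
/-- Weak Taylor expansion for an increment `u + v` in which `v` has a symmetric law. -/
lemma abs_taylor_drift_noise_le {g : V → ℝ} (hg : ContDiff ℝ 4 g) {x u v : V} {B : ℝ}
    (h2 : ∀ t ∈ Set.Icc (0 : ℝ) 1, ‖iteratedFDeriv ℝ 2 g (x + v + t • u)‖ ≤ B)
    (h3 : ∀ t ∈ Set.Icc (0 : ℝ) 1, ‖iteratedFDeriv ℝ 3 g (x + t • v)‖ ≤ B)
    (h4 : ∀ t ∈ Set.Icc (-1 : ℝ) 1, ‖iteratedFDeriv ℝ 4 g (x + t • v)‖ ≤ B) :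
    |g (x + v + u) - g x - (fderiv ℝ g x u + 2⁻¹ * fderiv ℝ (fderiv ℝ g) x v v +
      (2⁻¹ * (g (x + v) - g (x - v)) + fderiv ℝ (fderiv ℝ g) x v u))| ≤
      B * (‖u‖ ^ 2 + ‖v‖ ^ 2 * ‖u‖ + ‖v‖ ^ 4) := by
  have hg1 : ContDiff ℝ 3 (fderiv ℝ g) := hg.fderiv_right (by norm_num)
  have e2 : ∀ y, ‖fderiv ℝ (fderiv ℝ g) y‖ = ‖iteratedFDeriv ℝ 2 g y‖ := fun y => by
    rw [← norm_iteratedFDeriv_one, norm_iteratedFDeriv_fderiv]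
  -- Three expansions are combined: in the drift `u` around `x + v`, of the first derivative in the
  -- direction `v`, and of the even part of `g (x + v)`. The odd part of `g (x + v)` and the mixed
  -- second derivative are kept as they stand, since they vanish in the mean.
  have b1 := norm_image_add_sub_sub_le (hg.of_le (by norm_num)) (x := x + v) (u := u) (B := B)
    fun t ht => by rw [e2]; exact h2 t ht
  have b2 := norm_image_add_sub_sub_le (hg1.of_le (by norm_num)) (x := x) (u := v) (B := B)
    fun t ht => by
      rw [← norm_iteratedFDeriv_one, norm_iteratedFDeriv_fderiv, norm_iteratedFDeriv_fderiv]
      exact h3 t ht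
  have b3 := abs_symmetric_taylor_le hg (x := x) (v := v) (B := B) fun t ht => by
      rw [← norm_iteratedFDeriv_one, norm_iteratedFDeriv_fderiv, norm_iteratedFDeriv_fderiv,
        norm_iteratedFDeriv_fderiv]
      exact h4 t ht
  have b2' := ((fderiv ℝ g (x + v) - fderiv ℝ g x - fderiv ℝ (fderiv ℝ g) x v).le_opNorm u).trans
    (mul_le_mul_of_nonneg_right b2 (norm_nonneg u))
  simp only [sub_apply, Real.norm_eq_abs] at b1 b2'
  rw [abs_le] at *
  constructor <;> linarith [b1.1, b1.2, b2'.1, b2'.2, b3.1, b3.2]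

end Taylor

end SASGLD
end

noncomputable section

namespace SASGLD

variable {d : ℕ}

/-! ### Gaussian integrals and independent noise. -/

section Gaussian

lemma integrable_norm_pow_stdGaussian (p : ℕ) :
    Integrable (fun x : E d => ‖x‖ ^ p) (stdGaussian (E d)) := by
  have h := (IsGaussian.memLp_id (stdGaussian (E d)) p (by simp)).integrable_norm_pow'
  simpa using h

lemma map_neg_stdGaussian : (stdGaussian (E d)).map (fun x => -x) = stdGaussian (E d) :=
  stdGaussian_map (LinearIsometryEquiv.neg ℝ : E d ≃ₗᵢ[ℝ] E d)

lemma integral_inner_mul_inner_stdGaussian (x y : E d) :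
    ∫ z, inner ℝ x z * inner ℝ y z ∂(stdGaussian (E d)) = inner ℝ x y := by
  have h := covarianceBilin_apply (μ := stdGaussian (E d))
    (IsGaussian.memLp_id _ 2 (by simp)) x y
  have h0 : ∫ z, id z ∂(stdGaussian (E d)) = 0 := integral_id_stdGaussian
  rw [covarianceBilin_stdGaussian, h0] at h
  simp only [sub_zero] at h
  exact h.symm

lemma integrable_inner_mul_inner_stdGaussian (x y : E d) :
    Integrable (fun z => inner ℝ x z * inner ℝ y z) (stdGaussian (E d)) := by
  refine ((integrable_norm_pow_stdGaussian 2).const_mul (‖x‖ * ‖y‖)).mono' (by fun_prop)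
    (ae_of_all _ fun z => ?_)
  rw [norm_mul]
  calc _ ≤ (‖x‖ * ‖z‖) * (‖y‖ * ‖z‖) := by
        gcongr <;> exact norm_inner_le_norm _ _
    _ = _ := by ring

/-- The covariance is the identity, so a quadratic form integrates to its trace; for a second
derivative this is the Laplacian. -/
lemma integral_bilin_stdGaussian (B : E d →L[ℝ] E d →L[ℝ] ℝ) :
    ∫ z, B z z ∂(stdGaussian (E d)) = ∑ i, B (EuclideanSpace.basisFun (Fin d) ℝ i)
      (EuclideanSpace.basisFun (Fin d) ℝ i) := by
  set e := EuclideanSpace.basisFun (Fin d) ℝ with he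
  have h1 : ∀ z : E d, B z z = ∑ i, ∑ j, (inner ℝ (e i) z * inner ℝ (e j) z) * B (e i) (e j) := by
    intro z
    conv_lhs => rw [← e.sum_repr' z]
    simp only [map_sum, map_smul, sum_apply, smul_apply, smul_eq_mul,
      Finset.mul_sum]
    rw [Finset.sum_comm]
    exact Finset.sum_congr rfl fun i _ => Finset.sum_congr rfl fun j _ => by ring
  simp_rw [h1]
  rw [integral_finsetSum _ fun i _ => integrable_finsetSum _ fun j _ =>
    (integrable_inner_mul_inner_stdGaussian _ _).mul_const _]
  refine Finset.sum_congr rfl fun i _ => ?_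
  rw [integral_finsetSum _ fun j _ => (integrable_inner_mul_inner_stdGaussian _ _).mul_const _]
  simp_rw [integral_mul_const, integral_inner_mul_inner_stdGaussian,
    orthonormal_iff_ite.1 e.orthonormal]
  simp

variable {Ω Y : Type*} [MeasurableSpace Ω] [MeasurableSpace Y] {P : Measure Ω}
  [IsProbabilityMeasure P] {y : Ω → Y} {ε : Ω → E d}

lemma map_prod_eq_of_indepFun (hy : Measurable y) (hε : Measurable ε) (h : IndepFun y ε P)
    (hlaw : P.map ε = stdGaussian (E d)) :
    P.map (fun ω => (y ω, ε ω)) = (P.map y).prod (stdGaussian (E d)) := by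
  rw [(indepFun_iff_map_prod_eq_prod_map_map hy.aemeasurable hε.aemeasurable).1 h, hlaw]

/-- Odd functions of an independent Gaussian have mean zero. -/
lemma integral_odd_noise_eq_zero (hy : Measurable y) (hε : Measurable ε) (h : IndepFun y ε P)
    (hlaw : P.map ε = stdGaussian (E d)) {F : Y × E d → ℝ} (hF : Measurable F)
    (hodd : ∀ a e, F (a, -e) = -F (a, e)) : ∫ ω, F (y ω, ε ω) ∂P = 0 := by
  have hlaw' : P.map (fun ω => -ε ω) = stdGaussian (E d) := by
    rw [← map_neg_stdGaussian, ← hlaw, Measure.map_map measurable_neg hε]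
    rfl
  have hind' : IndepFun y (fun ω => -ε ω) P := h.comp measurable_id measurable_neg
  have h1 := map_prod_eq_of_indepFun hy hε h hlaw
  have h2 := map_prod_eq_of_indepFun hy hε.neg hind' hlaw'
  have h3 : ∫ ω, F (y ω, ε ω) ∂P = ∫ ω, F (y ω, -ε ω) ∂P := by
    rw [← integral_map (φ := fun ω => (y ω, ε ω)) (hy.prodMk hε).aemeasurable
      hF.aestronglyMeasurable, h1, ← h2,
      integral_map (hy.prodMk hε.neg).aemeasurable hF.aestronglyMeasurable]
    rfl
  simp_rw [hodd, integral_neg] at h3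
  linarith

lemma integral_comp_noise (hy : Measurable y) (hε : Measurable ε) (h : IndepFun y ε P)
    (hlaw : P.map ε = stdGaussian (E d)) {F : Y × E d → ℝ} (hF : Measurable F)
    (hint : Integrable (fun ω => F (y ω, ε ω)) P) :
    ∫ ω, F (y ω, ε ω) ∂P = ∫ ω, ∫ e, F (y ω, e) ∂(stdGaussian (E d)) ∂P := by
  have h1 := map_prod_eq_of_indepFun hy hε h hlaw
  have hm : Measurable fun ω => (y ω, ε ω) := hy.prodMk hε
  rw [← integral_map (φ := fun ω => (y ω, ε ω)) hm.aemeasurable hF.aestronglyMeasurable, h1,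
    integral_prod, integral_map hy.aemeasurable]
  · exact (hF.stronglyMeasurable.integral_prod_right').aestronglyMeasurable
  · rw [← h1]
    exact (integrable_map_measure hF.aestronglyMeasurable hm.aemeasurable).2 hint

end Gaussian

/-! ### The weak error of one Langevin step. -/

section OneStep

/-- `θ'` is obtained from `θ` by one Langevin step with random step size `Δ ∈ [0, D]`, stochastic
gradient `G` and independent Gaussian noise `ε`. -/
structure IsNoisyStep {Ω : Type*} [MeasurableSpace Ω] (P : Measure Ω) (β D : ℝ)
    (θ θ' G ε : Ω → E d) (Δ : Ω → ℝ) : Prop where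
  measurable_θ : Measurable θ
  measurable_G : Measurable G
  measurable_ε : Measurable ε
  measurable_Δ : Measurable Δ
  indep : IndepFun (fun ω => (θ ω, Δ ω, G ω)) ε P
  law : P.map ε = stdGaussian (E d)
  step : ∀ ω, θ' ω = θ ω - Δ ω • G ω + Real.sqrt (2 * β⁻¹ * Δ ω) • ε ω
  Δ_nonneg : ∀ ω, 0 ≤ Δ ω
  Δ_le : ∀ ω, Δ ω ≤ D

/-- The quantity that dominates all terms in the expansion of one step. -/
def stepDom {Ω : Type*} (N : ℕ) (θ θ' G ε : Ω → E d) (ω : Ω) : ℝ :=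
  (1 + ‖θ ω‖ + ‖θ' ω‖ + ‖ε ω‖) ^ (2 * N + 8) + ‖G ω‖ ^ 4

lemma add_four_pow_le {a b c : ℝ} (ha : 0 ≤ a) (hb : 0 ≤ b) (hc : 0 ≤ c) (n : ℕ) :
    (1 + a + b + c) ^ n ≤ 4 ^ n * (1 + a ^ n + b ^ n + c ^ n) := by
  have ha' : 0 ≤ a ^ n := by positivity
  have hb' : 0 ≤ b ^ n := by positivity
  have hc' : 0 ≤ c ^ n := by positivity
  obtain ⟨m, hm, h⟩ : ∃ m : ℝ, 1 + a + b + c ≤ 4 * m ∧ m ^ n ≤ 1 + a ^ n + b ^ n + c ^ n := by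
    refine ⟨max (max 1 a) (max b c), ?_, ?_⟩
    · have h1 : (1 : ℝ) ≤ max (max 1 a) (max b c) := (le_max_left _ _).trans (le_max_left _ _)
      have h2 : a ≤ max (max 1 a) (max b c) := (le_max_right _ _).trans (le_max_left _ _)
      have h3 : b ≤ max (max 1 a) (max b c) := (le_max_left _ _).trans (le_max_right _ _)
      have h4 : c ≤ max (max 1 a) (max b c) := (le_max_right _ _).trans (le_max_right _ _)
      linarith
    · rcases max_choice (max 1 a) (max b c) with h | h <;> rw [h]
      · rcases max_choice 1 a with h | h <;> rw [h]
        · rw [one_pow]; linarith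
        · linarith
      · rcases max_choice b c with h | h <;> rw [h] <;> linarith
  calc (1 + a + b + c) ^ n ≤ (4 * m) ^ n := by gcongr
    _ = 4 ^ n * m ^ n := mul_pow _ _ _
    _ ≤ _ := by gcongr

/-- Every term of the expansion contains at most `N + 4` powers of `X` and two powers of the
gradient norm. Squaring each of these factors explains the exponents `2 * N + 8` and `4` in
`stepDom`, and why fourth moments of the gradients suffice. -/
lemma pow_mul_pow_le_dom {X g : ℝ} (hX : 1 ≤ X) (hg : 0 ≤ g) {N k j : ℕ} (hk : k ≤ N + 4)
    (hj : j ≤ 2) : X ^ k * g ^ j ≤ 2 * (X ^ (2 * N + 8) + g ^ 4) := by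
  have h1 : X ^ k ≤ X ^ (N + 4) := pow_le_pow_right₀ hX hk
  have h2 : g ^ j ≤ 1 + g ^ 2 := by
    rcases le_total g 1 with h | h
    · have := pow_le_one₀ (n := j) hg h
      have := sq_nonneg g
      linarith
    · have := pow_le_pow_right₀ h hj
      linarith
  have h3 : X ^ (2 * N + 8) = (X ^ (N + 4)) ^ 2 := by rw [← pow_mul]; ring_nf
  have h4 : g ^ 4 = (g ^ 2) ^ 2 := by rw [← pow_mul]
  have h5 : 1 ≤ X ^ (N + 4) := one_le_pow₀ hX
  calc X ^ k * g ^ j ≤ X ^ (N + 4) * (1 + g ^ 2) := by gcongr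
    _ ≤ _ := by
      rw [h3, h4]
      nlinarith [sq_nonneg (X ^ (N + 4) - g ^ 2), sq_nonneg (g ^ 2)]

variable {Ω : Type*} [MeasurableSpace Ω] {P : Measure Ω}
  {β D : ℝ} {θ θ' G ε : Ω → E d} {Δ : Ω → ℝ}

lemma IsNoisyStep.measurable_θ' (h : IsNoisyStep P β D θ θ' G ε Δ) : Measurable θ' := by
  have h1 := h.measurable_θ
  have h2 := h.measurable_G
  have h3 := h.measurable_ε
  have h4 := h.measurable_Δ
  have : θ' = fun ω => θ ω - Δ ω • G ω + Real.sqrt (2 * β⁻¹ * Δ ω) • ε ω := funext h.step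
  rw [this]
  fun_prop

lemma integral_sub_sub_add {a b c₁ c₂ c₃ c₄ : Ω → ℝ} (ha : Integrable a P) (hb : Integrable b P)
    (h₁ : Integrable c₁ P) (h₂ : Integrable c₂ P) (h₃ : Integrable c₃ P) (h₄ : Integrable c₄ P) :
    ∫ ω, (a ω - b ω - (c₁ ω + c₂ ω + (c₃ ω + c₄ ω))) ∂P = ∫ ω, a ω ∂P - ∫ ω, b ω ∂P -
      (∫ ω, c₁ ω ∂P + ∫ ω, c₂ ω ∂P + (∫ ω, c₃ ω ∂P + ∫ ω, c₄ ω ∂P)) := by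
  have e1 : Integrable (fun ω => a ω - b ω) P := ha.sub hb
  have e2 : Integrable (fun ω => c₁ ω + c₂ ω) P := h₁.add h₂
  have e3 : Integrable (fun ω => c₃ ω + c₄ ω) P := h₃.add h₄
  have e4 : Integrable (fun ω => c₁ ω + c₂ ω + (c₃ ω + c₄ ω)) P := e2.add e3
  rw [integral_sub e1 e4, integral_sub ha hb, integral_add e2 e3, integral_add h₁ h₂,
    integral_add h₃ h₄]

variable [IsProbabilityMeasure P]

lemma IsNoisyStep.integrable_stepDom (h : IsNoisyStep P β D θ θ' G ε Δ) {N : ℕ} {K K' K₄ : ℝ}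
    (h1 : Integrable (fun ω => ‖θ ω‖ ^ (2 * N + 8)) P) (h1' : ∫ ω, ‖θ ω‖ ^ (2 * N + 8) ∂P ≤ K)
    (h2 : Integrable (fun ω => ‖θ' ω‖ ^ (2 * N + 8)) P) (h2' : ∫ ω, ‖θ' ω‖ ^ (2 * N + 8) ∂P ≤ K')
    (h3 : Integrable (fun ω => ‖G ω‖ ^ 4) P) (h3' : ∫ ω, ‖G ω‖ ^ 4 ∂P ≤ K₄) :
    Integrable (stepDom N θ θ' G ε) P ∧ ∫ ω, stepDom N θ θ' G ε ω ∂P ≤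
      4 ^ (2 * N + 8) * (1 + K + K' + ∫ x : E d, ‖x‖ ^ (2 * N + 8) ∂(stdGaussian (E d))) + K₄ := by
  have hε : Integrable (fun ω => ‖ε ω‖ ^ (2 * N + 8)) P := by
    have := integrable_norm_pow_stdGaussian (d := d) (2 * N + 8)
    rw [← h.law] at this
    exact (integrable_map_measure (by fun_prop) h.measurable_ε.aemeasurable).1 this
  have hε' : ∫ ω, ‖ε ω‖ ^ (2 * N + 8) ∂P = ∫ x : E d, ‖x‖ ^ (2 * N + 8) ∂(stdGaussian (E d)) := by
    rw [← h.law, integral_map h.measurable_ε.aemeasurable (by fun_prop)]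
  have hsum : Integrable (fun ω => 4 ^ (2 * N + 8) * (1 + ‖θ ω‖ ^ (2 * N + 8) +
      ‖θ' ω‖ ^ (2 * N + 8) + ‖ε ω‖ ^ (2 * N + 8)) + ‖G ω‖ ^ 4) P :=
    (((((integrable_const (1 : ℝ)).add h1).add h2).add hε).const_mul _).add h3
  have hle : ∀ ω, stepDom N θ θ' G ε ω ≤ 4 ^ (2 * N + 8) * (1 + ‖θ ω‖ ^ (2 * N + 8) +
      ‖θ' ω‖ ^ (2 * N + 8) + ‖ε ω‖ ^ (2 * N + 8)) + ‖G ω‖ ^ 4 := fun ω => by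
    unfold stepDom
    gcongr
    exact add_four_pow_le (norm_nonneg _) (norm_nonneg _) (norm_nonneg _) _
  have hi : Integrable (stepDom N θ θ' G ε) P := by
    refine hsum.mono' ?_ (ae_of_all _ fun ω => ?_)
    · have a1 := h.measurable_θ
      have a2 := h.measurable_G
      have a3 := h.measurable_ε
      have a4 := h.measurable_θ'
      unfold stepDom
      exact Measurable.aestronglyMeasurable (by fun_prop)
    · rw [Real.norm_of_nonneg (by unfold stepDom; positivity)]
      exact hle ω
  refine ⟨hi, (integral_mono hi hsum hle).trans ?_⟩
  have hs1 : Integrable (fun ω => 1 + ‖θ ω‖ ^ (2 * N + 8)) P := (integrable_const 1).add h1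
  have hs2 : Integrable (fun ω => 1 + ‖θ ω‖ ^ (2 * N + 8) + ‖θ' ω‖ ^ (2 * N + 8)) P := hs1.add h2
  have hs3 : Integrable (fun ω => 1 + ‖θ ω‖ ^ (2 * N + 8) + ‖θ' ω‖ ^ (2 * N + 8) +
    ‖ε ω‖ ^ (2 * N + 8)) P := hs2.add hε
  rw [integral_add (hs3.const_mul _) h3, integral_const_mul, integral_add hs2 hε,
    integral_add hs1 h2, integral_add (integrable_const 1) h1, hε']
  simp only [integral_const, probReal_univ, smul_eq_mul, one_mul]
  gcongr

lemma norm_iteratedFDeriv_le_of_norm_le {φ : E d → ℝ} {A : ℝ} (hA0 : 0 ≤ A) {N : ℕ}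
    (hA : ∀ j ≤ 4, ∀ x, ‖iteratedFDeriv ℝ j φ x‖ ≤ A * (1 + ‖x‖ ^ N)) {s X : ℝ}
    (hX : 1 ≤ X) {j : ℕ} (hj : j ≤ 4) {x : E d} (hx : ‖x‖ ≤ (1 + s) * X) :
    ‖iteratedFDeriv ℝ j φ x‖ ≤ A * (1 + (1 + s) ^ N) * X ^ N := by
  refine (hA j hj x).trans ?_
  have h1 : ‖x‖ ^ N ≤ (1 + s) ^ N * X ^ N := by
    rw [← mul_pow]; gcongr
  have h2 : 1 ≤ X ^ N := one_le_pow₀ hX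
  rw [mul_assoc]
  gcongr
  linarith

set_option maxHeartbeats 1000000 in
/-- The weak error of one step is of second order in the step size. -/
theorem IsNoisyStep.abs_weak_error_le {M h h₀ A Kd : ℝ} {N : ℕ} {φ : E d → ℝ} (hβ : 0 < β)
    (hM : 0 ≤ M) (hh : 0 ≤ h) (hh₀ : h ≤ h₀)
    (hs : IsNoisyStep P β (M * h) θ θ' G ε Δ) (hφ : ContDiff ℝ 4 φ) (hA0 : 0 ≤ A)
    (hA : ∀ j ≤ 4, ∀ x, ‖iteratedFDeriv ℝ j φ x‖ ≤ A * (1 + ‖x‖ ^ N))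
    (hdom : Integrable (stepDom N θ θ' G ε) P) (hKd : ∫ ω, stepDom N θ θ' G ε ω ∂P ≤ Kd) :
    |∫ ω, φ (θ' ω) ∂P - ∫ ω, φ (θ ω) ∂P -
      ∫ ω, (β⁻¹ * Δ ω * Laplacian.laplacian φ (θ ω) - Δ ω * fderiv ℝ φ (θ ω) (G ω)) ∂P| ≤
      A * (1 + (1 + Real.sqrt (2 * β⁻¹ * (M * h₀))) ^ N) *
        (M ^ 2 + 2 * β⁻¹ * M * M + (2 * β⁻¹ * M) ^ 2) * 2 * Kd * h ^ 2 := by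
  -- Bounds the factor in front of the noise for all `h ≤ h₀`, which keeps `h` out of the constant.
  set s : ℝ := Real.sqrt (2 * β⁻¹ * (M * h₀)) with hsdef
  set A' : ℝ := A * (1 + (1 + s) ^ N) with hA'
  have hs0 : 0 ≤ s := Real.sqrt_nonneg _
  have hA'0 : 0 ≤ A' := by positivity
  have hβi : 0 < β⁻¹ := inv_pos.2 hβ
  have hh₀' : 0 ≤ h₀ := hh.trans hh₀
  have m1 := hs.measurable_θ
  have m2 := hs.measurable_G
  have m3 := hs.measurable_ε
  have m4 := hs.measurable_Δ
  have m5 := hs.measurable_θ'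
  have c0 : Continuous φ := hφ.continuous
  have c1 : Continuous (fderiv ℝ φ) := hφ.continuous_fderiv (by norm_num)
  have c2 : Continuous (fderiv ℝ (fderiv ℝ φ)) :=
    (hφ.fderiv_right (m := 3) (by norm_num)).continuous_fderiv (by norm_num)
  set u : Ω → E d := fun ω => -(Δ ω • G ω) with hu
  set v : Ω → E d := fun ω => Real.sqrt (2 * β⁻¹ * Δ ω) • ε ω with hv
  set X : Ω → ℝ := fun ω => 1 + ‖θ ω‖ + ‖θ' ω‖ + ‖ε ω‖ with hXdef
  have hX1 : ∀ ω, 1 ≤ X ω := fun ω => by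
    simp only [hXdef]; linarith [norm_nonneg (θ ω), norm_nonneg (θ' ω), norm_nonneg (ε ω)]
  have hX0 : ∀ ω, 0 ≤ X ω := fun ω => zero_le_one.trans (hX1 ω)
  have hθX : ∀ ω, ‖θ ω‖ ≤ X ω := fun ω => by
    simp only [hXdef]; linarith [norm_nonneg (θ ω), norm_nonneg (θ' ω), norm_nonneg (ε ω)]
  have hθX' : ∀ ω, ‖θ' ω‖ ≤ X ω := fun ω => by
    simp only [hXdef]; linarith [norm_nonneg (θ ω), norm_nonneg (θ' ω), norm_nonneg (ε ω)]
  have hεX : ∀ ω, ‖ε ω‖ ≤ X ω := fun ω => by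
    simp only [hXdef]; linarith [norm_nonneg (θ ω), norm_nonneg (θ' ω), norm_nonneg (ε ω)]
  have hθεX : ∀ ω, ‖θ ω‖ + ‖ε ω‖ ≤ X ω := fun ω => by
    simp only [hXdef]; linarith [norm_nonneg (θ ω), norm_nonneg (θ' ω), norm_nonneg (ε ω)]
  have hsum : ∀ ω, θ' ω = θ ω + v ω + u ω := fun ω => by
    rw [hs.step ω]
    simp only [hu, hv]
    abel
  have hun : ∀ ω, ‖u ω‖ ≤ M * h * ‖G ω‖ := fun ω => by
    rw [hu]
    simp only [norm_neg, norm_smul, Real.norm_of_nonneg (hs.Δ_nonneg ω)]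
    gcongr
    exact hs.Δ_le ω
  have hvn2 : ∀ ω, ‖v ω‖ ^ 2 ≤ 2 * β⁻¹ * M * h * X ω ^ 2 := fun ω => by
    rw [hv]
    have h1 : (0 : ℝ) ≤ 2 * β⁻¹ * Δ ω := mul_nonneg (by positivity) (hs.Δ_nonneg ω)
    simp only [norm_smul, Real.norm_of_nonneg (Real.sqrt_nonneg _), mul_pow, Real.sq_sqrt h1]
    have h2 := hs.Δ_le ω
    have h3 := hεX ω
    calc 2 * β⁻¹ * Δ ω * ‖ε ω‖ ^ 2 ≤ 2 * β⁻¹ * (M * h) * X ω ^ 2 := by gcongr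
      _ = _ := by ring
  have hvn : ∀ ω, ‖v ω‖ ≤ s * ‖ε ω‖ := fun ω => by
    rw [hv]
    simp only [norm_smul, Real.norm_of_nonneg (Real.sqrt_nonneg _)]
    have h2 := hs.Δ_le ω
    gcongr
    rw [hsdef]
    refine Real.sqrt_le_sqrt ?_
    have h3 : M * h ≤ M * h₀ := by gcongr
    have : Δ ω ≤ M * h₀ := h2.trans h3
    gcongr
  have hvX : ∀ ω, ‖v ω‖ ≤ s * X ω := fun ω =>
    (hvn ω).trans (by gcongr; exact hεX ω)
  have hpm : ∀ ω, ∀ t : ℝ, |t| ≤ 1 → ‖θ ω + t • v ω‖ ≤ (1 + s) * X ω := fun ω t ht => by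
    have h1 : ‖t • v ω‖ ≤ ‖v ω‖ := by
      rw [norm_smul, Real.norm_eq_abs]
      exact mul_le_of_le_one_left (norm_nonneg _) ht
    have h2 := norm_add_le (θ ω) (t • v ω)
    have h3 := hvX ω
    have h4 := hθX ω
    linarith
  -- The points of the segment are controlled by its end points `θ + v` and `θ'`. A bound through
  -- the norm of `G` would produce its `N`-th power, but only the fourth moment of `G` is under
  -- control, whereas `θ'` has moments of all orders.
  have hseg : ∀ ω, ∀ t ∈ Set.Icc (0 : ℝ) 1, ‖θ ω + v ω + t • u ω‖ ≤ (1 + s) * X ω := by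
    intro ω t ht
    have h1 : θ ω + v ω + t • u ω = (1 - t) • (θ ω + v ω) + t • θ' ω := by
      rw [hsum ω, smul_add t, sub_smul, one_smul]
      abel
    have h2 := norm_add_le ((1 - t) • (θ ω + v ω)) (t • θ' ω)
    rw [norm_smul, norm_smul, Real.norm_of_nonneg ht.1,
      Real.norm_of_nonneg (sub_nonneg.2 ht.2)] at h2
    have h3 := hpm ω 1 (by simp)
    rw [one_smul] at h3
    have h4 : ‖θ' ω‖ ≤ (1 + s) * X ω := by nlinarith [hθX' ω, hX0 ω]
    rw [h1]
    nlinarith [ht.1, ht.2]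
  have hD : ∀ ω, ∀ j ≤ 4, ∀ x, ‖x‖ ≤ (1 + s) * X ω →
      ‖iteratedFDeriv ℝ j φ x‖ ≤ A' * X ω ^ N := fun ω j hj x hx =>
    norm_iteratedFDeriv_le_of_norm_le hA0 hA (hX1 ω) hj hx
  have hθs : ∀ ω, ‖θ ω‖ ≤ (1 + s) * X ω := fun ω => by nlinarith [hθX ω, hX0 ω]
  have hθs' : ∀ ω, ‖θ' ω‖ ≤ (1 + s) * X ω := fun ω => by nlinarith [hθX' ω, hX0 ω]
  have hφ0 : ∀ ω x, ‖x‖ ≤ (1 + s) * X ω → |φ x| ≤ A' * X ω ^ N := fun ω x hx => by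
    have := hD ω 0 (by norm_num) x hx
    rwa [norm_iteratedFDeriv_zero] at this
  have hφ1 : ∀ ω, ‖fderiv ℝ φ (θ ω)‖ ≤ A' * X ω ^ N := fun ω => by
    rw [← norm_iteratedFDeriv_one]
    exact hD ω 1 (by norm_num) _ (hθs ω)
  have hφ2 : ∀ ω, ‖fderiv ℝ (fderiv ℝ φ) (θ ω)‖ ≤ A' * X ω ^ N := fun ω => by
    rw [norm_fderiv_fderiv_eq]
    exact hD ω 2 (by norm_num) _ (hθs ω)
  have hdomle : ∀ ω, ∀ k j : ℕ, k ≤ N + 4 → j ≤ 2 →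
      X ω ^ k * ‖G ω‖ ^ j ≤ 2 * stepDom N θ θ' G ε ω := fun ω k j hk hj =>
    pow_mul_pow_le_dom (hX1 ω) (norm_nonneg _) hk hj
  have hint : ∀ (F : Ω → ℝ), Measurable F → (∃ (c : ℝ) (k j : ℕ), 0 ≤ c ∧ k ≤ N + 4 ∧ j ≤ 2 ∧
      ∀ ω, |F ω| ≤ c * (X ω ^ k * ‖G ω‖ ^ j)) → Integrable F P := by
    rintro F hF ⟨c, k, j, hc, hk, hj, hle⟩
    refine (hdom.const_mul (c * 2)).mono' hF.aestronglyMeasurable (ae_of_all _ fun ω => ?_)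
    refine (hle ω).trans ?_
    rw [mul_assoc]
    exact mul_le_mul_of_nonneg_left (hdomle ω k j hk hj) hc
  have mu : Measurable u := by fun_prop
  have mv : Measurable v := by fun_prop
  have cc1 : Continuous fun p : E d × E d => fderiv ℝ φ p.1 p.2 :=
    (c1.comp continuous_fst).clm_apply continuous_snd
  have cc2 : Continuous fun p : E d × E d × E d => fderiv ℝ (fderiv ℝ φ) p.1 p.2.1 p.2.2 :=
    ((c2.comp continuous_fst).clm_apply (continuous_fst.comp continuous_snd)).clm_apply
      (continuous_snd.comp continuous_snd)
  have I0 : Integrable (fun ω => φ (θ ω)) P := hint _ (c0.measurable.comp m1)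
    ⟨A', N, 0, hA'0, by omega, by omega, fun ω => by simpa using hφ0 ω _ (hθs ω)⟩
  have I0' : Integrable (fun ω => φ (θ' ω)) P := hint _ (c0.measurable.comp m5)
    ⟨A', N, 0, hA'0, by omega, by omega, fun ω => by simpa using hφ0 ω _ (hθs' ω)⟩
  have Ip : Integrable (fun ω => φ (θ ω + v ω)) P := hint _ (c0.measurable.comp (m1.add mv))
    ⟨A', N, 0, hA'0, by omega, by omega, fun ω => by
      simpa using hφ0 ω _ (by simpa using hpm ω 1 (by simp))⟩
  have Im : Integrable (fun ω => φ (θ ω - v ω)) P := hint _ (c0.measurable.comp (m1.sub mv))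
    ⟨A', N, 0, hA'0, by omega, by omega, fun ω => by
      have := hφ0 ω _ (hpm ω (-1) (by simp))
      simpa [sub_eq_add_neg] using this⟩
  have hMhG : ∀ ω, ‖u ω‖ ≤ M * h₀ * ‖G ω‖ := fun ω => (hun ω).trans (by gcongr)
  have I1 : Integrable (fun ω => fderiv ℝ φ (θ ω) (u ω)) P :=
    hint _ (cc1.measurable.comp (m1.prodMk mu))
    ⟨A' * (M * h₀), N, 1, by positivity, by omega, by omega, fun ω => by
      refine ((fderiv ℝ φ (θ ω)).le_opNorm (u ω)).trans ?_
      calc _ ≤ (A' * X ω ^ N) * (M * h₀ * ‖G ω‖) :=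
            mul_le_mul (hφ1 ω) (hMhG ω) (norm_nonneg _)
              (mul_nonneg hA'0 (pow_nonneg (hX0 ω) N))
        _ = _ := by ring⟩
  have I2 : Integrable (fun ω => fderiv ℝ (fderiv ℝ φ) (θ ω) (v ω) (u ω)) P :=
    hint _ (cc2.measurable.comp (m1.prodMk (mv.prodMk mu)))
    ⟨A' * s * (M * h₀), N + 1, 1, by positivity, by omega, by omega, fun ω => by
      refine ((fderiv ℝ (fderiv ℝ φ) (θ ω)).le_opNorm₂ (v ω) (u ω)).trans ?_
      have hp := pow_nonneg (hX0 ω) N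
      calc _ ≤ (A' * X ω ^ N) * (s * X ω) * (M * h₀ * ‖G ω‖) :=
            mul_le_mul (mul_le_mul (hφ2 ω) (hvX ω) (norm_nonneg _) (by positivity)) (hMhG ω)
              (norm_nonneg _) (mul_nonneg (by positivity) (mul_nonneg hs0 (hX0 ω)))
        _ = _ := by ring⟩
  have I3 : Integrable (fun ω => fderiv ℝ (fderiv ℝ φ) (θ ω) (v ω) (v ω)) P :=
    hint _ (cc2.measurable.comp (m1.prodMk (mv.prodMk mv)))
    ⟨A' * s * s, N + 2, 0, by positivity, by omega, by omega, fun ω => by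
      refine ((fderiv ℝ (fderiv ℝ φ) (θ ω)).le_opNorm₂ (v ω) (v ω)).trans ?_
      have hp := pow_nonneg (hX0 ω) N
      calc _ ≤ (A' * X ω ^ N) * (s * X ω) * (s * X ω) :=
            mul_le_mul (mul_le_mul (hφ2 ω) (hvX ω) (norm_nonneg _) (by positivity)) (hvX ω)
              (norm_nonneg _) (mul_nonneg (by positivity) (mul_nonneg hs0 (hX0 ω)))
        _ = _ := by ring⟩
  have my : Measurable fun ω => (θ ω, Δ ω, G ω) := m1.prodMk (m4.prodMk m2)
  -- This term and the mixed one in `Z2` are odd in the noise, which is independent of position,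
  -- step size and gradient.
  have Z1 : ∫ ω, 2⁻¹ * (φ (θ ω + v ω) - φ (θ ω - v ω)) ∂P = 0 := by
    refine integral_odd_noise_eq_zero my m3 hs.indep hs.law
      (F := fun p => 2⁻¹ * (φ (p.1.1 + Real.sqrt (2 * β⁻¹ * p.1.2.1) • p.2) -
        φ (p.1.1 - Real.sqrt (2 * β⁻¹ * p.1.2.1) • p.2))) ?_ ?_
    · exact Continuous.measurable (by fun_prop)
    · intro a e
      simp only [smul_neg, sub_neg_eq_add, ← sub_eq_add_neg]
      ring
  have Z2 : ∫ ω, fderiv ℝ (fderiv ℝ φ) (θ ω) (v ω) (u ω) ∂P = 0 := by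
    refine integral_odd_noise_eq_zero my m3 hs.indep hs.law
      (F := fun p => fderiv ℝ (fderiv ℝ φ) p.1.1 (Real.sqrt (2 * β⁻¹ * p.1.2.1) • p.2)
        (-(p.1.2.1 • p.1.2.2))) ?_ ?_
    · exact (cc2.comp (f := fun p : (E d × ℝ × E d) × E d =>
        (p.1.1, Real.sqrt (2 * β⁻¹ * p.1.2.1) • p.2, -(p.1.2.1 • p.1.2.2))) (by fun_prop)).measurable
    · intro a e
      simp
  -- For frozen position, step size and gradient, the covariance of `v` is `2 β⁻¹ Δ` times the
  -- identity; half of the second derivative thus averages to the diffusion part of the generator.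
  have Z3 : ∫ ω, 2⁻¹ * fderiv ℝ (fderiv ℝ φ) (θ ω) (v ω) (v ω) ∂P =
      ∫ ω, β⁻¹ * Δ ω * Laplacian.laplacian φ (θ ω) ∂P := by
    rw [integral_comp_noise my m3 hs.indep hs.law
      (F := fun p => 2⁻¹ * fderiv ℝ (fderiv ℝ φ) p.1.1 (Real.sqrt (2 * β⁻¹ * p.1.2.1) • p.2)
        (Real.sqrt (2 * β⁻¹ * p.1.2.1) • p.2)) ?_ (I3.const_mul _)]
    · refine integral_congr_ae (ae_of_all _ fun ω => ?_)
      have h1 : (0 : ℝ) ≤ 2 * β⁻¹ * Δ ω := mul_nonneg (by positivity) (hs.Δ_nonneg ω)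
      simp only [map_smul, smul_apply, smul_eq_mul]
      rw [integral_const_mul, integral_const_mul, integral_const_mul, integral_bilin_stdGaussian,
        laplacian_eq_sum, ← mul_assoc (Real.sqrt _), Real.mul_self_sqrt h1]
      ring
    · exact (continuous_const.mul (cc2.comp (f := fun p : (E d × ℝ × E d) × E d =>
        (p.1.1, Real.sqrt (2 * β⁻¹ * p.1.2.1) • p.2, Real.sqrt (2 * β⁻¹ * p.1.2.1) • p.2))
          (by fun_prop))).measurable
  have Ilap : Integrable (fun ω => β⁻¹ * Δ ω * Laplacian.laplacian φ (θ ω)) P := by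
    have cl : Continuous (Laplacian.laplacian φ) := by
      have h4 : (Laplacian.laplacian φ : E d → ℝ) = _ := funext fun x => laplacian_eq_sum φ x
      rw [h4]
      fun_prop
    refine hint _ ((m4.const_mul _).mul (cl.measurable.comp m1))
      ⟨β⁻¹ * (M * h₀) * (d * A'), N, 0, by positivity, by omega, by omega, fun ω => ?_⟩
    rw [abs_mul, abs_mul, abs_of_nonneg hβi.le, abs_of_nonneg (hs.Δ_nonneg ω)]
    have h1 := abs_laplacian_le φ (θ ω)
    have h2 : ‖iteratedFDeriv ℝ 2 φ (θ ω)‖ ≤ A' * X ω ^ N := hD ω 2 (by norm_num) _ (hθs ω)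
    have h3 : Δ ω ≤ M * h₀ := (hs.Δ_le ω).trans (by gcongr)
    calc β⁻¹ * Δ ω * |Laplacian.laplacian φ (θ ω)| ≤ β⁻¹ * (M * h₀) * (d * (A' * X ω ^ N)) := by
          gcongr
          exact h1.trans (by gcongr)
      _ = _ := by ring
  have hrem : ∀ ω, |φ (θ' ω) - φ (θ ω) - (fderiv ℝ φ (θ ω) (u ω) +
      2⁻¹ * fderiv ℝ (fderiv ℝ φ) (θ ω) (v ω) (v ω) +
      (2⁻¹ * (φ (θ ω + v ω) - φ (θ ω - v ω)) + fderiv ℝ (fderiv ℝ φ) (θ ω) (v ω) (u ω)))| ≤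
      A' * (M ^ 2 + 2 * β⁻¹ * M * M + (2 * β⁻¹ * M) ^ 2) * 2 * h ^ 2 *
        stepDom N θ θ' G ε ω := by
    intro ω
    rw [hsum ω]
    refine (abs_taylor_drift_noise_le hφ (B := A' * X ω ^ N)
      (fun t ht => hD ω 2 (by norm_num) _ (hseg ω t ht))
      (fun t ht => hD ω 3 (by norm_num) _ (hpm ω t (abs_le.2 ⟨by linarith [ht.1], ht.2⟩)))
      (fun t ht => hD ω 4 (by norm_num) _ (hpm ω t (abs_le.2 ht)))).trans ?_
    have hp := pow_nonneg (hX0 ω) N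
    have e1 := hun ω
    have e2 := hvn2 ω
    have e3 : ‖v ω‖ ^ 4 ≤ (2 * β⁻¹ * M * h * X ω ^ 2) ^ 2 := by
      calc ‖v ω‖ ^ 4 = (‖v ω‖ ^ 2) ^ 2 := by ring
        _ ≤ _ := by gcongr
    have d1 := hdomle ω N 2 (by omega) le_rfl
    have d2 := hdomle ω (N + 2) 1 (by omega) (by omega)
    have d3 := hdomle ω (N + 4) 0 le_rfl (by omega)
    calc A' * X ω ^ N * (‖u ω‖ ^ 2 + ‖v ω‖ ^ 2 * ‖u ω‖ + ‖v ω‖ ^ 4)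
        ≤ A' * X ω ^ N * ((M * h * ‖G ω‖) ^ 2 + 2 * β⁻¹ * M * h * X ω ^ 2 * (M * h * ‖G ω‖) +
          (2 * β⁻¹ * M * h * X ω ^ 2) ^ 2) := by
          gcongr
      _ = A' * h ^ 2 * (M ^ 2 * (X ω ^ N * ‖G ω‖ ^ 2) +
          2 * β⁻¹ * M * M * (X ω ^ (N + 2) * ‖G ω‖ ^ 1) +
          (2 * β⁻¹ * M) ^ 2 * (X ω ^ (N + 4) * ‖G ω‖ ^ 0)) := by ring
      _ ≤ A' * h ^ 2 * (M ^ 2 * (2 * stepDom N θ θ' G ε ω) +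
          2 * β⁻¹ * M * M * (2 * stepDom N θ θ' G ε ω) +
          (2 * β⁻¹ * M) ^ 2 * (2 * stepDom N θ θ' G ε ω)) := by gcongr
      _ = _ := by ring
  have hmain : ∫ ω, (φ (θ' ω) - φ (θ ω) - (fderiv ℝ φ (θ ω) (u ω) +
      2⁻¹ * fderiv ℝ (fderiv ℝ φ) (θ ω) (v ω) (v ω) +
      (2⁻¹ * (φ (θ ω + v ω) - φ (θ ω - v ω)) + fderiv ℝ (fderiv ℝ φ) (θ ω) (v ω) (u ω)))) ∂P =
      ∫ ω, φ (θ' ω) ∂P - ∫ ω, φ (θ ω) ∂P -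
      ∫ ω, (β⁻¹ * Δ ω * Laplacian.laplacian φ (θ ω) - Δ ω * fderiv ℝ φ (θ ω) (G ω)) ∂P := by
    have hneg : ∀ ω, -(Δ ω * fderiv ℝ φ (θ ω) (G ω)) = fderiv ℝ φ (θ ω) (u ω) := fun ω => by
      simp [hu]
    have h1 := integral_sub_sub_add I0' I0 I1 (I3.const_mul 2⁻¹) ((Ip.sub Im).const_mul 2⁻¹) I2
    refine h1.trans ?_
    have h2 : ∫ ω, (β⁻¹ * Δ ω * Laplacian.laplacian φ (θ ω) - Δ ω * fderiv ℝ φ (θ ω) (G ω)) ∂P =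
        ∫ ω, β⁻¹ * Δ ω * Laplacian.laplacian φ (θ ω) ∂P + ∫ ω, fderiv ℝ φ (θ ω) (u ω) ∂P := by
      rw [← integral_add Ilap I1]
      simp_rw [← hneg, ← sub_eq_add_neg]
    simp only [Pi.sub_apply] at *
    rw [Z1, Z2, Z3, h2]
    ring
  rw [← hmain]
  refine abs_integral_le_integral_abs.trans ?_
  refine (integral_mono_of_nonneg (ae_of_all _ fun _ => abs_nonneg _) (hdom.const_mul _)
    (ae_of_all _ hrem)).trans ?_
  rw [integral_const_mul]
  calc _ ≤ A' * (M ^ 2 + 2 * β⁻¹ * M * M + (2 * β⁻¹ * M) ^ 2) * 2 * h ^ 2 * Kd := by gcongr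
    _ = _ := by ring

end OneStep

end SASGLD
end

/-! ### Step sizes and the filtration of a run. -/

noncomputable section

namespace SASGLD

variable {d : ℕ}

/-- The step-size function `ψ`, extended from `[c, ∞)` to `ℝ` by its value at `c`. -/
def clippedStep (ψ : ℝ → ℝ) (c x : ℝ) : ℝ := ψ (max x c)

/-- The lower bound `(1 - ρ) δ / α` of the states `ζ_n`, `n ≥ 1`. -/
def stateFloor (α δ h : ℝ) : ℝ := (1 - rho α h) * δ / α

section StepFunction

variable {ψ : ℝ → ℝ} {m M Lψ α δ h : ℝ}

lemma clippedStep_of_le {c x : ℝ} (hx : c ≤ x) : clippedStep ψ c x = ψ x := by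
  rw [clippedStep, max_eq_left hx]

lemma IsStepFunction.le_clippedStep (hψ : IsStepFunction ψ m M Lψ α δ h) (x : ℝ) :
    m ≤ clippedStep ψ (stateFloor α δ h) x := hψ.lower _ (le_max_right _ _)

lemma IsStepFunction.clippedStep_le (hψ : IsStepFunction ψ m M Lψ α δ h) (x : ℝ) :
    clippedStep ψ (stateFloor α δ h) x ≤ M := hψ.upper _ (le_max_right _ _)

lemma IsStepFunction.lipschitz_nonneg (hψ : IsStepFunction ψ m M Lψ α δ h) : 0 ≤ Lψ := by
  have h1 := hψ.lipschitz (stateFloor α δ h + 1) (stateFloor α δ h)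
    (by unfold stateFloor; linarith) le_rfl
  have h2 := abs_nonneg (ψ (stateFloor α δ h + 1) - ψ (stateFloor α δ h))
  simp only [add_sub_cancel_left, abs_one, mul_one] at h1
  exact h2.trans h1

lemma IsStepFunction.le (hψ : IsStepFunction ψ m M Lψ α δ h) : m ≤ M :=
  (hψ.le_clippedStep 0).trans (hψ.clippedStep_le 0)

lemma IsStepFunction.abs_clippedStep_sub_le (hψ : IsStepFunction ψ m M Lψ α δ h) (x y : ℝ) :
    |clippedStep ψ (stateFloor α δ h) x - clippedStep ψ (stateFloor α δ h) y| ≤ Lψ * |x - y| :=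
  (hψ.lipschitz _ _ (le_max_right _ _) (le_max_right _ _)).trans
    (mul_le_mul_of_nonneg_left (abs_max_sub_max_le_abs x y _) hψ.lipschitz_nonneg)

/-- Supplies the measurability that is not assumed for `ψ` itself, which is controlled on a
half-line only. -/
lemma IsStepFunction.continuous_clippedStep (hψ : IsStepFunction ψ m M Lψ α δ h) :
    Continuous (clippedStep ψ (stateFloor α δ h)) := by
  have h1 : LipschitzWith ⟨Lψ, hψ.lipschitz_nonneg⟩ (clippedStep ψ (stateFloor α δ h)) :=
    LipschitzWith.of_dist_le_mul fun x y => hψ.abs_clippedStep_sub_le x y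
  exact h1.continuous

lemma rho_pos : 0 < rho α h := Real.exp_pos _

lemma rho_lt_one (hα : 0 < α) (hh : 0 < h) : rho α h < 1 := by
  rw [rho, Real.exp_lt_one_iff]
  have := mul_pos hα hh
  linarith

lemma one_sub_rho_le : 1 - rho α h ≤ α * h := by
  have := Real.add_one_le_exp (-(α * h))
  unfold rho
  linarith

/-- The step parameters with a positive rate are bounded. -/
lemma lt_of_gammaRate_pos {a L σ : ℝ} (hm : 0 < m) (hmM : m ≤ M) (hL : 0 < L) (hσ : 0 ≤ σ)
    (hh : 0 < h) (hγ : 0 < gammaRate a m M L σ h) : h < a * m / (L ^ 2 * M ^ 2) := by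
  have hM : 0 < M := hm.trans_le hmM
  rw [lt_div_iff₀ (by positivity)]
  unfold gammaRate at hγ
  have h1 : 0 ≤ σ * M * h := by positivity
  have h2 : 0 ≤ σ ^ 2 * M ^ 2 * h ^ 2 := by positivity
  have h3 : 0 < 2 * h * (a * m - h * (L ^ 2 * M ^ 2)) := by nlinarith
  have := (mul_pos_iff_of_pos_left (by positivity)).1 h3
  linarith

end StepFunction

/-- A run of the algorithm together with the standing assumptions that bound it uniformly. -/
structure IsControlledRun {Ω : Type*} [MeasurableSpace Ω] (P : Measure Ω) (U : E d → ℝ)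
    (ψ : ℝ → ℝ) (α β δ m M Lψ L a b σ σ₄ h : ℝ) (K : ℕ → ℝ)
    (θ : ℕ → Ω → E d) (ζ : ℕ → Ω → ℝ) (G ε : ℕ → Ω → E d) : Prop where
  run : IsRun P U ψ α β δ σ σ₄ h θ ζ G ε
  moments : HasMomentBounds P K θ
  step : IsStepFunction ψ m M Lψ α δ h
  potential : IsAdmissiblePotential U L a b
  α_pos : 0 < α
  β_pos : 0 < β
  δ_pos : 0 < δ
  m_pos : 0 < m
  L_pos : 0 < L
  a_pos : 0 < a
  σ_nonneg : 0 ≤ σ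
  h_pos : 0 < h
  rate_pos : 0 < gammaRate a m M L σ h

section Past

variable {Ω : Type*} (θ : ℕ → Ω → E d) (ζ : ℕ → Ω → ℝ) (G ε : ℕ → Ω → E d)

lemma past_mono (n : ℕ) : past θ ζ G ε n ≤ past θ ζ G ε (n + 1) :=
  sup_le_sup (sup_le_sup le_rfl (iSup_le fun k => le_iSup_of_le k.castSucc le_rfl))
    (iSup_le fun k => le_iSup_of_le k.castSucc le_rfl)

lemma measurable_G_past (n : ℕ) : Measurable[past θ ζ G ε (n + 1)] (G n) :=
  (comap_measurable (G n)).mono (le_sup_of_le_right (le_iSup_of_le (Fin.last n) le_rfl)) le_rfl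

lemma measurable_ε_past (n : ℕ) : Measurable[past θ ζ G ε (n + 1)] (ε (n + 1)) :=
  (comap_measurable (ε (n + 1))).mono
    (le_sup_of_le_left (le_sup_of_le_right (le_iSup_of_le (Fin.last n) le_rfl))) le_rfl

end Past

lemma measurable_state_update {Ω : Type*} {_ : MeasurableSpace Ω} {z : Ω → ℝ} {g : Ω → E d}
    (r c δ : ℝ) (hz : Measurable z) (hg : Measurable g) :
    Measurable fun ω => r * z ω + c * (‖g ω‖ ^ 2 + δ) := by
  fun_prop

namespace IsControlledRun

variable {Ω : Type*} [MeasurableSpace Ω] {P : Measure Ω} {U : E d → ℝ}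
  {ψ : ℝ → ℝ} {α β δ m M Lψ L a b σ σ₄ h : ℝ} {K : ℕ → ℝ}
  {θ : ℕ → Ω → E d} {ζ : ℕ → Ω → ℝ} {G ε : ℕ → Ω → E d}

lemma M_pos
    (H : IsControlledRun P U ψ α β δ m M Lψ L a b σ σ₄ h K θ ζ G ε) : 0 < M := H.m_pos.trans_le H.step.le

lemma h_lt
    (H : IsControlledRun P U ψ α β δ m M Lψ L a b σ σ₄ h K θ ζ G ε) : h < a * m / (L ^ 2 * M ^ 2) :=
  lt_of_gammaRate_pos H.m_pos H.step.le H.L_pos H.σ_nonneg H.h_pos H.rate_pos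

lemma coeff_pos
    (H : IsControlledRun P U ψ α β δ m M Lψ L a b σ σ₄ h K θ ζ G ε) : 0 < (1 - rho α h) / α :=
  div_pos (sub_pos.2 (rho_lt_one H.α_pos H.h_pos)) H.α_pos

lemma coeff_le
    (H : IsControlledRun P U ψ α β δ m M Lψ L a b σ σ₄ h K θ ζ G ε) : (1 - rho α h) / α ≤ h := by
  rw [div_le_iff₀ H.α_pos, mul_comm]
  exact one_sub_rho_le

lemma ζ_nonneg
    (H : IsControlledRun P U ψ α β δ m M Lψ L a b σ σ₄ h K θ ζ G ε) (n : ℕ) (ω : Ω) : 0 ≤ ζ n ω := by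
  induction n with
  | zero => exact H.run.ζ_zero_nonneg ω
  | succ n ih =>
    rw [H.run.ζ_succ]
    have h1 := H.coeff_pos
    have h2 := H.δ_pos
    have h3 : 0 < rho α h := rho_pos
    positivity

lemma stateFloor_le
    (H : IsControlledRun P U ψ α β δ m M Lψ L a b σ σ₄ h K θ ζ G ε) (n : ℕ) (ω : Ω) : stateFloor α δ h ≤ ζ (n + 1) ω := by
  rw [H.run.ζ_succ, stateFloor]
  have h1 := H.coeff_pos
  have h3 : 0 < rho α h := rho_pos
  have h4 : 0 ≤ rho α h * ζ n ω := mul_nonneg h3.le (H.ζ_nonneg n ω)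
  have h5 : 0 ≤ (1 - rho α h) / α * ‖G n ω‖ ^ 2 := by positivity
  have h6 : (1 - rho α h) * δ / α = (1 - rho α h) / α * δ := by ring
  rw [h6, mul_add]
  linarith

lemma clippedStep_eq
    (H : IsControlledRun P U ψ α β δ m M Lψ L a b σ σ₄ h K θ ζ G ε) (n : ℕ) (ω : Ω) :
    clippedStep ψ (stateFloor α δ h) (ζ (n + 1) ω) = ψ (ζ (n + 1) ω) :=
  clippedStep_of_le (H.stateFloor_le n ω)

lemma past_le (H : IsControlledRun P U ψ α β δ m M Lψ L a b σ σ₄ h K θ ζ G ε) (n : ℕ) :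
    past θ ζ G ε n ≤ ‹MeasurableSpace Ω› :=
  sup_le (sup_le (sup_le (H.run.measurable_θ 0).comap_le (H.run.measurable_ζ 0).comap_le)
    (iSup_le fun _ => (H.run.measurable_ε _).comap_le))
    (iSup_le fun _ => (H.run.measurable_G _).comap_le)

/-- The recursions express the new pair through the old one, `G n` and `ε (n + 1)`, all of which are
known at time `n + 1`. The clipped step size may be used because `ζ` lies above the floor after one
step. -/
lemma measurable_past (H : IsControlledRun P U ψ α β δ m M Lψ L a b σ σ₄ h K θ ζ G ε) (n : ℕ) :
    Measurable[past θ ζ G ε n] (θ n) ∧ Measurable[past θ ζ G ε n] (ζ n) := by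
  induction n with
  | zero =>
    exact ⟨(comap_measurable (θ 0)).mono (le_sup_of_le_left (le_sup_of_le_left le_sup_left)) le_rfl,
      (comap_measurable (ζ 0)).mono (le_sup_of_le_left (le_sup_of_le_left le_sup_right)) le_rfl⟩
  | succ n ih =>
    have hle := past_mono θ ζ G ε n
    have h1 := ih.1.mono hle le_rfl
    have h2 := ih.2.mono hle le_rfl
    have h3 := measurable_G_past θ ζ G ε n
    have h4 := measurable_ε_past θ ζ G ε n
    have h5 : Measurable[past θ ζ G ε (n + 1)] (ζ (n + 1)) := by
      rw [show ζ (n + 1) = _ from funext (H.run.ζ_succ n)]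
      exact measurable_state_update _ _ _ h2 h3
    refine ⟨?_, h5⟩
    have h6 : θ (n + 1) = fun ω => θ n ω - (clippedStep ψ (stateFloor α δ h) (ζ (n + 1) ω) * h) •
        G n ω + Real.sqrt (2 * β⁻¹ * (clippedStep ψ (stateFloor α δ h) (ζ (n + 1) ω) * h)) •
          ε (n + 1) ω := by
      funext ω
      rw [H.clippedStep_eq, H.run.θ_succ]
    have h7 := ((H.step.continuous_clippedStep.measurable.comp h5).mul_const h)
    rw [h6]
    exact (h1.sub (h7.smul h3)).add ((h7.const_mul (2 * β⁻¹)).sqrt.smul h4)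

lemma isNoisyStep (H : IsControlledRun P U ψ α β δ m M Lψ L a b σ σ₄ h K θ ζ G ε) (n : ℕ) :
    IsNoisyStep P β (M * h) (θ n) (θ (n + 1)) (G n) (ε (n + 1))
      (fun ω => clippedStep ψ (stateFloor α δ h) (ζ (n + 1) ω) * h) where
  measurable_θ := H.run.measurable_θ n
  measurable_G := H.run.measurable_G n
  measurable_ε := H.run.measurable_ε _
  measurable_Δ := (H.step.continuous_clippedStep.measurable.comp (H.run.measurable_ζ _)).mul_const h
  -- The new step size involves `G n` and `ζ n` but not the new noise, so the triple is measurable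
  -- for the `σ`-algebra that appears in `noise_indep`.
  indep := by
    refine indep_of_indep_of_le_left (H.run.noise_indep n) (Measurable.comap_le ?_)
    have h1 := (H.measurable_past n).1.mono
      (le_sup_left : _ ≤ past θ ζ G ε n ⊔ MeasurableSpace.comap (G n) inferInstance) le_rfl
    have h2 := (H.measurable_past n).2.mono
      (le_sup_left : _ ≤ past θ ζ G ε n ⊔ MeasurableSpace.comap (G n) inferInstance) le_rfl
    have h3 := (comap_measurable (G n)).mono
      (le_sup_right : _ ≤ past θ ζ G ε n ⊔ MeasurableSpace.comap (G n) inferInstance) le_rfl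
    refine h1.prodMk (((H.step.continuous_clippedStep.measurable.comp ?_).mul_const h).prodMk h3)
    rw [show ζ (n + 1) = _ from funext (H.run.ζ_succ n)]
    exact measurable_state_update _ _ _ h2 h3
  law := H.run.noise_law n
  step ω := by rw [H.clippedStep_eq, H.run.θ_succ]
  Δ_nonneg ω := mul_nonneg (H.m_pos.le.trans (H.step.le_clippedStep _)) H.h_pos.le
  Δ_le ω := mul_le_mul_of_nonneg_right (H.step.clippedStep_le _) H.h_pos.le

end IsControlledRun

end SASGLD
end

/-! ### Moments and unbiasedness of the stochastic gradients. -/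

noncomputable section

namespace SASGLD

variable {d : ℕ}

lemma integral_le_of_condExp_le {Ω : Type*} {m mΩ : MeasurableSpace Ω} {P : Measure Ω}
    [IsFiniteMeasure P] (hm : m ≤ mΩ) {X Y : Ω → ℝ} (hY : Integrable Y P) (h : P[X | m] ≤ᵐ[P] Y) :
    ∫ ω, X ω ∂P ≤ ∫ ω, Y ω ∂P := by
  rw [← integral_condExp hm]
  exact integral_mono_ae integrable_condExp hY h

lemma add_pow_four_le (x y : ℝ) : (x + y) ^ 4 ≤ 8 * (x ^ 4 + y ^ 4) := by
  nlinarith [sq_nonneg (x - y), sq_nonneg (x + y), sq_nonneg (x ^ 2 - y ^ 2), mul_nonneg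
    (sq_nonneg (x - y)) (sq_nonneg (x + y)), mul_nonneg (sq_nonneg (x - y)) (sq_nonneg (x - y)),
    mul_nonneg (sq_nonneg (x - y)) (sq_nonneg x), mul_nonneg (sq_nonneg (x - y)) (sq_nonneg y)]

/-- A bound for the fourth moments of the stochastic gradients. -/
def gradFourth (U : E d → ℝ) (L σ₄ : ℝ) (K : ℕ → ℝ) : ℝ :=
  64 * (‖gradient U 0‖ ^ 4 + L ^ 4 * K 4) + 8 * (σ₄ ^ 2 * (1 + K 4))

namespace IsControlledRun

variable {Ω : Type*} [MeasurableSpace Ω] {P : Measure Ω} [IsProbabilityMeasure P] {U : E d → ℝ}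
  {ψ : ℝ → ℝ} {α β δ m M Lψ L a b σ σ₄ h : ℝ} {K : ℕ → ℝ}
  {θ : ℕ → Ω → E d} {ζ : ℕ → Ω → ℝ} {G ε : ℕ → Ω → E d}

lemma integrable_comp_θ (H : IsControlledRun P U ψ α β δ m M Lψ L a b σ σ₄ h K θ ζ G ε)
    {g : E d → ℝ} (hg : Measurable g) (hp : PolyBounded g) (n : ℕ) :
    Integrable (fun ω => g (θ n ω)) P := by
  obtain ⟨A, N, hA, hle⟩ := hp
  exact (((integrable_const 1).add (H.moments N n).1).const_mul A).mono'
    (hg.comp (H.run.measurable_θ n)).aestronglyMeasurable (ae_of_all _ fun ω => hle _)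

lemma integral_comp_θ_le (H : IsControlledRun P U ψ α β δ m M Lψ L a b σ σ₄ h K θ ζ G ε)
    {g : E d → ℝ} (hg : Measurable g) {A : ℝ} {N : ℕ} (hA : 0 ≤ A)
    (hle : ∀ x, ‖g x‖ ≤ A * (1 + ‖x‖ ^ N)) (n : ℕ) :
    ∫ ω, g (θ n ω) ∂P ≤ A * (1 + K N) := by
  have h1 := (H.moments N n).1
  calc ∫ ω, g (θ n ω) ∂P ≤ ∫ ω, A * (1 + ‖θ n ω‖ ^ N) ∂P :=
        integral_mono (H.integrable_comp_θ hg ⟨A, N, hA, hle⟩ n)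
          (((integrable_const 1).add h1).const_mul A) fun ω => (le_abs_self _).trans (hle _)
    _ = A * (1 + ∫ ω, ‖θ n ω‖ ^ N ∂P) := by
        rw [integral_const_mul, integral_add (integrable_const 1) h1]
        simp
    _ ≤ _ := by gcongr; exact (H.moments N n).2

lemma integral_noise_fourth_le
    (H : IsControlledRun P U ψ α β δ m M Lψ L a b σ σ₄ h K θ ζ G ε) (n : ℕ) :
    ∫ ω, ‖G n ω - gradient U (θ n ω)‖ ^ 4 ∂P ≤ σ₄ ^ 2 * (1 + K 4) := by
  have h1 := (H.moments 4 n).1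
  refine (integral_le_of_condExp_le (H.past_le n) (((integrable_const 1).add h1).const_mul _)
    (H.run.grad_fourth n)).trans ?_
  have h2 : ∫ ω, (1 + ‖θ n ω‖ ^ 4) ∂P = 1 + ∫ ω, ‖θ n ω‖ ^ 4 ∂P := by
    rw [integral_add (integrable_const 1) h1]; simp
  calc _ = σ₄ ^ 2 * (1 + ∫ ω, ‖θ n ω‖ ^ 4 ∂P) := by
        rw [← h2, ← integral_const_mul]; rfl
    _ ≤ _ := by gcongr; exact (H.moments 4 n).2

lemma integrable_G_fourth
    (H : IsControlledRun P U ψ α β δ m M Lψ L a b σ σ₄ h K θ ζ G ε) (n : ℕ) :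
    Integrable (fun ω => ‖G n ω‖ ^ 4) P ∧ ∫ ω, ‖G n ω‖ ^ 4 ∂P ≤ gradFourth U L σ₄ K := by
  have h1 := (H.moments 4 n).1
  have h2 := H.run.grad_fourth_integrable n
  have hb : ∀ ω, ‖G n ω‖ ^ 4 ≤ 64 * (‖gradient U 0‖ ^ 4 + L ^ 4 * ‖θ n ω‖ ^ 4) +
      8 * ‖G n ω - gradient U (θ n ω)‖ ^ 4 := fun ω => by
    have e1 : ‖G n ω‖ ≤ (‖gradient U 0‖ + L * ‖θ n ω‖) + ‖G n ω - gradient U (θ n ω)‖ := by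
      have := norm_add_le (gradient U (θ n ω)) (G n ω - gradient U (θ n ω))
      rw [add_sub_cancel] at this
      linarith [H.potential.norm_gradient_le (θ n ω)]
    calc ‖G n ω‖ ^ 4 ≤ ((‖gradient U 0‖ + L * ‖θ n ω‖) + ‖G n ω - gradient U (θ n ω)‖) ^ 4 := by
          gcongr
      _ ≤ 8 * ((‖gradient U 0‖ + L * ‖θ n ω‖) ^ 4 + ‖G n ω - gradient U (θ n ω)‖ ^ 4) :=
          add_pow_four_le _ _
      _ ≤ 8 * (8 * (‖gradient U 0‖ ^ 4 + (L * ‖θ n ω‖) ^ 4) +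
          ‖G n ω - gradient U (θ n ω)‖ ^ 4) := by
          gcongr
          exact add_pow_four_le _ _
      _ = _ := by ring
  have h3 : Integrable (fun ω => ‖gradient U 0‖ ^ 4 + L ^ 4 * ‖θ n ω‖ ^ 4) P :=
    (integrable_const _).add (h1.const_mul _)
  have hi := (h3.const_mul 64).add (h2.const_mul 8)
  have hG : Integrable (fun ω => ‖G n ω‖ ^ 4) P := by
    refine hi.mono' ((H.run.measurable_G n).norm.pow_const 4).aestronglyMeasurable
      (ae_of_all _ fun ω => ?_)
    rw [Real.norm_of_nonneg (by positivity)]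
    exact hb ω
  refine ⟨hG, (integral_mono hG hi hb).trans ?_⟩
  simp only [Pi.add_apply]
  rw [integral_add (h3.const_mul 64) (h2.const_mul 8), integral_const_mul, integral_const_mul,
    integral_add (integrable_const _) (h1.const_mul _), integral_const_mul, gradFourth]
  simp only [integral_const, probReal_univ, smul_eq_mul, one_mul]
  gcongr
  · exact (H.moments 4 n).2
  · exact H.integral_noise_fourth_le n

/-- A factor known from the past can be pulled out of the conditional expectation, and the remaining
factor has conditional mean zero. -/
lemma integral_mul_noise_eq_zero
    (H : IsControlledRun P U ψ α β δ m M Lψ L a b σ σ₄ h K θ ζ G ε) (n : ℕ)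
    {Y : Ω → E d →L[ℝ] ℝ} (hY : StronglyMeasurable[past θ ζ G ε n] Y)
    (hi : Integrable (fun ω => Y ω (G n ω - gradient U (θ n ω))) P) :
    ∫ ω, Y ω (G n ω - gradient U (θ n ω)) ∂P = 0 := by
  have hle := H.past_le n
  have hgm : StronglyMeasurable[past θ ζ G ε n] fun ω => gradient U (θ n ω) :=
    (H.potential.continuous_gradient.measurable.comp (H.measurable_past n).1).stronglyMeasurable
  have hgi : Integrable (fun ω => gradient U (θ n ω)) P :=
    integrable_condExp.congr (H.run.grad_unbiased n)
  have h1 := condExp_bilin_of_stronglyMeasurable_left (ContinuousLinearMap.id ℝ (E d →L[ℝ] ℝ))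
    hY (g := fun ω => G n ω - gradient U (θ n ω)) hi ((H.run.grad_integrable n).sub hgi)
  have h2 : P[fun ω => G n ω - gradient U (θ n ω) | past θ ζ G ε n] =ᵐ[P] 0 := by
    refine (condExp_sub (H.run.grad_integrable n) hgi _).trans ?_
    filter_upwards [H.run.grad_unbiased n] with ω hω
    rw [condExp_of_stronglyMeasurable hle hgm hgi]
    simp [hω]
  rw [← integral_condExp hle]
  refine integral_eq_zero_of_ae (h1.trans ?_)
  filter_upwards [h2] with ω hω
  simp [hω]

end IsControlledRun

lemma exists_common_polyBounded {φ : E d → ℝ} (hp : ∀ j ≤ 4, PolyBounded (iteratedFDeriv ℝ j φ)) :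
    ∃ (A : ℝ) (N : ℕ), 0 ≤ A ∧ ∀ j ≤ 4, ∀ x, ‖iteratedFDeriv ℝ j φ x‖ ≤ A * (1 + ‖x‖ ^ N) := by
  have h1 : PolyBounded fun x => ∑ j ∈ Finset.range 5, ‖iteratedFDeriv ℝ j φ x‖ := by
    simp only [Finset.sum_range_succ, Finset.sum_range_zero, zero_add]
    exact (((((hp 0 (by norm_num)).norm.add (hp 1 (by norm_num)).norm).add
      (hp 2 (by norm_num)).norm).add (hp 3 (by norm_num)).norm).add (hp 4 (by norm_num)).norm)
  obtain ⟨A, N, hA, hle⟩ := h1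
  refine ⟨A, N, hA, fun j hj x => (le_trans ?_ (le_abs_self _)).trans (hle x)⟩
  exact Finset.single_le_sum (f := fun j => ‖iteratedFDeriv ℝ j φ x‖)
    (fun _ _ => norm_nonneg _) (Finset.mem_range.2 (by omega))

end SASGLD
end

/-! ### The weak error along a run. -/

noncomputable section

namespace SASGLD

variable {d : ℕ}

lemma inner_gradient_eq (φ : E d → ℝ) (x v : E d) : inner ℝ v (gradient φ x) = fderiv ℝ φ x v := by
  rw [real_inner_comm, gradient, InnerProductSpace.toDual_symm_apply]

lemma integral_add_add_add {Ω : Type*} [MeasurableSpace Ω] {P : Measure Ω} {a b c e : Ω → ℝ}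
    (ha : Integrable a P) (hb : Integrable b P) (hc : Integrable c P) (he : Integrable e P) :
    ∫ ω, (a ω + b ω + c ω + e ω) ∂P =
      ∫ ω, a ω ∂P + ∫ ω, b ω ∂P + ∫ ω, c ω ∂P + ∫ ω, e ω ∂P := by
  have h1 : Integrable (fun ω => a ω + b ω) P := ha.add hb
  have h2 : Integrable (fun ω => a ω + b ω + c ω) P := h1.add hc
  rw [integral_add h2 he, integral_add h1 hc, integral_add ha hb]

universe u

set_option maxHeartbeats 1000000 in

/-- The one-step weak error, uniformly over all controlled runs. -/
theorem exists_weak_error_bound (U : E d → ℝ) (ψ : ℝ → ℝ) (α β δ m M Lψ L a b σ σ₄ : ℝ)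
    (K : ℕ → ℝ) {φ : E d → ℝ} (hφ : ContDiff ℝ 4 φ)
    (hp : ∀ j ≤ 4, PolyBounded (iteratedFDeriv ℝ j φ)) (hgc : Continuous (generator U β φ))
    (hgp : PolyBounded (generator U β φ)) :
    ∃ C : ℝ, 0 ≤ C ∧ ∀ (h : ℝ) (Ω : Type u) [MeasurableSpace Ω] (P : Measure Ω)
      [IsProbabilityMeasure P] (θ : ℕ → Ω → E d) (ζ : ℕ → Ω → ℝ) (G ε : ℕ → Ω → E d),
      IsControlledRun P U ψ α β δ m M Lψ L a b σ σ₄ h K θ ζ G ε → ∀ n,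
      |∫ ω, φ (θ (n + 1) ω) ∂P - ∫ ω, φ (θ n ω) ∂P - h * ∫ ω, clippedStep ψ (stateFloor α δ h)
        (ζ (n + 1) ω) * generator U β φ (θ n ω) ∂P| ≤ C * h ^ 2 := by
  obtain ⟨A, N, hA, hle⟩ := exists_common_polyBounded hp
  obtain ⟨A₄, N₄, hA₄, hle₄⟩ := (hp 1 (by norm_num)).norm.pow 4
  set p := 2 * N + 8
  set Kd : ℝ := 4 ^ p * (1 + K p + K p + ∫ x, ‖x‖ ^ p ∂(stdGaussian (E d))) + gradFourth U L σ₄ K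
    with hKd
  -- Under the root stands the upper bound for `h` that follows from the positive rate; this makes
  -- the constant independent of `h`.
  set C₁ : ℝ := A * (1 + (1 + Real.sqrt (2 * β⁻¹ * (M * (a * m / (L ^ 2 * M ^ 2))))) ^ N) *
    (M ^ 2 + 2 * β⁻¹ * M * M + (2 * β⁻¹ * M) ^ 2) * 2 * Kd with hC₁
  set C₂ : ℝ := Lψ * (gradFourth U L σ₄ K + δ ^ 2 + A₄ * (1 + K N₄) + σ₄ ^ 2 * (1 + K 4)) with hC₂
  refine ⟨|C₁| + |C₂|, by positivity, ?_⟩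
  intro h Ω _ P _ θ ζ G ε H n
  have hMp := H.M_pos
  have hhp := H.h_pos
  have hβ := H.β_pos
  set ψ' := clippedStep ψ (stateFloor α δ h) with hψ'
  have hs := H.isNoisyStep n
  obtain ⟨hG4, hG4'⟩ := H.integrable_G_fourth n
  obtain ⟨hd1, hd2⟩ := hs.integrable_stepDom (N := N) (H.moments p n).1 (H.moments p n).2
    (H.moments p (n + 1)).1 (H.moments p (n + 1)).2 hG4 hG4'
  have hW := hs.abs_weak_error_le hβ hMp.le hhp.le H.h_lt.le hφ hA hle hd1 hd2
  have mθ := H.run.measurable_θ n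
  have mG := H.run.measurable_G n
  have mζ := H.run.measurable_ζ n
  have mζ' := H.run.measurable_ζ (n + 1)
  have mψ : Measurable ψ' := H.step.continuous_clippedStep.measurable
  have cU := H.potential.continuous_gradient
  have cφ : Continuous (fderiv ℝ φ) := hφ.continuous_fderiv (by norm_num)
  have cc : Continuous fun q : E d × E d => fderiv ℝ φ q.1 q.2 :=
    (cφ.comp continuous_fst).clm_apply continuous_snd
  have hψabs : ∀ x, |ψ' x| ≤ M := fun x => by
    rw [abs_of_nonneg (H.m_pos.le.trans (H.step.le_clippedStep x))]
    exact H.step.clippedStep_le x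
  set ξ : Ω → E d := fun ω => G n ω - gradient U (θ n ω) with hξ
  have mξ : Measurable ξ := mG.sub (cU.measurable.comp mθ)
  have hξ4 := H.run.grad_fourth_integrable n
  have hξ4' := H.integral_noise_fourth_le n
  have hD4 : Integrable (fun ω => ‖iteratedFDeriv ℝ 1 φ (θ n ω)‖ ^ 4) P :=
    H.integrable_comp_θ (g := fun x => ‖iteratedFDeriv ℝ 1 φ x‖ ^ 4)
      ((hφ.continuous_iteratedFDeriv (m := 1) (by norm_num)).norm.pow 4).measurable
      ⟨A₄, N₄, hA₄, hle₄⟩ n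
  have hD4' : ∫ ω, ‖iteratedFDeriv ℝ 1 φ (θ n ω)‖ ^ 4 ∂P ≤ A₄ * (1 + K N₄) :=
    H.integral_comp_θ_le (g := fun x => ‖iteratedFDeriv ℝ 1 φ x‖ ^ 4)
      ((hφ.continuous_iteratedFDeriv (m := 1) (by norm_num)).norm.pow 4).measurable
      hA₄ hle₄ n
  have hprod : ∀ ω, |fderiv ℝ φ (θ n ω) (ξ ω)| ≤
      ‖iteratedFDeriv ℝ 1 φ (θ n ω)‖ * ‖ξ ω‖ := fun ω => by
    rw [norm_iteratedFDeriv_one]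
    exact (fderiv ℝ φ (θ n ω)).le_opNorm _
  have hYi : ∀ Y : Ω → ℝ, Measurable Y → (∀ ω, |Y ω| ≤ M) →
      Integrable (fun ω => Y ω * fderiv ℝ φ (θ n ω) (ξ ω)) P := by
    intro Y mY hY
    refine ((((integrable_const (2 : ℝ)).add hD4).add hξ4).const_mul M).mono'
      (mY.mul (cc.measurable.comp (mθ.prodMk mξ))).aestronglyMeasurable (ae_of_all _ fun ω => ?_)
    rw [Real.norm_eq_abs, abs_mul]
    refine mul_le_mul (hY ω) ((hprod ω).trans ?_) (abs_nonneg _) hMp.le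
    simp only [Pi.add_apply]
    change _ ≤ 2 + _ + ‖ξ ω‖ ^ 4
    set s := ‖iteratedFDeriv ℝ 1 φ (θ n ω)‖
    set t := ‖ξ ω‖
    nlinarith [sq_nonneg (s - t), sq_nonneg (s ^ 2 - 1), sq_nonneg (t ^ 2 - 1)]
  -- The step size without the contribution of the new gradient. It is measurable for the past, so
  -- the gradient noise integrates to zero against it.
  set Y₀ : Ω → ℝ := fun ω => ψ' (rho α h * ζ n ω) with hY₀
  have i1 := hYi (fun ω => ψ' (ζ (n + 1) ω)) (mψ.comp mζ') fun ω => hψabs _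
  have i0 := hYi Y₀ (mψ.comp (mζ.const_mul _)) fun ω => hψabs _
  have hzero : ∫ ω, Y₀ ω * fderiv ℝ φ (θ n ω) (ξ ω) ∂P = 0 := by
    have hY : StronglyMeasurable[past θ ζ G ε n] fun ω => Y₀ ω • fderiv ℝ φ (θ n ω) := by
      have e1 : Measurable[past θ ζ G ε n] Y₀ := mψ.comp ((H.measurable_past n).2.const_mul _)
      have e2 : Measurable[past θ ζ G ε n] fun ω => fderiv ℝ φ (θ n ω) :=
        cφ.measurable.comp (H.measurable_past n).1
      exact e1.stronglyMeasurable.smul e2.stronglyMeasurable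
    have := H.integral_mul_noise_eq_zero n hY (by simpa only [smul_apply, smul_eq_mul] using i0)
    simpa only [smul_apply, smul_eq_mul] using this
  -- The new gradient enters `ζ` with weight `(1 - ρ) / α ≤ h`. The correlation between step size
  -- and gradient noise is therefore of order `h`, and of order `h ^ 2` after multiplication with
  -- the step parameter.
  have hζd : ∀ ω, |ψ' (ζ (n + 1) ω) - Y₀ ω| ≤ Lψ * (h * (‖G n ω‖ ^ 2 + δ)) := fun ω => by
    refine (H.step.abs_clippedStep_sub_le _ _).trans ?_
    refine mul_le_mul_of_nonneg_left ?_ H.step.lipschitz_nonneg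
    have hδ := H.δ_pos
    rw [H.run.ζ_succ, add_sub_cancel_left, abs_of_nonneg (mul_nonneg H.coeff_pos.le (by positivity))]
    exact mul_le_mul_of_nonneg_right H.coeff_le (by positivity)
  have hnoise : |∫ ω, ψ' (ζ (n + 1) ω) * fderiv ℝ φ (θ n ω) (ξ ω) ∂P| ≤ C₂ * h := by
    have e1 : ∫ ω, ψ' (ζ (n + 1) ω) * fderiv ℝ φ (θ n ω) (ξ ω) ∂P =
        ∫ ω, (ψ' (ζ (n + 1) ω) - Y₀ ω) * fderiv ℝ φ (θ n ω) (ξ ω) ∂P := by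
      simp_rw [sub_mul]
      rw [integral_sub i1 i0, hzero, sub_zero]
    rw [e1]
    have hI : Integrable (fun ω => ‖G n ω‖ ^ 4 + δ ^ 2 + ‖iteratedFDeriv ℝ 1 φ (θ n ω)‖ ^ 4 +
        ‖ξ ω‖ ^ 4) P := ((hG4.add (integrable_const _)).add hD4).add hξ4
    have hLψ := H.step.lipschitz_nonneg
    calc _ ≤ ∫ ω, Lψ * h * (‖G n ω‖ ^ 4 + δ ^ 2 + ‖iteratedFDeriv ℝ 1 φ (θ n ω)‖ ^ 4 +
          ‖ξ ω‖ ^ 4) ∂P := by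
          refine abs_integral_le_integral_abs.trans
            (integral_mono_of_nonneg (ae_of_all _ fun _ => abs_nonneg _) (hI.const_mul _)
              (ae_of_all _ fun ω => ?_))
          simp only [abs_mul]
          have e2 := hprod ω
          have hδ := H.δ_pos
          calc _ ≤ (Lψ * (h * (‖G n ω‖ ^ 2 + δ))) *
                (‖iteratedFDeriv ℝ 1 φ (θ n ω)‖ * ‖ξ ω‖) :=
                mul_le_mul (hζd ω) e2 (abs_nonneg _) (by positivity)
            _ = Lψ * h * ((‖G n ω‖ ^ 2 + δ) * (‖iteratedFDeriv ℝ 1 φ (θ n ω)‖ * ‖ξ ω‖)) := by ring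
            _ ≤ _ := by
                refine mul_le_mul_of_nonneg_left ?_ (by positivity)
                set s := ‖iteratedFDeriv ℝ 1 φ (θ n ω)‖
                set t := ‖ξ ω‖
                set r := ‖G n ω‖
                nlinarith [sq_nonneg (r ^ 2 + δ - s * t), sq_nonneg (r ^ 2 - δ),
                  sq_nonneg (s ^ 2 - t ^ 2), sq_nonneg (s ^ 2), sq_nonneg (t ^ 2)]
      _ = Lψ * h * (∫ ω, ‖G n ω‖ ^ 4 ∂P + δ ^ 2 + ∫ ω, ‖iteratedFDeriv ℝ 1 φ (θ n ω)‖ ^ 4 ∂P +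
          ∫ ω, ‖ξ ω‖ ^ 4 ∂P) := by
          rw [integral_const_mul, integral_add_add_add hG4 (integrable_const _) hD4 hξ4]
          simp only [integral_const, probReal_univ, smul_eq_mul, one_mul]
          rfl
      _ ≤ Lψ * h * (gradFourth U L σ₄ K + δ ^ 2 + A₄ * (1 + K N₄) + σ₄ ^ 2 * (1 + K 4)) := by
          gcongr
      _ = C₂ * h := by rw [hC₂]; ring
  have iF : Integrable (fun ω => ψ' (ζ (n + 1) ω) * generator U β φ (θ n ω)) P :=
    (H.integrable_comp_θ hgc.measurable hgp n).bdd_mul (c := M)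
      (mψ.comp mζ').aestronglyMeasurable (ae_of_all _ fun ω => hψabs _)
  have hgen : ∫ ω, (β⁻¹ * (ψ' (ζ (n + 1) ω) * h) * Laplacian.laplacian φ (θ n ω) -
      ψ' (ζ (n + 1) ω) * h * fderiv ℝ φ (θ n ω) (G n ω)) ∂P =
      h * ∫ ω, ψ' (ζ (n + 1) ω) * generator U β φ (θ n ω) ∂P -
      h * ∫ ω, ψ' (ζ (n + 1) ω) * fderiv ℝ φ (θ n ω) (ξ ω) ∂P := by
    rw [← mul_sub, ← integral_sub iF i1, ← integral_const_mul]
    refine integral_congr_ae (ae_of_all _ fun ω => ?_)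
    simp only [generator, inner_gradient_eq, hξ, map_sub]
    ring
  rw [hgen] at hW
  have e3 : |h * ∫ ω, ψ' (ζ (n + 1) ω) * fderiv ℝ φ (θ n ω) (ξ ω) ∂P| ≤ h * (C₂ * h) := by
    rw [abs_mul, abs_of_pos hhp]
    gcongr
  have e4 : C₁ * h ^ 2 ≤ |C₁| * h ^ 2 := by gcongr; exact le_abs_self _
  have e5 : C₂ * h ^ 2 ≤ |C₂| * h ^ 2 := by gcongr; exact le_abs_self _
  have e6 : h * (C₂ * h) = C₂ * h ^ 2 := by ring
  rw [e6] at e3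
  have e7 := hW.trans (le_of_eq (show _ = C₁ * h ^ 2 from rfl))
  generalize C₁ = c₁ at e4 e7 ⊢
  generalize C₂ = c₂ at e3 e5 ⊢
  rw [abs_le] at e7 e3 ⊢
  constructor <;> linarith [e7.1, e7.2, e3.1, e3.2]

end SASGLD
end

/-! ### The stationary bias. -/

noncomputable section

namespace SASGLD

variable {d : ℕ}

section Limit

variable {Ω : Type*} [MeasurableSpace Ω] {P : Measure Ω} [IsProbabilityMeasure P] {U : E d → ℝ}
  {ψ : ℝ → ℝ} {α β δ m M Lψ L a b σ σ₄ h : ℝ} {K : ℕ → ℝ}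
  {θ : ℕ → Ω → E d} {ζ : ℕ → Ω → ℝ} {G ε : ℕ → Ω → E d}
  {ν : Measure (E d × ℝ)} [IsProbabilityMeasure ν]

/-- The squares have uniformly bounded means by the moment bounds for `θ`, so setwise convergence
extends to these unbounded functions. The state `ζ`, whose initial value is merely integrable, must
enter in a bounded way. -/
lemma IsControlledRun.tendsto_integral
    (H : IsControlledRun P U ψ α β δ m M Lψ L a b σ σ₄ h K θ ζ G ε)
    (hS : SetwiseTendsto (fun n => P.map fun ω => (θ n ω, ζ n ω)) ν) {u : E d × ℝ → ℝ}
    (hu : Measurable u) {g : E d → ℝ} (hgm : Measurable g) (hg : PolyBounded g)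
    (hle : ∀ x, |u x| ≤ |g x.1|) :
    Integrable u ν ∧ Tendsto (fun n => ∫ ω, u (θ n ω, ζ n ω) ∂P) atTop (𝓝 (∫ x, u x ∂ν)) := by
  have hX : ∀ n, Measurable fun ω => (θ n ω, ζ n ω) := fun n =>
    (H.run.measurable_θ n).prodMk (H.run.measurable_ζ n)
  have hpr : ∀ n, IsProbabilityMeasure (P.map fun ω => (θ n ω, ζ n ω)) := fun n =>
    Measure.isProbabilityMeasure_map (hX n).aemeasurable
  have hu2 : Measurable fun x => u x ^ 2 := hu.pow_const 2
  have hgi : ∀ n, Integrable (fun ω => g (θ n ω) ^ 2) P := fun n =>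
    H.integrable_comp_θ (hgm.pow_const 2) (hg.pow 2) n
  have hui : ∀ n, Integrable (fun ω => u (θ n ω, ζ n ω) ^ 2) P := fun n => by
    refine (hgi n).mono' (hu2.comp (hX n)).aestronglyMeasurable (ae_of_all _ fun ω => ?_)
    rw [Real.norm_of_nonneg (sq_nonneg _)]
    exact sq_le_sq.2 (hle _)
  obtain ⟨A, N, hA, hAle⟩ := hg.pow 2
  have h1 : ∀ n, Integrable (fun x => u x ^ 2) (P.map fun ω => (θ n ω, ζ n ω)) := fun n =>
    (integrable_map_measure hu2.aestronglyMeasurable (hX n).aemeasurable).2 (hui n)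
  have h2 : ∀ n, ∫ x, u x ^ 2 ∂(P.map fun ω => (θ n ω, ζ n ω)) ≤ A * (1 + K N) := fun n => by
    rw [integral_map (hX n).aemeasurable hu2.aestronglyMeasurable]
    refine (integral_mono (hui n) (hgi n) fun ω => sq_le_sq.2 (hle _)).trans ?_
    exact H.integral_comp_θ_le (hgm.pow_const 2) hA hAle n
  refine ⟨integrable_of_sq hu.aestronglyMeasurable
    (hS.integrable_of_nonneg hu2 (fun x => sq_nonneg _) h1 h2).1, ?_⟩
  have h3 := hS.tendsto_integral_of_sq_bounded hu h1 h2
  refine h3.congr fun n => ?_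
  rw [integral_map (hX n).aemeasurable hu.aestronglyMeasurable]

end Limit

/-- The targets `(‖G_n‖² + δ) / α` of the averages `ζ_n`. -/
def gradTarget {Ω : Type*} (α δ : ℝ) (G : ℕ → Ω → E d) (n : ℕ) (ω : Ω) : ℝ :=
  (‖G n ω‖ ^ 2 + δ) / α

/-- The part of `ζ_n` that does not come from the initial value. -/
def drivenState {Ω : Type*} (α h : ℝ) (ζ : ℕ → Ω → ℝ) (n : ℕ) (ω : Ω) : ℝ :=
  ζ n ω - rho α h ^ n * ζ 0 ω

/-- A bound for the second moments of the targets of `ζ_n`. -/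
def targetSq (U : E d → ℝ) (α δ L σ₄ : ℝ) (K : ℕ → ℝ) : ℝ :=
  2 * (gradFourth U L σ₄ K + δ ^ 2) / α ^ 2

namespace IsControlledRun

variable {Ω : Type*} [MeasurableSpace Ω] {P : Measure Ω} {U : E d → ℝ}
  {ψ : ℝ → ℝ} {α β δ m M Lψ L a b σ σ₄ h : ℝ} {K : ℕ → ℝ}
  {θ : ℕ → Ω → E d} {ζ : ℕ → Ω → ℝ} {G ε : ℕ → Ω → E d}

lemma measurable_gradTarget (H : IsControlledRun P U ψ α β δ m M Lψ L a b σ σ₄ h K θ ζ G ε)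
    (n : ℕ) : Measurable (gradTarget α δ G n) :=
  (((H.run.measurable_G n).norm.pow_const 2).add_const δ).div_const α

lemma measurable_drivenState (H : IsControlledRun P U ψ α β δ m M Lψ L a b σ σ₄ h K θ ζ G ε)
    (n : ℕ) : Measurable (drivenState α h ζ n) :=
  (H.run.measurable_ζ n).sub ((H.run.measurable_ζ 0).const_mul _)

lemma gradTarget_nonneg (H : IsControlledRun P U ψ α β δ m M Lψ L a b σ σ₄ h K θ ζ G ε)
    (n : ℕ) (ω : Ω) : 0 ≤ gradTarget α δ G n ω := by
  have := H.δ_pos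
  have := H.α_pos
  unfold gradTarget
  positivity

lemma drivenState_succ (H : IsControlledRun P U ψ α β δ m M Lψ L a b σ σ₄ h K θ ζ G ε)
    (n : ℕ) (ω : Ω) : drivenState α h ζ (n + 1) ω =
      rho α h * drivenState α h ζ n ω + (1 - rho α h) * gradTarget α δ G n ω := by
  rw [drivenState, H.run.ζ_succ, drivenState, gradTarget]
  ring

lemma drivenState_nonneg (H : IsControlledRun P U ψ α β δ m M Lψ L a b σ σ₄ h K θ ζ G ε)
    (n : ℕ) (ω : Ω) : 0 ≤ drivenState α h ζ n ω := by
  induction n with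
  | zero => simp [drivenState]
  | succ n ih =>
    rw [H.drivenState_succ]
    have h1 : 0 < rho α h := rho_pos
    have h2 := rho_lt_one H.α_pos H.h_pos
    exact add_nonneg (mul_nonneg h1.le ih)
      (mul_nonneg (by linarith) (H.gradTarget_nonneg n ω))

variable [IsProbabilityMeasure P]

lemma integrable_gradTarget_sq (H : IsControlledRun P U ψ α β δ m M Lψ L a b σ σ₄ h K θ ζ G ε)
    (n : ℕ) : Integrable (fun ω => gradTarget α δ G n ω ^ 2) P ∧
      ∫ ω, gradTarget α δ G n ω ^ 2 ∂P ≤ targetSq U α δ L σ₄ K := by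
  obtain ⟨h1, h2⟩ := H.integrable_G_fourth n
  have hα := H.α_pos
  have hle : ∀ ω, gradTarget α δ G n ω ^ 2 ≤ 2 / α ^ 2 * (‖G n ω‖ ^ 4 + δ ^ 2) := fun ω => by
    rw [gradTarget, div_pow, div_mul_eq_mul_div]
    gcongr
    nlinarith [sq_nonneg (‖G n ω‖ ^ 2 - δ)]
  have h3 : Integrable (fun ω => ‖G n ω‖ ^ 4 + δ ^ 2) P := h1.add (integrable_const _)
  have h4 : Integrable (fun ω => gradTarget α δ G n ω ^ 2) P := by
    refine (h3.const_mul (2 / α ^ 2)).mono'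
      ((H.measurable_gradTarget n).pow_const 2).aestronglyMeasurable (ae_of_all _ fun ω => ?_)
    rw [Real.norm_of_nonneg (sq_nonneg _)]
    exact hle ω
  refine ⟨h4, (integral_mono h4 (h3.const_mul _) hle).trans ?_⟩
  rw [integral_const_mul, integral_add h1 (integrable_const _), targetSq]
  simp only [integral_const, probReal_univ, smul_eq_mul, one_mul]
  rw [div_mul_eq_mul_div]
  gcongr

/-- Each driven state is a convex combination of the previous one and a target, so convexity of the
square propagates the bound, uniformly in `h`. The initial part is split off because `ζ 0` is only
assumed to be integrable. -/
lemma integrable_drivenState_sq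
    (H : IsControlledRun P U ψ α β δ m M Lψ L a b σ σ₄ h K θ ζ G ε) (n : ℕ) :
    Integrable (fun ω => drivenState α h ζ n ω ^ 2) P ∧
      ∫ ω, drivenState α h ζ n ω ^ 2 ∂P ≤ targetSq U α δ L σ₄ K := by
  induction n with
  | zero =>
    simp only [drivenState, pow_zero, one_mul, sub_self, ne_eq, OfNat.ofNat_ne_zero,
      not_false_eq_true, zero_pow, integral_zero]
    exact ⟨integrable_zero _ _ _,
      (integral_nonneg fun ω => sq_nonneg _).trans (H.integrable_gradTarget_sq 0).2⟩
  | succ n ih =>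
    obtain ⟨h1, h2⟩ := H.integrable_gradTarget_sq n
    have r0 : 0 < rho α h := rho_pos
    have r1 := rho_lt_one H.α_pos H.h_pos
    have hle : ∀ ω, drivenState α h ζ (n + 1) ω ^ 2 ≤ rho α h * drivenState α h ζ n ω ^ 2 +
        (1 - rho α h) * gradTarget α δ G n ω ^ 2 := fun ω => by
      rw [H.drivenState_succ]
      nlinarith [mul_nonneg (mul_nonneg r0.le (sub_pos.2 r1).le)
        (sq_nonneg (drivenState α h ζ n ω - gradTarget α δ G n ω))]
    have h3 : Integrable (fun ω => rho α h * drivenState α h ζ n ω ^ 2 +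
        (1 - rho α h) * gradTarget α δ G n ω ^ 2) P := (ih.1.const_mul _).add (h1.const_mul _)
    have h4 : Integrable (fun ω => drivenState α h ζ (n + 1) ω ^ 2) P := by
      refine h3.mono'
        ((H.measurable_drivenState (n + 1)).pow_const 2).aestronglyMeasurable
        (ae_of_all _ fun ω => ?_)
      rw [Real.norm_of_nonneg (sq_nonneg _)]
      exact hle ω
    refine ⟨h4, (integral_mono h4 h3 hle).trans ?_⟩
    rw [integral_add (ih.1.const_mul _) (h1.const_mul _), integral_const_mul, integral_const_mul]
    nlinarith [mul_le_mul_of_nonneg_left ih.2 r0.le,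
      mul_le_mul_of_nonneg_left h2 (sub_pos.2 r1).le]

/-- Replacing the new step size by the old one costs `O(h)`, up to a transient. -/
lemma abs_integral_step_increment_le
    (H : IsControlledRun P U ψ α β δ m M Lψ L a b σ σ₄ h K θ ζ G ε) {F : E d → ℝ}
    (hFm : Measurable F) {A : ℝ} {N : ℕ} (hA : 0 ≤ A) (hF : ∀ x, ‖F x ^ 2‖ ≤ A * (1 + ‖x‖ ^ N))
    (n : ℕ) :
    ∫ ω, |(clippedStep ψ (stateFloor α δ h) (ζ (n + 1) ω) -
      clippedStep ψ (stateFloor α δ h) (ζ n ω)) * F (θ n ω)| ∂P ≤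
      Lψ * α * (targetSq U α δ L σ₄ K + A * (1 + K N)) * h +
        Real.sqrt (rho α h) ^ n * (A * (1 + K N) + 2 * M * Lψ * ∫ ω, ζ 0 ω ∂P) := by
  set ψ' := clippedStep ψ (stateFloor α δ h) with hψ'
  set W := drivenState α h ζ n with hW
  set y := gradTarget α δ G n with hy
  set ρ := rho α h with hρ
  set r := Real.sqrt ρ with hr
  have r0 : 0 < ρ := rho_pos
  have r1 : ρ < 1 := rho_lt_one H.α_pos H.h_pos
  have hr0 : 0 < r := Real.sqrt_pos.2 r0
  have hα := H.α_pos
  have hhp := H.h_pos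
  have hM := H.M_pos
  have hLψ := H.step.lipschitz_nonneg
  have hαh : 1 - ρ ≤ α * h := one_sub_rho_le
  obtain ⟨iW, iW'⟩ := H.integrable_drivenState_sq n
  obtain ⟨iy, iy'⟩ := H.integrable_gradTarget_sq n
  have iF : Integrable (fun ω => F (θ n ω) ^ 2) P :=
    H.integrable_comp_θ (hFm.pow_const 2) ⟨A, N, hA, hF⟩ n
  have iF' : ∫ ω, F (θ n ω) ^ 2 ∂P ≤ A * (1 + K N) :=
    H.integral_comp_θ_le (hFm.pow_const 2) hA hF n
  have iz := H.run.ζ_zero_integrable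
  have hbd : ∀ ω, |(ψ' (ζ (n + 1) ω) - ψ' (ζ n ω)) * F (θ n ω)| ≤
      Lψ * (α * h) * (2⁻¹ * y ω ^ 2 + 2⁻¹ * W ω ^ 2 + F (θ n ω) ^ 2) +
        r ^ n * (F (θ n ω) ^ 2 + 2 * M * Lψ * ζ 0 ω) := by
    intro ω
    -- An intermediate state that omits the relaxation of the initial value. Moving from `ζ n` to
    -- `z` costs `O(h)`, and moving from `z` to `ζ (n + 1)` is the transient.
    set z := ζ n ω + (1 - ρ) * (y ω - W ω) with hz
    have hW0 : 0 ≤ W ω := H.drivenState_nonneg n ω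
    have hy0 : 0 ≤ y ω := H.gradTarget_nonneg n ω
    have hζ0 := H.run.ζ_zero_nonneg ω
    have e1 : |ψ' z - ψ' (ζ n ω)| ≤ Lψ * (α * h) * (y ω + W ω) := by
      refine (H.step.abs_clippedStep_sub_le _ _).trans ?_
      rw [hz, add_sub_cancel_left, abs_mul, abs_of_pos (sub_pos.2 r1), mul_assoc]
      have : |y ω - W ω| ≤ y ω + W ω := abs_le.2 ⟨by linarith, by linarith⟩
      gcongr
    have e2 : |ψ' (ζ (n + 1) ω) - ψ' z| ≤ Lψ * (ρ ^ n * ζ 0 ω) := by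
      refine (H.step.abs_clippedStep_sub_le _ _).trans ?_
      have e3 : ζ (n + 1) ω - z = -((1 - ρ) * (ρ ^ n * ζ 0 ω)) := by
        rw [hz, H.run.ζ_succ, hW, hy, drivenState, gradTarget]
        ring
      have e4 : 0 ≤ ρ ^ n * ζ 0 ω := by positivity
      rw [e3, abs_neg, abs_mul, abs_of_pos (sub_pos.2 r1), abs_of_nonneg e4]
      have : (1 - ρ) * (ρ ^ n * ζ 0 ω) ≤ ρ ^ n * ζ 0 ω := by nlinarith
      gcongr
    have e5 : |ψ' (ζ (n + 1) ω) - ψ' z| ≤ 2 * M := by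
      have a1 := H.step.le_clippedStep (ζ (n + 1) ω)
      have a2 := H.step.clippedStep_le (ζ (n + 1) ω)
      have a3 := H.step.le_clippedStep z
      have a4 := H.step.clippedStep_le z
      have := H.m_pos
      exact abs_le.2 ⟨by linarith, by linarith⟩
    set q := |ψ' (ζ (n + 1) ω) - ψ' z| with hq
    have hq0 : 0 ≤ q := abs_nonneg _
    -- Since `ζ 0` need not have a second moment, the Lipschitz bound is multiplied with the trivial
    -- bound `2 M`. The product is linear in `ζ 0` and bounds `q ^ 2`; Young's inequality with
    -- weight `r ^ n`, where `r ^ 2 = ρ`, then leaves a geometric factor.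
    have e6 : q * |F (θ n ω)| ≤ r ^ n * (F (θ n ω) ^ 2 + 2 * M * Lψ * ζ 0 ω) := by
      have hrn : 0 < r ^ n := by positivity
      have b1 : q ^ 2 ≤ (2 * M) * (Lψ * (ρ ^ n * ζ 0 ω)) := by
        rw [sq]; exact mul_le_mul e5 e2 hq0 (by positivity)
      have b2 : ρ ^ n = r ^ n * r ^ n := by rw [← mul_pow, Real.mul_self_sqrt r0.le]
      rw [b2] at b1
      have b3 := sq_abs (F (θ n ω))
      have b4 : 0 ≤ |F (θ n ω)| := abs_nonneg _
      have b5 : 0 ≤ 2 * M * Lψ * ζ 0 ω := by positivity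
      have b6 : q * |F (θ n ω)| * r ^ n ≤
          r ^ n * (F (θ n ω) ^ 2 + 2 * M * Lψ * ζ 0 ω) * r ^ n := by
        rw [← b3]
        nlinarith [sq_nonneg (q - r ^ n * |F (θ n ω)|), mul_nonneg (mul_nonneg hrn.le hrn.le) b5,
          mul_nonneg (mul_nonneg hrn.le hrn.le) (sq_nonneg |F (θ n ω)|)]
      exact le_of_mul_le_mul_right b6 hrn
    have e7 : |ψ' z - ψ' (ζ n ω)| * |F (θ n ω)| ≤
        Lψ * (α * h) * (2⁻¹ * y ω ^ 2 + 2⁻¹ * W ω ^ 2 + F (θ n ω) ^ 2) := by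
      refine (mul_le_mul_of_nonneg_right e1 (abs_nonneg _)).trans ?_
      rw [mul_assoc]
      refine mul_le_mul_of_nonneg_left ?_ (by positivity)
      rw [← sq_abs (F (θ n ω))]
      nlinarith [sq_nonneg (y ω - |F (θ n ω)|), sq_nonneg (W ω - |F (θ n ω)|)]
    calc |(ψ' (ζ (n + 1) ω) - ψ' (ζ n ω)) * F (θ n ω)|
        = |ψ' (ζ (n + 1) ω) - ψ' z + (ψ' z - ψ' (ζ n ω))| * |F (θ n ω)| := by
          rw [abs_mul]; congr 2; ring
      _ ≤ (q + |ψ' z - ψ' (ζ n ω)|) * |F (θ n ω)| := by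
          gcongr; exact abs_add_le _ _
      _ ≤ _ := by rw [add_mul]; linarith
  have i1 : Integrable (fun ω => 2⁻¹ * y ω ^ 2 + 2⁻¹ * W ω ^ 2) P :=
    (iy.const_mul _).add (iW.const_mul _)
  have i2 : Integrable (fun ω => 2⁻¹ * y ω ^ 2 + 2⁻¹ * W ω ^ 2 + F (θ n ω) ^ 2) P := i1.add iF
  have i3 : Integrable (fun ω => F (θ n ω) ^ 2 + 2 * M * Lψ * ζ 0 ω) P :=
    iF.add (iz.const_mul _)
  refine (integral_mono_of_nonneg (ae_of_all _ fun _ => abs_nonneg _)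
    ((i2.const_mul (Lψ * (α * h))).add (i3.const_mul (r ^ n))) (ae_of_all _ hbd)).trans ?_
  simp only [Pi.add_apply]
  rw [integral_add (i2.const_mul _) (i3.const_mul _), integral_const_mul, integral_const_mul,
    integral_add i1 iF, integral_add (iy.const_mul _) (iW.const_mul _), integral_const_mul,
    integral_const_mul, integral_add iF (iz.const_mul _), integral_const_mul]
  have c1 : 2⁻¹ * ∫ ω, y ω ^ 2 ∂P + 2⁻¹ * ∫ ω, W ω ^ 2 ∂P + ∫ ω, F (θ n ω) ^ 2 ∂P ≤
      targetSq U α δ L σ₄ K + A * (1 + K N) := by linarith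
  calc _ ≤ Lψ * (α * h) * (targetSq U α δ L σ₄ K + A * (1 + K N)) +
        r ^ n * (A * (1 + K N) + 2 * M * Lψ * ∫ ω, ζ 0 ω ∂P) := by
        gcongr
    _ = _ := by ring

end IsControlledRun

universe u

/-- The stationary bias is of first order in the step parameter, uniformly over all controlled
runs. -/
theorem exists_bias_bound (U : E d → ℝ) (ψ : ℝ → ℝ) (α β δ m M Lψ L a b σ σ₄ : ℝ)
    (K : ℕ → ℝ) {φ : E d → ℝ} (hφ : ContDiff ℝ 4 φ)
    (hp : ∀ j ≤ 4, PolyBounded (iteratedFDeriv ℝ j φ)) (hgc : Continuous (generator U β φ))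
    (hgp : PolyBounded (generator U β φ)) :
    ∃ C : ℝ, 0 ≤ C ∧ ∀ (h : ℝ) (Ω : Type u) [MeasurableSpace Ω] (P : Measure Ω)
      [IsProbabilityMeasure P] (θ : ℕ → Ω → E d) (ζ : ℕ → Ω → ℝ) (G ε : ℕ → Ω → E d)
      (ν : Measure (E d × ℝ)) [IsProbabilityMeasure ν],
      IsControlledRun P U ψ α β δ m M Lψ L a b σ σ₄ h K θ ζ G ε →
      SetwiseTendsto (fun n => P.map fun ω => (θ n ω, ζ n ω)) ν →
      |∫ x, clippedStep ψ (stateFloor α δ h) x.2 * generator U β φ x.1 ∂ν| ≤ C * h := by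
  obtain ⟨C₁, hC₁, hW⟩ := exists_weak_error_bound.{u} U ψ α β δ m M Lψ L a b σ σ₄ K hφ hp hgc hgp
  obtain ⟨A, N, hA, hle⟩ := hgp.pow 2
  refine ⟨C₁ + |Lψ * α * (targetSq U α δ L σ₄ K + A * (1 + K N))|, by positivity, ?_⟩
  intro h Ω _ P _ θ ζ G ε ν _ H hS
  set ψ' := clippedStep ψ (stateFloor α δ h) with hψ'
  set F := generator U β φ with hF
  set C₂ := Lψ * α * (targetSq U α δ L σ₄ K + A * (1 + K N)) with hC₂
  set T := A * (1 + K N) + 2 * M * Lψ * ∫ ω, ζ 0 ω ∂P with hT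
  set r := Real.sqrt (rho α h) with hr
  have hhp := H.h_pos
  have mψ : Measurable ψ' := H.step.continuous_clippedStep.measurable
  have hψabs : ∀ x, |ψ' x| ≤ M := fun x => by
    rw [abs_of_nonneg (H.m_pos.le.trans (H.step.le_clippedStep x))]
    exact H.step.clippedStep_le x
  have hr0 : 0 ≤ r := Real.sqrt_nonneg _
  have hr1 : r < 1 := by
    rw [hr, Real.sqrt_lt' one_pos, one_pow]
    exact rho_lt_one H.α_pos hhp
  have hφp : PolyBounded φ := (hp 0 (by norm_num)).norm.of_le fun x => by
    rw [norm_iteratedFDeriv_zero]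
  have la := (H.tendsto_integral hS (u := fun x => φ x.1)
    (hφ.continuous.measurable.comp measurable_fst) hφ.continuous.measurable hφp fun x => le_rfl).2
  have lb := (H.tendsto_integral hS (u := fun x => ψ' x.2 * F x.1)
    ((mψ.comp measurable_snd).mul (hgc.measurable.comp measurable_fst))
    (g := fun x => M * F x) (hgc.measurable.const_mul M) (hgp.const_mul M) fun x => by
      rw [abs_mul, abs_mul, abs_of_pos H.M_pos]
      exact mul_le_mul_of_nonneg_right (hψabs _) (abs_nonneg _)).2
  have hstep : ∀ n, |∫ ω, φ (θ (n + 1) ω) ∂P - ∫ ω, φ (θ n ω) ∂P -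
      h * ∫ ω, ψ' (ζ n ω) * F (θ n ω) ∂P| ≤ C₁ * h ^ 2 + h * (C₂ * h + r ^ n * T) := by
    intro n
    have h1 := hW h Ω P θ ζ G ε H n
    have h2 := H.abs_integral_step_increment_le hgc.measurable hA hle n
    have iF := H.integrable_comp_θ hgc.measurable hgp n
    have i1 : ∀ k, Integrable (fun ω => ψ' (ζ k ω) * F (θ n ω)) P := fun k =>
      iF.bdd_mul (c := M) (mψ.comp (H.run.measurable_ζ k)).aestronglyMeasurable
        (ae_of_all _ fun ω => hψabs _)
    have h3 : |∫ ω, ψ' (ζ (n + 1) ω) * F (θ n ω) ∂P - ∫ ω, ψ' (ζ n ω) * F (θ n ω) ∂P| ≤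
        C₂ * h + r ^ n * T := by
      rw [← integral_sub (i1 _) (i1 _)]
      simp_rw [← sub_mul]
      exact abs_integral_le_integral_abs.trans h2
    have h4 := mul_le_mul_of_nonneg_left h3 hhp.le
    rw [← abs_of_pos hhp, ← abs_mul, abs_of_pos hhp, mul_sub] at h4
    refine le_trans ?_ (add_le_add h1 h4)
    refine le_trans (le_of_eq ?_) (abs_add_le _ _)
    congr 1
    ring
  -- In the limit the two expectations of `φ` cancel and the transient disappears; `h` times the
  -- stationary mean of the weighted generator is left, bounded by a multiple of `h ^ 2`.
  have lhs : Tendsto (fun n => |∫ ω, φ (θ (n + 1) ω) ∂P - ∫ ω, φ (θ n ω) ∂P -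
      h * ∫ ω, ψ' (ζ n ω) * F (θ n ω) ∂P|) atTop (𝓝 |∫ x, φ x.1 ∂ν - ∫ x, φ x.1 ∂ν -
        h * ∫ x, ψ' x.2 * F x.1 ∂ν|) :=
    (((la.comp (tendsto_add_atTop_nat 1)).sub la).sub (lb.const_mul h)).abs
  have rhs : Tendsto (fun n => C₁ * h ^ 2 + h * (C₂ * h + r ^ n * T)) atTop
      (𝓝 (C₁ * h ^ 2 + h * (C₂ * h + 0 * T))) :=
    ((((tendsto_pow_atTop_nhds_zero_of_lt_one hr0 hr1).mul_const T).const_add _).const_mul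
      h).const_add _
  have h5 := le_of_tendsto_of_tendsto' lhs rhs hstep
  rw [sub_self, zero_sub, abs_neg, abs_mul, abs_of_pos hhp] at h5
  have h6 : h * |∫ x, ψ' x.2 * F x.1 ∂ν| ≤ h * ((C₁ + |C₂|) * h) := by
    have := mul_le_mul_of_nonneg_right (le_abs_self C₂) (sq_nonneg h)
    nlinarith
  exact le_of_mul_le_mul_left h6 hhp

end SASGLD
end

/-! ### Time averages. -/

noncomputable section

namespace SASGLD

variable {d : ℕ}

/-- The time averages start at index `1`, where `ζ` is already above the floor, while the strong law
starts at index `0`. -/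
lemma tendsto_average_succ {a : ℕ → ℝ} {l : ℝ}
    (h : Tendsto (fun n : ℕ => (∑ k ∈ Finset.range n, a k) / n) atTop (𝓝 l)) :
    Tendsto (fun n : ℕ => (∑ k ∈ Finset.range n, a (k + 1)) / n) atTop (𝓝 l) := by
  have h1 := h.comp (tendsto_add_atTop_nat 1)
  have h2 : Tendsto (fun n : ℕ => (1 : ℝ) / n) atTop (𝓝 0) := tendsto_one_div_atTop_nhds_zero_nat
  have h3 := (h1.mul (h2.const_add 1)).sub (h2.const_mul (a 0))
  rw [add_zero, mul_one, mul_zero, sub_zero] at h3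
  refine h3.congr' ?_
  filter_upwards [eventually_ge_atTop 1] with n hn
  have hn' : (n : ℝ) ≠ 0 := by positivity
  have hn1 : ((n + 1 : ℕ) : ℝ) ≠ 0 := by positivity
  simp only [Function.comp, Finset.sum_range_succ']
  field_simp
  push_cast
  ring

/-- No rate of convergence is used. From some `n₀` on the error is at most `e`; the earlier errors
are bounded by `B ≤ B * n₀ / n`. -/
lemma exists_forall_abs_sub_le_add_div {a : ℕ → ℝ} {l e : ℝ} (h : Tendsto a atTop (𝓝 l))
    (he : 0 < e) : ∃ C : ℝ, ∀ n : ℕ, 1 ≤ n → |a n - l| ≤ e + C / n := by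
  have h1 := (h.sub_const l).abs
  rw [sub_self, abs_zero] at h1
  obtain ⟨B, hB⟩ := h1.bddAbove_range
  obtain ⟨n₀, hn₀⟩ := eventually_atTop.1 (h1.eventually (ge_mem_nhds he))
  have hB' : ∀ n, |a n - l| ≤ B := fun n => hB ⟨n, rfl⟩
  have hB0 : 0 ≤ B := (abs_nonneg _).trans (hB' 0)
  refine ⟨B * n₀, fun n hn => ?_⟩
  have hn' : (0 : ℝ) < n := by positivity
  by_cases hc : n₀ ≤ n
  · have : 0 ≤ B * n₀ / n := by positivity
    linarith [hn₀ n hc]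
  · have h2 : (n : ℝ) ≤ n₀ := by exact_mod_cast (not_le.1 hc).le
    have h3 : B ≤ B * n₀ / n := by
      rw [le_div_iff₀ hn']
      gcongr
    linarith [hB' n]

namespace IsControlledRun

variable {Ω : Type*} [MeasurableSpace Ω] {P : Measure Ω} {U : E d → ℝ}
  {ψ : ℝ → ℝ} {α β δ m M Lψ L a b σ σ₄ h : ℝ} {K : ℕ → ℝ}
  {θ : ℕ → Ω → E d} {ζ : ℕ → Ω → ℝ} {G ε : ℕ → Ω → E d} {f : E d → ℝ}
  {ν : Measure (E d × ℝ)}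

lemma timeAverage_eq (H : IsControlledRun P U ψ α β δ m M Lψ L a b σ σ₄ h K θ ζ G ε)
    (f : E d → ℝ) (n : ℕ) (ω : Ω) : timeAverage ψ h f θ ζ n ω =
      (∑ k ∈ Finset.range n, clippedStep ψ (stateFloor α δ h) (ζ (k + 1) ω) * f (θ (k + 1) ω)) /
        ∑ k ∈ Finset.range n, clippedStep ψ (stateFloor α δ h) (ζ (k + 1) ω) := by
  have e : ∀ g : ℕ → ℝ, ∑ k ∈ Finset.Icc 1 n, g k = ∑ k ∈ Finset.range n, g (k + 1) := fun g => by
    rw [← Finset.Ico_add_one_right_eq_Icc, Finset.sum_Ico_eq_sum_range]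
    simp [add_comm]
  rw [timeAverage, e, e]
  simp only [← H.clippedStep_eq]
  rw [← Finset.sum_mul]
  simp_rw [mul_right_comm _ h]
  rw [← Finset.sum_mul, mul_div_mul_right _ _ H.h_pos.ne']

/-- Cauchy–Schwarz in the numerator and the lower bound `n * m` for the denominator, both free of
the common factor `h`. -/
lemma abs_timeAverage_sq_le (H : IsControlledRun P U ψ α β δ m M Lψ L a b σ σ₄ h K θ ζ G ε)
    (f : E d → ℝ) (n : ℕ) (ω : Ω) : timeAverage ψ h f θ ζ n ω ^ 2 ≤
      (M / m) ^ 2 * ((∑ k ∈ Finset.range n, f (θ (k + 1) ω) ^ 2) / n) := by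
  rw [H.timeAverage_eq]
  have hm := H.m_pos
  have hM := H.M_pos
  rcases Nat.eq_zero_or_pos n with rfl | hn
  · simp
  have hn' : (0 : ℝ) < n := by exact_mod_cast hn
  set S := ∑ k ∈ Finset.range n,
    clippedStep ψ (stateFloor α δ h) (ζ (k + 1) ω) * f (θ (k + 1) ω) with hS
  set T := ∑ k ∈ Finset.range n, clippedStep ψ (stateFloor α δ h) (ζ (k + 1) ω) with hT
  have hT1 : n * m ≤ T := by
    have := Finset.card_nsmul_le_sum (Finset.range n)
      (fun k => clippedStep ψ (stateFloor α δ h) (ζ (k + 1) ω)) m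
      fun k _ => H.step.le_clippedStep _
    simpa using this
  have hT0 : 0 < T := (by positivity : 0 < n * m).trans_le hT1
  have hS1 : S ^ 2 ≤ n * (M ^ 2 * ∑ k ∈ Finset.range n, f (θ (k + 1) ω) ^ 2) := by
    have h1 := sq_sum_le_card_mul_sum_sq (s := Finset.range n)
      (f := fun k => clippedStep ψ (stateFloor α δ h) (ζ (k + 1) ω) * f (θ (k + 1) ω))
    rw [Finset.card_range] at h1
    refine h1.trans (mul_le_mul_of_nonneg_left ?_ hn'.le)
    rw [Finset.mul_sum]
    refine Finset.sum_le_sum fun k _ => ?_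
    rw [mul_pow]
    have h2 := H.step.le_clippedStep (ζ (k + 1) ω)
    have h3 := H.step.clippedStep_le (ζ (k + 1) ω)
    have h4 : 0 ≤ clippedStep ψ (stateFloor α δ h) (ζ (k + 1) ω) := hm.le.trans h2
    gcongr
  have hQ : 0 ≤ ∑ k ∈ Finset.range n, f (θ (k + 1) ω) ^ 2 :=
    Finset.sum_nonneg fun _ _ => sq_nonneg _
  rw [div_pow, div_le_iff₀ (by positivity)]
  refine hS1.trans ?_
  have h5 : (n * m) ^ 2 ≤ T ^ 2 := by gcongr
  calc n * (M ^ 2 * ∑ k ∈ Finset.range n, f (θ (k + 1) ω) ^ 2)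
      = (M / m) ^ 2 * ((∑ k ∈ Finset.range n, f (θ (k + 1) ω) ^ 2) / n) * (n * m) ^ 2 := by
        field_simp
    _ ≤ _ := by gcongr

lemma measurable_timeAverage (H : IsControlledRun P U ψ α β δ m M Lψ L a b σ σ₄ h K θ ζ G ε)
    (hf : Measurable f) (n : ℕ) : Measurable (timeAverage ψ h f θ ζ n) := by
  rw [show timeAverage ψ h f θ ζ n = _ from funext (H.timeAverage_eq f n)]
  have h1 : ∀ k, Measurable fun ω => clippedStep ψ (stateFloor α δ h) (ζ (k + 1) ω) := fun k =>
    H.step.continuous_clippedStep.measurable.comp (H.run.measurable_ζ _)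
  exact (Finset.measurable_fun_sum _ fun k _ =>
    (h1 k).mul (hf.comp (H.run.measurable_θ (k + 1)))).div
    (Finset.measurable_fun_sum _ fun k _ => h1 k)

lemma tendsto_timeAverage [IsProbabilityMeasure P] [IsProbabilityMeasure ν]
    (H : IsControlledRun P U ψ α β δ m M Lψ L a b σ σ₄ h K θ ζ G ε)
    {κ : Kernel (E d × ℝ) (E d × ℝ)} [IsMarkovKernel κ]
    (hκ : IsMarkovChain P (fun n ω => (θ n ω, ζ n ω)) κ)
    (herg : IsErgodicKernel κ {x : E d × ℝ | 0 ≤ x.2} ν) (hf : Measurable f)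
    (hfi : Integrable (fun x => clippedStep ψ (stateFloor α δ h) x.2 * f x.1) ν) :
    ∀ᵐ ω ∂P, Tendsto (fun n => timeAverage ψ h f θ ζ n ω) atTop
      (𝓝 ((∫ x, clippedStep ψ (stateFloor α δ h) x.2 * f x.1 ∂ν) /
        ∫ x, clippedStep ψ (stateFloor α δ h) x.2 ∂ν)) := by
  set ψ' := clippedStep ψ (stateFloor α δ h) with hψ'
  have mψ : Measurable fun x : E d × ℝ => ψ' x.2 :=
    H.step.continuous_clippedStep.measurable.comp measurable_snd
  have iψ : Integrable (fun x : E d × ℝ => ψ' x.2) ν :=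
    (integrable_const M).mono' mψ.aestronglyMeasurable (ae_of_all _ fun x => by
      rw [Real.norm_of_nonneg (H.m_pos.le.trans (H.step.le_clippedStep _))]
      exact H.step.clippedStep_le _)
  have hD : MeasurableSet {x : E d × ℝ | 0 ≤ x.2} := measurableSet_le measurable_const measurable_snd
  have hX : ∀ n, Measurable fun ω => (θ n ω, ζ n ω) := fun n =>
    (H.run.measurable_θ n).prodMk (H.run.measurable_ζ n)
  have hin : ∀ n ω, (θ n ω, ζ n ω) ∈ {x : E d × ℝ | 0 ≤ x.2} := fun n ω => H.ζ_nonneg n ω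
  have l1 := IsMarkovChain.strongLaw hD hX hκ herg hin (mψ.mul (hf.comp measurable_fst)) hfi
  have l2 := IsMarkovChain.strongLaw hD hX hκ herg hin mψ iψ
  have hpos : m ≤ ∫ x, ψ' x.2 ∂ν := by
    have := integral_mono (integrable_const m) iψ fun x => H.step.le_clippedStep x.2
    simpa using this
  have hne : ∫ x, ψ' x.2 ∂ν ≠ 0 := (H.m_pos.trans_le hpos).ne'
  filter_upwards [l1, l2] with ω h1 h2
  have h3 := (tendsto_average_succ h1).div (tendsto_average_succ h2) hne
  refine h3.congr' ?_
  filter_upwards [eventually_ge_atTop 1] with n hn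
  have hn' : (n : ℝ) ≠ 0 := by positivity
  rw [H.timeAverage_eq]
  exact div_div_div_cancel_right₀ hn' _ _

lemma integral_timeAverage_sq_le [IsProbabilityMeasure P]
    (H : IsControlledRun P U ψ α β δ m M Lψ L a b σ σ₄ h K θ ζ G ε) (hf : Measurable f)
    {A : ℝ} {N : ℕ} (hA : 0 ≤ A) (hfA : ∀ x, ‖f x ^ 2‖ ≤ A * (1 + ‖x‖ ^ N)) (n : ℕ) :
    Integrable (fun ω => timeAverage ψ h f θ ζ n ω ^ 2) P ∧
      ∫ ω, timeAverage ψ h f θ ζ n ω ^ 2 ∂P ≤ (M / m) ^ 2 * (A * (1 + K N)) := by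
  have hi : ∀ k, Integrable (fun ω => f (θ k ω) ^ 2) P := fun k =>
    H.integrable_comp_θ (hf.pow_const 2) ⟨A, N, hA, hfA⟩ k
  have hs : Integrable (fun ω => (M / m) ^ 2 *
      ((∑ k ∈ Finset.range n, f (θ (k + 1) ω) ^ 2) / n)) P :=
    ((integrable_finsetSum _ fun k _ => hi (k + 1)).div_const _).const_mul _
  have h1 : Integrable (fun ω => timeAverage ψ h f θ ζ n ω ^ 2) P := by
    refine hs.mono' ((H.measurable_timeAverage hf n).pow_const 2).aestronglyMeasurable
      (ae_of_all _ fun ω => ?_)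
    rw [Real.norm_of_nonneg (sq_nonneg _)]
    exact H.abs_timeAverage_sq_le f n ω
  refine ⟨h1, (integral_mono h1 hs fun ω => H.abs_timeAverage_sq_le f n ω).trans ?_⟩
  rw [integral_const_mul, integral_div, integral_finsetSum _ fun k _ => hi (k + 1)]
  have hb : ∀ k, ∫ ω, f (θ k ω) ^ 2 ∂P ≤ A * (1 + K N) := fun k =>
    H.integral_comp_θ_le (hf.pow_const 2) hA hfA k
  have hb0 : 0 ≤ A * (1 + K N) := (integral_nonneg fun _ => sq_nonneg _).trans (hb 0)
  gcongr
  rcases Nat.eq_zero_or_pos n with rfl | hn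
  · simpa using hb0
  rw [div_le_iff₀ (by exact_mod_cast hn)]
  refine (Finset.sum_le_card_nsmul _ _ _ fun k _ => hb (k + 1)).trans (le_of_eq ?_)
  simp [mul_comm]

/-- From index `1` on, `ζ` lies above the floor, and the setwise limit inherits this. It allows a
return from the clipped step size to `ψ` in the final statement. -/
lemma ae_eq_clippedStep [IsProbabilityMeasure P] [IsProbabilityMeasure ν]
    (H : IsControlledRun P U ψ α β δ m M Lψ L a b σ σ₄ h K θ ζ G ε)
    (hS : SetwiseTendsto (fun n => P.map fun ω => (θ n ω, ζ n ω)) ν) :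
    (fun x : E d × ℝ => ψ x.2) =ᵐ[ν] fun x => clippedStep ψ (stateFloor α δ h) x.2 := by
  have hB : MeasurableSet {x : E d × ℝ | stateFloor α δ h ≤ x.2} :=
    measurableSet_le measurable_const measurable_snd
  have h1 := (hS _ hB).comp (tendsto_add_atTop_nat 1)
  have h2 : ν {x : E d × ℝ | stateFloor α δ h ≤ x.2} = 1 := by
    refine tendsto_nhds_unique h1 (tendsto_const_nhds.congr fun n => ?_)
    simp only [Function.comp]
    rw [Measure.map_apply ((H.run.measurable_θ _).prodMk (H.run.measurable_ζ _)) hB]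
    rw [show (fun ω => (θ (n + 1) ω, ζ (n + 1) ω)) ⁻¹' {x : E d × ℝ | stateFloor α δ h ≤ x.2} =
      Set.univ from Set.eq_univ_of_forall fun ω => H.stateFloor_le n ω, measure_univ]
  have h3 : ∀ᵐ x ∂ν, x ∈ {x : E d × ℝ | stateFloor α δ h ≤ x.2} := (mem_ae_iff_prob_eq_one hB).2 h2
  filter_upwards [h3] with x hx
  exact (clippedStep_of_le hx).symm

end IsControlledRun

end SASGLD
end

noncomputable section

namespace SASGLD

/-! ### Markov operators and couplings. -/

section KernelOp

variable {S : Type*} [MeasurableSpace S]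

/-- The action of a Markov kernel on functions. -/
def kernelOp (κ : Kernel S S) (g : S → ℝ) (x : S) : ℝ := ∫ y, g y ∂(κ x)

lemma measurable_kernelOp (κ : Kernel S S) [IsMarkovKernel κ] {g : S → ℝ} (hg : Measurable g) :
    Measurable (kernelOp κ g) :=
  (hg.stronglyMeasurable.integral_kernel (κ := κ)).measurable

lemma abs_kernelOp_le (κ : Kernel S S) [IsMarkovKernel κ] {g : S → ℝ} {R : ℝ}
    (hR : ∀ x, |g x| ≤ R) (x : S) : |kernelOp κ g x| ≤ R := by
  have := norm_integral_le_of_norm_le_const (μ := κ x) (f := g) (C := R) (ae_of_all _ hR)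
  simpa [kernelOp] using this

lemma measurable_kernelOp_iterate (κ : Kernel S S) [IsMarkovKernel κ] {g : S → ℝ}
    (hg : Measurable g) (n : ℕ) : Measurable ((kernelOp κ)^[n] g) := by
  induction n with
  | zero => exact hg
  | succ n ih => rw [Function.iterate_succ_apply']; exact measurable_kernelOp κ ih

lemma abs_kernelOp_iterate_le (κ : Kernel S S) [IsMarkovKernel κ] {g : S → ℝ} {R : ℝ}
    (hR : ∀ x, |g x| ≤ R) (n : ℕ) (x : S) : |(kernelOp κ)^[n] g x| ≤ R := by
  induction n generalizing x with
  | zero => exact hR x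
  | succ n ih => rw [Function.iterate_succ_apply']; exact abs_kernelOp_le κ ih x

/-- The measures `μ` and `ν` have a coupling that gives mass at least `s` to `A`. -/
def HasCoupling (μ ν : Measure S) (s : ℝ) (A : Set (S × S)) : Prop :=
  ∃ Λ : Measure (S × S), Λ.fst = μ ∧ Λ.snd = ν ∧ s ≤ Λ.real A

lemma hasCoupling_prod (μ ν : Measure S) [IsProbabilityMeasure μ] [IsProbabilityMeasure ν] :
    HasCoupling μ ν 0 ∅ :=
  ⟨μ.prod ν, by simp, by simp, by simp⟩

/-- Integrate the pointwise oscillation bound along the coupling; the improvement by `c` on `A`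
counts with the mass of `A`. -/
lemma HasCoupling.abs_integral_sub_le {μ ν : Measure S} [IsProbabilityMeasure μ] {s : ℝ}
    {A : Set (S × S)} (h : HasCoupling μ ν s A) (hA : MeasurableSet A) {g W : S → ℝ} {R a b c : ℝ}
    (hg : Measurable g) (hR : ∀ x, |g x| ≤ R) (hWm : Measurable W) (hW : Integrable W μ)
    (hW' : Integrable W ν) (hc : 0 ≤ c) (hle : ∀ x y, |g x - g y| ≤ a + b * (W x + W y))
    (hleA : ∀ x y, (x, y) ∈ A → |g x - g y| ≤ a + b * (W x + W y) - c) :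
    |∫ x, g x ∂μ - ∫ x, g x ∂ν| ≤ a + b * (∫ x, W x ∂μ + ∫ x, W x ∂ν) - s * c := by
  obtain ⟨Λ, rfl, rfl, hs⟩ := h
  have hΛ : IsProbabilityMeasure Λ := ⟨by
    rw [← Measure.fst_univ, measure_univ]⟩
  have e1 : ∀ w : S → ℝ, Measurable w → ∫ x, w x ∂Λ.fst = ∫ p, w p.1 ∂Λ := fun w hw =>
    integral_map measurable_fst.aemeasurable hw.aestronglyMeasurable
  have e2 : ∀ w : S → ℝ, Measurable w → ∫ x, w x ∂Λ.snd = ∫ p, w p.2 ∂Λ := fun w hw =>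
    integral_map measurable_snd.aemeasurable hw.aestronglyMeasurable
  have i1 : Integrable (fun p : S × S => W p.1) Λ :=
    (integrable_map_measure hWm.aestronglyMeasurable measurable_fst.aemeasurable).1 hW
  have i2 : Integrable (fun p : S × S => W p.2) Λ :=
    (integrable_map_measure hWm.aestronglyMeasurable measurable_snd.aemeasurable).1 hW'
  have g1 : Integrable (fun p : S × S => g p.1) Λ :=
    (integrable_const R).mono' (hg.comp measurable_fst).aestronglyMeasurable
      (ae_of_all _ fun p => hR _)
  have g2 : Integrable (fun p : S × S => g p.2) Λ :=
    (integrable_const R).mono' (hg.comp measurable_snd).aestronglyMeasurable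
      (ae_of_all _ fun p => hR _)
  have i3 : Integrable (fun p : S × S => a + b * (W p.1 + W p.2)) Λ :=
    (integrable_const a).add ((i1.add i2).const_mul b)
  have i4 : Integrable (A.indicator fun _ : S × S => c) Λ := (integrable_const c).indicator hA
  rw [e1 g hg, e2 g hg, e1 W hWm, e2 W hWm, ← integral_sub g1 g2, ← integral_add i1 i2]
  calc |∫ p, (g p.1 - g p.2) ∂Λ| ≤ ∫ p, (a + b * (W p.1 + W p.2) - A.indicator (fun _ => c) p) ∂Λ := by
        refine abs_integral_le_integral_abs.trans (integral_mono (g1.sub g2).abs (i3.sub i4) ?_)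
        intro p
        by_cases hp : p ∈ A
        · simpa [hp] using hleA p.1 p.2 hp
        · simpa [hp] using hle p.1 p.2
    _ = a + b * ∫ p, (W p.1 + W p.2) ∂Λ - Λ.real A * c := by
        have i5 : Integrable (fun p : S × S => b * (W p.1 + W p.2)) Λ := (i1.add i2).const_mul b
        rw [integral_sub i3 i4, integral_add (integrable_const a) i5,
          integral_const_mul, integral_indicator_const c hA]
        simp
    _ ≤ _ := by gcongr

/-- Two finite measures with a common part, of which the coupled version is concentrated on `A`,
have a coupling that charges `A`. -/
lemma hasCoupling_of_le {μ ν : Measure S} [IsProbabilityMeasure μ] [IsProbabilityMeasure ν]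
    {Γ : Measure (S × S)} [IsProbabilityMeasure Γ] {A : Set (S × S)} {s : ℝ}
    (hs1 : s < 1) (h1 : ENNReal.ofReal s • Γ.fst ≤ μ)
    (h2 : ENNReal.ofReal s • Γ.snd ≤ ν) (hΓ : Γ A = 1) : HasCoupling μ ν s A := by
  set t := ENNReal.ofReal s with ht
  have htop : t ≠ ⊤ := ENNReal.ofReal_ne_top
  have ht1 : t < 1 := by rw [ht, ENNReal.ofReal_lt_one]; exact hs1
  have hf1 : IsFiniteMeasure (t • Γ.fst) := Measure.smul_finite _ htop
  have hf2 : IsFiniteMeasure (t • Γ.snd) := Measure.smul_finite _ htop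
  have m1 : (μ - t • Γ.fst) Set.univ = 1 - t := by
    rw [Measure.sub_apply MeasurableSet.univ h1]
    simp
  have m2 : (ν - t • Γ.snd) Set.univ = 1 - t := by
    rw [Measure.sub_apply MeasurableSet.univ h2]
    simp
  have hne : 1 - t ≠ 0 := (tsub_pos_of_lt ht1).ne'
  have hne' : 1 - t ≠ ⊤ := ENNReal.sub_ne_top ENNReal.one_ne_top
  -- What remains of `μ` and `ν` has mass `1 - t` in both cases and is coupled independently; the
  -- factor `(1 - t)⁻¹` corrects the mass `(1 - t) ^ 2` of the product.
  refine ⟨t • Γ + (1 - t)⁻¹ • (μ - t • Γ.fst).prod (ν - t • Γ.snd), ?_, ?_, ?_⟩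
  · rw [Measure.fst, Measure.map_add _ _ measurable_fst, Measure.map_smul, Measure.map_smul]
    rw [Measure.map_fst_prod, m2, smul_smul, ENNReal.inv_mul_cancel hne hne', one_smul, add_comm]
    exact Measure.sub_add_cancel_of_le h1
  · rw [Measure.snd, Measure.map_add _ _ measurable_snd, Measure.map_smul, Measure.map_smul]
    rw [Measure.map_snd_prod, m1, smul_smul, ENNReal.inv_mul_cancel hne hne', one_smul, add_comm]
    exact Measure.sub_add_cancel_of_le h2
  · have hfin : IsFiniteMeasure (t • Γ + (1 - t)⁻¹ • (μ - t • Γ.fst).prod (ν - t • Γ.snd)) := by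
      have a1 : IsFiniteMeasure (t • Γ) := Measure.smul_finite _ htop
      have a2 : IsFiniteMeasure ((1 - t)⁻¹ • (μ - t • Γ.fst).prod (ν - t • Γ.snd)) :=
        Measure.smul_finite _ (ENNReal.inv_ne_top.2 hne)
      infer_instance
    rw [Measure.real, ← ENNReal.ofReal_le_iff_le_toReal (measure_ne_top _ _)]
    simp only [Measure.coe_add, Measure.coe_smul, Pi.add_apply, Pi.smul_apply, smul_eq_mul, hΓ,
      mul_one]
    exact le_self_add

end KernelOp

end SASGLD
end

noncomputable section

namespace SASGLD

/-! ### A weak form of Harris' theorem. -/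

section WeakHarris

variable {S : Type*} [MeasurableSpace S]

/-- A weak form of the assumptions of Harris' theorem: a drift condition, a smoothing inequality
for the oscillation at distance `D` between related points, and couplings that bring any two
points of a sublevel set of `V` to small distance with a probability bounded below. -/
structure IsWeakHarris (κ : Kernel S S) (V : S → ℝ) (rel : S → S → Prop) (D : S → S → ℝ)
    (γ K r C : ℝ) : Prop where
  measurable_V : Measurable V
  V_nonneg : ∀ x, 0 ≤ V x
  D_nonneg : ∀ x y, 0 ≤ D x y
  γ_nonneg : 0 ≤ γ
  γ_lt_one : γ < 1
  K_nonneg : 0 ≤ K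
  r_nonneg : 0 ≤ r
  r_lt_one : r < 1
  C_nonneg : 0 ≤ C
  integrable_V : ∀ x, Integrable V (κ x)
  drift : ∀ x, ∫ y, V y ∂(κ x) ≤ γ * V x + K
  smoothing : ∀ (g : S → ℝ) (R N N' : ℝ), Measurable g → (∀ x, |g x| ≤ R) → 0 ≤ N → 0 ≤ N' →
    (∀ x y, |g x - g y| ≤ N * (2 + (V x + V y))) → (∀ x y, rel x y → |g x - g y| ≤ N' * D x y) →
    ∀ x y, rel x y → |kernelOp κ g x - kernelOp κ g y| ≤ (r * N' + C * N) * D x y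
  coupling : ∀ R : ℝ, ∃ (s : ℝ) (A : ℕ → Set (S × S)) (e : ℕ → ℝ), 0 < s ∧ s ≤ 1 ∧
    (∀ j, MeasurableSet (A j)) ∧ Tendsto e atTop (𝓝 0) ∧
    (∀ x y, V x + V y ≤ R → HasCoupling (κ x) (κ y) s (A 0)) ∧
    (∀ j x y, (x, y) ∈ A j → HasCoupling (κ x) (κ y) s (A (j + 1))) ∧
    ∀ j x y, (x, y) ∈ A j → rel x y ∧ D x y ≤ e j

variable {κ : Kernel S S} {V : S → ℝ} {rel : S → S → Prop} {D : S → S → ℝ}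
  {γ K r C : ℝ}

/-- The bound for the expectation of `V` after `n` steps. -/
def driftBound (V : S → ℝ) (γ K : ℝ) (n : ℕ) (x : S) : ℝ :=
  γ ^ n * V x + K / (1 - γ) * (1 - γ ^ n)

lemma IsWeakHarris.driftBound_le (H : IsWeakHarris κ V rel D γ K r C) (n : ℕ) (x : S) :
    driftBound V γ K n x ≤ V x + K / (1 - γ) := by
  have h1 : γ ^ n ≤ 1 := pow_le_one₀ H.γ_nonneg H.γ_lt_one.le
  have h2 : 0 ≤ γ ^ n := pow_nonneg H.γ_nonneg n
  have h3 : 0 ≤ K / (1 - γ) := div_nonneg H.K_nonneg (sub_nonneg.2 H.γ_lt_one.le)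
  have h4 := H.V_nonneg x
  unfold driftBound
  nlinarith

lemma IsWeakHarris.driftBound_le' (H : IsWeakHarris κ V rel D γ K r C) (n : ℕ) (x : S) :
    driftBound V γ K (n + 1) x ≤ γ * V x + K / (1 - γ) := by
  have h1 : γ ^ n ≤ 1 := pow_le_one₀ H.γ_nonneg H.γ_lt_one.le
  have h2 : 0 ≤ γ ^ (n + 1) := pow_nonneg H.γ_nonneg _
  have h3 : 0 ≤ K / (1 - γ) := div_nonneg H.K_nonneg (sub_nonneg.2 H.γ_lt_one.le)
  have h4 := H.V_nonneg x
  have h5 : γ ^ (n + 1) * V x ≤ γ * V x := by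
    rw [pow_succ']
    have := mul_le_of_le_one_right H.γ_nonneg h1
    gcongr
  unfold driftBound
  nlinarith

lemma IsWeakHarris.measurable_driftBound (H : IsWeakHarris κ V rel D γ K r C) (n : ℕ) :
    Measurable (driftBound V γ K n) := (H.measurable_V.const_mul _).add_const _

variable [IsMarkovKernel κ]

lemma IsWeakHarris.integrable_driftBound (H : IsWeakHarris κ V rel D γ K r C) (n : ℕ) (x : S) :
    Integrable (driftBound V γ K n) (κ x) :=
  ((H.integrable_V x).const_mul _).add (integrable_const _)

lemma IsWeakHarris.integral_driftBound_le (H : IsWeakHarris κ V rel D γ K r C) (n : ℕ) (x : S) :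
    ∫ y, driftBound V γ K n y ∂(κ x) ≤ driftBound V γ K (n + 1) x := by
  have h1 := H.drift x
  have h2 : 0 ≤ γ ^ n := pow_nonneg H.γ_nonneg n
  have h3 : 1 - γ ≠ 0 := (sub_pos.2 H.γ_lt_one).ne'
  unfold driftBound
  rw [integral_add ((H.integrable_V x).const_mul _) (integrable_const _), integral_const_mul]
  simp only [integral_const, probReal_univ, smul_eq_mul, one_mul]
  have h4 : γ ^ (n + 1) * V x + K / (1 - γ) * (1 - γ ^ (n + 1)) =
      γ ^ n * (γ * V x + K) + K / (1 - γ) * (1 - γ ^ n) := by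
    field_simp
    ring
  rw [h4]
  gcongr

/-- Couplings transport oscillation bounds through one step. -/
lemma IsWeakHarris.abs_kernelOp_sub_le (H : IsWeakHarris κ V rel D γ K r C) {g : S → ℝ}
    {R N β c s : ℝ} {n : ℕ} {A : Set (S × S)} (hg : Measurable g) (hR : ∀ x, |g x| ≤ R)
    (hN : 0 ≤ N) (hβ : 0 ≤ β) (hc : 0 ≤ c) (hA : MeasurableSet A)
    (hle : ∀ x y, |g x - g y| ≤ N * (2 + β * (driftBound V γ K n x + driftBound V γ K n y)))
    (hleA : ∀ x y, (x, y) ∈ A → |g x - g y| ≤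
      N * (2 + β * (driftBound V γ K n x + driftBound V γ K n y)) - c)
    {x y : S} (hxy : HasCoupling (κ x) (κ y) s A) :
    |kernelOp κ g x - kernelOp κ g y| ≤
      N * (2 + β * (driftBound V γ K (n + 1) x + driftBound V γ K (n + 1) y)) - s * c := by
  have h1 := hxy.abs_integral_sub_le hA (a := N * 2) (b := N * β) (c := c) hg hR
    (H.measurable_driftBound n) (H.integrable_driftBound n x) (H.integrable_driftBound n y) hc
    (fun x y => (hle x y).trans (le_of_eq (by ring)))
    (fun x y h => (hleA x y h).trans (le_of_eq (by ring)))
  refine h1.trans ?_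
  have h2 := H.integral_driftBound_le n x
  have h3 := H.integral_driftBound_le n y
  have h4 : N * (2 + β * (driftBound V γ K (n + 1) x + driftBound V γ K (n + 1) y)) =
    N * 2 + N * β * (driftBound V γ K (n + 1) x + driftBound V γ K (n + 1) y) := by ring
  rw [h4]
  gcongr

lemma IsWeakHarris.abs_iterate_sub_le (H : IsWeakHarris κ V rel D γ K r C) {g : S → ℝ}
    {R N β : ℝ} (hg : Measurable g) (hR : ∀ x, |g x| ≤ R) (hN : 0 ≤ N) (hβ : 0 ≤ β)
    (hle : ∀ x y, |g x - g y| ≤ N * (2 + β * (V x + V y))) (n : ℕ) (x y : S) :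
    |(kernelOp κ)^[n] g x - (kernelOp κ)^[n] g y| ≤
      N * (2 + β * (driftBound V γ K n x + driftBound V γ K n y)) := by
  induction n generalizing x y with
  | zero => simpa [driftBound] using hle x y
  | succ n ih =>
    rw [Function.iterate_succ_apply']
    have := H.abs_kernelOp_sub_le (measurable_kernelOp_iterate κ hg n)
      (abs_kernelOp_iterate_le κ hR n) hN hβ le_rfl MeasurableSet.empty ih
      (fun _ _ h => h.elim) (hasCoupling_prod (κ x) (κ y))
    simpa using this

/-- Since `β * (K / (1 - γ)) ≤ 1`, the weighted oscillation of all iterates stays below the one with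
constant `2 * N`. The smoothing inequality then gives the recursion `x ↦ r * x + 2 * C * N`, with
fixed point `2 * C * N / (1 - r)`. -/
lemma IsWeakHarris.abs_iterate_sub_le_of_rel (H : IsWeakHarris κ V rel D γ K r C) {g : S → ℝ}
    {R N N' β : ℝ} (hg : Measurable g) (hR : ∀ x, |g x| ≤ R) (hN : 0 ≤ N) (hN' : 0 ≤ N')
    (hβ : 0 ≤ β) (hβ1 : β ≤ 1) (hβK : β * (K / (1 - γ)) ≤ 1)
    (hle : ∀ x y, |g x - g y| ≤ N * (2 + β * (V x + V y)))
    (hle' : ∀ x y, rel x y → |g x - g y| ≤ N' * D x y) (n : ℕ) (x y : S) (hxy : rel x y) :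
    |(kernelOp κ)^[n] g x - (kernelOp κ)^[n] g y| ≤
      (r ^ n * N' + 2 * C * N / (1 - r)) * D x y := by
  have hr1 : 0 < 1 - r := sub_pos.2 H.r_lt_one
  have hr0 := H.r_nonneg
  have hC := H.C_nonneg
  induction n generalizing x y with
  | zero =>
    refine (hle' x y hxy).trans ?_
    have := H.D_nonneg x y
    have h1 : 0 ≤ 2 * C * N / (1 - r) := by positivity
    rw [pow_zero, one_mul]
    gcongr
    linarith
  | succ n ih =>
    rw [Function.iterate_succ_apply']
    have h1 : ∀ x y, |(kernelOp κ)^[n] g x - (kernelOp κ)^[n] g y| ≤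
        (2 * N) * (2 + (V x + V y)) := fun x y => by
      refine (H.abs_iterate_sub_le hg hR hN hβ hle n x y).trans ?_
      have a1 := H.driftBound_le n x
      have a2 := H.driftBound_le n y
      have a3 := H.V_nonneg x
      have a4 := H.V_nonneg y
      have a5 : β * (driftBound V γ K n x + driftBound V γ K n y) ≤ V x + V y + 2 := by
        calc _ ≤ β * (V x + K / (1 - γ) + (V y + K / (1 - γ))) := by gcongr
          _ = β * (V x + V y) + 2 * (β * (K / (1 - γ))) := by ring
          _ ≤ 1 * (V x + V y) + 2 * 1 := by gcongr
          _ = _ := by ring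
      nlinarith
    have h2 := H.smoothing _ R (2 * N) (r ^ n * N' + 2 * C * N / (1 - r))
      (measurable_kernelOp_iterate κ hg n) (abs_kernelOp_iterate_le κ hR n) (by positivity)
      (by positivity) h1 ih x y hxy
    refine h2.trans (le_of_eq ?_)
    field_simp
    ring

/-- A pair that starts in `A j` is coupled for `n` steps with probability at least `s ^ n`. -/
lemma IsWeakHarris.abs_iterate_sub_le_of_mem (H : IsWeakHarris κ V rel D γ K r C) {g : S → ℝ}
    {R N N' β s : ℝ} {A : ℕ → Set (S × S)} {e : ℕ → ℝ} (hg : Measurable g)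
    (hR : ∀ x, |g x| ≤ R) (hN : 0 ≤ N) (hN' : 0 ≤ N') (hβ : 0 ≤ β) (hs : 0 ≤ s)
    (hle : ∀ x y, |g x - g y| ≤ N * (2 + β * (V x + V y)))
    (hle' : ∀ x y, rel x y → |g x - g y| ≤ N' * D x y) (hA : ∀ j, MeasurableSet (A j))
    (hstep : ∀ j x y, (x, y) ∈ A j → HasCoupling (κ x) (κ y) s (A (j + 1)))
    (hrel : ∀ j x y, (x, y) ∈ A j → rel x y ∧ D x y ≤ e j) (n j : ℕ)
    (he : N' * e (j + n) ≤ 2 * N) {x y : S} (hxy : (x, y) ∈ A j) :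
    |(kernelOp κ)^[n] g x - (kernelOp κ)^[n] g y| ≤
      N * (2 + β * (driftBound V γ K n x + driftBound V γ K n y)) -
        s ^ n * (2 * N - N' * e (j + n)) := by
  induction n generalizing j x y with
  | zero =>
    obtain ⟨h1, h2⟩ := hrel j x y hxy
    have h3 := mul_le_mul_of_nonneg_left h2 hN'
    have h4 : 0 ≤ N * (β * (V x + V y)) :=
      mul_nonneg hN (mul_nonneg hβ (add_nonneg (H.V_nonneg x) (H.V_nonneg y)))
    have h5 := hle' x y h1
    simp only [Function.iterate_zero, id_eq, driftBound, pow_zero, one_mul, sub_self, mul_zero,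
      add_zero]
    linarith
  | succ n ih =>
    rw [Function.iterate_succ_apply', pow_succ', mul_assoc]
    rw [show j + (n + 1) = j + 1 + n by ring] at he ⊢
    exact H.abs_kernelOp_sub_le (measurable_kernelOp_iterate κ hg n)
      (abs_kernelOp_iterate_le κ hR n) hN hβ (mul_nonneg (pow_nonneg hs n) (sub_nonneg.2 he))
      (hA (j + 1)) (H.abs_iterate_sub_le hg hR hN hβ hle n)
      (fun a b hab => ih (j + 1) he hab) (hstep j x y hxy)

set_option maxHeartbeats 1000000 in
/-- After sufficiently many steps, both oscillation bounds contract. -/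
theorem IsWeakHarris.exists_contraction (H : IsWeakHarris κ V rel D γ K r C) :
    ∃ (n : ℕ) (B β q : ℝ), 0 < n ∧ 1 ≤ B ∧ 0 < β ∧ β ≤ 1 ∧ 0 ≤ q ∧ q < 1 ∧
      ∀ (g : S → ℝ) (R N : ℝ), Measurable g → (∀ x, |g x| ≤ R) → 0 ≤ N →
        (∀ x y, |g x - g y| ≤ N * (2 + β * (V x + V y))) →
        (∀ x y, rel x y → |g x - g y| ≤ B * N * D x y) →
        (∀ x y, |(kernelOp κ)^[n] g x - (kernelOp κ)^[n] g y| ≤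
          q * N * (2 + β * (V x + V y))) ∧
        ∀ x y, rel x y →
          |(kernelOp κ)^[n] g x - (kernelOp κ)^[n] g y| ≤ B * (q * N) * D x y := by
  have hγ0 := H.γ_nonneg
  have hγ1 : 0 < 1 - γ := sub_pos.2 H.γ_lt_one
  have hr0 := H.r_nonneg
  have hr1 : 0 < 1 - r := sub_pos.2 H.r_lt_one
  have hC := H.C_nonneg
  set k := K / (1 - γ) with hk
  have hk0 : 0 ≤ k := div_nonneg H.K_nonneg hγ1.le
  -- Above this level of `V x + V y` the drift alone contracts: a quarter of `(1 - γ) * v` already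
  -- exceeds `2 * k + 1`.
  set R₀ := 4 * (2 * k + 1) / (1 - γ) with hR₀
  have hR₀0 : 0 < R₀ := by positivity
  have hR₀' : (1 - γ) * R₀ = 4 * (2 * k + 1) := by rw [hR₀]; field_simp
  obtain ⟨s, A, e, hs, hs1, hA, he, hA0, hAs, hrel⟩ := H.coupling R₀
  -- The local oscillation is weighted with `B`, large enough for the inhomogeneous term `2 * C / (1
  -- - r)` to use up at most half of the gap `(1 - r) * B`.
  set B := 4 * C / (1 - r) ^ 2 + 1 with hB
  have hB1 : 1 ≤ B := by
    have : 0 ≤ 4 * C / (1 - r) ^ 2 := by positivity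
    linarith
  have hB0 : 0 < B := by linarith
  have hBC : 2 * C / (1 - r) ≤ (1 - r) / 2 * B := by
    have : 2 * C / (1 - r) = (1 - r) / 2 * (4 * C / (1 - r) ^ 2) := by
      field_simp
      ring
    rw [this, hB]
    gcongr
    linarith
  -- After `j₀` further steps a coupled pair is so close that its local oscillation bound, at most
  -- `N`, is half of the trivial `2 * N`.
  obtain ⟨j₀, hj₀⟩ : ∃ j₀, e j₀ ≤ 1 / B :=
    (he.eventually (ge_mem_nhds (show (0 : ℝ) < 1 / B by positivity))).exists
  have hBe : B * e j₀ ≤ 1 := by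
    have := mul_le_mul_of_nonneg_left hj₀ hB0.le
    rwa [mul_one_div_cancel hB0.ne'] at this
  set n := j₀ + 1 with hn
  have hsn : 0 < s ^ n := pow_pos hs n
  have hsn1 : s ^ n ≤ 1 := pow_le_one₀ hs.le hs1
  -- On the sublevel set the weighted energies then cost at most half of the gain `s ^ n` from the
  -- coupling.
  set β := s ^ n / (2 * (R₀ + 2 * k + 1)) with hβ
  have hβ0 : 0 < β := by positivity
  have hβR : β * (R₀ + 2 * k + 1) = s ^ n / 2 := by rw [hβ]; field_simp
  have hβ1 : β ≤ 1 := by nlinarith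
  have hβk : β * k ≤ 1 := by nlinarith
  -- The three bounds serve, in this order, the drift for large energies, the constant term `2` for
  -- large energies, and the coupling gain in the sublevel set.
  set t := min (min ((1 - γ) / 4) (β / 2)) (s ^ n / 4) with ht
  have ht1 : t ≤ (1 - γ) / 4 := (min_le_left _ _).trans (min_le_left _ _)
  have ht2 : t ≤ β / 2 := (min_le_left _ _).trans (min_le_right _ _)
  have ht3 : t ≤ s ^ n / 4 := min_le_right _ _
  have ht0 : 0 < t := by
    rw [ht]
    exact lt_min (lt_min (by positivity) (by positivity)) (by positivity)
  refine ⟨n, B, β, max (1 - t) ((1 + r) / 2), Nat.succ_pos _, hB1, hβ0, hβ1,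
    le_max_of_le_right (by linarith), max_lt (by linarith) (by linarith), ?_⟩
  intro g R N hg hR hN hle hle'
  set q := max (1 - t) ((1 + r) / 2) with hq
  have hq1 : 1 - t ≤ q := le_max_left _ _
  have hq2 : (1 + r) / 2 ≤ q := le_max_right _ _
  have hBN : 0 ≤ B * N := mul_nonneg hB0.le hN
  refine ⟨fun x y => ?_, fun x y hxy => ?_⟩
  · have hVx := H.V_nonneg x
    have hVy := H.V_nonneg y
    set v := V x + V y with hv
    have hv0 : 0 ≤ v := add_nonneg hVx hVy
    have hW : driftBound V γ K n x + driftBound V γ K n y ≤ γ * v + 2 * k := by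
      have h1 := H.driftBound_le' j₀ x
      have h2 := H.driftBound_le' j₀ y
      rw [hv]
      linarith
    suffices h : |(kernelOp κ)^[n] g x - (kernelOp κ)^[n] g y| ≤ N * ((1 - t) * (2 + β * v)) by
      refine h.trans ?_
      rw [mul_comm q, mul_assoc]
      have : 0 ≤ 2 + β * v := by positivity
      gcongr
    -- In the sublevel set the coupling gains `s ^ n * N`; outside, the decrease of the energy
    -- suffices.
    by_cases hvR : v ≤ R₀
    · have h1 : |(kernelOp κ)^[n] g x - (kernelOp κ)^[n] g y| ≤
          N * (2 + β * (driftBound V γ K n x + driftBound V γ K n y)) - s * (s ^ j₀ * N) := by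
        rw [hn, Function.iterate_succ_apply']
        refine H.abs_kernelOp_sub_le (measurable_kernelOp_iterate κ hg j₀)
          (abs_kernelOp_iterate_le κ hR j₀) hN hβ0.le (by positivity) (hA 0)
          (H.abs_iterate_sub_le hg hR hN hβ0.le hle j₀) (fun a b hab => ?_) (hA0 x y hvR)
        have hBe' : B * N * e (0 + j₀) ≤ N := by
          rw [zero_add, mul_right_comm]
          exact mul_le_of_le_one_left hN hBe
        refine (H.abs_iterate_sub_le_of_mem hg hR hN hBN hβ0.le hs.le hle hle' hA hAs hrel j₀ 0
          (by linarith) hab).trans ?_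
        have : s ^ j₀ * N ≤ s ^ j₀ * (2 * N - B * N * e (0 + j₀)) := by
          gcongr
          linarith
        linarith
      refine h1.trans ?_
      have h2 : s * (s ^ j₀ * N) = N * s ^ n := by rw [hn, pow_succ]; ring
      rw [h2, ← mul_sub]
      refine mul_le_mul_of_nonneg_left ?_ hN
      have h3 : β * (driftBound V γ K n x + driftBound V γ K n y) ≤ β * (R₀ + 2 * k + 1) := by
        refine mul_le_mul_of_nonneg_left ?_ hβ0.le
        have : γ * v ≤ R₀ := by nlinarith [H.γ_lt_one]
        linarith
      have h4 : 0 ≤ β * v := by positivity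
      have h5 : t ≤ 1 := by linarith
      nlinarith [mul_nonneg (sub_nonneg.2 h5) h4]
    · refine (H.abs_iterate_sub_le hg hR hN hβ0.le hle n x y).trans
        (mul_le_mul_of_nonneg_left ?_ hN)
      have h1 := mul_le_mul_of_nonneg_left hW hβ0.le
      have h2 : R₀ < v := not_le.1 hvR
      have h3 : (1 - γ) * R₀ ≤ (1 - γ) * v := by gcongr
      have h4 : t * v ≤ (1 - γ) / 4 * v := by gcongr
      have h5 : γ * v + 2 * k + 1 ≤ (1 - t) * v := by linarith
      have h6 := mul_le_mul_of_nonneg_left h5 hβ0.le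
      linarith
  · refine (H.abs_iterate_sub_le_of_rel hg hR hN hBN hβ0.le hβ1 hβk hle hle' n x y hxy).trans ?_
    refine mul_le_mul_of_nonneg_right ?_ (H.D_nonneg x y)
    have h1 : r ^ n ≤ r := by
      rw [hn, pow_succ]
      exact mul_le_of_le_one_left hr0 (pow_le_one₀ hr0 H.r_lt_one.le)
    calc r ^ n * (B * N) + 2 * C * N / (1 - r) = (r ^ n * B + 2 * C / (1 - r)) * N := by ring
      _ ≤ (r * B + (1 - r) / 2 * B) * N := by gcongr
      _ = B * ((1 + r) / 2 * N) := by ring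
      _ ≤ B * (q * N) := by gcongr

/-- Geometric decay of the oscillations under a weak Harris condition. -/
theorem IsWeakHarris.exists_geometric_decay (H : IsWeakHarris κ V rel D γ K r C) :
    ∃ C₁ r₁ : ℝ, 0 ≤ C₁ ∧ 0 < r₁ ∧ r₁ < 1 ∧ ∀ (g : S → ℝ) (N : ℝ), Measurable g →
      (∀ x, |g x| ≤ N) → (∀ x y, rel x y → |g x - g y| ≤ N * D x y) →
      ∀ n x y, |(kernelOp κ)^[n] g x - (kernelOp κ)^[n] g y| ≤
        C₁ * N * r₁ ^ n * (1 + V x + V y) := by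
  obtain ⟨n₀, B, β, q, hn₀, hB, hβ, hβ1, hq, hq1, hcon⟩ := H.exists_contraction
  -- Keeps the contraction factor positive, as required for the division by `q'` and for a positive
  -- rate per step, its `n₀`-th root.
  set q' := max q (1 / 2) with hq'
  have hq'0 : 0 < q' := lt_max_of_lt_right (by norm_num)
  have hq'1 : q' < 1 := max_lt hq1 (by norm_num)
  have hn₀' : (n₀ : ℝ) ≠ 0 := by positivity
  set r₁ := q' ^ (1 / (n₀ : ℝ)) with hr₁
  have hr₁0 : 0 < r₁ := Real.rpow_pos_of_pos hq'0 _
  have hr₁1 : r₁ < 1 := Real.rpow_lt_one hq'0.le hq'1 (by positivity)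
  have hr₁n : r₁ ^ n₀ = q' := by
    rw [hr₁, ← Real.rpow_natCast, ← Real.rpow_mul hq'0.le, one_div_mul_cancel hn₀', Real.rpow_one]
  have hk0 : 0 ≤ K / (1 - γ) := div_nonneg H.K_nonneg (sub_nonneg.2 H.γ_lt_one.le)
  refine ⟨(2 + 2 * (K / (1 - γ))) / q', r₁, by positivity, hr₁0, hr₁1, ?_⟩
  intro g N hg hR hrel n x y
  have hN : 0 ≤ N := (abs_nonneg _).trans (hR x)
  have hosc : ∀ x y, |g x - g y| ≤ N * (2 + β * (V x + V y)) := fun x y => by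
    have h1 := abs_sub (g x) (g y)
    have h2 : 0 ≤ N * (β * (V x + V y)) :=
      mul_nonneg hN (mul_nonneg hβ.le (add_nonneg (H.V_nonneg x) (H.V_nonneg y)))
    nlinarith [hR x, hR y]
  have hiter : ∀ j : ℕ, (∀ x y, |(kernelOp κ)^[n₀ * j] g x - (kernelOp κ)^[n₀ * j] g y| ≤
      q ^ j * N * (2 + β * (V x + V y))) ∧ ∀ x y, rel x y →
      |(kernelOp κ)^[n₀ * j] g x - (kernelOp κ)^[n₀ * j] g y| ≤ B * (q ^ j * N) * D x y := by
    intro j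
    induction j with
    | zero =>
      refine ⟨by simpa using hosc, fun x y hxy => ?_⟩
      rw [mul_zero, pow_zero, one_mul]
      refine (hrel x y hxy).trans (mul_le_mul_of_nonneg_right ?_ (H.D_nonneg x y))
      exact le_mul_of_one_le_left hN hB
    | succ j ih =>
      have h1 := hcon _ N (q ^ j * N) (measurable_kernelOp_iterate κ hg (n₀ * j))
        (abs_kernelOp_iterate_le κ hR _) (by positivity) ih.1 ih.2
      rw [show n₀ * (j + 1) = n₀ + n₀ * j by ring, pow_succ', mul_assoc q]
      simp only [Function.iterate_add_apply]
      exact h1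
  have hdiv := Nat.div_add_mod n n₀
  set j := n / n₀ with hj
  set i := n % n₀ with hi
  have h1 := H.abs_iterate_sub_le (measurable_kernelOp_iterate κ hg (n₀ * j))
    (abs_kernelOp_iterate_le κ hR _) (by positivity) hβ.le (hiter j).1 i x y
  rw [← Function.iterate_add_apply, add_comm i, hdiv] at h1
  refine h1.trans ?_
  have a1 := H.driftBound_le i x
  have a2 := H.driftBound_le i y
  have a3 := H.V_nonneg x
  have a4 := H.V_nonneg y
  have h2 : 2 + β * (driftBound V γ K i x + driftBound V γ K i y) ≤
      (2 + 2 * (K / (1 - γ))) * (1 + V x + V y) := by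
    have h3 : β * (driftBound V γ K i x + driftBound V γ K i y) ≤
        1 * (V x + V y + 2 * (K / (1 - γ))) := by
      have h4 : 0 ≤ V x + V y + 2 * (K / (1 - γ)) := by positivity
      calc _ ≤ β * (V x + V y + 2 * (K / (1 - γ))) :=
            mul_le_mul_of_nonneg_left (by linarith) hβ.le
        _ ≤ _ := mul_le_mul_of_nonneg_right hβ1 h4
    nlinarith [mul_nonneg hk0 a3, mul_nonneg hk0 a4]
  have h3 : q ^ j ≤ r₁ ^ n / q' := by
    have hin : i ≤ n₀ := (Nat.mod_lt _ hn₀).le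
    rw [le_div_iff₀ hq'0, ← hdiv]
    calc q ^ j * q' ≤ q' ^ j * r₁ ^ n₀ := by
          rw [hr₁n]
          gcongr
          exact le_max_left _ _
      _ ≤ q' ^ j * r₁ ^ i :=
          mul_le_mul_of_nonneg_left (pow_le_pow_of_le_one hr₁0.le hr₁1.le hin) (by positivity)
      _ = r₁ ^ (n₀ * j + i) := by rw [pow_add, pow_mul, hr₁n]
  calc q ^ j * N * (2 + β * (driftBound V γ K i x + driftBound V γ K i y))
      ≤ q ^ j * N * ((2 + 2 * (K / (1 - γ))) * (1 + V x + V y)) :=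
        mul_le_mul_of_nonneg_left h2 (by positivity)
    _ ≤ (r₁ ^ n / q') * N * ((2 + 2 * (K / (1 - γ))) * (1 + V x + V y)) := by
        gcongr
    _ = _ := by ring

end WeakHarris

end SASGLD
end

/-! ### Comparison of Gaussian laws through their densities. -/

noncomputable section

namespace SASGLD

variable {d : ℕ}

/-- For `|a - b| ≤ 1` the difference is below its square root, and otherwise the bound is trivial.
With the root, a log-density difference of quadratic growth counts only linearly, and its product
with a function of linear growth is controlled by second moments. -/
lemma abs_exp_sub_exp_le (a b : ℝ) :
    |Real.exp a - Real.exp b| ≤ Real.sqrt |a - b| * (Real.exp a + Real.exp b) := by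
  wlog hab : b ≤ a generalizing a b
  · rw [abs_sub_comm, abs_sub_comm a, add_comm]
    exact this b a (not_le.1 hab).le
  have ha := Real.exp_pos a
  have hb := Real.exp_pos b
  have h0 : 0 ≤ a - b := sub_nonneg.2 hab
  rw [abs_of_nonneg (sub_nonneg.2 (Real.exp_le_exp.2 hab)), abs_of_nonneg h0]
  by_cases h1 : a - b ≤ 1
  · have h2 : a - b ≤ Real.sqrt (a - b) := by
      refine Real.le_sqrt_of_sq_le ?_
      nlinarith
    have h3 : Real.exp a - Real.exp b ≤ (a - b) * Real.exp a := by
      have h4 := Real.add_one_le_exp (-(a - b))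
      have h5 : Real.exp b = Real.exp (-(a - b)) * Real.exp a := by
        rw [← Real.exp_add]; congr 1; ring
      rw [h5]
      nlinarith
    have h6 := Real.sqrt_nonneg (a - b)
    nlinarith [mul_le_mul_of_nonneg_right h2 ha.le, mul_nonneg h6 hb.le]
  · have h2 : 1 ≤ Real.sqrt (a - b) := Real.one_le_sqrt.2 (not_le.1 h1).le
    nlinarith

/-- The logarithm of the density of the Gaussian law with mean `v` and covariance `τ I`. -/
def gaussianLogDensity (τ : ℝ) (v x : E d) : ℝ :=
  -(d / 2 * Real.log (2 * Real.pi * τ)) - ‖x - v‖ ^ 2 / (2 * τ)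

lemma continuous_gaussianLogDensity (τ : ℝ) (v : E d) : Continuous (gaussianLogDensity τ v) := by
  unfold gaussianLogDensity
  fun_prop

lemma integral_exp_gaussianLogDensity_mul_cexp {τ : ℝ} (hτ : 0 < τ) (v t : E d) :
    ∫ x, (Real.exp (gaussianLogDensity τ v x) : ℂ) *
      Complex.exp (((inner ℝ x t : ℝ) : ℂ) * Complex.I) =
      Complex.exp (-((τ * ‖t‖ ^ 2 / 2 : ℝ) : ℂ)) *
        Complex.exp (((inner ℝ v t : ℝ) : ℂ) * Complex.I) := by
  have hπ := Real.pi_pos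
  have hb : 0 < (((2 * τ)⁻¹ : ℝ) : ℂ).re := by
    rw [Complex.ofReal_re]; positivity
  rw [← integral_add_left_eq_self _ v]
  have e1 : ∀ y : E d, (Real.exp (gaussianLogDensity τ v (v + y)) : ℂ) *
      Complex.exp (((inner ℝ (v + y) t : ℝ) : ℂ) * Complex.I) =
      ((Real.exp (-(d / 2 * Real.log (2 * Real.pi * τ))) : ℝ) : ℂ) *
        Complex.exp (((inner ℝ v t : ℝ) : ℂ) * Complex.I) *
        Complex.exp (-(((2 * τ)⁻¹ : ℝ) : ℂ) * ‖y‖ ^ 2 + Complex.I * ((inner ℝ t y : ℝ) : ℂ)) := by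
    intro y
    rw [gaussianLogDensity, add_sub_cancel_left, inner_add_left, real_inner_comm t y]
    simp only [Complex.ofReal_exp, ← Complex.exp_add]
    congr 1
    push_cast
    ring
  simp_rw [e1]
  rw [integral_const_mul, GaussianFourier.integral_cexp_neg_mul_sq_norm_add hb]
  have e2 : ((Real.pi : ℂ) / (((2 * τ)⁻¹ : ℝ) : ℂ)) ^ ((Module.finrank ℝ (E d) : ℂ) / 2) =
      ((Real.exp (d / 2 * Real.log (2 * Real.pi * τ)) : ℝ) : ℂ) := by
    rw [← Complex.ofReal_div, show Real.pi / (2 * τ)⁻¹ = 2 * Real.pi * τ by field_simp,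
      show ((Module.finrank ℝ (E d) : ℂ) / 2) = (((d / 2 : ℝ)) : ℂ) by simp,
      ← Complex.ofReal_cpow (by positivity), Real.rpow_def_of_pos (by positivity), mul_comm]
  rw [e2, Complex.I_sq]
  simp only [Complex.ofReal_exp, ← Complex.exp_add]
  congr 1
  push_cast
  field_simp
  ring

/-- The affine images of the standard Gaussian law have a density. -/
theorem map_stdGaussian_eq_withDensity {τ : ℝ} (hτ : 0 < τ) (v : E d) :
    (stdGaussian (E d)).map (fun e => v + Real.sqrt τ • e) =
      volume.withDensity fun x => ENNReal.ofReal (Real.exp (gaussianLogDensity τ v x)) := by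
  have hm : Measurable fun x => ENNReal.ofReal (Real.exp (gaussianLogDensity τ v x)) :=
    (Real.continuous_exp.comp (continuous_gaussianLogDensity τ v)).measurable.ennreal_ofReal
  have hfin : IsFiniteMeasure (volume.withDensity fun x =>
      ENNReal.ofReal (Real.exp (gaussianLogDensity τ v x))) := by
    have h1 := integral_exp_gaussianLogDensity_mul_cexp hτ v 0
    have h2 : Integrable (fun x => (Real.exp (gaussianLogDensity τ v x) : ℂ)) := by
      -- Without integrability the integral would have the default value `0`, whereas the Fourier
      -- formula at `0` gives an exponential.
      by_contra hc
      simp only [inner_zero_right, Complex.ofReal_zero, zero_mul, Complex.exp_zero, mul_one] at h1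
      rw [integral_undef hc] at h1
      exact Complex.exp_ne_zero _ h1.symm
    have h3 : Integrable (fun x => Real.exp (gaussianLogDensity τ v x)) := by
      simpa only [RCLike.re_to_complex, Complex.ofReal_re] using h2.re
    exact isFiniteMeasure_withDensity_ofReal h3.2
  have hmp : IsProbabilityMeasure ((stdGaussian (E d)).map (fun e => v + Real.sqrt τ • e)) :=
    Measure.isProbabilityMeasure_map (by fun_prop)
  refine Measure.ext_of_charFun (funext fun t => ?_)
  have h1 : (stdGaussian (E d)).map (fun e => v + Real.sqrt τ • e) =
      ((stdGaussian (E d)).map (fun e => Real.sqrt τ • e)).map (fun x => v + x) := by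
    rw [Measure.map_map (by fun_prop) (by fun_prop)]
    rfl
  rw [h1, charFun_map_const_add, charFun_map_smul, charFun_stdGaussian, charFun_apply,
    integral_withDensity_eq_integral_toReal_smul hm (ae_of_all _ fun _ => ENNReal.ofReal_lt_top)]
  have h2 := integral_exp_gaussianLogDensity_mul_cexp hτ v t
  simp only [ENNReal.toReal_ofReal (Real.exp_pos _).le, Complex.real_smul]
  rw [h2]
  congr 2
  rw [norm_smul, Real.norm_of_nonneg (Real.sqrt_nonneg _)]
  push_cast
  rw [mul_pow, ← Complex.ofReal_pow, Real.sq_sqrt hτ.le]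
  ring

/-- Comparison of expectations under two laws given by densities. -/
lemma abs_integral_sub_integral_withDensity_le {X : Type*} [MeasurableSpace X] {μ : Measure X}
    {l₁ l₂ g w : X → ℝ} {c R : ℝ} (h₁ : Measurable l₁) (h₂ : Measurable l₂) (hg : Measurable g)
    [IsProbabilityMeasure (μ.withDensity fun x => ENNReal.ofReal (Real.exp (l₁ x)))]
    [IsProbabilityMeasure (μ.withDensity fun x => ENNReal.ofReal (Real.exp (l₂ x)))]
    (hR : ∀ x, |g x| ≤ R) (hw : ∀ x, |g x - c| * Real.sqrt |l₁ x - l₂ x| ≤ w x)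
    (hw₁ : Integrable w (μ.withDensity fun x => ENNReal.ofReal (Real.exp (l₁ x))))
    (hw₂ : Integrable w (μ.withDensity fun x => ENNReal.ofReal (Real.exp (l₂ x)))) :
    |∫ x, g x ∂(μ.withDensity fun x => ENNReal.ofReal (Real.exp (l₁ x))) -
      ∫ x, g x ∂(μ.withDensity fun x => ENNReal.ofReal (Real.exp (l₂ x)))| ≤
      ∫ x, w x ∂(μ.withDensity fun x => ENNReal.ofReal (Real.exp (l₁ x))) +
      ∫ x, w x ∂(μ.withDensity fun x => ENNReal.ofReal (Real.exp (l₂ x))) := by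
  have e : ∀ {l : X → ℝ}, Measurable l → ∀ u : X → ℝ,
      ∫ x, u x ∂(μ.withDensity fun x => ENNReal.ofReal (Real.exp (l x))) =
        ∫ x, Real.exp (l x) * u x ∂μ := fun {l} hl u => by
    have hl' : Measurable fun x => ENNReal.ofReal (Real.exp (l x)) :=
      (Real.measurable_exp.comp hl).ennreal_ofReal
    rw [integral_withDensity_eq_integral_toReal_smul hl'
      (ae_of_all _ fun _ => ENNReal.ofReal_lt_top)]
    simp only [ENNReal.toReal_ofReal (Real.exp_pos _).le, smul_eq_mul]
  have i : ∀ {l : X → ℝ}, Measurable l → ∀ u : X → ℝ,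
      Integrable u (μ.withDensity fun x => ENNReal.ofReal (Real.exp (l x))) →
        Integrable (fun x => Real.exp (l x) * u x) μ := fun {l} hl u hu => by
    have := (integrable_withDensity_iff_integrable_smul' (Real.measurable_exp.comp hl).ennreal_ofReal
      (ae_of_all _ fun _ => ENNReal.ofReal_lt_top)).1 hu
    simpa only [ENNReal.toReal_ofReal (Real.exp_pos _).le, smul_eq_mul, Function.comp] using this
  have hgi : ∀ ρ : Measure X, IsProbabilityMeasure ρ → Integrable (fun x => g x - c) ρ ∧
      ∫ x, (g x - c) ∂ρ = ∫ x, g x ∂ρ - c := fun ρ _ => by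
    have h : Integrable g ρ :=
      (integrable_const R).mono' hg.aestronglyMeasurable (ae_of_all _ hR)
    refine ⟨h.sub (integrable_const c), ?_⟩
    rw [integral_sub h (integrable_const c)]
    simp
  obtain ⟨a1, a2⟩ := hgi (μ.withDensity fun x => ENNReal.ofReal (Real.exp (l₁ x))) inferInstance
  obtain ⟨b1, b2⟩ := hgi (μ.withDensity fun x => ENNReal.ofReal (Real.exp (l₂ x))) inferInstance
  rw [← sub_sub_sub_cancel_right _ _ c, ← a2, ← b2, e h₁, e h₂, e h₁, e h₂,
    ← integral_sub (i h₁ _ a1) (i h₂ _ b1), ← integral_add (i h₁ _ hw₁) (i h₂ _ hw₂)]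
  refine abs_integral_le_integral_abs.trans (integral_mono_of_nonneg
    (ae_of_all _ fun _ => abs_nonneg _) ((i h₁ _ hw₁).add (i h₂ _ hw₂)) (ae_of_all _ fun x => ?_))
  have h3 := abs_exp_sub_exp_le (l₁ x) (l₂ x)
  have h4 := hw x
  have h5 := Real.exp_pos (l₁ x)
  have h6 := Real.exp_pos (l₂ x)
  calc |Real.exp (l₁ x) * (g x - c) - Real.exp (l₂ x) * (g x - c)|
      = |g x - c| * |Real.exp (l₁ x) - Real.exp (l₂ x)| := by
        rw [← sub_mul, abs_mul, mul_comm]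
    _ ≤ |g x - c| * (Real.sqrt |l₁ x - l₂ x| * (Real.exp (l₁ x) + Real.exp (l₂ x))) := by
        gcongr
    _ = (|g x - c| * Real.sqrt |l₁ x - l₂ x|) * (Real.exp (l₁ x) + Real.exp (l₂ x)) := by ring
    _ ≤ w x * (Real.exp (l₁ x) + Real.exp (l₂ x)) := by gcongr
    _ = _ := by ring

/-- Comparison of expectations under two Gaussian laws. -/
lemma abs_integral_gaussian_sub_le {τ τ' : ℝ} (hτ : 0 < τ) (hτ' : 0 < τ') (v v' : E d)
    {g w : E d → ℝ} {c R : ℝ} (hg : Measurable g) (hwm : Measurable w) (hR : ∀ x, |g x| ≤ R)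
    (hw : ∀ x, |g x - c| *
      Real.sqrt |gaussianLogDensity τ v x - gaussianLogDensity τ' v' x| ≤ w x)
    (hw₁ : Integrable (fun e => w (v + Real.sqrt τ • e)) (stdGaussian (E d)))
    (hw₂ : Integrable (fun e => w (v' + Real.sqrt τ' • e)) (stdGaussian (E d))) :
    |∫ e, g (v + Real.sqrt τ • e) ∂(stdGaussian (E d)) -
      ∫ e, g (v' + Real.sqrt τ' • e) ∂(stdGaussian (E d))| ≤
      ∫ e, w (v + Real.sqrt τ • e) ∂(stdGaussian (E d)) +
      ∫ e, w (v' + Real.sqrt τ' • e) ∂(stdGaussian (E d)) := by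
  have hm : ∀ (τ : ℝ) (v : E d), Measurable fun e : E d => v + Real.sqrt τ • e := fun τ v => by
    fun_prop
  have e1 : ∀ (τ : ℝ) (v : E d) {u : E d → ℝ}, Measurable u →
      ∫ e, u (v + Real.sqrt τ • e) ∂(stdGaussian (E d)) =
        ∫ x, u x ∂((stdGaussian (E d)).map fun e => v + Real.sqrt τ • e) := fun τ v u hu =>
    (integral_map (hm τ v).aemeasurable hu.aestronglyMeasurable).symm
  have j1 := (integrable_map_measure hwm.aestronglyMeasurable (hm τ v).aemeasurable).2 hw₁
  have j2 := (integrable_map_measure hwm.aestronglyMeasurable (hm τ' v').aemeasurable).2 hw₂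
  have p1 : IsProbabilityMeasure ((stdGaussian (E d)).map fun e => v + Real.sqrt τ • e) :=
    Measure.isProbabilityMeasure_map (hm τ v).aemeasurable
  have p2 : IsProbabilityMeasure ((stdGaussian (E d)).map fun e => v' + Real.sqrt τ' • e) :=
    Measure.isProbabilityMeasure_map (hm τ' v').aemeasurable
  rw [e1 τ v hg, e1 τ' v' hg, e1 τ v hwm, e1 τ' v' hwm]
  rw [map_stdGaussian_eq_withDensity hτ] at *
  rw [map_stdGaussian_eq_withDensity hτ'] at *
  exact abs_integral_sub_integral_withDensity_le
    (continuous_gaussianLogDensity τ v).measurable (continuous_gaussianLogDensity τ' v').measurable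
    hg hR hw j1 j2

/-- The Gaussian laws with bounded parameters have a common part on the unit ball. -/
lemma exists_smul_volume_le_map_stdGaussian (d : ℕ) {τ₀ : ℝ} (hτ₀ : 0 < τ₀) (τ₁ R : ℝ) :
    ∃ p : ℝ, 0 < p ∧ ∀ (τ : ℝ) (v : E d), τ₀ ≤ τ → τ ≤ τ₁ → ‖v‖ ≤ R →
      ENNReal.ofReal p • volume.restrict (Metric.closedBall (0 : E d) 1) ≤
        (stdGaussian (E d)).map fun e => v + Real.sqrt τ • e := by
  -- A lower bound for the density on the unit ball: the normalisation of the largest variance, with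
  -- the exponent of the smallest variance at the largest distance `1 + R`.
  refine ⟨Real.exp (-(d / 2 * Real.log (2 * Real.pi * τ₁)) - (1 + R) ^ 2 / (2 * τ₀)),
    Real.exp_pos _, fun τ v h0 h1 hv => ?_⟩
  have hτ : 0 < τ := hτ₀.trans_le h0
  have hπ := Real.pi_pos
  rw [map_stdGaussian_eq_withDensity hτ, ← withDensity_const]
  refine Measure.le_iff.2 fun B hB => ?_
  rw [withDensity_apply _ hB, withDensity_apply _ hB, Measure.restrict_restrict hB]
  refine (setLIntegral_mono' (hB.inter Metric.isClosed_closedBall.measurableSet)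
    fun x hx => ?_).trans (lintegral_mono_set Set.inter_subset_left)
  refine ENNReal.ofReal_le_ofReal (Real.exp_le_exp.2 ?_)
  unfold gaussianLogDensity
  have hx1 : ‖x‖ ≤ 1 := by simpa using hx.2
  have h2 : ‖x - v‖ ≤ 1 + R := (norm_sub_le _ _).trans (add_le_add hx1 hv)
  have h3 : Real.log (2 * Real.pi * τ) ≤ Real.log (2 * Real.pi * τ₁) :=
    Real.log_le_log (by positivity) (by gcongr)
  gcongr

/-- The dependence of the Gaussian log-density of one step on the step size. -/
lemma abs_gaussianLogDensity_sub_le {τ₀ Δ₀ Δ₁ Δ Δ' : ℝ} (hτ₀ : 0 < τ₀) (hΔ₀ : 0 < Δ₀)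
    (h0 : Δ₀ ≤ Δ) (h0' : Δ₀ ≤ Δ') (h1 : Δ ≤ Δ₁) (h1' : Δ' ≤ Δ₁) (θ G x : E d) :
    |gaussianLogDensity (τ₀ * Δ) (θ - Δ • G) x - gaussianLogDensity (τ₀ * Δ') (θ - Δ' • G) x| ≤
      (d / (2 * Δ₀) + (1 + Δ₁) ^ 2 / (2 * τ₀ * Δ₀ ^ 2) + (1 + Δ₁) / (τ₀ * Δ₀)) *
        |Δ - Δ'| * (1 + ‖G‖ + ‖x - θ‖) ^ 2 := by
  have hΔ : 0 < Δ := hΔ₀.trans_le h0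
  have hΔ' : 0 < Δ' := hΔ₀.trans_le h0'
  have hΔ₁ : 0 < Δ₁ := hΔ.trans_le h1
  have hπ := Real.pi_pos
  set X := 1 + ‖G‖ + ‖x - θ‖ with hX
  have hX1 : 1 ≤ X := by
    have := norm_nonneg G
    have := norm_nonneg (x - θ)
    rw [hX]; linarith
  have hX0 : 0 ≤ X := by linarith
  have hGX : ‖G‖ ≤ X := by
    have := norm_nonneg (x - θ)
    rw [hX]; linarith
  have hn : ∀ D, 0 < D → D ≤ Δ₁ → ‖x - (θ - D • G)‖ ≤ (1 + Δ₁) * X := fun D hD hD1 => by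
    have e : x - (θ - D • G) = (x - θ) + D • G := by abel
    have e1 := norm_add_le (x - θ) (D • G)
    rw [norm_smul, Real.norm_of_nonneg hD.le] at e1
    have e2 : ‖x - θ‖ ≤ X := by
      have := norm_nonneg G
      rw [hX]; linarith
    have e3 : D * ‖G‖ ≤ Δ₁ * X := by gcongr
    rw [e]
    linarith
  have n1 := hn Δ hΔ h1
  have n2 := hn Δ' hΔ' h1'
  set u := ‖x - (θ - Δ • G)‖ with hu
  set u' := ‖x - (θ - Δ' • G)‖ with hu'
  have hu0 : 0 ≤ u := norm_nonneg _
  have hu0' : 0 ≤ u' := norm_nonneg _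
  have huu : |u - u'| ≤ |Δ - Δ'| * X := by
    refine (abs_norm_sub_norm_le _ _).trans ?_
    have e : x - (θ - Δ • G) - (x - (θ - Δ' • G)) = (Δ - Δ') • G := by
      rw [sub_smul]; abel
    rw [e, norm_smul, Real.norm_eq_abs]
    gcongr
  have hlog : |Real.log (2 * Real.pi * (τ₀ * Δ)) - Real.log (2 * Real.pi * (τ₀ * Δ'))| ≤
      |Δ - Δ'| / Δ₀ := by
    have key : ∀ a b : ℝ, Δ₀ ≤ a → Δ₀ ≤ b → Real.log (2 * Real.pi * (τ₀ * a)) -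
        Real.log (2 * Real.pi * (τ₀ * b)) ≤ |a - b| / Δ₀ := fun a b ha hb => by
      have ha0 : 0 < a := hΔ₀.trans_le ha
      have hb0 : 0 < b := hΔ₀.trans_le hb
      rw [← Real.log_div (by positivity) (by positivity)]
      have e : 2 * Real.pi * (τ₀ * a) / (2 * Real.pi * (τ₀ * b)) = a / b := by
        field_simp
      rw [e]
      refine (Real.log_le_sub_one_of_pos (by positivity)).trans ?_
      rw [div_sub_one hb0.ne']
      exact (div_le_div_of_nonneg_right (le_abs_self _) hb0.le).trans
        (div_le_div_of_nonneg_left (abs_nonneg _) hΔ₀ hb)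
    refine abs_le.2 ⟨?_, key _ _ h0 h0'⟩
    have := key _ _ h0' h0
    rw [abs_sub_comm] at this
    linarith
  have hquad : |u ^ 2 / (2 * (τ₀ * Δ)) - u' ^ 2 / (2 * (τ₀ * Δ'))| ≤
      (1 + Δ₁) ^ 2 / (2 * τ₀ * Δ₀ ^ 2) * |Δ - Δ'| * X ^ 2 +
        (1 + Δ₁) / (τ₀ * Δ₀) * |Δ - Δ'| * X ^ 2 := by
    -- Separates the change of the variance from the change of the mean.
    have e : u ^ 2 / (2 * (τ₀ * Δ)) - u' ^ 2 / (2 * (τ₀ * Δ')) =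
        u ^ 2 * (Δ' - Δ) / (2 * τ₀ * (Δ * Δ')) + (u - u') * (u + u') / (2 * τ₀ * Δ') := by
      field_simp
      ring
    rw [e]
    refine (abs_add_le _ _).trans (add_le_add ?_ ?_)
    · rw [abs_div, abs_mul, abs_of_nonneg (sq_nonneg u), abs_sub_comm Δ',
        abs_of_pos (show 0 < 2 * τ₀ * (Δ * Δ') by positivity)]
      have e1 : u ^ 2 ≤ (1 + Δ₁) ^ 2 * X ^ 2 := by rw [← mul_pow]; gcongr
      have e2 : Δ₀ ^ 2 ≤ Δ * Δ' := by rw [sq]; gcongr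
      calc u ^ 2 * |Δ - Δ'| / (2 * τ₀ * (Δ * Δ'))
          ≤ (1 + Δ₁) ^ 2 * X ^ 2 * |Δ - Δ'| / (2 * τ₀ * Δ₀ ^ 2) := by gcongr
        _ = _ := by ring
    · rw [abs_div, abs_mul, abs_of_nonneg (add_nonneg hu0 hu0'),
        abs_of_pos (show 0 < 2 * τ₀ * Δ' by positivity)]
      calc |u - u'| * (u + u') / (2 * τ₀ * Δ')
          ≤ (|Δ - Δ'| * X) * ((1 + Δ₁) * X + (1 + Δ₁) * X) / (2 * τ₀ * Δ₀) := by gcongr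
        _ = _ := by field_simp; ring
  have hX2 : 1 ≤ X ^ 2 := one_le_pow₀ hX1
  unfold gaussianLogDensity
  rw [← hu, ← hu']
  have e : -(d / 2 * Real.log (2 * Real.pi * (τ₀ * Δ))) - u ^ 2 / (2 * (τ₀ * Δ)) -
      (-(d / 2 * Real.log (2 * Real.pi * (τ₀ * Δ'))) - u' ^ 2 / (2 * (τ₀ * Δ'))) =
      -(d / 2 * (Real.log (2 * Real.pi * (τ₀ * Δ)) - Real.log (2 * Real.pi * (τ₀ * Δ')))) -
        (u ^ 2 / (2 * (τ₀ * Δ)) - u' ^ 2 / (2 * (τ₀ * Δ'))) := by ring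
  rw [e]
  refine (abs_sub _ _).trans ?_
  rw [abs_neg, abs_mul, abs_of_nonneg (show (0 : ℝ) ≤ d / 2 by positivity)]
  calc _ ≤ (d / 2 : ℝ) * (|Δ - Δ'| / Δ₀) * X ^ 2 +
        ((1 + Δ₁) ^ 2 / (2 * τ₀ * Δ₀ ^ 2) * |Δ - Δ'| * X ^ 2 +
        (1 + Δ₁) / (τ₀ * Δ₀) * |Δ - Δ'| * X ^ 2) := by
        refine add_le_add ?_ hquad
        refine le_trans ?_ (le_mul_of_one_le_right (by positivity) hX2)
        gcongr
    _ = _ := by ring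

end SASGLD
end

/-! ### The transition kernel and its energy. -/

noncomputable section

namespace SASGLD

variable {d : ℕ}

lemma integrable_norm_add_smul_sq (u : E d) (t : ℝ) :
    Integrable (fun e : E d => ‖u + t • e‖ ^ 2) (stdGaussian (E d)) := by
  have h := (integrable_norm_pow_stdGaussian (d := d) 2).const_mul (2 * t ^ 2)
  refine ((integrable_const (2 * ‖u‖ ^ 2)).add h).mono' (by fun_prop) (ae_of_all _ fun e => ?_)
  rw [Real.norm_of_nonneg (sq_nonneg _)]
  have h1 := norm_add_le u (t • e)
  rw [norm_smul, Real.norm_eq_abs] at h1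
  have h2 : ‖u + t • e‖ ^ 2 ≤ (‖u‖ + |t| * ‖e‖) ^ 2 := by gcongr
  simp only [Pi.add_apply]
  have h3 := sq_abs t
  nlinarith [sq_nonneg (‖u‖ - |t| * ‖e‖)]

/-- Symmetry of the Gaussian law and the parallelogram identity eliminate the cross term. -/
lemma integral_norm_add_smul_sq (u : E d) (t : ℝ) :
    ∫ e : E d, ‖u + t • e‖ ^ 2 ∂(stdGaussian (E d)) =
      ‖u‖ ^ 2 + t ^ 2 * ∫ e : E d, ‖e‖ ^ 2 ∂(stdGaussian (E d)) := by
  have h1 : ∫ e : E d, ‖u + t • e‖ ^ 2 ∂(stdGaussian (E d)) =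
      ∫ e : E d, ‖u + (-t) • e‖ ^ 2 ∂(stdGaussian (E d)) := by
    conv_lhs => rw [← map_neg_stdGaussian]
    rw [integral_map (by fun_prop) (by fun_prop)]
    simp
  have h2 : ∀ e : E d, ‖u + t • e‖ ^ 2 + ‖u + (-t) • e‖ ^ 2 =
      2 * ‖u‖ ^ 2 + 2 * t ^ 2 * ‖e‖ ^ 2 := fun e => by
    have := parallelogram_law_with_norm ℝ u (t • e)
    rw [norm_smul, Real.norm_eq_abs] at this
    rw [neg_smul, ← sub_eq_add_neg]
    have h3 := sq_abs t
    linear_combination this + 2 * ‖e‖ ^ 2 * h3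
  have h3 : 2 * ∫ e : E d, ‖u + t • e‖ ^ 2 ∂(stdGaussian (E d)) =
      ∫ e : E d, (‖u + t • e‖ ^ 2 + ‖u + (-t) • e‖ ^ 2) ∂(stdGaussian (E d)) := by
    rw [integral_add (integrable_norm_add_smul_sq u t) (integrable_norm_add_smul_sq u (-t)), ← h1]
    ring
  simp_rw [h2] at h3
  rw [integral_add (integrable_const _) ((integrable_norm_pow_stdGaussian 2).const_mul _),
    integral_const_mul (2 * t ^ 2) fun e : E d => ‖e‖ ^ 2] at h3
  simp only [integral_const, probReal_univ, smul_eq_mul, one_mul] at h3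
  linarith

/-- The transition mechanism of the algorithm for stochastic gradients with law `Q θ` at the
position `θ`, with its drift and moment bounds. -/
structure StepModel (d : ℕ) where
  /-- the law of the stochastic gradient -/
  Q : Kernel (E d) (E d)
  markov : IsMarkovKernel Q
  /-- the step size as a function of the state `ζ` -/
  size : ℝ → ℝ
  (ρ c δ τ₀ Δ₀ Δ₁ Lip A B₀ CG : ℝ)
  ρ_pos : 0 < ρ
  ρ_lt_one : ρ < 1
  c_pos : 0 < c
  δ_nonneg : 0 ≤ δ
  τ₀_pos : 0 < τ₀
  Δ₀_pos : 0 < Δ₀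
  Lip_nonneg : 0 ≤ Lip
  A_lt_one : A < 1
  B₀_pos : 0 < B₀
  CG_pos : 0 < CG
  le_size : ∀ z, Δ₀ ≤ size z
  size_le : ∀ z, size z ≤ Δ₁
  size_lipschitz : ∀ y z, |size y - size z| ≤ Lip * |y - z|
  integrable_sq : ∀ θ, Integrable (fun G => ‖G‖ ^ 2) (Q θ)
  integral_sq_le : ∀ θ, ∫ G, ‖G‖ ^ 2 ∂(Q θ) ≤ CG * (1 + ‖θ‖ ^ 2)
  -- The step size is an arbitrary function of the gradient between the two bounds, because the
  -- comparison of two states also needs moves whose size belongs to the other state.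
  drift : ∀ (θ : E d) (D : E d → ℝ), Measurable D → (∀ G, Δ₀ ≤ D G) → (∀ G, D G ≤ Δ₁) →
    ∫ G, ‖θ - D G • G‖ ^ 2 ∂(Q θ) ≤ A * ‖θ‖ ^ 2 + B₀

namespace StepModel

variable (M : StepModel d)

instance : IsMarkovKernel M.Q := M.markov

/-- The new state `ζ`. -/
def nextState (z : ℝ) (G : E d) : ℝ := M.ρ * z + M.c * (‖G‖ ^ 2 + M.δ)

/-- The new position for the step size `Δ`, stochastic gradient `G` and noise `e`. -/
def move (θ : E d) (Δ : ℝ) (G e : E d) : E d := (θ - Δ • G) + Real.sqrt (M.τ₀ * Δ) • e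

/-- One step of the algorithm. -/
def update (x : E d × ℝ) (w : E d × E d) : E d × ℝ :=
  (M.move x.1 (M.size (M.nextState x.2 w.1)) w.1 w.2, M.nextState x.2 w.1)

lemma continuous_size : Continuous M.size := by
  have h1 : LipschitzWith ⟨M.Lip, M.Lip_nonneg⟩ M.size :=
    LipschitzWith.of_dist_le_mul fun x y => M.size_lipschitz x y
  exact h1.continuous

lemma Δ₁_pos : 0 < M.Δ₁ := M.Δ₀_pos.trans_le ((M.le_size 0).trans (M.size_le 0))

lemma size_pos (z : ℝ) : 0 < M.size z := M.Δ₀_pos.trans_le (M.le_size z)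

lemma continuous_nextState : Continuous fun p : ℝ × E d => M.nextState p.1 p.2 := by
  unfold nextState
  fun_prop

lemma continuous_move :
    Continuous fun p : E d × ℝ × E d × E d => M.move p.1 p.2.1 p.2.2.1 p.2.2.2 := by
  unfold move
  fun_prop

lemma continuous_update : Continuous fun p : (E d × ℝ) × (E d × E d) => M.update p.1 p.2 := by
  have h1 : Continuous fun p : (E d × ℝ) × (E d × E d) => M.nextState p.1.2 p.2.1 :=
    M.continuous_nextState.comp (by fun_prop :
      Continuous fun p : (E d × ℝ) × (E d × E d) => (p.1.2, p.2.1))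
  have h2 := M.continuous_size.comp h1
  exact (M.continuous_move.comp ((continuous_fst.comp continuous_fst).prodMk
    (h2.prodMk ((continuous_fst.comp continuous_snd).prodMk
      (continuous_snd.comp continuous_snd))))).prodMk h1

lemma measurable_update : Measurable fun p : (E d × ℝ) × (E d × E d) => M.update p.1 p.2 :=
  M.continuous_update.measurable

/-- The transition kernel of the pair `(θ, ζ)`. -/
def kernel : Kernel (E d × ℝ) (E d × ℝ) :=
  (Kernel.id ×ₖ (M.Q.comap Prod.fst measurable_fst ×ₖ
    Kernel.const (E d × ℝ) (stdGaussian (E d)))).map fun p => M.update p.1 p.2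

instance : IsMarkovKernel M.kernel := Kernel.IsMarkovKernel.map _ M.measurable_update

lemma kernel_apply (x : E d × ℝ) :
    M.kernel x = ((M.Q x.1).prod (stdGaussian (E d))).map (M.update x) := by
  rw [kernel, Kernel.map_apply _ M.measurable_update, Kernel.prod_apply, Kernel.prod_apply,
    Kernel.id_apply, Kernel.comap_apply, Kernel.const_apply, Measure.dirac_prod,
    Measure.map_map M.measurable_update (by fun_prop)]
  rfl

lemma integral_kernel (x : E d × ℝ) {g : E d × ℝ → ℝ} (hg : Measurable g) :
    ∫ y, g y ∂(M.kernel x) =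
      ∫ w, g (M.update x w) ∂((M.Q x.1).prod (stdGaussian (E d))) := by
  have hm : Measurable (M.update x) := M.measurable_update.comp measurable_prodMk_left
  rw [kernel_apply, integral_map hm.aemeasurable hg.aestronglyMeasurable]

/-- The weight of the state `ζ` in the Lyapunov function. -/
def weight : ℝ := (1 - M.A) / (2 * M.c * M.CG)

/-- The quadratic Lyapunov function. -/
def energy (x : E d × ℝ) : ℝ := ‖x.1‖ ^ 2 + M.weight * |x.2|

/-- The contraction rate of the energy. -/
def rate : ℝ := max ((1 + M.A) / 2) M.ρ

/-- The additive constant in the drift condition for the energy. -/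
def driftConst : ℝ := M.B₀ + M.τ₀ * M.Δ₁ * (∫ e : E d, ‖e‖ ^ 2 ∂(stdGaussian (E d))) +
  M.weight * M.c * (M.CG + M.δ)

lemma weight_pos : 0 < M.weight :=
  div_pos (sub_pos.2 M.A_lt_one) (mul_pos (mul_pos two_pos M.c_pos) M.CG_pos)

/-- The weight is chosen so that the gradient term in the new state `ζ` uses up exactly half of the
contraction `1 - A` of the position. -/
lemma weight_mul : M.weight * M.c * M.CG = (1 - M.A) / 2 := by
  have := M.c_pos
  have := M.CG_pos
  unfold weight
  field_simp

lemma energy_nonneg (x : E d × ℝ) : 0 ≤ M.energy x := by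
  have := M.weight_pos
  unfold energy
  positivity

lemma norm_sq_le_energy (x : E d × ℝ) : ‖x.1‖ ^ 2 ≤ M.energy x := by
  have := M.weight_pos
  have : 0 ≤ M.weight * |x.2| := by positivity
  unfold energy
  linarith

lemma measurable_energy : Measurable M.energy := by
  unfold energy
  fun_prop

lemma rate_nonneg : 0 ≤ M.rate := le_max_of_le_right M.ρ_pos.le

lemma rate_lt_one : M.rate < 1 := max_lt (by linarith [M.A_lt_one]) M.ρ_lt_one

lemma driftConst_pos : 0 < M.driftConst := by
  have h1 := M.B₀_pos
  have h2 := M.τ₀_pos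
  have h3 := M.Δ₁_pos
  have h4 := M.weight_pos
  have h5 := M.c_pos
  have h6 := M.CG_pos
  have h7 := M.δ_nonneg
  have h8 : 0 ≤ ∫ e : E d, ‖e‖ ^ 2 ∂(stdGaussian (E d)) := integral_nonneg fun _ => sq_nonneg _
  unfold driftConst
  positivity

lemma measurable_move {D : E d → ℝ} (hD : Measurable D) (θ : E d) :
    Measurable fun w : E d × E d => M.move θ (D w.1) w.1 w.2 :=
  M.continuous_move.measurable.comp (measurable_const.prodMk
    ((hD.comp measurable_fst).prodMk (measurable_fst.prodMk measurable_snd)))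

lemma integrable_norm_move_sq (θ : E d) {D : E d → ℝ} (hD : Measurable D)
    (h0 : ∀ G, M.Δ₀ ≤ D G) (h1 : ∀ G, D G ≤ M.Δ₁) :
    Integrable (fun w : E d × E d => ‖M.move θ (D w.1) w.1 w.2‖ ^ 2)
      ((M.Q θ).prod (stdGaussian (E d))) ∧
    ∫ w : E d × E d, ‖M.move θ (D w.1) w.1 w.2‖ ^ 2 ∂((M.Q θ).prod (stdGaussian (E d))) ≤
      M.A * ‖θ‖ ^ 2 + (M.B₀ + M.τ₀ * M.Δ₁ * (∫ e : E d, ‖e‖ ^ 2 ∂(stdGaussian (E d)))) := by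
  have hτ := M.τ₀_pos
  have hΔ₁ := M.Δ₁_pos
  have hD0 : ∀ G, 0 < D G := fun G => M.Δ₀_pos.trans_le (h0 G)
  have i1 : Integrable (fun w : E d × E d => ‖w.1‖ ^ 2) ((M.Q θ).prod (stdGaussian (E d))) :=
    (M.integrable_sq θ).comp_fst _
  have i2 : Integrable (fun w : E d × E d => ‖w.2‖ ^ 2) ((M.Q θ).prod (stdGaussian (E d))) :=
    (integrable_norm_pow_stdGaussian (d := d) 2).comp_snd _
  have hi : Integrable (fun w : E d × E d => ‖M.move θ (D w.1) w.1 w.2‖ ^ 2)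
      ((M.Q θ).prod (stdGaussian (E d))) := by
    refine (((integrable_const (3 * ‖θ‖ ^ 2)).add (i1.const_mul (3 * M.Δ₁ ^ 2))).add
      (i2.const_mul (3 * (M.τ₀ * M.Δ₁)))).mono'
      ((M.measurable_move hD θ).norm.pow_const 2).aestronglyMeasurable (ae_of_all _ fun w => ?_)
    rw [Real.norm_of_nonneg (sq_nonneg _)]
    have e1 : ‖M.move θ (D w.1) w.1 w.2‖ ≤
        ‖θ‖ + M.Δ₁ * ‖w.1‖ + Real.sqrt (M.τ₀ * M.Δ₁) * ‖w.2‖ := by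
      unfold move
      refine (norm_add_le _ _).trans (add_le_add ((norm_sub_le _ _).trans ?_) ?_)
      · rw [norm_smul, Real.norm_of_nonneg (hD0 _).le]
        gcongr
        exact h1 _
      · rw [norm_smul, Real.norm_of_nonneg (Real.sqrt_nonneg _)]
        gcongr
        exact h1 _
    have e2 : ‖M.move θ (D w.1) w.1 w.2‖ ^ 2 ≤
        (‖θ‖ + M.Δ₁ * ‖w.1‖ + Real.sqrt (M.τ₀ * M.Δ₁) * ‖w.2‖) ^ 2 := by gcongr
    have e3 := Real.sq_sqrt (show 0 ≤ M.τ₀ * M.Δ₁ by positivity)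
    simp only [Pi.add_apply]
    rw [← e3]
    nlinarith [sq_nonneg (‖θ‖ - M.Δ₁ * ‖w.1‖), sq_nonneg (‖θ‖ - Real.sqrt (M.τ₀ * M.Δ₁) * ‖w.2‖),
      sq_nonneg (M.Δ₁ * ‖w.1‖ - Real.sqrt (M.τ₀ * M.Δ₁) * ‖w.2‖)]
  refine ⟨hi, ?_⟩
  rw [integral_prod _ hi]
  set Ce := ∫ e : E d, ‖e‖ ^ 2 ∂(stdGaussian (E d)) with hCe
  have hCe0 : 0 ≤ Ce := integral_nonneg fun _ => sq_nonneg _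
  have j1 : Integrable (fun G : E d => ‖θ - D G • G‖ ^ 2) (M.Q θ) := by
    refine ((integrable_const (2 * ‖θ‖ ^ 2)).add ((M.integrable_sq θ).const_mul
      (2 * M.Δ₁ ^ 2))).mono' (Measurable.aestronglyMeasurable (by fun_prop))
      (ae_of_all _ fun G => ?_)
    rw [Real.norm_of_nonneg (sq_nonneg _)]
    have e1 : ‖θ - D G • G‖ ≤ ‖θ‖ + M.Δ₁ * ‖G‖ := by
      refine (norm_sub_le _ _).trans ?_
      rw [norm_smul, Real.norm_of_nonneg (hD0 _).le]
      gcongr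
      exact h1 _
    have e2 : ‖θ - D G • G‖ ^ 2 ≤ (‖θ‖ + M.Δ₁ * ‖G‖) ^ 2 := by gcongr
    simp only [Pi.add_apply]
    nlinarith [sq_nonneg (‖θ‖ - M.Δ₁ * ‖G‖)]
  calc ∫ G, ∫ e, ‖M.move θ (D G) G e‖ ^ 2 ∂(stdGaussian (E d)) ∂(M.Q θ)
      ≤ ∫ G, (‖θ - D G • G‖ ^ 2 + M.τ₀ * M.Δ₁ * Ce) ∂(M.Q θ) := by
        refine integral_mono hi.integral_prod_left (j1.add (integrable_const _)) fun G => ?_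
        simp only [move]
        rw [integral_norm_add_smul_sq, Real.sq_sqrt (mul_nonneg hτ.le (hD0 G).le)]
        have := h1 G
        gcongr
    _ = ∫ G, ‖θ - D G • G‖ ^ 2 ∂(M.Q θ) + M.τ₀ * M.Δ₁ * Ce := by
        rw [integral_add j1 (integrable_const _)]
        simp
    _ ≤ _ := by linarith [M.drift θ D hD h0 h1]

/-- The drift condition for the energy. The step sizes may belong to another state than `z`. -/
lemma integral_energy_le (θ : E d) (z : ℝ) {D : E d → ℝ} (hD : Measurable D)
    (h0 : ∀ G, M.Δ₀ ≤ D G) (h1 : ∀ G, D G ≤ M.Δ₁) :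
    Integrable (fun w : E d × E d => M.energy (M.move θ (D w.1) w.1 w.2, M.nextState z w.1))
      ((M.Q θ).prod (stdGaussian (E d))) ∧
    ∫ w : E d × E d, M.energy (M.move θ (D w.1) w.1 w.2, M.nextState z w.1)
      ∂((M.Q θ).prod (stdGaussian (E d))) ≤ M.rate * M.energy (θ, z) + M.driftConst := by
  obtain ⟨i1, i1'⟩ := M.integrable_norm_move_sq θ hD h0 h1
  have hw := M.weight_pos
  have hρ := M.ρ_pos
  have hc := M.c_pos
  have hδ := M.δ_nonneg
  have i2 : Integrable (fun w : E d × E d => ‖w.1‖ ^ 2) ((M.Q θ).prod (stdGaussian (E d))) :=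
    (M.integrable_sq θ).comp_fst _
  have i2' : ∫ w : E d × E d, ‖w.1‖ ^ 2 ∂((M.Q θ).prod (stdGaussian (E d))) ≤
      M.CG * (1 + ‖θ‖ ^ 2) := by
    rw [integral_fun_fst (fun G : E d => ‖G‖ ^ 2)]
    simpa using M.integral_sq_le θ
  set b : E d × E d → ℝ := fun w => ‖M.move θ (D w.1) w.1 w.2‖ ^ 2 +
    (M.weight * M.c * ‖w.1‖ ^ 2 + M.weight * (M.ρ * |z| + M.c * M.δ)) with hb
  have ib2 : Integrable (fun w : E d × E d => M.weight * M.c * ‖w.1‖ ^ 2 +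
      M.weight * (M.ρ * |z| + M.c * M.δ)) ((M.Q θ).prod (stdGaussian (E d))) :=
    (i2.const_mul _).add (integrable_const _)
  have ib : Integrable b ((M.Q θ).prod (stdGaussian (E d))) := i1.add ib2
  have hle : ∀ w : E d × E d,
      M.energy (M.move θ (D w.1) w.1 w.2, M.nextState z w.1) ≤ b w := fun w => by
    simp only [energy, hb, nextState]
    have e1 : |M.ρ * z + M.c * (‖w.1‖ ^ 2 + M.δ)| ≤ M.ρ * |z| + M.c * (‖w.1‖ ^ 2 + M.δ) := by
      refine (abs_add_le _ _).trans ?_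
      rw [abs_mul, abs_of_pos hρ, abs_of_nonneg (show 0 ≤ M.c * (‖w.1‖ ^ 2 + M.δ) by positivity)]
    have e2 := mul_le_mul_of_nonneg_left e1 hw.le
    linarith
  have hm : Measurable fun w : E d × E d =>
      M.energy (M.move θ (D w.1) w.1 w.2, M.nextState z w.1) :=
    M.measurable_energy.comp ((M.measurable_move hD θ).prodMk
      (M.continuous_nextState.measurable.comp (measurable_const.prodMk measurable_fst)))
  have hi := ib.mono' hm.aestronglyMeasurable (ae_of_all _ fun w => by
    rw [Real.norm_of_nonneg (M.energy_nonneg _)]; exact hle w)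
  refine ⟨hi, (integral_mono hi ib hle).trans ?_⟩
  rw [hb, integral_add i1 ib2, integral_add (i2.const_mul _) (integrable_const _),
    integral_const_mul]
  simp only [integral_const, probReal_univ, smul_eq_mul, one_mul]
  have h2 := mul_le_mul_of_nonneg_left i2' (mul_pos hw hc).le
  have h3 := M.weight_mul
  have h4 : M.weight * M.c * (M.CG * (1 + ‖θ‖ ^ 2)) = (1 - M.A) / 2 * ‖θ‖ ^ 2 +
      M.weight * M.c * M.CG := by
    linear_combination ‖θ‖ ^ 2 * h3
  have h5 : (1 + M.A) / 2 * ‖θ‖ ^ 2 ≤ M.rate * ‖θ‖ ^ 2 := by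
    gcongr; exact le_max_left _ _
  have h6 : M.ρ * (M.weight * |z|) ≤ M.rate * (M.weight * |z|) := by
    gcongr; exact le_max_right _ _
  simp only [energy, driftConst]
  linarith

/-- Jensen's inequality for the square root in its tangent form `√E ≤ E / (2 t) + t / 2`, with `t ^
2` the bound for the mean energy. The root, rather than the energy, serves as Lyapunov function, so
that products with another factor of linear growth remain integrable. -/
lemma integrable_sqrt_energy (x : E d × ℝ) :
    Integrable (fun y => Real.sqrt (M.energy y)) (M.kernel x) ∧
      ∫ y, Real.sqrt (M.energy y) ∂(M.kernel x) ≤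
        Real.sqrt M.rate * Real.sqrt (M.energy x) + Real.sqrt M.driftConst := by
  have hm : Measurable fun y => Real.sqrt (M.energy y) := M.measurable_energy.sqrt
  have hD : Measurable fun G : E d => M.size (M.nextState x.2 G) :=
    M.continuous_size.measurable.comp
      (M.continuous_nextState.measurable.comp (measurable_const.prodMk measurable_id))
  obtain ⟨i1, i1'⟩ := M.integral_energy_le x.1 x.2 hD (fun G => M.le_size _)
    (fun G => M.size_le _)
  set t := Real.sqrt (M.rate * M.energy x + M.driftConst) with ht
  have hr := M.rate_nonneg
  have hE := M.energy_nonneg x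
  have hK := M.driftConst_pos
  have hpos : 0 < M.rate * M.energy x + M.driftConst := by positivity
  have ht0 : 0 < t := Real.sqrt_pos.2 hpos
  have ht2 : t ^ 2 = M.rate * M.energy x + M.driftConst := Real.sq_sqrt hpos.le
  have hle : ∀ y, Real.sqrt (M.energy y) ≤ M.energy y / (2 * t) + t / 2 := fun y => by
    have h1 := Real.sq_sqrt (M.energy_nonneg y)
    have h2 : M.energy y / (2 * t) + t / 2 = (M.energy y + t ^ 2) / (2 * t) := by
      field_simp
    rw [h2, le_div_iff₀ (by positivity)]
    nlinarith [sq_nonneg (Real.sqrt (M.energy y) - t)]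
  have i2 : Integrable (fun y => M.energy y / (2 * t) + t / 2) (M.kernel x) := by
    refine Integrable.add (Integrable.div_const ?_ _) (integrable_const _)
    rw [kernel_apply]
    exact (integrable_map_measure M.measurable_energy.aestronglyMeasurable
      (M.measurable_update.comp measurable_prodMk_left).aemeasurable).2 i1
  have i3 := i2.mono' hm.aestronglyMeasurable (ae_of_all _ fun y => by
    rw [Real.norm_of_nonneg (Real.sqrt_nonneg _)]; exact hle y)
  refine ⟨i3, (integral_mono i3 i2 hle).trans ?_⟩
  have h3 : ∫ y, M.energy y ∂(M.kernel x) ≤ t ^ 2 := by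
    rw [M.integral_kernel x M.measurable_energy, ht2]
    exact i1'
  rw [integral_add (Integrable.div_const (by
    rw [kernel_apply]
    exact (integrable_map_measure M.measurable_energy.aestronglyMeasurable
      (M.measurable_update.comp measurable_prodMk_left).aemeasurable).2 i1) _) (integrable_const _),
    integral_div]
  simp only [integral_const, probReal_univ, smul_eq_mul, one_mul]
  have h4 : (∫ y, M.energy y ∂(M.kernel x)) / (2 * t) ≤ t / 2 := by
    rw [div_le_iff₀ (by positivity)]
    nlinarith
  have h5 : t ≤ Real.sqrt M.rate * Real.sqrt (M.energy x) + Real.sqrt M.driftConst := by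
    rw [← Real.sqrt_mul hr]
    refine Real.sqrt_le_iff.2 ⟨by positivity, ?_⟩
    have h6 := Real.sq_sqrt (mul_nonneg hr hE)
    have h7 := Real.sq_sqrt hK.le
    have h8 := mul_nonneg (Real.sqrt_nonneg (M.rate * M.energy x)) (Real.sqrt_nonneg M.driftConst)
    nlinarith
  linarith

end StepModel

end SASGLD
end

/-! ### The smoothing inequality. -/

noncomputable section

namespace SASGLD

variable {d : ℕ}

namespace StepModel

variable (M : StepModel d)

/-- The step size as a function of the previous state and the stochastic gradient. -/
def nextSize (z : ℝ) (G : E d) : ℝ := M.size (M.nextState z G)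

lemma measurable_nextSize (z : ℝ) : Measurable (M.nextSize z) :=
  M.continuous_size.measurable.comp
    (M.continuous_nextState.measurable.comp (measurable_const.prodMk measurable_id))

lemma abs_nextState_sub (z z' : ℝ) (G : E d) :
    |M.nextState z G - M.nextState z' G| = M.ρ * |z - z'| := by
  have : M.nextState z G - M.nextState z' G = M.ρ * (z - z') := by
    unfold nextState
    ring
  rw [this, abs_mul, abs_of_pos M.ρ_pos]

/-- The weight of the energy in the distance. -/
def distWeight : ℝ := (1 - Real.sqrt M.ρ) / (2 * M.driftConst)

lemma sqrt_ρ_lt_one : Real.sqrt M.ρ < 1 := by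
  rw [Real.sqrt_lt' one_pos]
  simpa using M.ρ_lt_one

lemma distWeight_pos : 0 < M.distWeight :=
  div_pos (sub_pos.2 M.sqrt_ρ_lt_one) (mul_pos two_pos M.driftConst_pos)

/-- The distance of two states with the same position. -/
def stateDist (x y : E d × ℝ) : ℝ :=
  Real.sqrt |x.2 - y.2| * (1 + M.distWeight * (M.energy x + M.energy y))

lemma stateDist_nonneg (x y : E d × ℝ) : 0 ≤ M.stateDist x y := by
  have := M.distWeight_pos
  have := M.energy_nonneg x
  have := M.energy_nonneg y
  unfold stateDist
  positivity

/-- The contraction rate of the distance. -/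
def distRate : ℝ := Real.sqrt M.ρ * (2 - Real.sqrt M.ρ)

lemma distRate_nonneg : 0 ≤ M.distRate :=
  mul_nonneg (Real.sqrt_nonneg _) (by linarith [M.sqrt_ρ_lt_one])

/-- The gap is `(1 - √ρ) ^ 2`. -/
lemma distRate_lt_one : M.distRate < 1 := by
  unfold distRate
  nlinarith [sq_pos_of_pos (sub_pos.2 M.sqrt_ρ_lt_one)]

/-- The modulus in the comparison of the Gaussian laws with different step sizes. -/
def overlapConst : ℝ :=
  3 / 2 * Real.sqrt ((d / (2 * M.Δ₀) + (1 + M.Δ₁) ^ 2 / (2 * M.τ₀ * M.Δ₀ ^ 2) +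
    (1 + M.Δ₁) / (M.τ₀ * M.Δ₀)) * (M.Lip * M.ρ))

lemma overlapConst_nonneg : 0 ≤ M.overlapConst := by
  unfold overlapConst
  positivity

/-- The step sizes differ by at most `Lip * ρ * |z - z'|`, so the log-densities differ by a multiple
of `|z - z'| * X ^ 2`. The root is linear in `X`, and the product with an oscillation of order
`√energy` is at most quadratic, hence integrable by the energy estimate. -/
lemma abs_sub_mul_sqrt_le {N : ℝ} {g : E d × ℝ → ℝ} (hN : 0 ≤ N)
    (hg : ∀ x y, |g x - g y| ≤
      N * (2 + (Real.sqrt (M.energy x) + Real.sqrt (M.energy y))))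
    (θ : E d) (z z' : ℝ) (G u : E d) :
    |g (u, M.nextState z' G) - g (θ, z')| * Real.sqrt
      |gaussianLogDensity (M.τ₀ * M.nextSize z G) (θ - M.nextSize z G • G) u -
        gaussianLogDensity (M.τ₀ * M.nextSize z' G) (θ - M.nextSize z' G • G) u| ≤
      N * M.overlapConst * Real.sqrt |z - z'| *
        (5 + ‖G‖ ^ 2 + 3 * M.energy (u, M.nextState z' G) + 3 * M.energy (θ, z')) := by
  have hτ := M.τ₀_pos
  have hΔ₀ := M.Δ₀_pos
  have hΔ₁ := M.Δ₁_pos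
  have hρ := M.ρ_pos
  have hLip := M.Lip_nonneg
  set Cl := (d / (2 * M.Δ₀) + (1 + M.Δ₁) ^ 2 / (2 * M.τ₀ * M.Δ₀ ^ 2) +
    (1 + M.Δ₁) / (M.τ₀ * M.Δ₀)) with hCl
  have hCl0 : 0 ≤ Cl := by rw [hCl]; positivity
  set E₁ := M.energy (u, M.nextState z' G)
  set E₂ := M.energy (θ, z')
  set X := 1 + ‖G‖ + ‖u - θ‖ with hX
  have hX0 : 0 ≤ X := by rw [hX]; positivity
  have h1 := abs_gaussianLogDensity_sub_le (d := d) hτ hΔ₀ (M.le_size (M.nextState z G))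
    (M.le_size (M.nextState z' G)) (M.size_le _) (M.size_le _) θ G u
  have h2 : |M.nextSize z G - M.nextSize z' G| ≤ M.Lip * M.ρ * |z - z'| := by
    have := M.size_lipschitz (M.nextState z G) (M.nextState z' G)
    rw [M.abs_nextState_sub] at this
    unfold nextSize
    linarith
  have h3 : Real.sqrt |gaussianLogDensity (M.τ₀ * M.nextSize z G) (θ - M.nextSize z G • G) u -
      gaussianLogDensity (M.τ₀ * M.nextSize z' G) (θ - M.nextSize z' G • G) u| ≤
      Real.sqrt (Cl * (M.Lip * M.ρ)) * Real.sqrt |z - z'| * X := by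
    rw [← Real.sqrt_mul (by positivity)]
    refine Real.sqrt_le_iff.2 ⟨by positivity, ?_⟩
    rw [mul_pow, Real.sq_sqrt (by positivity)]
    refine h1.trans ?_
    have := mul_le_mul_of_nonneg_left h2 hCl0
    have := mul_le_mul_of_nonneg_right this (sq_nonneg X)
    unfold nextSize at this
    linarith
  have h4 : (2 + (Real.sqrt E₁ + Real.sqrt E₂)) * X ≤
      3 / 2 * (5 + ‖G‖ ^ 2 + 3 * E₁ + 3 * E₂) := by
    have a1 := Real.sq_sqrt (M.energy_nonneg (u, M.nextState z' G))
    have a2 := Real.sq_sqrt (M.energy_nonneg (θ, z'))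
    have a3 := M.norm_sq_le_energy (u, M.nextState z' G)
    have a4 := M.norm_sq_le_energy (θ, z')
    have a5 : ‖u - θ‖ ^ 2 ≤ 2 * ‖u‖ ^ 2 + 2 * ‖θ‖ ^ 2 := by
      have := norm_sub_le u θ
      have : ‖u - θ‖ ^ 2 ≤ (‖u‖ + ‖θ‖) ^ 2 := by gcongr
      nlinarith [sq_nonneg (‖u‖ - ‖θ‖)]
    have a6 : X ^ 2 ≤ 3 * (1 + ‖G‖ ^ 2 + ‖u - θ‖ ^ 2) := by
      rw [hX]
      nlinarith [sq_nonneg (1 - ‖G‖), sq_nonneg (1 - ‖u - θ‖), sq_nonneg (‖G‖ - ‖u - θ‖)]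
    have a7 : (2 + (Real.sqrt E₁ + Real.sqrt E₂)) ^ 2 ≤ 3 * (4 + E₁ + E₂) := by
      nlinarith [sq_nonneg (2 - Real.sqrt E₁), sq_nonneg (2 - Real.sqrt E₂),
        sq_nonneg (Real.sqrt E₁ - Real.sqrt E₂)]
    have a8 := two_mul_le_add_sq (2 + (Real.sqrt E₁ + Real.sqrt E₂)) X
    simp only at a3 a4
    linarith
  have h5 := hg (u, M.nextState z' G) (θ, z')
  have hs : 0 ≤ Real.sqrt (Cl * (M.Lip * M.ρ)) * Real.sqrt |z - z'| := by positivity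
  calc _ ≤ (N * (2 + (Real.sqrt E₁ + Real.sqrt E₂))) *
        (Real.sqrt (Cl * (M.Lip * M.ρ)) * Real.sqrt |z - z'| * X) :=
        mul_le_mul h5 h3 (Real.sqrt_nonneg _) (by positivity)
    _ = N * (Real.sqrt (Cl * (M.Lip * M.ρ)) * Real.sqrt |z - z'|) *
        ((2 + (Real.sqrt E₁ + Real.sqrt E₂)) * X) := by ring
    _ ≤ N * (Real.sqrt (Cl * (M.Lip * M.ρ)) * Real.sqrt |z - z'|) *
        (3 / 2 * (5 + ‖G‖ ^ 2 + 3 * E₁ + 3 * E₂)) :=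
        mul_le_mul_of_nonneg_left h4 (mul_nonneg hN hs)
    _ = _ := by
        unfold overlapConst
        rw [← hCl]
        ring

/-- The integral against the kernel after a change of the state `ζ` of the step size only. -/
lemma abs_integral_move_sub_le {N R : ℝ} {g : E d × ℝ → ℝ} (hg : Measurable g)
    (hR : ∀ x, |g x| ≤ R) (hN : 0 ≤ N)
    (hgN : ∀ x y, |g x - g y| ≤
      N * (2 + (Real.sqrt (M.energy x) + Real.sqrt (M.energy y))))
    (θ : E d) (z z' : ℝ) :
    |∫ w : E d × E d, (g (M.move θ (M.nextSize z w.1) w.1 w.2, M.nextState z' w.1) -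
        g (M.move θ (M.nextSize z' w.1) w.1 w.2, M.nextState z' w.1))
        ∂((M.Q θ).prod (stdGaussian (E d)))| ≤
      2 * M.overlapConst * (11 + M.CG + 3 * M.driftConst) * N * Real.sqrt |z - z'| *
        (1 + M.energy (θ, z')) := by
  have hτ := M.τ₀_pos
  set c₀ := N * M.overlapConst * Real.sqrt |z - z'| with hc₀
  have hc₀0 : 0 ≤ c₀ := mul_nonneg (mul_nonneg hN M.overlapConst_nonneg) (Real.sqrt_nonneg _)
  have hE₂ := M.energy_nonneg (θ, z')
  have hstate : Measurable fun w : E d × E d => M.nextState z' w.1 :=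
    M.continuous_nextState.measurable.comp (measurable_const.prodMk measurable_fst)
  have hmv : ∀ y, Measurable fun w : E d × E d =>
      (M.move θ (M.nextSize y w.1) w.1 w.2, M.nextState z' w.1) := fun y =>
    (M.measurable_move (M.measurable_nextSize y) θ).prodMk hstate
  have hgm : ∀ y, Integrable (fun w : E d × E d =>
      g (M.move θ (M.nextSize y w.1) w.1 w.2, M.nextState z' w.1))
      ((M.Q θ).prod (stdGaussian (E d))) := fun y =>
    (integrable_const R).mono' (hg.comp (hmv y)).aestronglyMeasurable
      (ae_of_all _ fun w => hR _)
  set W : ℝ → E d × E d → ℝ := fun y w => c₀ * (5 + ‖w.1‖ ^ 2 +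
    3 * M.energy (M.move θ (M.nextSize y w.1) w.1 w.2, M.nextState z' w.1) +
    3 * M.energy (θ, z')) with hW
  have hen : ∀ y, _ := fun y => M.integral_energy_le θ z' (M.measurable_nextSize y)
    (fun G => M.le_size _) (fun G => M.size_le _)
  have i1 : Integrable (fun w : E d × E d => ‖w.1‖ ^ 2) ((M.Q θ).prod (stdGaussian (E d))) :=
    (M.integrable_sq θ).comp_fst _
  have i1' : ∫ w : E d × E d, ‖w.1‖ ^ 2 ∂((M.Q θ).prod (stdGaussian (E d))) ≤
      M.CG * (1 + ‖θ‖ ^ 2) := by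
    rw [integral_fun_fst (fun G : E d => ‖G‖ ^ 2)]
    simpa using M.integral_sq_le θ
  have i2 : Integrable (fun w : E d × E d => 5 + ‖w.1‖ ^ 2)
      ((M.Q θ).prod (stdGaussian (E d))) := (integrable_const _).add i1
  have i3 : ∀ y, Integrable (fun w : E d × E d => 5 + ‖w.1‖ ^ 2 +
      3 * M.energy (M.move θ (M.nextSize y w.1) w.1 w.2, M.nextState z' w.1))
      ((M.Q θ).prod (stdGaussian (E d))) := fun y => i2.add ((hen y).1.const_mul 3)
  have iW : ∀ y, Integrable (W y) ((M.Q θ).prod (stdGaussian (E d))) := fun y =>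
    ((i3 y).add (integrable_const _)).const_mul c₀
  have hWle : ∀ y, ∫ w, W y w ∂((M.Q θ).prod (stdGaussian (E d))) ≤
      c₀ * ((11 + M.CG + 3 * M.driftConst) * (1 + M.energy (θ, z'))) := fun y => by
    rw [hW, integral_const_mul, integral_add (i3 y) (integrable_const _),
      integral_add i2 ((hen y).1.const_mul 3), integral_add (integrable_const _) i1,
      integral_const_mul]
    refine mul_le_mul_of_nonneg_left ?_ hc₀0
    simp only [integral_const, probReal_univ, smul_eq_mul, one_mul]
    have a1 := (hen y).2
    have a2 := M.norm_sq_le_energy (θ, z')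
    have a3 := M.driftConst_pos
    have a4 : M.rate * M.energy (θ, z') ≤ 1 * M.energy (θ, z') := by
      gcongr; exact M.rate_lt_one.le
    have a5 := mul_le_mul_of_nonneg_left a2 M.CG_pos.le
    have a6 := mul_nonneg a3.le hE₂
    simp only at a5
    nlinarith
  rw [integral_prod (fun w : E d × E d =>
    g (M.move θ (M.nextSize z w.1) w.1 w.2, M.nextState z' w.1) -
      g (M.move θ (M.nextSize z' w.1) w.1 w.2, M.nextState z' w.1)) ((hgm z).sub (hgm z'))]
  have hbound : ∀ G, ‖∫ e, (g (M.move θ (M.nextSize z G) G e, M.nextState z' G) -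
      g (M.move θ (M.nextSize z' G) G e, M.nextState z' G)) ∂(stdGaussian (E d))‖ ≤
      ∫ e, W z (G, e) ∂(stdGaussian (E d)) + ∫ e, W z' (G, e) ∂(stdGaussian (E d)) := fun G => by
    have hgG : ∀ y, Integrable (fun e : E d =>
        g (M.move θ (M.nextSize y G) G e, M.nextState z' G)) (stdGaussian (E d)) := fun y =>
      (integrable_const R).mono'
        ((hg.comp (hmv y)).comp measurable_prodMk_left).aestronglyMeasurable
        (ae_of_all _ fun w => hR _)
    rw [integral_sub (hgG z) (hgG z'), Real.norm_eq_abs]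
    have hWi : ∀ y, Integrable (fun e => W y (G, e)) (stdGaussian (E d)) := fun y => by
      have hm : ∀ e : E d, ‖M.move θ (M.nextSize y G) G e‖ ^ 2 =
          ‖(θ - M.nextSize y G • G) + Real.sqrt (M.τ₀ * M.nextSize y G) • e‖ ^ 2 := fun e => rfl
      simp only [hW, energy]
      simp_rw [hm]
      exact (((integrable_const _).add (((integrable_norm_add_smul_sq _ _).add
        (integrable_const _)).const_mul 3)).add (integrable_const _)).const_mul c₀
    have hwm : Measurable fun u : E d => c₀ * (5 + ‖G‖ ^ 2 +
        3 * M.energy (u, M.nextState z' G) + 3 * M.energy (θ, z')) := by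
      unfold energy
      fun_prop
    -- Both laws are probability measures, so the value at `(θ, z')` may be subtracted; only the
    -- oscillation of `g` then enters, not its supremum.
    exact abs_integral_gaussian_sub_le (mul_pos hτ (M.size_pos _)) (mul_pos hτ (M.size_pos _))
      (θ - M.nextSize z G • G) (θ - M.nextSize z' G • G)
      (g := fun u => g (u, M.nextState z' G)) (c := g (θ, z')) (R := R)
      (hg.comp measurable_prodMk_right) hwm (fun u => hR _)
      (fun u => M.abs_sub_mul_sqrt_le hN hgN θ z z' G u) (hWi z) (hWi z')
  have hint := norm_integral_le_of_norm_le
    ((iW z).integral_prod_left.add (iW z').integral_prod_left) (ae_of_all _ hbound)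
  rw [Real.norm_eq_abs] at hint
  refine hint.trans ?_
  simp only [Pi.add_apply]
  rw [integral_add (iW z).integral_prod_left (iW z').integral_prod_left,
    ← integral_prod _ (iW z), ← integral_prod _ (iW z')]
  have a1 := hWle z
  have a2 := hWle z'
  rw [hc₀] at a1 a2
  linarith

/-- The smoothing inequality for the kernel. -/
lemma abs_kernelOp_sub_le {N N' R : ℝ} {g : E d × ℝ → ℝ} (hg : Measurable g)
    (hR : ∀ x, |g x| ≤ R) (hN : 0 ≤ N) (hN' : 0 ≤ N')
    (hgN : ∀ x y, |g x - g y| ≤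
      N * (2 + (Real.sqrt (M.energy x) + Real.sqrt (M.energy y))))
    (hgN' : ∀ x y : E d × ℝ, x.1 = y.1 → |g x - g y| ≤ N' * M.stateDist x y)
    (x y : E d × ℝ) (hxy : x.1 = y.1) :
    |kernelOp M.kernel g x - kernelOp M.kernel g y| ≤
      (M.distRate * N' + 2 * M.overlapConst * (11 + M.CG + 3 * M.driftConst) *
        (1 + 1 / M.distWeight) * N) * M.stateDist x y := by
  obtain ⟨θ, z⟩ := x
  obtain ⟨θ', z'⟩ := y
  obtain rfl : θ = θ' := hxy
  have hη := M.distWeight_pos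
  have hE₁ := M.energy_nonneg (θ, z)
  have hE₂ := M.energy_nonneg (θ, z')
  have hK := M.driftConst_pos
  have hstate : ∀ y, Measurable fun w : E d × E d => M.nextState y w.1 := fun y =>
    M.continuous_nextState.measurable.comp (measurable_const.prodMk measurable_fst)
  have hgm : ∀ y y', Integrable (fun w : E d × E d =>
      g (M.move θ (M.nextSize y w.1) w.1 w.2, M.nextState y' w.1))
      ((M.Q θ).prod (stdGaussian (E d))) := fun y y' =>
    (integrable_const R).mono' (hg.comp ((M.measurable_move (M.measurable_nextSize y) θ).prodMk
      (hstate y'))).aestronglyMeasurable (ae_of_all _ fun w => hR _)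
  have hen : ∀ y y', _ := fun y y' => M.integral_energy_le θ y' (M.measurable_nextSize y)
    (fun G => M.le_size _) (fun G => M.size_le _)
  -- The intermediate term moves with the step size of `z` but carries the new state of `z'`. In the
  -- first difference the positions agree and the states have approached by the factor `ρ`; in the
  -- second the states agree and only the Gaussian laws of the positions differ.
  have hsplit : kernelOp M.kernel g (θ, z) - kernelOp M.kernel g (θ, z') =
      ∫ w : E d × E d, (g (M.move θ (M.nextSize z w.1) w.1 w.2, M.nextState z w.1) -
        g (M.move θ (M.nextSize z w.1) w.1 w.2, M.nextState z' w.1))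
        ∂((M.Q θ).prod (stdGaussian (E d))) +
      ∫ w : E d × E d, (g (M.move θ (M.nextSize z w.1) w.1 w.2, M.nextState z' w.1) -
        g (M.move θ (M.nextSize z' w.1) w.1 w.2, M.nextState z' w.1))
        ∂((M.Q θ).prod (stdGaussian (E d))) := by
    rw [integral_sub (hgm z z) (hgm z z'), integral_sub (hgm z z') (hgm z' z'),
      sub_add_sub_cancel, kernelOp, kernelOp, M.integral_kernel _ hg, M.integral_kernel _ hg]
    rfl
  have h1 := M.abs_integral_move_sub_le hg hR hN hgN θ z z'
  have h2 : |∫ w : E d × E d, (g (M.move θ (M.nextSize z w.1) w.1 w.2, M.nextState z w.1) -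
        g (M.move θ (M.nextSize z w.1) w.1 w.2, M.nextState z' w.1))
        ∂((M.Q θ).prod (stdGaussian (E d)))| ≤ M.distRate * N' * M.stateDist (θ, z) (θ, z') := by
    have i1 : Integrable (fun w : E d × E d =>
        M.energy (M.move θ (M.nextSize z w.1) w.1 w.2, M.nextState z w.1) +
          M.energy (M.move θ (M.nextSize z w.1) w.1 w.2, M.nextState z' w.1))
        ((M.Q θ).prod (stdGaussian (E d))) := (hen z z).1.add (hen z z').1
    have hb := norm_integral_le_of_norm_le
      (((integrable_const (1 : ℝ)).add (i1.const_mul M.distWeight)).const_mul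
        (N' * Real.sqrt (M.ρ * |z - z'|)))
      (ae_of_all _ fun w : E d × E d => show
        ‖g (M.move θ (M.nextSize z w.1) w.1 w.2, M.nextState z w.1) -
          g (M.move θ (M.nextSize z w.1) w.1 w.2, M.nextState z' w.1)‖ ≤ _ by
        have := hgN' (M.move θ (M.nextSize z w.1) w.1 w.2, M.nextState z w.1)
          (M.move θ (M.nextSize z w.1) w.1 w.2, M.nextState z' w.1) rfl
        simp only [stateDist, M.abs_nextState_sub] at this
        rw [Real.norm_eq_abs]
        simp only [Pi.add_apply]
        rw [mul_assoc]
        exact this)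
    rw [Real.norm_eq_abs] at hb
    refine hb.trans ?_
    rw [integral_const_mul]
    simp only [Pi.add_apply]
    rw [integral_add (integrable_const _) (i1.const_mul _), integral_const_mul,
      integral_add (hen z z).1 (hen z z').1]
    simp only [integral_const, probReal_univ, smul_eq_mul, one_mul]
    have a1 := (hen z z).2
    have a2 := (hen z z').2
    have a3 : M.rate * M.energy (θ, z) ≤ 1 * M.energy (θ, z) := by
      gcongr; exact M.rate_lt_one.le
    have a4 : M.rate * M.energy (θ, z') ≤ 1 * M.energy (θ, z') := by
      gcongr; exact M.rate_lt_one.le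
    -- By the choice of the weight, the two additive drift constants raise the weighted factor by at
    -- most `1 - √ρ`. With `√ρ` from the distance of the states the rate is `√ρ * (2 - √ρ)`.
    have a5 : 2 * M.distWeight * M.driftConst = 1 - Real.sqrt M.ρ := by
      unfold distWeight
      field_simp
    have a6 := mul_le_mul_of_nonneg_left (add_le_add a1 a2) hη.le
    have a7 : 1 + M.distWeight * (∫ w : E d × E d,
        M.energy (M.move θ (M.nextSize z w.1) w.1 w.2, M.nextState z w.1)
          ∂((M.Q θ).prod (stdGaussian (E d))) + ∫ w : E d × E d,
        M.energy (M.move θ (M.nextSize z w.1) w.1 w.2, M.nextState z' w.1)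
          ∂((M.Q θ).prod (stdGaussian (E d)))) ≤
        (2 - Real.sqrt M.ρ) * (1 + M.distWeight * (M.energy (θ, z) + M.energy (θ, z'))) := by
      have b1 := mul_le_mul_of_nonneg_left a3 hη.le
      have b2 := mul_le_mul_of_nonneg_left a4 hη.le
      have b3 : 0 ≤ (1 - Real.sqrt M.ρ) * (M.distWeight * (M.energy (θ, z) + M.energy (θ, z'))) :=
        mul_nonneg (sub_pos.2 M.sqrt_ρ_lt_one).le (by positivity)
      nlinarith
    rw [Real.sqrt_mul M.ρ_pos.le]
    refine (mul_le_mul_of_nonneg_left a7 (by positivity)).trans (le_of_eq ?_)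
    unfold distRate stateDist
    ring
  have h3 : 1 + M.energy (θ, z') ≤ (1 + 1 / M.distWeight) *
      (1 + M.distWeight * (M.energy (θ, z) + M.energy (θ, z'))) := by
    have : (1 + 1 / M.distWeight) * (1 + M.distWeight * (M.energy (θ, z) + M.energy (θ, z'))) =
        1 + 1 / M.distWeight + (M.energy (θ, z) + M.energy (θ, z')) +
          M.distWeight * (M.energy (θ, z) + M.energy (θ, z')) := by
      field_simp
      ring
    rw [this]
    have : 0 < 1 / M.distWeight := by positivity
    have : 0 ≤ M.distWeight * (M.energy (θ, z) + M.energy (θ, z')) := by positivity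
    linarith
  have hC : 0 ≤ 2 * M.overlapConst * (11 + M.CG + 3 * M.driftConst) * N *
      Real.sqrt |z - z'| := by
    have := M.overlapConst_nonneg
    have := M.CG_pos
    positivity
  rw [hsplit]
  refine (abs_add_le _ _).trans ((add_le_add h2 (h1.trans
    (mul_le_mul_of_nonneg_left h3 hC))).trans (le_of_eq ?_))
  unfold stateDist
  ring

end StepModel

end SASGLD
end

/-! ### Couplings of the transition kernel. -/

noncomputable section

namespace SASGLD

variable {d : ℕ}

/-- The uniform distribution on the unit ball. -/
def unitBallMeasure (d : ℕ) : Measure (E d) := cond volume (Metric.closedBall 0 1)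

lemma volume_unitBall_ne_zero (d : ℕ) : volume (Metric.closedBall (0 : E d) 1) ≠ 0 :=
  (Metric.measure_closedBall_pos volume _ one_pos).ne'

lemma volume_unitBall_ne_top (d : ℕ) : volume (Metric.closedBall (0 : E d) 1) ≠ ⊤ :=
  measure_closedBall_lt_top.ne

instance : IsProbabilityMeasure (unitBallMeasure d) :=
  cond_isProbabilityMeasure_of_finite (volume_unitBall_ne_zero d) (volume_unitBall_ne_top d)

lemma ae_mem_unitBall : ∀ᵐ x ∂(unitBallMeasure d), x ∈ Metric.closedBall (0 : E d) 1 :=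
  ae_cond_mem Metric.isClosed_closedBall.measurableSet

lemma smul_unitBallMeasure {p : ℝ} (hp : 0 ≤ p) :
    ENNReal.ofReal (p * volume.real (Metric.closedBall (0 : E d) 1)) • unitBallMeasure d =
      ENNReal.ofReal p • volume.restrict (Metric.closedBall (0 : E d) 1) := by
  rw [unitBallMeasure, ProbabilityTheory.cond, smul_smul, ENNReal.ofReal_mul hp, Measure.real,
    ENNReal.ofReal_toReal (volume_unitBall_ne_top d), mul_assoc,
    ENNReal.mul_inv_cancel (volume_unitBall_ne_zero d) (volume_unitBall_ne_top d), mul_one]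

namespace StepModel

variable (M : StepModel d)

/-- For a gradient in `B`, the noise places the new position uniformly on the unit ball with mass `2
* s`, while the new state is a function of the gradient alone. The factor `2` pays for conditioning
the gradient on an event of probability at least one half. -/
lemma smul_map_le_kernel {B : Set (E d)} {s : ℝ} (x : E d × ℝ) (hB : MeasurableSet B)
    (hmin : ∀ G ∈ B, ENNReal.ofReal (2 * s) • unitBallMeasure d ≤
      (stdGaussian (E d)).map fun e => M.move x.1 (M.nextSize x.2 G) G e)
    {μ : Measure (E d)} [SFinite μ] (hμ : μ ≤ (2 : ENNReal) • (M.Q x.1).restrict B) :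
    ENNReal.ofReal s • (μ.prod (unitBallMeasure d)).map
      (fun w => (w.2, M.nextState x.2 w.1)) ≤ M.kernel x := by
  have hst : Measurable fun w : E d × E d => (w.2, M.nextState x.2 w.1) :=
    measurable_snd.prodMk
      (M.continuous_nextState.measurable.comp (measurable_const.prodMk measurable_fst))
  have hup : Measurable (M.update x) := M.measurable_update.comp measurable_prodMk_left
  refine Measure.le_iff.2 fun S hS => ?_
  rw [kernel_apply, Measure.map_apply hup hS, Measure.smul_apply, Measure.map_apply hst hS,
    Measure.prod_apply (hst hS), Measure.prod_apply (hup hS), smul_eq_mul]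
  set T : E d → ENNReal := fun G => unitBallMeasure d {Z | (Z, M.nextState x.2 G) ∈ S} with hT
  have hmeas : Measurable T := measurable_measure_prodMk_left (hst hS)
  have hS' : ∀ G, MeasurableSet {Z : E d | (Z, M.nextState x.2 G) ∈ S} := fun G =>
    measurable_prodMk_right hS
  have hpt : ∀ G ∈ B, ENNReal.ofReal (2 * s) * T G ≤
      stdGaussian (E d) (Prod.mk G ⁻¹' (M.update x ⁻¹' S)) := fun G hG => by
    have hmv : Measurable fun e => M.move x.1 (M.nextSize x.2 G) G e := by
      unfold move
      fun_prop
    have h1 := Measure.le_iff.1 (hmin G hG) _ (hS' G)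
    rw [Measure.map_apply hmv (hS' G), Measure.smul_apply, smul_eq_mul] at h1
    exact h1
  have h1 : ∫⁻ G, T G ∂μ ≤ 2 * ∫⁻ G in B, T G ∂(M.Q x.1) := by
    refine (lintegral_mono' hμ le_rfl).trans ?_
    rw [lintegral_smul_measure, smul_eq_mul]
  have h2 : ENNReal.ofReal s * (2 * ∫⁻ G in B, T G ∂(M.Q x.1)) =
      ∫⁻ G in B, ENNReal.ofReal (2 * s) * T G ∂(M.Q x.1) := by
    rw [lintegral_const_mul _ hmeas, ENNReal.ofReal_mul zero_le_two, ENNReal.ofReal_ofNat]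
    ring
  refine (mul_le_mul_right h1 (ENNReal.ofReal s)).trans ?_
  rw [h2]
  exact (setLIntegral_mono' hB hpt).trans (lintegral_mono' Measure.restrict_le_self le_rfl)

/-- With mass `s` both chains jump to the same uniform point of the ball, with gradients conditioned
on `B`. Equal positions share the gradient, so that the states `ζ` approach each other; different
positions take independent gradients. -/
lemma hasCoupling_kernel {B : Set (E d)} {s : ℝ} (x y : E d × ℝ) (hB : MeasurableSet B)
    (hs1 : s < 1) (hBx : 1 / 2 ≤ M.Q x.1 B) (hBy : 1 / 2 ≤ M.Q y.1 B)
    (hmx : ∀ G ∈ B, ENNReal.ofReal (2 * s) • unitBallMeasure d ≤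
      (stdGaussian (E d)).map fun e => M.move x.1 (M.nextSize x.2 G) G e)
    (hmy : ∀ G ∈ B, ENNReal.ofReal (2 * s) • unitBallMeasure d ≤
      (stdGaussian (E d)).map fun e => M.move y.1 (M.nextSize y.2 G) G e)
    {A : Set ((E d × ℝ) × (E d × ℝ))} (hA : MeasurableSet A)
    (hmem : ∀ G ∈ B, ∀ G' ∈ B, (x.1 = y.1 → G = G') → ∀ Z ∈ Metric.closedBall (0 : E d) 1,
      ((Z, M.nextState x.2 G), (Z, M.nextState y.2 G')) ∈ A) :
    HasCoupling (M.kernel x) (M.kernel y) s A := by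
  have hne : ∀ θ, 1 / 2 ≤ M.Q θ B → M.Q θ B ≠ 0 := fun θ h h0 => by simp [h0] at h
  have hprob : ∀ θ, 1 / 2 ≤ M.Q θ B → IsProbabilityMeasure (cond (M.Q θ) B) := fun θ h =>
    cond_isProbabilityMeasure (hne θ h)
  have hle : ∀ θ, 1 / 2 ≤ M.Q θ B → cond (M.Q θ) B ≤ (2 : ENNReal) • (M.Q θ).restrict B :=
    fun θ h => by
      have h2 : (M.Q θ B)⁻¹ ≤ 2 := by
        have := ENNReal.inv_le_inv.2 h
        simpa using this
      refine Measure.le_iff.2 fun S _ => ?_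
      simp only [ProbabilityTheory.cond, Measure.smul_apply, smul_eq_mul]
      gcongr
  have := hprob _ hBx
  have := hprob _ hBy
  obtain ⟨q, hq, hq1, hq2, hqd⟩ : ∃ q : Measure (E d × E d), IsProbabilityMeasure q ∧
      q.fst = cond (M.Q x.1) B ∧ q.snd = cond (M.Q y.1) B ∧
      ∀ᵐ p ∂q, x.1 = y.1 → p.1 = p.2 := by
    by_cases hxy : x.1 = y.1
    · have hm : Measurable fun G : E d => (G, G) := by fun_prop
      refine ⟨(cond (M.Q x.1) B).map fun G => (G, G),
        Measure.isProbabilityMeasure_map hm.aemeasurable, ?_, ?_, ?_⟩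
      · rw [Measure.fst, Measure.map_map measurable_fst hm]
        exact Measure.map_id
      · rw [Measure.snd, Measure.map_map measurable_snd hm, ← hxy]
        exact Measure.map_id
      · have : ∀ᵐ p : E d × E d ∂((cond (M.Q x.1) B).map fun G => (G, G)), p.1 = p.2 :=
          (ae_map_iff hm.aemeasurable (measurableSet_eq_fun measurable_fst measurable_snd)).2
            (ae_of_all _ fun _ => rfl)
        filter_upwards [this] with p hp _ using hp
    · exact ⟨(cond (M.Q x.1) B).prod (cond (M.Q y.1) B), inferInstance, by simp, by simp,
        ae_of_all _ fun p h => absurd h hxy⟩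
  have hst : ∀ z, Measurable fun w : E d × E d => (w.2, M.nextState z w.1) := fun z =>
    measurable_snd.prodMk
      (M.continuous_nextState.measurable.comp (measurable_const.prodMk measurable_fst))
  set F : (E d × E d) × E d → (E d × ℝ) × (E d × ℝ) := fun w =>
    ((w.2, M.nextState x.2 w.1.1), (w.2, M.nextState y.2 w.1.2)) with hF
  have hFm : Measurable F :=
    ((hst x.2).comp ((measurable_fst.comp measurable_fst).prodMk measurable_snd)).prodMk
      ((hst y.2).comp ((measurable_snd.comp measurable_fst).prodMk measurable_snd))
  have hΓ : IsProbabilityMeasure ((q.prod (unitBallMeasure d)).map F) :=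
    Measure.isProbabilityMeasure_map hFm.aemeasurable
  have hfst : ((q.prod (unitBallMeasure d)).map F).fst =
      ((cond (M.Q x.1) B).prod (unitBallMeasure d)).map
        (fun w => (w.2, M.nextState x.2 w.1)) := by
    have e1 : q.fst.prod (unitBallMeasure d) =
        (q.prod (unitBallMeasure d)).map (Prod.map Prod.fst id) := by
      rw [← Measure.map_prod_map _ _ measurable_fst measurable_id, Measure.map_id, Measure.fst]
    rw [← hq1, e1, Measure.map_map (hst _) (by fun_prop), Measure.fst,
      Measure.map_map measurable_fst hFm]
    rfl
  have hsnd : ((q.prod (unitBallMeasure d)).map F).snd =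
      ((cond (M.Q y.1) B).prod (unitBallMeasure d)).map
        (fun w => (w.2, M.nextState y.2 w.1)) := by
    have e1 : q.snd.prod (unitBallMeasure d) =
        (q.prod (unitBallMeasure d)).map (Prod.map Prod.snd id) := by
      rw [← Measure.map_prod_map _ _ measurable_snd measurable_id, Measure.map_id, Measure.snd]
    rw [← hq2, e1, Measure.map_map (hst _) (by fun_prop), Measure.snd,
      Measure.map_map measurable_snd hFm]
    rfl
  refine hasCoupling_of_le hs1 (Γ := (q.prod (unitBallMeasure d)).map F) ?_ ?_ ?_
  · rw [hfst]
    exact M.smul_map_le_kernel x hB hmx (hle _ hBx)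
  · rw [hsnd]
    exact M.smul_map_le_kernel y hB hmy (hle _ hBy)
  · rw [← prob_compl_eq_zero_iff hA, ← mem_ae_iff]
    have b1 : ∀ᵐ p ∂q, p.1 ∈ B := ae_of_ae_map (f := Prod.fst) measurable_fst.aemeasurable (by
      have : q.map Prod.fst = cond (M.Q x.1) B := hq1
      rw [this]
      exact ae_cond_mem hB)
    have b2 : ∀ᵐ p ∂q, p.2 ∈ B := ae_of_ae_map (f := Prod.snd) measurable_snd.aemeasurable (by
      have : q.map Prod.snd = cond (M.Q y.1) B := hq2
      rw [this]
      exact ae_cond_mem hB)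
    have b3 : ∀ᵐ p ∂(q.prod (unitBallMeasure d)),
        p.1.1 ∈ B ∧ p.1.2 ∈ B ∧ (x.1 = y.1 → p.1.1 = p.1.2) :=
      Measure.quasiMeasurePreserving_fst.ae (p := fun p : E d × E d =>
        p.1 ∈ B ∧ p.2 ∈ B ∧ (x.1 = y.1 → p.1 = p.2)) (b1.and (b2.and hqd))
    have b4 : ∀ᵐ p ∂(q.prod (unitBallMeasure d)), p.2 ∈ Metric.closedBall (0 : E d) 1 :=
      Measure.quasiMeasurePreserving_snd.ae ae_mem_unitBall
    refine (ae_map_iff hFm.aemeasurable hA).2 ?_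
    filter_upwards [b3, b4] with p h1 h2 using hmem _ h1.1 _ h1.2.1 h1.2.2 _ h2

/-- Markov's inequality at twice the bound for the second moment. -/
lemma half_le_gradient_law {R₂ : ℝ} {θ : E d} (hθ : ‖θ‖ ≤ R₂) :
    1 / 2 ≤ M.Q θ {G | ‖G‖ ^ 2 < 2 * (M.CG * (1 + R₂ ^ 2))} := by
  have hCG := M.CG_pos
  have hε : 0 < M.CG * (1 + R₂ ^ 2) := by positivity
  have hm : MeasurableSet {G : E d | ‖G‖ ^ 2 < 2 * (M.CG * (1 + R₂ ^ 2))} :=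
    measurableSet_lt (by fun_prop) measurable_const
  have h1 := mul_meas_ge_le_integral_of_nonneg (μ := M.Q θ) (f := fun G => ‖G‖ ^ 2)
    (ae_of_all _ fun _ => sq_nonneg _) (M.integrable_sq θ) (2 * (M.CG * (1 + R₂ ^ 2)))
  have h2 : ∫ G, ‖G‖ ^ 2 ∂(M.Q θ) ≤ M.CG * (1 + R₂ ^ 2) := by
    refine (M.integral_sq_le θ).trans ?_
    gcongr
  have h3 : (M.Q θ).real {G : E d | 2 * (M.CG * (1 + R₂ ^ 2)) ≤ ‖G‖ ^ 2} ≤ 1 / 2 := by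
    by_contra! h
    have := mul_lt_mul_of_pos_left h (mul_pos two_pos hε)
    linarith
  have h4 : {G : E d | ‖G‖ ^ 2 < 2 * (M.CG * (1 + R₂ ^ 2))}ᶜ =
      {G : E d | 2 * (M.CG * (1 + R₂ ^ 2)) ≤ ‖G‖ ^ 2} := by
    ext G; simp
  have h5 := probReal_compl_eq_one_sub (μ := M.Q θ) hm
  rw [h4] at h5
  have h6 : (1 / 2 : ℝ) ≤ (M.Q θ).real {G : E d | ‖G‖ ^ 2 < 2 * (M.CG * (1 + R₂ ^ 2))} := by
    linarith
  rw [Measure.real, ← ENNReal.ofReal_le_iff_le_toReal (measure_ne_top _ _)] at h6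
  simpa using h6

/-- Pairs of states with the same position in the unit ball and states `ζ` in `[-r, r]` at
distance at most `t`. -/
def closePairs (d : ℕ) (r t : ℝ) : Set ((E d × ℝ) × (E d × ℝ)) :=
  {p | p.1.1 = p.2.1 ∧ ‖p.1.1‖ ≤ 1 ∧ |p.1.2| ≤ r ∧ |p.2.2| ≤ r ∧ |p.1.2 - p.2.2| ≤ t}

lemma measurableSet_closePairs (r t : ℝ) : MeasurableSet (closePairs d r t) := by
  have h1 : MeasurableSet {p : (E d × ℝ) × (E d × ℝ) | p.1.1 = p.2.1} :=
    measurableSet_eq_fun (by fun_prop) (by fun_prop)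
  have h2 : MeasurableSet {p : (E d × ℝ) × (E d × ℝ) | ‖p.1.1‖ ≤ 1} :=
    measurableSet_le (by fun_prop) (by fun_prop)
  have h3 : MeasurableSet {p : (E d × ℝ) × (E d × ℝ) | |p.1.2| ≤ r} :=
    measurableSet_le (by fun_prop) (by fun_prop)
  have h4 : MeasurableSet {p : (E d × ℝ) × (E d × ℝ) | |p.2.2| ≤ r} :=
    measurableSet_le (by fun_prop) (by fun_prop)
  have h5 : MeasurableSet {p : (E d × ℝ) × (E d × ℝ) | |p.1.2 - p.2.2| ≤ t} :=
    measurableSet_le (by fun_prop) (by fun_prop)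
  exact h1.inter (h2.inter (h3.inter (h4.inter h5)))

lemma abs_nextState_le {ε r z : ℝ} {G : E d} (hz : |z| ≤ r) (hG : ‖G‖ ^ 2 < ε)
    (hr : M.c * (ε + M.δ) ≤ (1 - M.ρ) * r) : |M.nextState z G| ≤ r := by
  have hρ := M.ρ_pos
  have hc := M.c_pos
  have hδ := M.δ_nonneg
  have h1 : M.c * (‖G‖ ^ 2 + M.δ) ≤ M.c * (ε + M.δ) := by gcongr
  have h2 : M.ρ * |z| ≤ M.ρ * r := by gcongr
  unfold nextState
  refine (abs_add_le _ _).trans ?_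
  rw [abs_mul, abs_of_pos hρ, abs_of_nonneg (show 0 ≤ M.c * (‖G‖ ^ 2 + M.δ) by positivity)]
  linarith

/-- The first coupled step merges the positions inside the unit ball. From then on common gradients
keep them merged while the distance of the states `ζ` shrinks by `ρ`, which determines `A` and `e`.
Exact merging of the states cannot be expected, since they carry no noise except that of the
gradients. -/
lemma exists_coupling (R : ℝ) :
    ∃ (s : ℝ) (A : ℕ → Set ((E d × ℝ) × (E d × ℝ))) (e : ℕ → ℝ), 0 < s ∧ s ≤ 1 ∧
      (∀ j, MeasurableSet (A j)) ∧ Tendsto e atTop (𝓝 0) ∧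
      (∀ x y, Real.sqrt (M.energy x) + Real.sqrt (M.energy y) ≤ R →
        HasCoupling (M.kernel x) (M.kernel y) s (A 0)) ∧
      (∀ j x y, (x, y) ∈ A j → HasCoupling (M.kernel x) (M.kernel y) s (A (j + 1))) ∧
      ∀ j x y, (x, y) ∈ A j → x.1 = y.1 ∧ M.stateDist x y ≤ e j := by
  have hρ := M.ρ_pos
  have hρ1 := M.ρ_lt_one
  have hτ := M.τ₀_pos
  have hΔ₀ := M.Δ₀_pos
  have hCG := M.CG_pos
  have hc := M.c_pos
  have hδ := M.δ_nonneg
  have hw := M.weight_pos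
  have hη := M.distWeight_pos
  -- At least `1`, so that the positions reached by the coupling are covered as well.
  set R₂ := max R 1 with hR₂
  set ε := 2 * (M.CG * (1 + R₂ ^ 2)) with hε
  have hε0 : 0 < ε := by positivity
  -- The first entry contains the states of the sublevel set; the second makes `[-r, r]` stable
  -- under updates with gradients of squared norm below `ε`.
  set r := max (R ^ 2 / M.weight) (M.c * (ε + M.δ) / (1 - M.ρ)) with hr
  have hr0 : 0 ≤ r := le_max_of_le_left (by positivity)
  have hr1 : M.c * (ε + M.δ) ≤ (1 - M.ρ) * r := by
    have := le_max_right (R ^ 2 / M.weight) (M.c * (ε + M.δ) / (1 - M.ρ))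
    rw [← hr, div_le_iff₀ (sub_pos.2 hρ1)] at this
    linarith
  have hB : MeasurableSet {G : E d | ‖G‖ ^ 2 < ε} :=
    measurableSet_lt (by fun_prop) measurable_const
  obtain ⟨p, hp, hmin⟩ := exists_smul_volume_le_map_stdGaussian d (mul_pos hτ hΔ₀)
    (M.τ₀ * M.Δ₁) (R₂ + M.Δ₁ * Real.sqrt ε)
  set m₀ := p * volume.real (Metric.closedBall (0 : E d) 1) with hm₀
  have hm₀0 : 0 < m₀ := mul_pos hp
    (ENNReal.toReal_pos (volume_unitBall_ne_zero d) (volume_unitBall_ne_top d))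
  simp_rw [← smul_unitBallMeasure hp.le] at hmin
  have hm₀1 : m₀ ≤ 1 := by
    have h1 := hmin (M.τ₀ * M.Δ₀) 0 le_rfl (by gcongr; exact (M.le_size 0).trans (M.size_le 0))
      (by
        rw [norm_zero]
        have := M.Δ₁_pos
        positivity) Set.univ
    rw [Measure.smul_apply, measure_univ, Measure.map_apply (by fun_prop) MeasurableSet.univ,
      Set.preimage_univ, measure_univ, smul_eq_mul, mul_one, ENNReal.ofReal_le_one] at h1
    exact h1
  have hminor : ∀ x : E d × ℝ, ‖x.1‖ ≤ R₂ → ∀ G ∈ {G : E d | ‖G‖ ^ 2 < ε},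
      ENNReal.ofReal (2 * (m₀ / 2)) • unitBallMeasure d ≤
        (stdGaussian (E d)).map fun e => M.move x.1 (M.nextSize x.2 G) G e := by
    intro x hx G hG
    rw [mul_div_cancel₀ _ two_ne_zero]
    refine hmin _ _ (by gcongr; exact M.le_size _) (by gcongr; exact M.size_le _) ?_
    refine (norm_sub_le _ _).trans (add_le_add hx ?_)
    have hn : 0 < M.nextSize x.2 G := M.size_pos _
    have hn1 : M.nextSize x.2 G ≤ M.Δ₁ := M.size_le _
    have hΔ₁ := M.Δ₁_pos
    rw [norm_smul, Real.norm_of_nonneg hn.le]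
    have : ‖G‖ ≤ Real.sqrt ε := Real.le_sqrt_of_sq_le (le_of_lt hG)
    gcongr
  have hcoup : ∀ (x y : E d × ℝ) (A : Set ((E d × ℝ) × (E d × ℝ))), ‖x.1‖ ≤ R₂ → ‖y.1‖ ≤ R₂ →
      MeasurableSet A → (∀ G ∈ {G : E d | ‖G‖ ^ 2 < ε}, ∀ G' ∈ {G : E d | ‖G‖ ^ 2 < ε},
        (x.1 = y.1 → G = G') → ∀ Z ∈ Metric.closedBall (0 : E d) 1,
        ((Z, M.nextState x.2 G), (Z, M.nextState y.2 G')) ∈ A) →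
      HasCoupling (M.kernel x) (M.kernel y) (m₀ / 2) A := fun x y A hx hy hA hmem =>
    M.hasCoupling_kernel x y hB (by linarith) (M.half_le_gradient_law hx)
      (M.half_le_gradient_law hy) (hminor x hx) (hminor y hy) hA hmem
  refine ⟨m₀ / 2, fun j => closePairs d r (2 * r * M.ρ ^ j),
    fun j => Real.sqrt (2 * r * M.ρ ^ j) * (1 + M.distWeight * (2 * (1 + M.weight * r))),
    by positivity, by linarith, fun j => measurableSet_closePairs _ _, ?_, ?_, ?_, ?_⟩
  · have h1 := ((tendsto_pow_atTop_nhds_zero_of_lt_one hρ.le hρ1).const_mul (2 * r)).sqrt.mul_const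
      (1 + M.distWeight * (2 * (1 + M.weight * r)))
    simpa using h1
  · intro x y hxy
    have hV : ∀ v w : E d × ℝ, Real.sqrt (M.energy v) + Real.sqrt (M.energy w) ≤ R →
        ‖v.1‖ ≤ R₂ ∧ |v.2| ≤ r := fun v w h => by
      have a1 : Real.sqrt (M.energy v) ≤ R := by linarith [Real.sqrt_nonneg (M.energy w)]
      have a2 : M.energy v ≤ R ^ 2 := (Real.sqrt_le_left ((Real.sqrt_nonneg _).trans a1)).1 a1
      refine ⟨?_, ?_⟩
      · exact ((Real.le_sqrt_of_sq_le (M.norm_sq_le_energy v)).trans a1).trans (le_max_left _ _)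
      · refine le_trans ?_ (le_max_left _ _)
        rw [le_div_iff₀ hw]
        have : 0 ≤ ‖v.1‖ ^ 2 := sq_nonneg _
        unfold energy at a2
        linarith
    obtain ⟨hx1, hx2⟩ := hV x y hxy
    obtain ⟨hy1, hy2⟩ := hV y x (by rwa [add_comm])
    refine hcoup x y _ hx1 hy1 (measurableSet_closePairs _ _) fun G hG G' hG' _ Z hZ => ?_
    have b1 := M.abs_nextState_le hx2 hG hr1
    have b2 := M.abs_nextState_le hy2 hG' hr1
    refine ⟨rfl, by simpa using hZ, b1, b2, ?_⟩
    rw [pow_zero, mul_one]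
    refine (abs_sub _ _).trans ?_
    simp only
    linarith
  · rintro j x y ⟨h1, h2, h3, h4, h5⟩
    have hR₂1 : (1 : ℝ) ≤ R₂ := le_max_right _ _
    simp only at h1 h2 h3 h4 h5
    refine hcoup x y _ (h2.trans hR₂1) (h1 ▸ h2.trans hR₂1) (measurableSet_closePairs _ _)
      fun G hG G' hG' hGG Z hZ => ?_
    obtain rfl := hGG h1
    refine ⟨rfl, by simpa using hZ, M.abs_nextState_le h3 hG hr1,
      M.abs_nextState_le h4 hG hr1, ?_⟩
    simp only
    rw [M.abs_nextState_sub, pow_succ]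
    have := mul_le_mul_of_nonneg_left h5 hρ.le
    linarith
  · rintro j x y ⟨h1, h2, h3, h4, h5⟩
    simp only at h1 h2 h3 h4 h5
    refine ⟨h1, ?_⟩
    have hE : ∀ v : E d × ℝ, ‖v.1‖ ≤ 1 → |v.2| ≤ r → M.energy v ≤ 1 + M.weight * r :=
      fun v a1 a2 => by
        unfold energy
        gcongr
        exact pow_le_one₀ (norm_nonneg _) a1
    have e1 := hE x h2 h3
    have e2 := hE y (h1 ▸ h2) h4
    have e3 := M.energy_nonneg x
    have e4 := M.energy_nonneg y
    have e5 : M.energy x + M.energy y ≤ 2 * (1 + M.weight * r) := by linarith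
    have e6 : 1 + M.distWeight * (M.energy x + M.energy y) ≤
        1 + M.distWeight * (2 * (1 + M.weight * r)) :=
      add_le_add_right (mul_le_mul_of_nonneg_left e5 hη.le) 1
    exact mul_le_mul (Real.sqrt_le_sqrt h5) e6 (by positivity) (Real.sqrt_nonneg _)

theorem isWeakHarris : IsWeakHarris M.kernel (fun x => Real.sqrt (M.energy x))
    (fun x y => x.1 = y.1) M.stateDist (Real.sqrt M.rate) (Real.sqrt M.driftConst) M.distRate
    (2 * M.overlapConst * (11 + M.CG + 3 * M.driftConst) * (1 + 1 / M.distWeight)) where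
  measurable_V := M.measurable_energy.sqrt
  V_nonneg _ := Real.sqrt_nonneg _
  D_nonneg := M.stateDist_nonneg
  γ_nonneg := Real.sqrt_nonneg _
  γ_lt_one := by
    rw [Real.sqrt_lt' one_pos]
    simpa using M.rate_lt_one
  K_nonneg := Real.sqrt_nonneg _
  r_nonneg := M.distRate_nonneg
  r_lt_one := M.distRate_lt_one
  C_nonneg := by
    have := M.overlapConst_nonneg
    have := M.CG_pos
    have := M.driftConst_pos
    have := M.distWeight_pos
    positivity
  integrable_V x := (M.integrable_sqrt_energy x).1
  drift x := (M.integrable_sqrt_energy x).2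
  smoothing _ _ _ _ hg hR hN hN' h1 h2 x y hxy := M.abs_kernelOp_sub_le hg hR hN hN' h1 h2 x y hxy
  coupling := M.exists_coupling

end StepModel

end SASGLD
end

/-! ### The drift of the algorithm. -/

noncomputable section

namespace SASGLD

variable {d : ℕ}

lemma sq_integral_le_integral_sq {X : Type*} [MeasurableSpace X] {μ : Measure X}
    [IsProbabilityMeasure μ] {u : X → ℝ} (hu : Integrable u μ) (hu2 : Integrable (fun x => u x ^ 2) μ) :
    (∫ x, u x ∂μ) ^ 2 ≤ ∫ x, u x ^ 2 ∂μ := by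
  set I := ∫ x, u x ∂μ with hI
  have h1 : 0 ≤ ∫ x, (u x - I) ^ 2 ∂μ := integral_nonneg fun x => sq_nonneg _
  have h2 : ∀ x, (u x - I) ^ 2 = u x ^ 2 + (I ^ 2 - 2 * I * u x) := fun x => by ring
  have i1 : Integrable (fun x => I ^ 2 - 2 * I * u x) μ :=
    (integrable_const _).sub (hu.const_mul _)
  simp_rw [h2] at h1
  rw [integral_add hu2 i1,
    integral_sub (integrable_const _) (hu.const_mul _), integral_const_mul] at h1
  simp only [integral_const, probReal_univ, smul_eq_mul, one_mul] at h1
  rw [← hI] at h1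
  nlinarith

/-- A dissipative gradient step with step sizes that may depend on the gradient. -/
lemma integral_norm_sub_smul_sq_le {μ : Measure (E d)} [IsProbabilityMeasure μ] {θ v : E d}
    {D : E d → ℝ} {Δ₀ Δ₁ a b s : ℝ} (hΔ : 0 < Δ₀) (h0 : ∀ G, Δ₀ ≤ D G)
    (h1 : ∀ G, D G ≤ Δ₁) (ha : 0 ≤ a) (hb : 0 ≤ b) (hs : 0 ≤ s)
    (hi : Integrable (fun G => ‖G - v‖ ^ 2) μ) (hle : ∫ G, ‖G - v‖ ^ 2 ∂μ ≤ s ^ 2 * (1 + ‖θ‖ ^ 2))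
    (hd : a * ‖θ‖ ^ 2 - b ≤ inner ℝ θ v) :
    ∫ G, ‖θ - D G • G‖ ^ 2 ∂μ ≤ ‖θ‖ ^ 2 - 2 * (Δ₀ * a * ‖θ‖ ^ 2 - Δ₁ * b) +
      2 * Δ₁ * (s * (1 + ‖θ‖ ^ 2)) +
      Δ₁ ^ 2 * (2 * ‖v‖ ^ 2 + 2 * (s ^ 2 * (1 + ‖θ‖ ^ 2))) := by
  have hΔ₁ : 0 < Δ₁ := hΔ.trans_le ((h0 0).trans (h1 0))
  have hi1 : Integrable (fun G => ‖G - v‖) μ := by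
    refine ((integrable_const (1 : ℝ)).add hi).mono' (by fun_prop) (ae_of_all _ fun G => ?_)
    rw [Real.norm_of_nonneg (norm_nonneg _)]
    simp only [Pi.add_apply]
    nlinarith [sq_nonneg (‖G - v‖ - 1)]
  have hI := sq_integral_le_integral_sq hi1 hi
  have hI0 : 0 ≤ ∫ G, ‖G - v‖ ∂μ := integral_nonneg fun _ => norm_nonneg _
  set I := ∫ G, ‖G - v‖ ∂μ
  -- Because the step size depends on the gradient, the product of position and gradient noise does
  -- not average out. The Cauchy–Schwarz bound used instead is the origin of the term `2 σ M h` in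
  -- the rate.
  have hcross : ‖θ‖ * I ≤ s * (1 + ‖θ‖ ^ 2) := by
    refine le_of_sq_le_sq ?_ (by positivity)
    have e1 : I ^ 2 ≤ s ^ 2 * (1 + ‖θ‖ ^ 2) := hI.trans hle
    have e2 := mul_le_mul_of_nonneg_left e1 (sq_nonneg ‖θ‖)
    have e3 : 0 ≤ s ^ 2 * (1 + ‖θ‖ ^ 2) := by positivity
    nlinarith
  set B : E d → ℝ := fun G => (‖θ‖ ^ 2 - 2 * (Δ₀ * a * ‖θ‖ ^ 2 - Δ₁ * b) +
    Δ₁ ^ 2 * (2 * ‖v‖ ^ 2)) + 2 * Δ₁ * ‖θ‖ * ‖G - v‖ with hB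
  have iB : Integrable B μ := (integrable_const _).add (hi1.const_mul _)
  have hpt : ∀ G, ‖θ - D G • G‖ ^ 2 ≤ B G + 2 * Δ₁ ^ 2 * ‖G - v‖ ^ 2 := fun G => by
    have hDG : 0 < D G := hΔ.trans_le (h0 G)
    have e1 : ‖θ - D G • G‖ ^ 2 = ‖θ‖ ^ 2 - 2 * (D G * inner ℝ θ v) -
        2 * (D G * inner ℝ θ (G - v)) + D G ^ 2 * ‖G‖ ^ 2 := by
      rw [norm_sub_sq_real, norm_smul, inner_smul_right, inner_sub_right, mul_pow,
        Real.norm_eq_abs, sq_abs]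
      ring
    have e2 : Δ₀ * a * ‖θ‖ ^ 2 - Δ₁ * b ≤ D G * inner ℝ θ v := by
      have c1 := mul_le_mul_of_nonneg_left hd hDG.le
      have c2 := mul_le_mul_of_nonneg_right (h0 G) (mul_nonneg ha (sq_nonneg ‖θ‖))
      have c3 := mul_le_mul_of_nonneg_right (h1 G) hb
      linarith
    have e3 : -(Δ₁ * (‖θ‖ * ‖G - v‖)) ≤ D G * inner ℝ θ (G - v) := by
      have c1 := neg_le_of_abs_le (abs_real_inner_le_norm θ (G - v))
      have c2 := mul_le_mul_of_nonneg_left c1 hDG.le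
      have c3 := mul_le_mul_of_nonneg_right (h1 G)
        (mul_nonneg (norm_nonneg θ) (norm_nonneg (G - v)))
      linarith
    have e4 : ‖G‖ ^ 2 ≤ 2 * ‖v‖ ^ 2 + 2 * ‖G - v‖ ^ 2 := by
      have c1 : ‖G‖ ≤ ‖v‖ + ‖G - v‖ := by simpa using norm_add_le v (G - v)
      have c2 : ‖G‖ ^ 2 ≤ (‖v‖ + ‖G - v‖) ^ 2 := by gcongr
      nlinarith [sq_nonneg (‖v‖ - ‖G - v‖)]
    have e5 : D G ^ 2 * ‖G‖ ^ 2 ≤ Δ₁ ^ 2 * (2 * ‖v‖ ^ 2 + 2 * ‖G - v‖ ^ 2) := by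
      have := h1 G
      gcongr
    rw [e1, hB]
    linarith
  have hmono := integral_mono_of_nonneg (ae_of_all μ fun G => sq_nonneg ‖θ - D G • G‖)
    (iB.add (hi.const_mul (2 * Δ₁ ^ 2))) (ae_of_all μ hpt)
  refine hmono.trans ?_
  simp only [Pi.add_apply]
  rw [integral_add iB (hi.const_mul _), hB, integral_add (integrable_const _) (hi1.const_mul _),
    integral_const_mul, integral_const_mul]
  simp only [integral_const, probReal_univ, smul_eq_mul, one_mul]
  have f1 := mul_le_mul_of_nonneg_left hcross (mul_pos two_pos hΔ₁).le
  have f2 := mul_le_mul_of_nonneg_left hle (mul_pos two_pos (pow_pos hΔ₁ 2)).le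
  linarith

namespace IsControlledRun

variable {Ω : Type*} [MeasurableSpace Ω] {P : Measure Ω} {U : E d → ℝ}
  {ψ : ℝ → ℝ} {α β δ m M Lψ L a b σ σ₄ h : ℝ} {K : ℕ → ℝ}
  {θ : ℕ → Ω → E d} {ζ : ℕ → Ω → ℝ} {G ε : ℕ → Ω → E d}

lemma exists_stepModel (H : IsControlledRun P U ψ α β δ m M Lψ L a b σ σ₄ h K θ ζ G ε)
    {Q : Kernel (E d) (E d)} [IsMarkovKernel Q]
    (hQi : ∀ θ, Integrable (fun G => ‖G - gradient U θ‖ ^ 2) (Q θ))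
    (hQ : ∀ θ, ∫ G, ‖G - gradient U θ‖ ^ 2 ∂(Q θ) ≤ σ ^ 2 * (1 + ‖θ‖ ^ 2)) :
    ∃ Mo : StepModel d, Mo.Q = Q ∧ ∀ n ω,
      (θ (n + 1) ω, ζ (n + 1) ω) = Mo.update (θ n ω, ζ n ω) (G n ω, ε (n + 1) ω) := by
  have hm := H.m_pos
  have hM := H.M_pos
  have hh := H.h_pos
  have hβ := H.β_pos
  have hL := H.L_pos
  have hσ := H.σ_nonneg
  have ha := H.a_pos
  have hb : 0 ≤ b := by
    have := H.potential.dissipative 0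
    simp only [norm_zero, inner_zero_left] at this
    linarith
  have hrate := H.rate_pos
  set γ := gammaRate a m M L σ h with hγ
  set g₁ := ‖gradient U 0‖ with hg₁
  have hg₁0 : 0 ≤ g₁ := norm_nonneg _
  have hgrad : ∀ θ, ‖gradient U θ‖ ^ 2 ≤ g₁ ^ 2 + 2 * g₁ * L * ‖θ‖ + L ^ 2 * ‖θ‖ ^ 2 := fun θ => by
    have h1 := H.potential.norm_gradient_le θ
    have h2 : ‖gradient U θ‖ ^ 2 ≤ (g₁ + L * ‖θ‖) ^ 2 := by gcongr
    linarith
  have hnorm : ∀ θ G : E d, ‖G‖ ^ 2 ≤ 2 * ‖gradient U θ‖ ^ 2 + 2 * ‖G - gradient U θ‖ ^ 2 :=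
    fun θ G => by
      have c1 : ‖G‖ ≤ ‖gradient U θ‖ + ‖G - gradient U θ‖ := by
        simpa using norm_add_le (gradient U θ) (G - gradient U θ)
      have c2 : ‖G‖ ^ 2 ≤ (‖gradient U θ‖ + ‖G - gradient U θ‖) ^ 2 := by gcongr
      nlinarith [sq_nonneg (‖gradient U θ‖ - ‖G - gradient U θ‖)]
  have hint : ∀ θ, Integrable
      (fun G => 2 * ‖gradient U θ‖ ^ 2 + 2 * ‖G - gradient U θ‖ ^ 2) (Q θ) := fun θ =>
    (integrable_const _).add ((hQi θ).const_mul 2)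
  have hQ2 : ∀ θ, Integrable (fun G => ‖G‖ ^ 2) (Q θ) := fun θ =>
    (hint θ).mono' (by fun_prop) (ae_of_all _ fun G => by
      rw [Real.norm_of_nonneg (sq_nonneg _)]; exact hnorm θ G)
  -- The coefficient of the term linear in `‖θ‖`, from expanding the square of the gradient bound.
  set c₁ := M ^ 2 * h ^ 2 * (4 * g₁ * L) with hc₁
  have hc₁0 : 0 ≤ c₁ := by rw [hc₁]; positivity
  have hρ1 := rho_lt_one H.α_pos hh
  refine ⟨{
    Q := Q
    markov := inferInstance
    size := fun z => clippedStep ψ (stateFloor α δ h) z * h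
    ρ := rho α h
    c := (1 - rho α h) / α
    δ := δ
    τ₀ := 2 * β⁻¹
    Δ₀ := m * h
    Δ₁ := M * h
    Lip := Lψ * h
    -- The quadratic terms leave exactly `1 - γ`; half of `γ` is spent on the linear term with
    -- coefficient `c₁`, by Young's inequality. The summands `1` in `B₀` and `CG` ensure positivity.
    A := 1 - γ / 2
    B₀ := 2 * (M * h) * b + 2 * (M * h) * σ + (M * h) ^ 2 * (2 * g₁ ^ 2 + 2 * σ ^ 2) +
      c₁ ^ 2 / (2 * γ) + 1
    CG := 4 * g₁ ^ 2 + 4 * L ^ 2 + 2 * σ ^ 2 + 1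
    ρ_pos := rho_pos
    ρ_lt_one := hρ1
    c_pos := H.coeff_pos
    δ_nonneg := H.δ_pos.le
    τ₀_pos := by positivity
    Δ₀_pos := by positivity
    Lip_nonneg := mul_nonneg H.step.lipschitz_nonneg hh.le
    A_lt_one := by linarith
    B₀_pos := by positivity
    CG_pos := by positivity
    le_size := fun z => mul_le_mul_of_nonneg_right (H.step.le_clippedStep z) hh.le
    size_le := fun z => mul_le_mul_of_nonneg_right (H.step.clippedStep_le z) hh.le
    size_lipschitz := fun y z => by
      rw [← sub_mul, abs_mul, abs_of_pos hh]
      have := mul_le_mul_of_nonneg_right (H.step.abs_clippedStep_sub_le y z) hh.le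
      linarith
    integrable_sq := hQ2
    integral_sq_le := fun θ => by
      refine (integral_mono (hQ2 θ) (hint θ) (hnorm θ)).trans ?_
      rw [integral_add (integrable_const _) ((hQi θ).const_mul 2),
        integral_const_mul 2 fun G => ‖G - gradient U θ‖ ^ 2]
      simp only [integral_const, probReal_univ, smul_eq_mul, one_mul]
      have h1 := hQ θ
      have h2 := hgrad θ
      nlinarith [sq_nonneg (g₁ - L * ‖θ‖), sq_nonneg (g₁ * ‖θ‖), sq_nonneg ‖θ‖]
    drift := fun θ D _ h0 h1 => by
      refine (integral_norm_sub_smul_sq_le (by positivity) h0 h1 ha.le hb hσ (hQi θ) (hQ θ)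
        (H.potential.dissipative θ)).trans ?_
      have e1 := mul_le_mul_of_nonneg_left (hgrad θ)
        (show 0 ≤ 2 * (M * h) ^ 2 by positivity)
      have e2 : c₁ * ‖θ‖ ≤ γ / 2 * ‖θ‖ ^ 2 + c₁ ^ 2 / (2 * γ) := by
        have : γ / 2 * ‖θ‖ ^ 2 + c₁ ^ 2 / (2 * γ) - c₁ * ‖θ‖ =
            (γ * ‖θ‖ - c₁) ^ 2 / (2 * γ) := by
          field_simp
          ring
        have : 0 ≤ (γ * ‖θ‖ - c₁) ^ 2 / (2 * γ) := by positivity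
        linarith
      have e4 : γ * ‖θ‖ ^ 2 = (2 * a * m * h - (2 * L ^ 2 + 2 * σ ^ 2) * M ^ 2 * h ^ 2 -
        2 * σ * M * h) * ‖θ‖ ^ 2 := rfl
      rw [hc₁] at e2
      linarith }, rfl, fun n ω => ?_⟩
  refine Prod.ext ?_ (H.run.ζ_succ n ω)
  simp only [StepModel.update, StepModel.move, StepModel.nextState]
  rw [← H.run.ζ_succ, H.run.θ_succ, H.clippedStep_eq]

end IsControlledRun

end SASGLD
end

/-! ### The Markov property for fresh gradients. -/

noncomputable section

namespace SASGLD

variable {d : ℕ}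

/-- The kernel `Q` at the current position is the conditional law of the stochastic gradients
given the past. -/
def IsGradientLaw {Ω : Type*} [MeasurableSpace Ω] (P : Measure Ω) (θ : ℕ → Ω → E d)
    (ζ : ℕ → Ω → ℝ) (G ε : ℕ → Ω → E d) (Q : Kernel (E d) (E d)) : Prop :=
  ∀ (n : ℕ) (B : Set (E d)), MeasurableSet B →
    P[(G n ⁻¹' B).indicator (fun _ => (1 : ℝ)) | past θ ζ G ε n] =ᵐ[P]
      fun ω => (Q (θ n ω)).real B

namespace IsControlledRun

variable {Ω : Type*} [MeasurableSpace Ω] {P : Measure Ω} [IsProbabilityMeasure P] {U : E d → ℝ}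
  {ψ : ℝ → ℝ} {α β δ m M Lψ L a b σ σ₄ h : ℝ} {K : ℕ → ℝ}
  {θ : ℕ → Ω → E d} {ζ : ℕ → Ω → ℝ} {G ε : ℕ → Ω → E d}
  {Q : Kernel (E d) (E d)} [IsMarkovKernel Q]
  {T : Type*} [MeasurableSpace T]

/-- On rectangles this is the conditional law of the gradient integrated over an event of the past.
The variable `y` may carry more than the position, which is recovered by `π`. -/
lemma map_prod_gradient_eq (H : IsControlledRun P U ψ α β δ m M Lψ L a b σ σ₄ h K θ ζ G ε)
    (hQ : IsGradientLaw P θ ζ G ε Q) {n : ℕ} {y : Ω → T} (hy : Measurable[past θ ζ G ε n] y)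
    {π : T → E d} (hπ : Measurable π) (hyπ : ∀ ω, π (y ω) = θ n ω) :
    P.map (fun ω => (y ω, G n ω)) = (P.map y) ⊗ₘ (Q.comap π hπ) := by
  have hy' : Measurable y := hy.mono (H.past_le n) le_rfl
  have hG := H.run.measurable_G n
  have hpr : IsProbabilityMeasure (P.map fun ω => (y ω, G n ω)) :=
    Measure.isProbabilityMeasure_map (hy'.prodMk hG).aemeasurable
  have hpr' : IsProbabilityMeasure (P.map y) := Measure.isProbabilityMeasure_map hy'.aemeasurable
  refine Measure.ext_prod fun {S B} hS hB => ?_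
  have hA : MeasurableSet[past θ ζ G ε n] (y ⁻¹' S) := hy hS
  have hA' : MeasurableSet (y ⁻¹' S) := hy' hS
  have hQm : Measurable fun x : T => Q.comap π hπ x B := Kernel.measurable_coe _ hB
  rw [Measure.map_apply (hy'.prodMk hG) (hS.prod hB), Measure.compProd_apply_prod hS hB,
    setLIntegral_map hS hQm hy', Set.mk_preimage_prod]
  have h1 := setIntegral_condExp (H.past_le n) (f := (G n ⁻¹' B).indicator fun _ => (1 : ℝ))
    ((integrable_const (μ := P) (1 : ℝ)).indicator (hG hB)) hA
  rw [setIntegral_congr_ae hA' ((hQ n B hB).mono fun ω hω _ => hω),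
    setIntegral_indicator (hG hB)] at h1
  simp only [integral_const, MeasurableSet.univ, measureReal_restrict_apply, Set.univ_inter,
    smul_eq_mul, mul_one] at h1
  have h2 : ∀ ω, Q.comap π hπ (y ω) B = ENNReal.ofReal ((Q (θ n ω)).real B) := fun ω => by
    rw [Kernel.comap_apply, hyπ, ofReal_measureReal]
  simp_rw [h2]
  have hQr : Measurable fun ω => (Q (θ n ω)).real B :=
    ((Kernel.measurable_coe Q hB).comp (H.run.measurable_θ n)).ennreal_toReal
  rw [← ofReal_integral_eq_lintegral_ofReal _ (ae_of_all _ fun ω => measureReal_nonneg), h1,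
    ofReal_measureReal]
  exact ((integrable_const (1 : ℝ)).mono' hQr.aestronglyMeasurable (ae_of_all _ fun ω => by
    rw [Real.norm_of_nonneg measureReal_nonneg]
    exact measureReal_le_one)).integrableOn

/-- The joint law of a function of the past, the stochastic gradient and the noise. -/
lemma map_past_gradient_noise (H : IsControlledRun P U ψ α β δ m M Lψ L a b σ σ₄ h K θ ζ G ε)
    (hQ : IsGradientLaw P θ ζ G ε Q) {n : ℕ} {y : Ω → T} (hy : Measurable[past θ ζ G ε n] y)
    {π : T → E d} (hπ : Measurable π) (hyπ : ∀ ω, π (y ω) = θ n ω) :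
    P.map (fun ω => (y ω, (G n ω, ε (n + 1) ω))) =
      (P.map y) ⊗ₘ ((Q.comap π hπ) ×ₖ Kernel.const T (stdGaussian (E d))) := by
  have hy' : Measurable y := hy.mono (H.past_le n) le_rfl
  have hG := H.run.measurable_G n
  have hε := H.run.measurable_ε (n + 1)
  have hpr' : IsProbabilityMeasure (P.map y) := Measure.isProbabilityMeasure_map hy'.aemeasurable
  have hm3 : Measurable fun ω => (y ω, (G n ω, ε (n + 1) ω)) := hy'.prodMk (hG.prodMk hε)
  have hpr3 : IsProbabilityMeasure (P.map fun ω => (y ω, (G n ω, ε (n + 1) ω))) :=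
    Measure.isProbabilityMeasure_map hm3.aemeasurable
  have hyG : Measurable[past θ ζ G ε n ⊔ MeasurableSpace.comap (G n) inferInstance]
      fun ω => (y ω, G n ω) :=
    (hy.mono le_sup_left le_rfl).prodMk ((comap_measurable (G n)).mono le_sup_right le_rfl)
  have hind : IndepFun (fun ω => (y ω, G n ω)) (ε (n + 1)) P :=
    indep_of_indep_of_le_left (H.run.noise_indep n) hyG.comap_le
  refine Measure.ext_prod₃ fun {S B C} hS hB hC => ?_
  have h1 : (fun ω => (y ω, (G n ω, ε (n + 1) ω))) ⁻¹' (S ×ˢ B ×ˢ C) =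
      (fun ω => (y ω, G n ω)) ⁻¹' (S ×ˢ B) ∩ ε (n + 1) ⁻¹' C := by
    ext ω
    simp [and_assoc]
  rw [Measure.map_apply hm3 (hS.prod (hB.prod hC)), h1,
    hind.measure_inter_preimage_eq_mul _ _ (hS.prod hB) hC,
    ← Measure.map_apply (hy'.prodMk hG) (hS.prod hB), H.map_prod_gradient_eq hQ hy hπ hyπ,
    ← Measure.map_apply hε hC, H.run.noise_law, Measure.compProd_apply_prod hS hB,
    Measure.compProd_apply_prod hS (hB.prod hC)]
  simp_rw [Kernel.prod_apply_prod, Kernel.const_apply]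
  rw [lintegral_mul_const _ (Kernel.measurable_coe _ hB)]

/-- The expectation of a function of the past, the stochastic gradient and the noise. -/
lemma integral_past_gradient_noise (H : IsControlledRun P U ψ α β δ m M Lψ L a b σ σ₄ h K θ ζ G ε)
    (hQ : IsGradientLaw P θ ζ G ε Q) {n : ℕ} {y : Ω → T} (hy : Measurable[past θ ζ G ε n] y)
    {π : T → E d} (hπ : Measurable π) (hyπ : ∀ ω, π (y ω) = θ n ω)
    {F : T × (E d × E d) → ℝ} (hF : Measurable F)
    (hi : Integrable (fun ω => F (y ω, (G n ω, ε (n + 1) ω))) P) :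
    ∫ ω, F (y ω, (G n ω, ε (n + 1) ω)) ∂P =
      ∫ ω, ∫ w, F (y ω, w) ∂((Q (θ n ω)).prod (stdGaussian (E d))) ∂P := by
  have hy' : Measurable y := hy.mono (H.past_le n) le_rfl
  have hm3 : Measurable fun ω => (y ω, (G n ω, ε (n + 1) ω)) :=
    hy'.prodMk ((H.run.measurable_G n).prodMk (H.run.measurable_ε (n + 1)))
  have hpr' : IsProbabilityMeasure (P.map y) := Measure.isProbabilityMeasure_map hy'.aemeasurable
  have hi3 := (integrable_map_measure hF.aestronglyMeasurable hm3.aemeasurable).2 hi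
  have e1 := integral_map hm3.aemeasurable (μ := P) hF.aestronglyMeasurable
  rw [H.map_past_gradient_noise hQ hy hπ hyπ] at hi3 e1
  rw [← e1, Measure.integral_compProd hi3, integral_map hy'.aemeasurable
    hF.stronglyMeasurable.integral_kernel_prod_right'.aestronglyMeasurable]
  simp_rw [Kernel.prod_apply, Kernel.comap_apply, Kernel.const_apply, hyπ]

/-- The conditional law of the stochastic gradients can be modified so that the bound for the
conditional variance holds at all positions. -/
lemma exists_isGradientLaw (H : IsControlledRun P U ψ α β δ m M Lψ L a b σ σ₄ h K θ ζ G ε)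
    (hQ : IsGradientLaw P θ ζ G ε Q) :
    ∃ Q' : Kernel (E d) (E d), IsMarkovKernel Q' ∧ IsGradientLaw P θ ζ G ε Q' ∧
      (∀ x, Integrable (fun G => ‖G - gradient U x‖ ^ 2) (Q' x)) ∧
      ∀ x, ∫ G, ‖G - gradient U x‖ ^ 2 ∂(Q' x) ≤ σ ^ 2 * (1 + ‖x‖ ^ 2) := by
  have hgc := H.potential.continuous_gradient
  set s : E d × E d → ENNReal := fun p => ENNReal.ofReal (‖p.2 - gradient U p.1‖ ^ 2) with hs
  have hsm : Measurable s := by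
    have := hgc.measurable
    fun_prop
  set t : E d → ENNReal := fun x => ENNReal.ofReal (σ ^ 2 * (1 + ‖x‖ ^ 2)) with ht
  have htm : Measurable t := by fun_prop
  set V : E d → ENNReal := fun x => ∫⁻ G, s (x, G) ∂(Q x) with hV
  have hVm : Measurable V := hsm.lintegral_kernel_prod_right'
  have hgood : MeasurableSet {x | V x ≤ t x} := measurableSet_le hVm htm
  -- Positions where the variance of `Q` exceeds its bound are almost surely not visited: such a
  -- visit is an event of the past, and positive probability would contradict the integrated
  -- conditional bound.
  have hae : ∀ n, ∀ᵐ ω ∂P, V (θ n ω) ≤ t (θ n ω) := by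
    intro n
    have hθm := H.run.measurable_θ n
    have hbad : MeasurableSet {x | t x < V x} := measurableSet_lt htm hVm
    have hA : MeasurableSet[past θ ζ G ε n] (θ n ⁻¹' {x | t x < V x}) :=
      (H.measurable_past n).1 hbad
    have hA' : MeasurableSet (θ n ⁻¹' {x | t x < V x}) := hθm hbad
    by_contra hne
    have h0 : P (θ n ⁻¹' {x | t x < V x}) ≠ 0 := by
      intro h0
      refine hne ((measure_eq_zero_iff_ae_notMem.1 h0).mono fun ω hω => ?_)
      simpa using hω
    have iσ : Integrable (fun ω => σ ^ 2 * (1 + ‖θ n ω‖ ^ 2)) P :=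
      ((integrable_const _).add (H.moments 2 n).1).const_mul _
    have h1 : ∫ ω in θ n ⁻¹' {x | t x < V x}, ‖G n ω - gradient U (θ n ω)‖ ^ 2 ∂P ≤
        ∫ ω in θ n ⁻¹' {x | t x < V x}, σ ^ 2 * (1 + ‖θ n ω‖ ^ 2) ∂P := by
      rw [← setIntegral_condExp (H.past_le n) (H.run.grad_sq_integrable n) hA]
      exact setIntegral_mono_ae integrable_condExp.integrableOn iσ.integrableOn
        (H.run.grad_sq n)
    have h2 : ∫⁻ ω in θ n ⁻¹' {x | t x < V x}, t (θ n ω) ∂P =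
        ENNReal.ofReal (∫ ω in θ n ⁻¹' {x | t x < V x}, σ ^ 2 * (1 + ‖θ n ω‖ ^ 2) ∂P) :=
      (ofReal_integral_eq_lintegral_ofReal iσ.integrableOn
        (ae_of_all _ fun ω => by positivity)).symm
    have h3 : ∫⁻ ω in θ n ⁻¹' {x | t x < V x}, s (θ n ω, G n ω) ∂P =
        ENNReal.ofReal (∫ ω in θ n ⁻¹' {x | t x < V x},
          ‖G n ω - gradient U (θ n ω)‖ ^ 2 ∂P) :=
      (ofReal_integral_eq_lintegral_ofReal (H.run.grad_sq_integrable n).integrableOn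
        (ae_of_all _ fun ω => by positivity)).symm
    have h4 : ∫⁻ ω in θ n ⁻¹' {x | t x < V x}, s (θ n ω, G n ω) ∂P =
        ∫⁻ ω in θ n ⁻¹' {x | t x < V x}, V (θ n ω) ∂P := by
      have hlaw := H.map_prod_gradient_eq hQ (H.measurable_past n).1 measurable_id fun ω => rfl
      have hpr' : IsProbabilityMeasure (P.map (θ n)) :=
        Measure.isProbabilityMeasure_map hθm.aemeasurable
      have hm2 : Measurable fun ω => (θ n ω, G n ω) := hθm.prodMk (H.run.measurable_G n)
      have e1 := setLIntegral_map (μ := P) (hbad.prod MeasurableSet.univ) hsm hm2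
      have e2 := Measure.setLIntegral_compProd (μ := P.map (θ n)) (κ := Q.comap id measurable_id)
        hsm hbad MeasurableSet.univ
      rw [hlaw, e2, setLIntegral_map hbad (by
        simpa [Kernel.comap_apply] using hVm) hθm, Set.mk_preimage_prod, Set.preimage_univ,
        Set.inter_univ] at e1
      rw [← e1]
      simp [hV]
    have h5 : ∫⁻ ω in θ n ⁻¹' {x | t x < V x}, t (θ n ω) ∂P <
        ∫⁻ ω in θ n ⁻¹' {x | t x < V x}, V (θ n ω) ∂P :=
      setLIntegral_strict_mono hA' h0 (hVm.comp hθm) (by rw [h2]; exact ENNReal.ofReal_ne_top)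
        (ae_of_all _ fun ω hω => hω)
    rw [← h4, h3, h2] at h5
    exact absurd (ENNReal.ofReal_le_ofReal h1) (not_le.2 h5)
  classical
  -- On the exceptional set the exact gradient, which has variance zero, is substituted; the chain
  -- does not notice the change.
  set Q' : Kernel (E d) (E d) :=
    Kernel.piecewise hgood Q (Kernel.deterministic (gradient U) hgc.measurable) with hQ'
  have hmem : ∀ x, V x ≤ t x → Q' x = Q x := fun x hx => by
    rw [hQ', Kernel.piecewise_apply, if_pos (show x ∈ {x | V x ≤ t x} from hx)]
  have hnot : ∀ x, ¬ V x ≤ t x → Q' x = Measure.dirac (gradient U x) := fun x hx => by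
    rw [hQ', Kernel.piecewise_apply, if_neg (show x ∉ {x | V x ≤ t x} from hx), Kernel.deterministic_apply]
  have hlin : ∀ x, ∫⁻ G, s (x, G) ∂(Q' x) ≤ t x := fun x => by
    by_cases hx : V x ≤ t x
    · rw [hmem x hx]
      exact hx
    · rw [hnot x hx, lintegral_dirac]
      simp [hs]
  have hmeas : ∀ x, Measurable fun G : E d => ‖G - gradient U x‖ ^ 2 := fun x => by fun_prop
  have hint : ∀ x, Integrable (fun G => ‖G - gradient U x‖ ^ 2) (Q' x) := fun x => by
    refine ⟨(hmeas x).aestronglyMeasurable, ?_⟩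
    rw [hasFiniteIntegral_iff_ofReal (ae_of_all _ fun G => sq_nonneg _)]
    exact (hlin x).trans_lt ENNReal.ofReal_lt_top
  refine ⟨Q', inferInstance, fun n B hB => (hQ n B hB).trans ?_, hint, fun x => ?_⟩
  · filter_upwards [hae n] with ω hω
    rw [hmem _ hω]
  · rw [← ENNReal.ofReal_le_ofReal_iff (by positivity),
      ofReal_integral_eq_lintegral_ofReal (hint x) (ae_of_all _ fun G => sq_nonneg _)]
    exact hlin x

variable {Mo : StepModel d}

/-- One step of the chain under the conditional expectation. -/
lemma integral_mul_step (H : IsControlledRun P U ψ α β δ m M Lψ L a b σ σ₄ h K θ ζ G ε)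
    (hQ : IsGradientLaw P θ ζ G ε Mo.Q) (hstep : ∀ n ω,
      (θ (n + 1) ω, ζ (n + 1) ω) = Mo.update (θ n ω, ζ n ω) (G n ω, ε (n + 1) ω))
    {n : ℕ} {Y : Ω → ℝ} (hY : Measurable[past θ ζ G ε n] Y) (hYi : Integrable Y P)
    {g : E d × ℝ → ℝ} {R : ℝ} (hg : Measurable g) (hR : ∀ x, |g x| ≤ R) :
    ∫ ω, Y ω * g (θ (n + 1) ω, ζ (n + 1) ω) ∂P =
      ∫ ω, Y ω * kernelOp Mo.kernel g (θ n ω, ζ n ω) ∂P := by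
  obtain ⟨hθ, hζ⟩ := H.measurable_past n
  have hX : ∀ k, Measurable fun ω => (θ k ω, ζ k ω) := fun k =>
    (H.run.measurable_θ k).prodMk (H.run.measurable_ζ k)
  have hF : Measurable fun p : (ℝ × (E d × ℝ)) × (E d × E d) => p.1.1 * g (Mo.update p.1.2 p.2) :=
    (measurable_fst.comp measurable_fst).mul (hg.comp (Mo.measurable_update.comp
      ((measurable_snd.comp measurable_fst).prodMk measurable_snd)))
  have hi : Integrable (fun ω => Y ω * g (θ (n + 1) ω, ζ (n + 1) ω)) P :=
    hYi.mul_bdd (hg.comp (hX _)).aestronglyMeasurable (ae_of_all _ fun ω => hR _)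
  simp_rw [hstep] at hi ⊢
  rw [H.integral_past_gradient_noise hQ (y := fun ω => (Y ω, (θ n ω, ζ n ω)))
    (hY.prodMk (hθ.prodMk hζ)) (π := fun p : ℝ × (E d × ℝ) => p.2.1) (by fun_prop)
    (fun ω => rfl) hF hi]
  refine integral_congr_ae (ae_of_all _ fun ω => ?_)
  simp only
  rw [integral_const_mul, kernelOp, Mo.integral_kernel _ hg]

lemma integral_mul_iterate (H : IsControlledRun P U ψ α β δ m M Lψ L a b σ σ₄ h K θ ζ G ε)
    (hQ : IsGradientLaw P θ ζ G ε Mo.Q) (hstep : ∀ n ω,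
      (θ (n + 1) ω, ζ (n + 1) ω) = Mo.update (θ n ω, ζ n ω) (G n ω, ε (n + 1) ω))
    {n : ℕ} {Y : Ω → ℝ} (hY : Measurable[past θ ζ G ε n] Y) (hYi : Integrable Y P)
    {g : E d × ℝ → ℝ} {R : ℝ} (hg : Measurable g) (hR : ∀ x, |g x| ≤ R) (k : ℕ) :
    ∫ ω, Y ω * g (θ (n + k) ω, ζ (n + k) ω) ∂P =
      ∫ ω, Y ω * (kernelOp Mo.kernel)^[k] g (θ n ω, ζ n ω) ∂P := by
  induction k generalizing g with
  | zero => rfl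
  | succ k ih =>
    have hYk : Measurable[past θ ζ G ε (n + k)] Y :=
      hY.mono (monotone_nat_of_le_succ (past_mono θ ζ G ε) (Nat.le_add_right n k)) le_rfl
    rw [← add_assoc, H.integral_mul_step hQ hstep hYk hYi hg hR,
      ih (measurable_kernelOp _ hg) (abs_kernelOp_le _ hR), Function.iterate_succ_apply]

end IsControlledRun

end SASGLD
end

/-! ### Exponential decay of correlations. -/

noncomputable section

namespace SASGLD

variable {d : ℕ}

/-- The function `F` of the position weighted with the step size. -/
def stepWeighted (ψ : ℝ → ℝ) (c : ℝ) (F : E d → ℝ) (x : E d × ℝ) : ℝ :=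
  clippedStep ψ c x.2 * F x.1

/-- The coefficients in the exponential decay of correlations after truncation of the
function. -/
lemma truncation_bound {M r s R A B C₁ c W k : ℝ} (hM : 0 ≤ M) (hA : 0 ≤ A) (hB : 0 ≤ B)
    (hC₁ : 0 ≤ C₁) (hc : 0 ≤ c) (hW : 0 ≤ W) (hs : 0 ≤ s) (hR : R⁻¹ = s) (hRk : R * r = s)
    (hk : k ≤ M / R * (A + B) + C₁ * (c * R) * r * (A + W) + M / R * (1 + B) * (1 + A)) :
    k ≤ (2 * M * (1 + B) + C₁ * c * (1 + W)) * (1 + A) * s := by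
  refine hk.trans ?_
  rw [div_eq_mul_inv, hR, show C₁ * (c * R) * r = C₁ * c * s by rw [← hRk]; ring]
  have h1 : A + B ≤ (1 + B) * (1 + A) := by nlinarith [mul_nonneg hA hB]
  have h2 : A + W ≤ (1 + W) * (1 + A) := by nlinarith [mul_nonneg hA hW]
  have h3 := mul_le_mul_of_nonneg_left h1 (mul_nonneg hM hs)
  have h4 := mul_le_mul_of_nonneg_left h2 (mul_nonneg (mul_nonneg hC₁ hc) hs)
  linarith

namespace IsControlledRun

variable {Ω : Type*} [MeasurableSpace Ω] {P : Measure Ω} {U : E d → ℝ}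
  {ψ : ℝ → ℝ} {α β δ m M Lψ L a b σ σ₄ h : ℝ} {K : ℕ → ℝ}
  {θ : ℕ → Ω → E d} {ζ : ℕ → Ω → ℝ} {G ε : ℕ → Ω → E d} {F : E d → ℝ}

lemma abs_clippedStep_le (H : IsControlledRun P U ψ α β δ m M Lψ L a b σ σ₄ h K θ ζ G ε) (z : ℝ) :
    |clippedStep ψ (stateFloor α δ h) z| ≤ M := by
  rw [abs_of_nonneg (H.m_pos.le.trans (H.step.le_clippedStep z))]
  exact H.step.clippedStep_le z

lemma measurable_stepWeighted (H : IsControlledRun P U ψ α β δ m M Lψ L a b σ σ₄ h K θ ζ G ε)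
    (hF : Measurable F) : Measurable (stepWeighted ψ (stateFloor α δ h) F) :=
  (H.step.continuous_clippedStep.measurable.comp measurable_snd).mul (hF.comp measurable_fst)

lemma abs_stepWeighted_le (H : IsControlledRun P U ψ α β δ m M Lψ L a b σ σ₄ h K θ ζ G ε)
    (F : E d → ℝ) (x : E d × ℝ) : |stepWeighted ψ (stateFloor α δ h) F x| ≤ M * |F x.1| := by
  rw [stepWeighted, abs_mul]
  exact mul_le_mul_of_nonneg_right (H.abs_clippedStep_le _) (abs_nonneg _)

/-- A bounded Lipschitz function is Hölder continuous of exponent `1 / 2`, and this is the modulus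
built into `stateDist`. -/
lemma abs_stepWeighted_sub_le (H : IsControlledRun P U ψ α β δ m M Lψ L a b σ σ₄ h K θ ζ G ε)
    (Mo : StepModel d) {R : ℝ} (hR : ∀ x, |F x| ≤ R) {x y : E d × ℝ} (hxy : x.1 = y.1) :
    |stepWeighted ψ (stateFloor α δ h) F x - stepWeighted ψ (stateFloor α δ h) F y| ≤
      (M + Real.sqrt (2 * M * Lψ)) * R * Mo.stateDist x y := by
  have hM := H.M_pos
  have hL := H.step.lipschitz_nonneg
  have hη := Mo.distWeight_pos
  have hE := Mo.energy_nonneg x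
  have hE' := Mo.energy_nonneg y
  have hR0 : 0 ≤ R := (abs_nonneg _).trans (hR x.1)
  set t := |clippedStep ψ (stateFloor α δ h) x.2 - clippedStep ψ (stateFloor α δ h) y.2| with ht
  have ht0 : 0 ≤ t := abs_nonneg _
  have h1 : t ≤ 2 * M := (abs_sub _ _).trans (by
    linarith [H.abs_clippedStep_le x.2, H.abs_clippedStep_le y.2])
  have h2 : t ≤ Lψ * |x.2 - y.2| := H.step.abs_clippedStep_sub_le _ _
  have h3 : t ≤ Real.sqrt (2 * M * Lψ) * Real.sqrt |x.2 - y.2| := by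
    rw [← Real.sqrt_mul (by positivity)]
    refine Real.le_sqrt_of_sq_le ?_
    have := mul_le_mul h1 h2 ht0 (by positivity)
    nlinarith
  have h4 : Real.sqrt |x.2 - y.2| ≤ Mo.stateDist x y := by
    unfold StepModel.stateDist
    refine le_mul_of_one_le_right (Real.sqrt_nonneg _) ?_
    have : 0 ≤ Mo.distWeight * (Mo.energy x + Mo.energy y) := by positivity
    linarith
  have h5 : t ≤ (M + Real.sqrt (2 * M * Lψ)) * Mo.stateDist x y := by
    have := Mo.stateDist_nonneg x y
    have := mul_le_mul_of_nonneg_left h4 (Real.sqrt_nonneg (2 * M * Lψ))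
    nlinarith
  rw [stepWeighted, stepWeighted, ← hxy, ← sub_mul, abs_mul, ← ht]
  have h6 := mul_le_mul h5 (hR x.1) (abs_nonneg _) (ht0.trans h5)
  linarith

/-- A bound for the energy along the chain. -/
def energyBound (H : StepModel d) (U : E d → ℝ) (α δ L σ₄ : ℝ) (K : ℕ → ℝ) (z₀ : ℝ) : ℝ :=
  |K 2| + H.weight * (1 + |targetSq U α δ L σ₄ K| + z₀)

lemma integral_energy_le [IsProbabilityMeasure P]
    (H : IsControlledRun P U ψ α β δ m M Lψ L a b σ σ₄ h K θ ζ G ε)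
    (Mo : StepModel d) (n : ℕ) :
    Integrable (fun ω => Mo.energy (θ n ω, ζ n ω)) P ∧ ∫ ω, Mo.energy (θ n ω, ζ n ω) ∂P ≤
      energyBound Mo U α δ L σ₄ K (∫ ω, ζ 0 ω ∂P) := by
  have hw := Mo.weight_pos
  obtain ⟨i1, i1'⟩ := H.moments 2 n
  obtain ⟨i2, i2'⟩ := H.integrable_drivenState_sq n
  have i3 := H.run.ζ_zero_integrable
  have iB : Integrable (fun ω => 1 + drivenState α h ζ n ω ^ 2 + ζ 0 ω) P :=
    ((integrable_const _).add i2).add i3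
  have hle : ∀ ω, Mo.energy (θ n ω, ζ n ω) ≤ ‖θ n ω‖ ^ 2 +
      Mo.weight * (1 + drivenState α h ζ n ω ^ 2 + ζ 0 ω) := fun ω => by
    have h1 : ζ n ω ≤ 1 + drivenState α h ζ n ω ^ 2 + ζ 0 ω := by
      have a1 : rho α h ^ n * ζ 0 ω ≤ 1 * ζ 0 ω :=
        mul_le_mul_of_nonneg_right (pow_le_one₀ rho_pos.le (rho_lt_one H.α_pos H.h_pos).le)
          (H.run.ζ_zero_nonneg ω)
      have a2 : ζ n ω = drivenState α h ζ n ω + rho α h ^ n * ζ 0 ω := by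
        unfold drivenState
        ring
      nlinarith [sq_nonneg (drivenState α h ζ n ω - 1)]
    simp only [StepModel.energy, abs_of_nonneg (H.ζ_nonneg n ω)]
    gcongr
  have hi := (i1.add (iB.const_mul Mo.weight)).mono' (Mo.measurable_energy.comp
    ((H.run.measurable_θ n).prodMk (H.run.measurable_ζ n))).aestronglyMeasurable
    (ae_of_all _ fun ω => by
      rw [Function.comp_apply, Real.norm_of_nonneg (Mo.energy_nonneg _)]; exact hle ω)
  refine ⟨hi, (integral_mono hi (i1.add (iB.const_mul Mo.weight)) hle).trans ?_⟩
  have i4 : Integrable (fun ω => 1 + drivenState α h ζ n ω ^ 2) P := (integrable_const _).add i2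
  simp only [Pi.add_apply]
  rw [integral_add i1 (iB.const_mul _), integral_const_mul, integral_add i4 i3,
    integral_add (integrable_const _) i2]
  simp only [integral_const, probReal_univ, smul_eq_mul, one_mul]
  unfold energyBound
  gcongr
  · exact i1'.trans (le_abs_self _)
  · exact i2'.trans (le_abs_self _)

variable [IsProbabilityMeasure P] {ν : Measure (E d × ℝ)} [IsProbabilityMeasure ν]
  {Mo : StepModel d}

/-- Geometric convergence of the expectations from a fixed starting point, for bounded
functions. -/
lemma abs_iterate_sub_integral_le
    (H : IsControlledRun P U ψ α β δ m M Lψ L a b σ σ₄ h K θ ζ G ε)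
    (hS : SetwiseTendsto (fun n => P.map fun ω => (θ n ω, ζ n ω)) ν)
    (hQ : IsGradientLaw P θ ζ G ε Mo.Q) (hstep : ∀ n ω,
      (θ (n + 1) ω, ζ (n + 1) ω) = Mo.update (θ n ω, ζ n ω) (G n ω, ε (n + 1) ω))
    {g : E d × ℝ → ℝ} (hg : Measurable g) {R B : ℝ} (hR : ∀ x, |g x| ≤ R) (hB : 0 ≤ B) {k : ℕ}
    (hdec : ∀ x y, |(kernelOp Mo.kernel)^[k] g x - (kernelOp Mo.kernel)^[k] g y| ≤
      B * (1 + Real.sqrt (Mo.energy x) + Real.sqrt (Mo.energy y))) (x : E d × ℝ) :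
    |(kernelOp Mo.kernel)^[k] g x - ∫ y, g y ∂ν| ≤
      B * (2 + energyBound Mo U α δ L σ₄ K (∫ ω, ζ 0 ω ∂P) + Real.sqrt (Mo.energy x)) := by
  set W := energyBound Mo U α δ L σ₄ K (∫ ω, ζ 0 ω ∂P)
  set T := (kernelOp Mo.kernel)^[k] g with hT
  have hX : ∀ l, Measurable fun ω => (θ l ω, ζ l ω) := fun l =>
    (H.run.measurable_θ l).prodMk (H.run.measurable_ζ l)
  have hTm : Measurable T := measurable_kernelOp_iterate _ hg k
  have hTR : ∀ x, |T x| ≤ R := abs_kernelOp_iterate_le _ hR k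
  -- The stationary mean is identified through the run itself: shifting time by `k` replaces `g` by
  -- its `k`-th iterate. This avoids any comparison of `Mo.kernel` with the kernel for which `ν` is
  -- known to be invariant.
  have hlim : Tendsto (fun l => ∫ ω, T (θ l ω, ζ l ω) ∂P) atTop (𝓝 (∫ y, g y ∂ν)) := by
    have h1 := (H.tendsto_integral hS hg (g := fun _ => R) measurable_const (polyBounded_const R)
      fun x => (hR x).trans (le_abs_self _)).2
    have h2 := h1.comp (tendsto_add_atTop_nat k)
    refine h2.congr fun l => ?_
    have := H.integral_mul_iterate hQ hstep (n := l) (Y := fun _ => 1) measurable_const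
      (integrable_const _) hg hR k
    simpa using this
  have hbound : ∀ l, |T x - ∫ ω, T (θ l ω, ζ l ω) ∂P| ≤
      B * (2 + W + Real.sqrt (Mo.energy x)) := fun l => by
    obtain ⟨iE, iE'⟩ := H.integral_energy_le Mo l
    have iT : Integrable (fun ω => T (θ l ω, ζ l ω)) P :=
      (integrable_const R).mono' (hTm.comp (hX l)).aestronglyMeasurable
        (ae_of_all _ fun ω => hTR _)
    have e1 : T x - ∫ ω, T (θ l ω, ζ l ω) ∂P = ∫ ω, (T x - T (θ l ω, ζ l ω)) ∂P := by
      rw [integral_sub (integrable_const _) iT]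
      simp
    have i2 : Integrable (fun ω => B * ((2 + Real.sqrt (Mo.energy x)) +
        Mo.energy (θ l ω, ζ l ω))) P := ((integrable_const _).add iE).const_mul B
    rw [e1, ← Real.norm_eq_abs]
    refine (norm_integral_le_of_norm_le i2 (ae_of_all _ fun ω => (hdec _ _).trans
      (mul_le_mul_of_nonneg_left ?_ hB))).trans ?_
    · have a1 := Real.sq_sqrt (Mo.energy_nonneg (θ l ω, ζ l ω))
      nlinarith [sq_nonneg (Real.sqrt (Mo.energy (θ l ω, ζ l ω)) - 1)]
    · rw [integral_const_mul, integral_add (integrable_const _) iE]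
      simp only [integral_const, probReal_univ, smul_eq_mul, one_mul]
      exact mul_le_mul_of_nonneg_left (by linarith) hB
  exact le_of_tendsto' ((tendsto_const_nhds.sub hlim).abs) hbound

/-- Exponential decay of correlations. -/
theorem exists_correlation_decay
    (H : IsControlledRun P U ψ α β δ m M Lψ L a b σ σ₄ h K θ ζ G ε)
    (hS : SetwiseTendsto (fun n => P.map fun ω => (θ n ω, ζ n ω)) ν)
    (hQ : IsGradientLaw P θ ζ G ε Mo.Q) (hstep : ∀ n ω,
      (θ (n + 1) ω, ζ (n + 1) ω) = Mo.update (θ n ω, ζ n ω) (G n ω, ε (n + 1) ω))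
    (hF : Measurable F) (hp : PolyBounded F) :
    ∃ C s : ℝ, 0 ≤ C ∧ 0 < s ∧ s < 1 ∧ ∀ (n k : ℕ) (Y : Ω → ℝ), Measurable[past θ ζ G ε n] Y →
      Integrable (fun ω => Y ω ^ 2) P →
      |∫ ω, Y ω * (stepWeighted ψ (stateFloor α δ h) F (θ (n + k) ω, ζ (n + k) ω) -
        ∫ x, stepWeighted ψ (stateFloor α δ h) F x ∂ν) ∂P| ≤
        C * (1 + ∫ ω, Y ω ^ 2 ∂P) * s ^ k := by
  obtain ⟨C₁, r, hC₁, hr, hr1, hdec⟩ := Mo.isWeakHarris.exists_geometric_decay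
  obtain ⟨A₄, N₄, hA₄, hF₄⟩ := hp.pow 4
  have hM := H.M_pos
  set W := energyBound Mo U α δ L σ₄ K (∫ ω, ζ 0 ω ∂P) with hW
  have hz₀ : 0 ≤ ∫ ω, ζ 0 ω ∂P := integral_nonneg fun ω => H.run.ζ_zero_nonneg ω
  have hW0 : 0 ≤ W := by
    have := Mo.weight_pos
    rw [hW, energyBound]
    positivity
  set B := A₄ * (1 + K N₄) with hB
  have hB4 : ∀ l, ∫ ω, F (θ l ω) ^ 4 ∂P ≤ B := fun l =>
    H.integral_comp_θ_le (hF.pow_const 4) hA₄ hF₄ l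
  have iF4 : ∀ l, Integrable (fun ω => F (θ l ω) ^ 4) P := fun l =>
    H.integrable_comp_θ (hF.pow_const 4) (hp.pow 4) l
  have hB0 : 0 ≤ B := (integral_nonneg fun ω => by positivity).trans (hB4 0)
  -- One constant, per unit of the truncation level, for both the supremum and the modulus of the
  -- truncated function, since the decay theorem works with a common bound.
  set c := M + Real.sqrt (2 * M * Lψ) with hc
  have hc0 : 0 ≤ c := by positivity
  have hX : ∀ l, Measurable fun ω => (θ l ω, ζ l ω) := fun l =>
    (H.run.measurable_θ l).prodMk (H.run.measurable_ζ l)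
  set v := stepWeighted ψ (stateFloor α δ h) F with hv
  have hvm : Measurable v := H.measurable_stepWeighted hF
  have iv : ∀ l, Integrable (fun ω => v (θ l ω, ζ l ω)) P := fun l => by
    refine ((H.integrable_comp_θ hF hp l).norm.const_mul M).mono'
      (hvm.comp (hX l)).aestronglyMeasurable (ae_of_all _ fun ω => ?_)
    exact H.abs_stepWeighted_le F _
  refine ⟨2 * M * (1 + B) + C₁ * c * (1 + ((2 + W) ^ 2 + W)), Real.sqrt r, by positivity,
    Real.sqrt_pos.2 hr, by rw [Real.sqrt_lt' one_pos]; simpa using hr1, fun n k Y hY hY2 => ?_⟩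
  set s := Real.sqrt r with hs
  have hs0 : 0 < s := Real.sqrt_pos.2 hr
  have hs2 : s * s = r := Real.mul_self_sqrt hr.le
  -- With `s ^ 2 = r`, this truncation level equates the truncation error `1 / R` and the geometric
  -- error `R * r ^ k`, both being `s ^ k`.
  set R := (s ^ k)⁻¹ with hR
  have hR0 : 0 < R := by positivity
  set g := stepWeighted ψ (stateFloor α δ h) (fun x => clamp R (F x)) with hg
  have hcl : Measurable fun x => clamp R (F x) := (measurable_clamp R).comp hF
  have hgm : Measurable g := H.measurable_stepWeighted hcl
  have hgR' : ∀ x, |g x| ≤ M * R := fun x => (H.abs_stepWeighted_le _ x).trans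
    (mul_le_mul_of_nonneg_left (abs_clamp_le hR0.le _) hM.le)
  have hgR : ∀ x, |g x| ≤ c * R := fun x => (hgR' x).trans
    (mul_le_mul_of_nonneg_right (le_add_of_nonneg_right (Real.sqrt_nonneg _)) hR0.le)
  have hdif : ∀ x, |v x - g x| ≤ M / R * F x.1 ^ 2 := fun x => by
    rw [hv, hg, stepWeighted, stepWeighted, ← mul_sub, abs_mul]
    have := mul_le_mul (H.abs_clippedStep_le x.2) (abs_sub_clamp_le hR0 (F x.1))
      (abs_nonneg _) hM.le
    calc _ ≤ _ := this
      _ = _ := by ring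
  have ig : ∀ l, Integrable (fun ω => g (θ l ω, ζ l ω)) P := fun l =>
    (integrable_const (c * R)).mono' (hgm.comp (hX l)).aestronglyMeasurable
      (ae_of_all _ fun ω => hgR _)
  have hYm : Measurable Y := hY.mono (H.past_le n) le_rfl
  have hYi : Integrable Y P := by
    refine ((integrable_const (1 : ℝ)).add hY2).mono' hYm.aestronglyMeasurable
      (ae_of_all _ fun ω => ?_)
    simp only [Pi.add_apply, Real.norm_eq_abs]
    nlinarith [sq_nonneg (|Y ω| - 1), sq_abs (Y ω)]
  set A := ∫ ω, Y ω ^ 2 ∂P with hA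
  have hA0 : 0 ≤ A := integral_nonneg fun ω => sq_nonneg _
  -- the truncation error in the stationary mean
  have hmean : |∫ x, v x ∂ν - ∫ x, g x ∂ν| ≤ M / R * (1 + B) := by
    have l1 := (H.tendsto_integral hS hvm (g := fun x => M * F x) (hF.const_mul M)
      (hp.const_mul M) fun x => by
        rw [abs_mul, abs_of_pos hM]; exact H.abs_stepWeighted_le F x).2
    have l2 := (H.tendsto_integral hS hgm (g := fun _ => c * R) measurable_const
      (polyBounded_const _) fun x => (hgR x).trans (le_abs_self _)).2
    refine le_of_tendsto' ((l1.sub l2).abs) fun l => ?_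
    rw [← integral_sub (iv l) (ig l), ← Real.norm_eq_abs]
    refine (norm_integral_le_of_norm_le (((integrable_const (1 : ℝ)).add (iF4 l)).const_mul (M / R))
      (ae_of_all _ fun ω => (hdif _).trans ?_)).trans ?_
    · simp only [Pi.add_apply]
      refine mul_le_mul_of_nonneg_left ?_ (by positivity)
      nlinarith [sq_nonneg (F (θ l ω) ^ 2 - 1)]
    · rw [integral_const_mul]
      simp only [Pi.add_apply]
      rw [integral_add (integrable_const _) (iF4 l)]
      simp only [integral_const, probReal_univ, smul_eq_mul, one_mul]
      exact mul_le_mul_of_nonneg_left (by linarith [hB4 l]) (by positivity)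
  -- the truncation error along the chain
  have h1 : Integrable (fun ω => Y ω * (v (θ (n + k) ω, ζ (n + k) ω) -
      g (θ (n + k) ω, ζ (n + k) ω))) P ∧ |∫ ω, Y ω * (v (θ (n + k) ω, ζ (n + k) ω) -
      g (θ (n + k) ω, ζ (n + k) ω)) ∂P| ≤ M / R * (A + B) := by
    have hbd : ∀ ω, ‖Y ω * (v (θ (n + k) ω, ζ (n + k) ω) - g (θ (n + k) ω, ζ (n + k) ω))‖ ≤
        M / R * (Y ω ^ 2 + F (θ (n + k) ω) ^ 4) := fun ω => by
      rw [norm_mul, Real.norm_eq_abs, Real.norm_eq_abs]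
      have a1 := mul_le_mul_of_nonneg_left (hdif (θ (n + k) ω, ζ (n + k) ω)) (abs_nonneg (Y ω))
      have a2 : |Y ω| * F (θ (n + k) ω) ^ 2 ≤ Y ω ^ 2 + F (θ (n + k) ω) ^ 4 := by
        nlinarith [sq_nonneg (|Y ω| - F (θ (n + k) ω) ^ 2), sq_abs (Y ω),
          sq_nonneg (F (θ (n + k) ω) ^ 2), sq_nonneg (Y ω)]
      have a3 := mul_le_mul_of_nonneg_left a2 (show 0 ≤ M / R by positivity)
      simp only at a1
      linarith
    have ib := (hY2.add (iF4 (n + k))).const_mul (M / R)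
    refine ⟨ib.mono' (hYm.mul ((hvm.comp (hX _)).sub (hgm.comp (hX _)))).aestronglyMeasurable
      (ae_of_all _ hbd), ?_⟩
    rw [← Real.norm_eq_abs]
    refine (norm_integral_le_of_norm_le ib (ae_of_all _ hbd)).trans ?_
    rw [integral_const_mul]
    simp only [Pi.add_apply]
    rw [integral_add hY2 (iF4 _)]
    exact mul_le_mul_of_nonneg_left (by linarith [hB4 (n + k)]) (by positivity)
  -- the bounded part
  set T := (kernelOp Mo.kernel)^[k] g with hT
  have hTm : Measurable T := measurable_kernelOp_iterate _ hgm k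
  have hTR : ∀ x, |T x| ≤ c * R := abs_kernelOp_iterate_le _ hgR k
  have hTdec : ∀ x, |T x - ∫ y, g y ∂ν| ≤
      C₁ * (c * R) * r ^ k * (2 + W + Real.sqrt (Mo.energy x)) :=
    H.abs_iterate_sub_integral_le hS hQ hstep hgm hgR (by positivity)
      (hdec g (c * R) hgm hgR (fun x y hxy => H.abs_stepWeighted_sub_le Mo
        (fun x => abs_clamp_le hR0.le _) hxy) k)
  have iYg : Integrable (fun ω => Y ω * g (θ (n + k) ω, ζ (n + k) ω)) P :=
    hYi.mul_bdd (hgm.comp (hX _)).aestronglyMeasurable (ae_of_all _ fun ω => hgR _)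
  have iYT : Integrable (fun ω => Y ω * T (θ n ω, ζ n ω)) P :=
    hYi.mul_bdd (hTm.comp (hX _)).aestronglyMeasurable (ae_of_all _ fun ω => hTR _)
  have h2 : |∫ ω, Y ω * (g (θ (n + k) ω, ζ (n + k) ω) - ∫ y, g y ∂ν) ∂P| ≤
      C₁ * (c * R) * r ^ k * (A + ((2 + W) ^ 2 + W)) := by
    obtain ⟨iE, iE'⟩ := H.integral_energy_le Mo n
    have e1 : ∫ ω, Y ω * (g (θ (n + k) ω, ζ (n + k) ω) - ∫ y, g y ∂ν) ∂P =
        ∫ ω, Y ω * (T (θ n ω, ζ n ω) - ∫ y, g y ∂ν) ∂P := by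
      simp_rw [mul_sub]
      rw [integral_sub iYg (hYi.mul_const _), integral_sub iYT (hYi.mul_const _),
        H.integral_mul_iterate hQ hstep hY hYi hgm hgR k]
    have iE2 : Integrable (fun ω => (2 + W) ^ 2 + Mo.energy (θ n ω, ζ n ω)) P :=
      (integrable_const _).add iE
    have ib : Integrable (fun ω => C₁ * (c * R) * r ^ k *
        (Y ω ^ 2 + ((2 + W) ^ 2 + Mo.energy (θ n ω, ζ n ω)))) P :=
      (hY2.add iE2).const_mul _
    rw [e1, ← Real.norm_eq_abs]
    refine (norm_integral_le_of_norm_le ib (ae_of_all _ fun ω => ?_)).trans ?_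
    · rw [norm_mul, Real.norm_eq_abs, Real.norm_eq_abs]
      have a1 := mul_le_mul_of_nonneg_left (hTdec (θ n ω, ζ n ω)) (abs_nonneg (Y ω))
      have a0 := Real.sq_sqrt (Mo.energy_nonneg (θ n ω, ζ n ω))
      set e := Real.sqrt (Mo.energy (θ n ω, ζ n ω))
      have a2 : |Y ω| * (2 + W + e) ≤ Y ω ^ 2 + ((2 + W) ^ 2 + Mo.energy (θ n ω, ζ n ω)) := by
        rw [← a0, ← sq_abs (Y ω)]
        nlinarith [sq_nonneg (|Y ω| - (2 + W)), sq_nonneg (|Y ω| - e), sq_nonneg (2 + W),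
          sq_nonneg e]
      have a3 := mul_le_mul_of_nonneg_left a2
        (show 0 ≤ C₁ * (c * R) * r ^ k by positivity)
      linarith
    · rw [integral_const_mul, integral_add hY2 iE2,
        integral_add (integrable_const _) iE]
      simp only [integral_const, probReal_univ, smul_eq_mul, one_mul]
      exact mul_le_mul_of_nonneg_left (by linarith) (by positivity)
  have h3 : |∫ ω, Y ω * (∫ y, g y ∂ν - ∫ y, v y ∂ν) ∂P| ≤ M / R * (1 + B) * (1 + A) := by
    rw [integral_mul_const, abs_mul, mul_comm, abs_sub_comm]
    have a1 : |∫ ω, Y ω ∂P| ≤ 1 + A := by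
      have := sq_integral_le_integral_sq hYi hY2
      rw [← hA] at this
      nlinarith [sq_nonneg (|∫ ω, Y ω ∂P| - 1), sq_abs (∫ ω, Y ω ∂P)]
    exact mul_le_mul hmean a1 (abs_nonneg _) (by positivity)
  have hsplit : ∫ ω, Y ω * (v (θ (n + k) ω, ζ (n + k) ω) - ∫ x, v x ∂ν) ∂P =
      ∫ ω, Y ω * (v (θ (n + k) ω, ζ (n + k) ω) - g (θ (n + k) ω, ζ (n + k) ω)) ∂P +
      ∫ ω, Y ω * (g (θ (n + k) ω, ζ (n + k) ω) - ∫ y, g y ∂ν) ∂P +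
      ∫ ω, Y ω * (∫ y, g y ∂ν - ∫ y, v y ∂ν) ∂P := by
    have j2 : Integrable (fun ω => Y ω * (g (θ (n + k) ω, ζ (n + k) ω) - ∫ y, g y ∂ν)) P := by
      simp_rw [mul_sub]
      exact iYg.sub (hYi.mul_const _)
    have j3 : Integrable (fun ω =>
        Y ω * (v (θ (n + k) ω, ζ (n + k) ω) - g (θ (n + k) ω, ζ (n + k) ω)) +
          Y ω * (g (θ (n + k) ω, ζ (n + k) ω) - ∫ y, g y ∂ν)) P := h1.1.add j2
    rw [← integral_add h1.1 j2, ← integral_add j3 (hYi.mul_const _)]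
    refine integral_congr_ae (ae_of_all _ fun ω => ?_)
    ring
  rw [hsplit]
  refine truncation_bound hM.le hA0 hB0 hC₁ hc0 (W := (2 + W) ^ 2 + W) (by positivity)
    (pow_nonneg hs0.le k) (inv_inv _) (R := R) (r := r ^ k) ?_ ?_
  · rw [hR, ← hs2, mul_pow, ← mul_assoc, inv_mul_cancel₀ (by positivity), one_mul]
  · exact (abs_add_le _ _).trans (add_le_add ((abs_add_le _ _).trans (add_le_add h1.2 h2)) h3)

end IsControlledRun

end SASGLD
end

/-! ### Second moments of centred sums and the rate `1 / n`. -/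

noncomputable section

namespace SASGLD

section SecondMoments

variable {Ω : Type*} [MeasurableSpace Ω] {P : Measure Ω}

lemma sum_pow_sub_le {s : ℝ} (hs : 0 ≤ s) (hs1 : s < 1) (n : ℕ) :
    ∑ j ∈ Finset.range n, s ^ (n - j) ≤ (1 - s)⁻¹ := by
  have h1 : ∑ j ∈ Finset.range n, s ^ (n - j) = ∑ j ∈ Finset.range n, s ^ (j + 1) := by
    rw [← Finset.sum_range_reflect]
    refine Finset.sum_congr rfl fun j hj => ?_
    have := Finset.mem_range.1 hj
    congr 1
    omega
  rw [h1]
  calc ∑ j ∈ Finset.range n, s ^ (j + 1) ≤ ∑ j ∈ Finset.range n, s ^ j :=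
        Finset.sum_le_sum fun j _ => pow_le_pow_of_le_one hs hs1.le (Nat.le_succ j)
    _ ≤ (1 - s)⁻¹ := by
        rw [← tsum_geometric_of_lt_one hs hs1]
        exact (summable_geometric_of_lt_one hs hs1).sum_le_tsum _ fun j _ => pow_nonneg hs j

/-- The second moment of a sum of exponentially decorrelated variables grows linearly. -/
lemma integral_sum_sq_le_of_decorrelated {a : ℕ → Ω → ℝ} {B C s : ℝ} (ha : ∀ j, MemLp (a j) 2 P)
    (hs : 0 ≤ s) (hs1 : s < 1) (hC : 0 ≤ C) (hB : ∀ j, ∫ ω, a j ω ^ 2 ∂P ≤ B)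
    (hcorr : ∀ j k, |∫ ω, a j ω * a (j + k) ω ∂P| ≤ C * s ^ k) (n : ℕ) :
    ∫ ω, (∑ j ∈ Finset.range n, a j ω) ^ 2 ∂P ≤ (2 * C * (1 - s)⁻¹ + B) * n := by
  induction n with
  | zero => simp
  | succ n ih =>
    have hS : MemLp (fun ω => ∑ j ∈ Finset.range n, a j ω) 2 P :=
      memLp_finsetSum _ fun j _ => ha j
    have i1 := hS.integrable_sq
    have i2 := (ha n).integrable_sq
    have i3 : ∀ j, Integrable (fun ω => a j ω * a n ω) P := fun j => (ha j).integrable_mul (ha n)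
    have i4 : Integrable (fun ω => ∑ j ∈ Finset.range n, a j ω * a n ω) P :=
      integrable_finsetSum _ fun j _ => i3 j
    have e1 : ∀ ω, (∑ j ∈ Finset.range (n + 1), a j ω) ^ 2 =
        (∑ j ∈ Finset.range n, a j ω) ^ 2 +
          (2 * ∑ j ∈ Finset.range n, a j ω * a n ω + a n ω ^ 2) := fun ω => by
      rw [Finset.sum_range_succ, ← Finset.sum_mul]
      ring
    have i5 : Integrable (fun ω => 2 * ∑ j ∈ Finset.range n, a j ω * a n ω + a n ω ^ 2) P :=
      (i4.const_mul 2).add i2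
    simp_rw [e1]
    rw [integral_add i1 i5, integral_add (i4.const_mul 2) i2, integral_const_mul,
      integral_finsetSum _ fun j _ => i3 j]
    have h1 : ∑ j ∈ Finset.range n, ∫ ω, a j ω * a n ω ∂P ≤ C * (1 - s)⁻¹ := by
      calc ∑ j ∈ Finset.range n, ∫ ω, a j ω * a n ω ∂P
          ≤ ∑ j ∈ Finset.range n, C * s ^ (n - j) := Finset.sum_le_sum fun j hj => by
            have := hcorr j (n - j)
            rw [Nat.add_sub_cancel' (Finset.mem_range.1 hj).le] at this
            exact (le_abs_self _).trans this
        _ = C * ∑ j ∈ Finset.range n, s ^ (n - j) := by rw [Finset.mul_sum]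
        _ ≤ _ := mul_le_mul_of_nonneg_left (sum_pow_sub_le hs hs1 n) hC
    have h2 := hB n
    push_cast
    linarith

/-- The expectation of a ratio with a denominator close to a constant. -/
lemma abs_integral_div_le [IsFiniteMeasure P] {u S : Ω → ℝ} {N τ m : ℝ} (hu : MemLp u 2 P)
    (hS : MemLp S 2 P) (hN : 0 < N) (hτ : 0 < τ) (hm : 0 < m)
    (hle : ∀ ω, N * m ≤ N * τ + S ω) :
    Integrable (fun ω => u ω / (N * τ + S ω)) P ∧ |∫ ω, u ω / (N * τ + S ω) ∂P| ≤
      |∫ ω, u ω ∂P| / (N * τ) +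
        (∫ ω, u ω ^ 2 ∂P + ∫ ω, S ω ^ 2 ∂P) / (2 * (N * τ) * (N * m)) := by
  have hNm : 0 < N * m := mul_pos hN hm
  have hNτ : 0 < N * τ := mul_pos hN hτ
  have hpos : ∀ ω, 0 < N * τ + S ω := fun ω => hNm.trans_le (hle ω)
  have hui : Integrable u P := hu.integrable one_le_two
  have iu2 := hu.integrable_sq
  have iS2 := hS.integrable_sq
  have hTm : AEStronglyMeasurable (fun ω => N * τ + S ω) P :=
    aestronglyMeasurable_const.add hS.aestronglyMeasurable
  -- Expansion of the reciprocal around `N * τ`: the leading term involves only the mean of `u`, and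
  -- the correction is quadratic in the fluctuations.
  have e1 : ∀ ω, u ω / (N * τ + S ω) = u ω / (N * τ) - u ω * S ω / ((N * τ) * (N * τ + S ω)) :=
    fun ω => by
      have := (hpos ω).ne'
      field_simp
      ring
  have hbd : ∀ ω, ‖u ω * S ω / ((N * τ) * (N * τ + S ω))‖ ≤
      (u ω ^ 2 + S ω ^ 2) / (2 * (N * τ) * (N * m)) := fun ω => by
    rw [norm_div, Real.norm_of_nonneg (mul_pos hNτ (hpos ω)).le, norm_mul, Real.norm_eq_abs,
      Real.norm_eq_abs, div_le_div_iff₀ (mul_pos hNτ (hpos ω)) (by positivity)]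
    have h1 : 2 * (|u ω| * |S ω|) ≤ u ω ^ 2 + S ω ^ 2 := by
      have := two_mul_le_add_sq |u ω| |S ω|
      rw [sq_abs, sq_abs] at this
      linarith
    have h2 := mul_le_mul h1 (hle ω) hNm.le (by positivity)
    have h3 := mul_le_mul_of_nonneg_left h2 hNτ.le
    linarith
  have ib : Integrable (fun ω => (u ω ^ 2 + S ω ^ 2) / (2 * (N * τ) * (N * m))) P :=
    (iu2.add iS2).div_const _
  have i2 : Integrable (fun ω => u ω * S ω / ((N * τ) * (N * τ + S ω))) P :=
    ib.mono' ((hu.aestronglyMeasurable.mul hS.aestronglyMeasurable).div₀ (hTm.const_mul _))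
      (ae_of_all _ hbd)
  simp_rw [e1]
  refine ⟨(hui.div_const _).sub i2, ?_⟩
  rw [integral_sub (hui.div_const _) i2, integral_div]
  refine (abs_sub _ _).trans (add_le_add ?_ ?_)
  · rw [abs_div, abs_of_pos hNτ]
  · rw [← integral_add iu2 iS2, ← integral_div, ← Real.norm_eq_abs]
    exact norm_integral_le_of_norm_le ib (ae_of_all _ hbd)

end SecondMoments

variable {d : ℕ}

namespace IsControlledRun

variable {Ω : Type*} [MeasurableSpace Ω] {P : Measure Ω} [IsProbabilityMeasure P] {U : E d → ℝ}
  {ψ : ℝ → ℝ} {α β δ m M Lψ L a b σ σ₄ h : ℝ} {K : ℕ → ℝ}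
  {θ : ℕ → Ω → E d} {ζ : ℕ → Ω → ℝ} {G ε : ℕ → Ω → E d}
  {ν : Measure (E d × ℝ)} [IsProbabilityMeasure ν] {Mo : StepModel d}

/-- The centred sums have bounded means and linearly growing second moments. -/
lemma exists_centred_sum_bounds
    (H : IsControlledRun P U ψ α β δ m M Lψ L a b σ σ₄ h K θ ζ G ε)
    (hS : SetwiseTendsto (fun n => P.map fun ω => (θ n ω, ζ n ω)) ν)
    (hQ : IsGradientLaw P θ ζ G ε Mo.Q) (hstep : ∀ n ω,
      (θ (n + 1) ω, ζ (n + 1) ω) = Mo.update (θ n ω, ζ n ω) (G n ω, ε (n + 1) ω))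
    {F : E d → ℝ} (hF : Measurable F) (hp : PolyBounded F) :
    ∃ C : ℝ, 0 ≤ C ∧ ∀ n : ℕ,
      MemLp (fun ω => ∑ k ∈ Finset.range n,
        (stepWeighted ψ (stateFloor α δ h) F (θ (k + 1) ω, ζ (k + 1) ω) -
          ∫ x, stepWeighted ψ (stateFloor α δ h) F x ∂ν)) 2 P ∧
      |∫ ω, ∑ k ∈ Finset.range n,
        (stepWeighted ψ (stateFloor α δ h) F (θ (k + 1) ω, ζ (k + 1) ω) -
          ∫ x, stepWeighted ψ (stateFloor α δ h) F x ∂ν) ∂P| ≤ C ∧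
      ∫ ω, (∑ k ∈ Finset.range n,
        (stepWeighted ψ (stateFloor α δ h) F (θ (k + 1) ω, ζ (k + 1) ω) -
          ∫ x, stepWeighted ψ (stateFloor α δ h) F x ∂ν)) ^ 2 ∂P ≤ C * n := by
  obtain ⟨C, s, hC, hs, hs1, hdec⟩ := H.exists_correlation_decay hS hQ hstep hF hp
  obtain ⟨A, N, hA, hle⟩ := hp.pow 2
  have hM := H.M_pos
  set μ := ∫ x, stepWeighted ψ (stateFloor α δ h) F x ∂ν with hμ
  have hvm := H.measurable_stepWeighted hF
  set w : ℕ → Ω → ℝ := fun k ω =>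
    stepWeighted ψ (stateFloor α δ h) F (θ k ω, ζ k ω) - μ with hw
  have hwp : ∀ k, Measurable[past θ ζ G ε k] (w k) := fun k =>
    (hvm.comp ((H.measurable_past k).1.prodMk (H.measurable_past k).2)).sub_const μ
  have hwm : ∀ k, Measurable (w k) := fun k => (hwp k).mono (H.past_le k) le_rfl
  have iF : ∀ k, Integrable (fun ω => F (θ k ω) ^ 2) P := fun k =>
    H.integrable_comp_θ (hF.pow_const 2) (hp.pow 2) k
  have hwle : ∀ k ω, w k ω ^ 2 ≤ 2 * M ^ 2 * F (θ k ω) ^ 2 + 2 * μ ^ 2 := fun k ω => by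
    have h1 := H.abs_stepWeighted_le F (θ k ω, ζ k ω)
    have h2 : stepWeighted ψ (stateFloor α δ h) F (θ k ω, ζ k ω) ^ 2 ≤ (M * |F (θ k ω)|) ^ 2 :=
      sq_le_sq' (neg_le_of_abs_le h1) (le_of_abs_le h1)
    rw [mul_pow, sq_abs] at h2
    simp only [hw]
    nlinarith [sq_nonneg (stepWeighted ψ (stateFloor α δ h) F (θ k ω, ζ k ω) + μ)]
  have iB : ∀ k, Integrable (fun ω => 2 * M ^ 2 * F (θ k ω) ^ 2 + 2 * μ ^ 2) P := fun k =>
    ((iF k).const_mul _).add (integrable_const _)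
  have iw : ∀ k, Integrable (fun ω => w k ω ^ 2) P := fun k =>
    (iB k).mono' ((hwm k).pow_const 2).aestronglyMeasurable (ae_of_all _ fun ω => by
      rw [Real.norm_of_nonneg (sq_nonneg _)]; exact hwle k ω)
  set B := 2 * M ^ 2 * (A * (1 + K N)) + 2 * μ ^ 2 with hB
  have hwB : ∀ k, ∫ ω, w k ω ^ 2 ∂P ≤ B := fun k => by
    refine (integral_mono (iw k) (iB k) (hwle k)).trans ?_
    rw [integral_add ((iF k).const_mul _) (integrable_const _), integral_const_mul]
    simp only [integral_const, probReal_univ, smul_eq_mul, one_mul]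
    have := H.integral_comp_θ_le (hF.pow_const 2) hA hle k
    rw [hB]
    gcongr
  have hB0 : 0 ≤ B := (integral_nonneg fun ω => sq_nonneg _).trans (hwB 0)
  have hL : ∀ k, MemLp (w k) 2 P := fun k =>
    (memLp_two_iff_integrable_sq (hwm k).aestronglyMeasurable).2 (iw k)
  -- The correlation bound at time zero with the constant factor `1` gives geometric convergence of
  -- the means, which makes the sum of the means bounded.
  have hmean : ∀ k, |∫ ω, w k ω ∂P| ≤ 2 * C * s ^ k := fun k => by
    have := hdec 0 k (fun _ => 1) measurable_const (integrable_const _)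
    simp only [zero_add, one_mul, one_pow, integral_const, probReal_univ, smul_eq_mul,
      mul_one] at this
    linarith
  have hcorr : ∀ j k, |∫ ω, w (j + 1) ω * w (j + k + 1) ω ∂P| ≤ C * (1 + B) * s ^ k :=
    fun j k => by
      have h1 := hdec (j + 1) k (w (j + 1)) (hwp _) (iw _)
      rw [show j + 1 + k = j + k + 1 by ring] at h1
      refine h1.trans ?_
      gcongr
      exact hwB _
  have hs0 : 0 < 1 - s := sub_pos.2 hs1
  set D := 2 * C * (1 - s)⁻¹ + (2 * (C * (1 + B)) * (1 - s)⁻¹ + B) with hD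
  have hD1 : 0 ≤ 2 * C * (1 - s)⁻¹ := by positivity
  have hD2 : 0 ≤ 2 * (C * (1 + B)) * (1 - s)⁻¹ + B := by positivity
  refine ⟨D, by positivity, fun n => ⟨memLp_finsetSum _ fun k _ => hL (k + 1), ?_, ?_⟩⟩
  · have e1 : ∫ ω, ∑ k ∈ Finset.range n, w (k + 1) ω ∂P =
        ∑ k ∈ Finset.range n, ∫ ω, w (k + 1) ω ∂P :=
      integral_finsetSum _ fun k _ => (hL (k + 1)).integrable one_le_two
    change |∫ ω, ∑ k ∈ Finset.range n, w (k + 1) ω ∂P| ≤ D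
    rw [e1]
    calc |∑ k ∈ Finset.range n, ∫ ω, w (k + 1) ω ∂P|
        ≤ ∑ k ∈ Finset.range n, |∫ ω, w (k + 1) ω ∂P| := Finset.abs_sum_le_sum_abs _ _
      _ ≤ ∑ k ∈ Finset.range n, 2 * C * s ^ k := Finset.sum_le_sum fun k _ =>
          (hmean (k + 1)).trans (mul_le_mul_of_nonneg_left
            (pow_le_pow_of_le_one hs.le hs1.le (Nat.le_succ k)) (by positivity))
      _ = 2 * C * ∑ k ∈ Finset.range n, s ^ k := by rw [Finset.mul_sum]
      _ ≤ 2 * C * (1 - s)⁻¹ := by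
          rw [← tsum_geometric_of_lt_one hs.le hs1]
          exact mul_le_mul_of_nonneg_left ((summable_geometric_of_lt_one hs.le hs1).sum_le_tsum _
            fun j _ => pow_nonneg hs.le j) (by positivity)
      _ ≤ D := by linarith
  · have h1 := integral_sum_sq_le_of_decorrelated (a := fun k => w (k + 1)) (B := B)
      (C := C * (1 + B)) (fun k => hL (k + 1)) hs.le hs1 (by positivity) (fun k => hwB _) hcorr n
    refine h1.trans (mul_le_mul_of_nonneg_right ?_ (Nat.cast_nonneg n))
    linarith

/-- The expectation of the time average converges at the rate `1 / n`. -/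
theorem exists_rate_bound
    (H : IsControlledRun P U ψ α β δ m M Lψ L a b σ σ₄ h K θ ζ G ε)
    (hS : SetwiseTendsto (fun n => P.map fun ω => (θ n ω, ζ n ω)) ν) {f : E d → ℝ}
    (hf : Continuous f) (hp : PolyBounded f) (hG : HasFreshGradients P θ ζ G ε) :
    ∃ C : ℝ, ∀ n : ℕ, 1 ≤ n → |∫ ω, timeAverage ψ h f θ ζ n ω ∂P -
        (∫ x, clippedStep ψ (stateFloor α δ h) x.2 * f x.1 ∂ν) /
        ∫ x, clippedStep ψ (stateFloor α δ h) x.2 ∂ν| ≤ C / n := by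
  obtain ⟨Q₀, hQ₀, hlaw₀⟩ := hG
  obtain ⟨Q, hQm, hlaw, hQi, hQ⟩ := H.exists_isGradientLaw (Q := Q₀) hlaw₀
  obtain ⟨Mo, rfl, hstep⟩ := H.exists_stepModel hQi hQ
  have hm := H.m_pos
  have hM := H.M_pos
  set c := stateFloor α δ h
  set τ := ∫ x, clippedStep ψ c x.2 ∂ν with hτ
  have hcm : Measurable fun x : E d × ℝ => clippedStep ψ c x.2 :=
    H.step.continuous_clippedStep.measurable.comp measurable_snd
  have ic : Integrable (fun x : E d × ℝ => clippedStep ψ c x.2) ν :=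
    (integrable_const M).mono' hcm.aestronglyMeasurable
      (ae_of_all _ fun x => H.abs_clippedStep_le _)
  have ifν : Integrable (fun x : E d × ℝ => clippedStep ψ c x.2 * f x.1) ν :=
    (H.tendsto_integral hS (H.measurable_stepWeighted hf.measurable) (g := fun x => M * f x)
      (hf.measurable.const_mul M) (hp.const_mul M) fun x => by
        rw [abs_mul, abs_of_pos hM]; exact H.abs_stepWeighted_le f x).1
  have hτm : m ≤ τ := by
    have := integral_mono (integrable_const m) ic fun x => H.step.le_clippedStep x.2
    simpa using this
  have hτ0 : 0 < τ := hm.trans_le hτm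
  set ℓ := (∫ x, clippedStep ψ c x.2 * f x.1 ∂ν) / τ with hℓ
  -- Centring `f` at the limit `ℓ` makes the stationary mean of the weighted function vanish, so the
  -- numerator of the centred ratio has a bounded mean.
  obtain ⟨C₁, hC₁, h1⟩ := H.exists_centred_sum_bounds hS hlaw hstep
    (hf.measurable.sub_const ℓ) (hp.sub (polyBounded_const ℓ))
  obtain ⟨C₂, hC₂, h2⟩ := H.exists_centred_sum_bounds hS hlaw hstep (F := fun _ => 1)
    measurable_const (polyBounded_const 1)
  have hν1 : ∫ x, stepWeighted ψ c (fun x => f x - ℓ) x ∂ν = 0 := by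
    simp only [stepWeighted, mul_sub]
    rw [integral_sub ifν (ic.mul_const ℓ), integral_mul_const, ← hτ, hℓ,
      mul_div_cancel₀ _ hτ0.ne', sub_self]
  have hν2 : ∫ x, stepWeighted ψ c (fun _ => 1) x ∂ν = τ := by
    simp only [stepWeighted, mul_one]
    exact hτ.symm
  rw [hν1] at h1
  rw [hν2] at h2
  simp only [sub_zero, stepWeighted, mul_one] at h1 h2
  refine ⟨C₁ / τ + (C₁ + C₂) / (2 * τ * m), fun n hn => ?_⟩
  have hn0 : (0 : ℝ) < n := by exact_mod_cast hn
  obtain ⟨a1, a2, a3⟩ := h1 n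
  obtain ⟨b1, -, b3⟩ := h2 n
  set u : Ω → ℝ := fun ω => ∑ k ∈ Finset.range n,
    clippedStep ψ c (ζ (k + 1) ω) * (f (θ (k + 1) ω) - ℓ) with hu
  set S : Ω → ℝ := fun ω => ∑ k ∈ Finset.range n, (clippedStep ψ c (ζ (k + 1) ω) - τ) with hSd
  have hT : ∀ ω, n * τ + S ω = ∑ k ∈ Finset.range n, clippedStep ψ c (ζ (k + 1) ω) := fun ω => by
    simp [hSd, Finset.sum_sub_distrib]
  have hTle : ∀ ω, n * m ≤ n * τ + S ω := fun ω => by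
    rw [hT]
    have := Finset.card_nsmul_le_sum (Finset.range n) (fun k => clippedStep ψ c (ζ (k + 1) ω)) m
      fun k _ => H.step.le_clippedStep _
    simpa using this
  obtain ⟨iU, hU⟩ := abs_integral_div_le a1 b1 hn0 hτ0 hm hTle
  have hA : ∀ ω, timeAverage ψ h f θ ζ n ω = u ω / (n * τ + S ω) + ℓ := fun ω => by
    have hpos : 0 < n * τ + S ω := (mul_pos hn0 hm).trans_le (hTle ω)
    rw [H.timeAverage_eq f n ω, ← hT, div_add' _ _ _ hpos.ne']
    congr 1
    rw [hT, hu, Finset.mul_sum, ← Finset.sum_add_distrib]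
    exact Finset.sum_congr rfl fun k _ => by ring
  simp_rw [hA]
  rw [integral_add iU (integrable_const _)]
  simp only [integral_const, probReal_univ, smul_eq_mul, one_mul, add_sub_cancel_right]
  refine hU.trans ?_
  have e1 : (C₁ / τ + (C₁ + C₂) / (2 * τ * m)) / n =
      C₁ / (n * τ) + (C₁ * n + C₂ * n) / (2 * (n * τ) * (n * m)) := by
    field_simp
  rw [e1]
  gcongr

end IsControlledRun

end SASGLD
end

/-! ### The theorem. -/

theorem theorem1 {d : ℕ} (U : SASGLD.E d → ℝ) (ψ : ℝ → ℝ)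
    (α β δ m M Lψ L a b σ σ₄ : ℝ) (K : ℕ → ℝ)
    (hα : 0 < α) (hβ : 0 < β) (hδ : 0 < δ) (hm : 0 < m) (hL : 0 < L) (ha : 0 < a)
    (hb : 0 ≤ b) (hσ : 0 ≤ σ)
    (hU : SASGLD.IsAdmissiblePotential U L a b)
    (f φ : SASGLD.E d → ℝ) (hφ : SASGLD.IsPoissonSolution U β f φ) :
    Integrable f (SASGLD.gibbs U β) ∧
    ∃ C : ℝ, 0 < C ∧
      ∀ h : ℝ, 0 < h → 0 < SASGLD.gammaRate a m M L σ h →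
        SASGLD.IsStepFunction ψ m M Lψ α δ h →
      ∀ (Ω : Type*) [MeasurableSpace Ω] (P : Measure Ω) [IsProbabilityMeasure P]
        (θ : ℕ → Ω → SASGLD.E d) (ζ : ℕ → Ω → ℝ) (G ε : ℕ → Ω → SASGLD.E d)
        (ν : Measure (SASGLD.E d × ℝ)),
        SASGLD.IsRun P U ψ α β δ σ σ₄ h θ ζ G ε →
        SASGLD.HasMomentBounds P K θ →
        SASGLD.IsErgodicMarkov P (fun n ω => (θ n ω, ζ n ω)) {x | 0 ≤ x.2} ν →
        -- the quantities below are well defined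
        (Integrable (fun x => ψ x.2) ν ∧ Integrable (fun x => ψ x.2 * f x.1) ν ∧
          ∀ n : ℕ, 1 ≤ n → Integrable (SASGLD.timeAverage ψ h f θ ζ n) P) ∧
        -- almost sure convergence of the weighted time averages
        (∀ᵐ ω ∂P, Tendsto (fun n => SASGLD.timeAverage ψ h f θ ζ n ω) atTop
          (𝓝 (SASGLD.weightedMarginal ψ ν f))) ∧
        -- bias of order `h`, with `C` independent of `h` and of the run
        |SASGLD.weightedMarginal ψ ν f - ∫ x, f x ∂(SASGLD.gibbs U β)| ≤ C * h ∧
        -- expected time average: `O(h) + O(1/n)`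
        (∃ C' : ℝ, ∀ n : ℕ, 1 ≤ n →
          |∫ ω, SASGLD.timeAverage ψ h f θ ζ n ω ∂P - ∫ x, f x ∂(SASGLD.gibbs U β)| ≤
            C * h + C' / n) ∧
        -- the sharper form with the stationary bias itself in place of `C h`
        (SASGLD.HasFreshGradients P θ ζ G ε →
          ∃ C' : ℝ, ∀ n : ℕ, 1 ≤ n →
            |∫ ω, SASGLD.timeAverage ψ h f θ ζ n ω ∂P - ∫ x, f x ∂(SASGLD.gibbs U β)| ≤
              |SASGLD.weightedMarginal ψ ν f - ∫ x, f x ∂(SASGLD.gibbs U β)| + C' / n) := by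
  have hfc := hφ.continuous hU
  have hfp := hφ.polyBounded_f hU
  have hgp := SASGLD.polyBounded_generator hU hφ
  have hgc : Continuous (SASGLD.generator U β φ) := SASGLD.continuous_generator hU hφ.contDiff
  refine ⟨hU.integrable_gibbs ha hb hβ hfc hfp, ?_⟩
  obtain ⟨C, hC, hbias⟩ := SASGLD.exists_bias_bound U ψ α β δ m M Lψ L a b σ σ₄ K hφ.contDiff
    (fun j hj => hφ.polyBounded hj) hgc hgp
  obtain ⟨A, N, hA, hfA⟩ := hfp.pow 2
  -- `C / m` bounds the bias after division by the mean step size, which is at least `m`. The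
  -- summand `1` absorbs the error `h` conceded to the expected time average and makes the constant
  -- positive.
  refine ⟨C / m + 1, by positivity, ?_⟩
  intro h hh hγ hψ Ω _ P _ θ ζ G ε ν hrun hK hmarkov
  obtain ⟨hν, κ, hκ, hchain, herg⟩ := hmarkov
  have H : SASGLD.IsControlledRun P U ψ α β δ m M Lψ L a b σ σ₄ h K θ ζ G ε :=
    ⟨hrun, hK, hψ, hU, hα, hβ, hδ, hm, hL, ha, hσ, hh, hγ⟩
  have hX : ∀ n, Measurable fun ω => (θ n ω, ζ n ω) := fun n =>
    (H.run.measurable_θ n).prodMk (H.run.measurable_ζ n)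
  have hS : SASGLD.SetwiseTendsto (fun n => P.map fun ω => (θ n ω, ζ n ω)) ν :=
    SASGLD.IsMarkovChain.setwiseTendsto hX hchain herg fun ω => H.ζ_nonneg 0 ω
  set c : ℝ := ∫ x, f x ∂(SASGLD.gibbs U β) with hc
  set ψ' := SASGLD.clippedStep ψ (SASGLD.stateFloor α δ h) with hψ'
  have mψ : Measurable fun x : SASGLD.E d × ℝ => ψ' x.2 :=
    H.step.continuous_clippedStep.measurable.comp measurable_snd
  have hψabs : ∀ x, |ψ' x| ≤ M := fun x => by
    rw [abs_of_nonneg (hm.le.trans (hψ.le_clippedStep x))]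
    exact hψ.clippedStep_le x
  have iψ : Integrable (fun x : SASGLD.E d × ℝ => ψ' x.2) ν :=
    (integrable_const M).mono' mψ.aestronglyMeasurable (ae_of_all _ fun x => hψabs _)
  have ifν : Integrable (fun x : SASGLD.E d × ℝ => ψ' x.2 * f x.1) ν :=
    (H.tendsto_integral hS (u := fun x => ψ' x.2 * f x.1) (mψ.mul (hfc.measurable.comp measurable_fst))
      (hfc.measurable.const_mul M) (hfp.const_mul M) fun x => by
        rw [abs_mul, abs_mul, abs_of_pos H.M_pos]
        exact mul_le_mul_of_nonneg_right (hψabs _) (abs_nonneg _)).1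
  have hae := H.ae_eq_clippedStep hS
  have hae' : (fun x : SASGLD.E d × ℝ => ψ x.2 * f x.1) =ᵐ[ν] fun x => ψ' x.2 * f x.1 := by
    filter_upwards [hae] with x hx
    rw [hx]
  have hπ : SASGLD.weightedMarginal ψ ν f = (∫ x, ψ' x.2 * f x.1 ∂ν) / ∫ x, ψ' x.2 ∂ν := by
    rw [SASGLD.weightedMarginal, integral_congr_ae hae, integral_congr_ae hae']
  have hpos : m ≤ ∫ x, ψ' x.2 ∂ν := by
    have := integral_mono (integrable_const m) iψ fun x => hψ.le_clippedStep x.2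
    simpa using this
  have has := H.tendsto_timeAverage hchain herg hfc.measurable ifν
  have hsq := fun n => H.integral_timeAverage_sq_le hfc.measurable hA hfA n
  have hAm := fun n => (H.measurable_timeAverage hfc.measurable n).aestronglyMeasurable (μ := P)
  have hb3 : |SASGLD.weightedMarginal ψ ν f - c| ≤ C / m * h := by
    have h1 := hbias h Ω P θ ζ G ε ν H hS
    have h2 : ∫ x, ψ' x.2 * SASGLD.generator U β φ x.1 ∂ν =
        ∫ x, ψ' x.2 * f x.1 ∂ν - (∫ x, ψ' x.2 ∂ν) * c := by
      rw [← integral_mul_const, ← integral_sub ifν (iψ.mul_const c)]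
      refine integral_congr_ae (ae_of_all _ fun x => ?_)
      simp only [hφ.eq, mul_sub, hc]
    have h3 : SASGLD.weightedMarginal ψ ν f - c =
        (∫ x, ψ' x.2 * SASGLD.generator U β φ x.1 ∂ν) / ∫ x, ψ' x.2 ∂ν := by
      rw [h2, hπ, sub_div, mul_div_cancel_left₀ _ (hm.trans_le hpos).ne']
    rw [h3, abs_div, abs_of_pos (hm.trans_le hpos), div_mul_eq_mul_div]
    gcongr
  refine ⟨⟨iψ.congr hae.symm, ifν.congr hae'.symm, fun n _ =>
    SASGLD.integrable_of_sq (hAm n) (hsq n).1⟩, by rw [hπ]; exact has,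
    hb3.trans (by gcongr; linarith), ?_, fun hG => ?_⟩
  · have hlim := SASGLD.tendsto_integral_of_ae_tendsto_of_sq_bounded hAm (fun n => (hsq n).1)
      (fun n => (hsq n).2) has
    -- The tolerance is `h` itself, so that convergence without a rate suffices here.
    obtain ⟨C', hC'⟩ := SASGLD.exists_forall_abs_sub_le_add_div hlim hh
    refine ⟨C', fun n hn => ?_⟩
    have h1 := hC' n hn
    rw [← hπ] at h1
    have h2 := abs_sub_le (∫ ω, SASGLD.timeAverage ψ h f θ ζ n ω ∂P)
      (SASGLD.weightedMarginal ψ ν f) c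
    linarith
  · obtain ⟨C', hC'⟩ := H.exists_rate_bound hS hfc hfp hG
    refine ⟨C', fun n hn => ?_⟩
    have h1 := hC' n hn
    rw [← hπ] at h1
    have h2 := abs_sub_le (∫ ω, SASGLD.timeAverage ψ h f θ ζ n ω ∂P)
      (SASGLD.weightedMarginal ψ ν f) c
    linarith
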